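/- Let $n\ge 2$, and let $\mathfrak{sl}(n)$ be the space of trace-free real $n\times n$ matrices. A Brownian motion on $\mathfrak{sl}(n)$ is an almost surely continuous $\mathfrak{sl}(n)$-valued process $B=(B_\tau)_{\tau\ge 0}$, adapted to a filtration, with $B_0=0$ and with stationary, centered Gaussian increments that are independent of the past; its covariance is arbitrary. For every such $B$ the Stratonovich equation $$dF=F_\tau\circ dB,\qquad F_{\tau=0}=\mathrm{id},$$ (matrix product on the right-hand side) has a continuous adapted matrix-valued solution $F$, which is unique up to indistinguishability. There is a Brownian motion $B$ on $\mathfrak{sl}(n)$, unique in law, for which the solution $F$ has the following three properties: (i) $\mathbf{O}(n)$-invariance: $OFO^{-1}=F$ in law, as processes, for all $O\in\mathbf{O}(n)$; (ii) the Itô and Stratonovich interpretations of the product coincide: $F_\tau\circ dB=F_\tau\,dB$; (iii) normalization: $\mathbb{E}\,F_\tau F_\tau^*=e^{\tau}\,\mathrm{id}$ for all $\tau\ge 0$, where $F^*$ is the transpose of $F$. More precisely, there is exactly one law $\mu$ of a Brownian motion on $\mathfrak{sl}(n)$ such that, for every Brownian motion $B$ on $\mathfrak{sl}(n)$ (on any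 filtered probability space), $B$ has law $\mu$ if and only if its solution $F$ satisfies (i)--(iii). -/

import Mathlib

open MeasureTheory ProbabilityTheory Filter Topology
open scoped NNReal ENNReal

universe u

namespace GeomBM

/-- Endomorphisms of the (co)tangent space `ℝⁿ`, written as real `n × n` matrices in an orthonormal
basis; the Euclidean adjoint is the transpose. -/
abbrev Mat (n : ℕ) : Type := Matrix (Fin n) (Fin n) ℝ

/-- The product σ-algebra on matrices. -/
instance instMeasurableSpaceMat (n : ℕ) : MeasurableSpace (Mat n) :=
  inferInstanceAs (MeasurableSpace (Fin n → Fin n → ℝ))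

instance instBorelSpaceMat (n : ℕ) : BorelSpace (Mat n) :=
  inferInstanceAs (BorelSpace (Fin n → Fin n → ℝ))

/-- `B` is a Brownian motion on the Lie algebra `𝔰𝔩(n)` of trace-free matrices, relative to the
filtration `ℱ`: a continuous adapted process started at `0` whose increments are independent of the
past, stationary, and centered Gaussian. The covariance `𝔼 B₁ ⊗ B₁` is arbitrary. -/
structure IsBrownianMotionSL {n : ℕ} {Ω : Type u} {mΩ : MeasurableSpace Ω} (P : Measure Ω)
    (ℱ : Filtration ℝ≥0 mΩ) (B : ℝ≥0 → Ω → Mat n) : Prop where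
  adapted : Adapted ℱ B
  mem_sl : ∀ᵐ ω ∂P, ∀ t, B t ω ∈ LieAlgebra.SpecialLinear.sl (Fin n) ℝ
  continuous : ∀ᵐ ω ∂P, Continuous fun t => B t ω
  zero : ∀ᵐ ω ∂P, B 0 ω = 0
  indep : ∀ s h : ℝ≥0,
    Indep (MeasurableSpace.comap (fun ω => B (s + h) ω - B s ω) inferInstance) (ℱ s) P
  stationary : ∀ s h : ℝ≥0, IdentDistrib (fun ω => B (s + h) ω - B s ω) (B h) P P
  gaussian : ∀ t, HasGaussianLaw (B t) P
  centered : ∀ t i j, ∫ ω, B t ω i j ∂P = 0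

/-- A finite partition `0 = pt 0 ≤ pt 1 ≤ ⋯ ≤ pt size = t` of `[0, t]`. -/
structure TimePartition (t : ℝ≥0) where
  size : ℕ
  pt : ℕ → ℝ≥0
  mono : Monotone pt
  pt_zero : pt 0 = 0
  pt_size : pt size = t

namespace TimePartition

/-- The mesh of a partition: the length of its longest interval. -/
noncomputable def mesh {t : ℝ≥0} (π : TimePartition t) : ℝ≥0 :=
  (Finset.range π.size).sup fun k => π.pt (k + 1) - π.pt k

/-- The filter `mesh → 0` on the partitions of `[0, t]`. -/
noncomputable def meshToZero (t : ℝ≥0) : Filter (TimePartition t) :=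
  comap mesh (𝓝 0)

variable {n : ℕ} {Ω : Type u} {t : ℝ≥0}

/-- Left-point sums `∑ F_{t_k} (B_{t_{k+1}} - B_{t_k})`. -/
noncomputable def leftSum (F B : ℝ≥0 → Ω → Mat n) (π : TimePartition t) (ω : Ω) : Mat n :=
  ∑ k ∈ Finset.range π.size, F (π.pt k) ω * (B (π.pt (k + 1)) ω - B (π.pt k) ω)

/-- Symmetric sums `∑ ½ (F_{t_k} + F_{t_{k+1}}) (B_{t_{k+1}} - B_{t_k})`. -/
noncomputable def symmSum (F B : ℝ≥0 → Ω → Mat n) (π : TimePartition t) (ω : Ω) : Mat n :=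
  ∑ k ∈ Finset.range π.size,
    ((1 / 2 : ℝ) • (F (π.pt k) ω + F (π.pt (k + 1)) ω)) * (B (π.pt (k + 1)) ω - B (π.pt k) ω)

/-- Sums of products of increments `∑ (F_{t_{k+1}} - F_{t_k}) (B_{t_{k+1}} - B_{t_k})`. -/
noncomputable def covSum (F B : ℝ≥0 → Ω → Mat n) (π : TimePartition t) (ω : Ω) : Mat n :=
  ∑ k ∈ Finset.range π.size,
    (F (π.pt (k + 1)) ω - F (π.pt k) ω) * (B (π.pt (k + 1)) ω - B (π.pt k) ω)

end TimePartition

section Integrals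

variable {n : ℕ} {Ω : Type u} {mΩ : MeasurableSpace Ω}

/-- For every `t`, the sums `S π` over the partitions `π` of `[0, t]` converge in probability,
entry by entry, to `I t` as the mesh tends to `0`. -/
def TendstoAlongPartitions (P : Measure Ω) (S : ∀ t : ℝ≥0, TimePartition t → Ω → Mat n)
    (I : ℝ≥0 → Ω → Mat n) : Prop :=
  ∀ (t : ℝ≥0) (i j : Fin n),
    TendstoInMeasure P (fun π ω => S t π ω i j) (TimePartition.meshToZero t) fun ω => I t ω i j

/-- `I t = ∫₀ᵗ F dB`, the Itô integral of a continuous adapted process `F` against a Brownian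
motion `B`: the limit in probability of the left-point sums. -/
def IsItoIntegral (P : Measure Ω) (F B I : ℝ≥0 → Ω → Mat n) : Prop :=
  TendstoAlongPartitions P (fun _ π => π.leftSum F B) I

/-- `V t = [F B]_t`, the quadratic covariation of `F` and `B` taken with the matrix product: the
limit in probability of the sums of products of increments, with continuous paths of locally finite
variation. -/
structure IsCovariation (P : Measure Ω) (F B V : ℝ≥0 → Ω → Mat n) : Prop where
  continuous : ∀ᵐ ω ∂P, Continuous fun t => V t ω
  finite_variation :
    ∀ᵐ ω ∂P, ∀ i j, LocallyBoundedVariationOn (fun t => V t ω i j) Set.univ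
  tendsto : TendstoAlongPartitions P (fun _ π => π.covSum F B) V

/-- `I t = ∫₀ᵗ F ∘ dB`, the Stratonovich integral of a continuous adapted process `F` against a
Brownian motion `B`: the limit in probability of the symmetric sums. As for every continuous
semimartingale, the covariation of `F` and `B` has to exist as a continuous process of finite
variation. (A process `F = F₀ + ∫ F ∘ dB` in this sense is therefore itself a semimartingale:
it is the sum of `F₀`, the Itô integral `∫ F dB` and the finite variation process `½ [F B]`.) -/
structure IsStratonovichIntegral (P : Measure Ω) (F B I : ℝ≥0 → Ω → Mat n) : Prop where
  exists_covariation : ∃ V, IsCovariation P F B V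
  tendsto : TendstoAlongPartitions P (fun _ π => π.symmSum F B) I

/-- `F` is a solution of the Stratonovich equation `dF = F ∘ dB`, `F₀ = id`: it is a continuous
adapted process with `F₀ = id` and `F_t - F₀ = ∫₀ᵗ F ∘ dB` for all `t`. -/
structure IsStratonovichSolution (P : Measure Ω) (ℱ : Filtration ℝ≥0 mΩ)
    (B F : ℝ≥0 → Ω → Mat n) : Prop where
  adapted : Adapted ℱ F
  continuous : ∀ᵐ ω ∂P, Continuous fun t => F t ω
  init : ∀ᵐ ω ∂P, F 0 ω = 1
  equation : IsStratonovichIntegral P F B fun t ω => F t ω - F 0 ω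

/-- The law of a process, as a measure on paths with the product σ-algebra (that is, the collection
of its finite-dimensional distributions). -/
noncomputable def processLaw (P : Measure Ω) (X : ℝ≥0 → Ω → Mat n) : Measure (ℝ≥0 → Mat n) :=
  P.map fun ω t => X t ω

/-- `O F O⁻¹` has the law of `F`, as a process, for every orthogonal `O`. -/
def IsOrthogonallyInvariant (P : Measure Ω) (F : ℝ≥0 → Ω → Mat n) : Prop :=
  ∀ O : Matrix.orthogonalGroup (Fin n) ℝ,
    IdentDistrib (fun ω t => (O : Mat n) * F t ω * (O⁻¹ : Matrix.orthogonalGroup (Fin n) ℝ))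
      (fun ω t => F t ω) P P

/-- The Itô and the Stratonovich interpretation of `F dB` coincide. -/
def ItoEqStratonovich (P : Measure Ω) (F B : ℝ≥0 → Ω → Mat n) : Prop :=
  ∃ I, IsStratonovichIntegral P F B I ∧ IsItoIntegral P F B I

/-- `𝔼 F_t F_t* = e^t id` for all `t`, the entries being integrable. -/
def IsNormalized (P : Measure Ω) (F : ℝ≥0 → Ω → Mat n) : Prop :=
  ∀ t i j, Integrable (fun ω => (F t ω * (F t ω).transpose) i j) P ∧
    ∫ ω, (F t ω * (F t ω).transpose) i j ∂P = (Real.exp t • (1 : Mat n)) i j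

end Integrals

end GeomBM

/-!
The law of a Brownian motion `B` on `𝔰𝔩(n)` is the same thing as its covariance tensor
`C = 𝔼 B₁ ⊗ B₁` (`IsBrownianMotionSL.processLaw_eq`, `covTensor_eq_of_processLaw_eq`), and the three
properties of the solution turn out to be linear conditions on `C`, with exactly one solution.

*The equation.* If `F` is an Itô integral against `B` plus a process of finite variation, then the
sums of products of increments converge to `∫ F ds · 𝔼 B₁ B₁` (`IsBrownianMotionSL.tendsto_covSum`).
So the Stratonovich equation is equivalent to the Itô equation with the drift `a = ½ 𝔼 B₁ B₁`
(`IsStratonovichSolution.solvesIto`, `SolvesItoEquation.isStratonovichSolution`). Uniqueness holds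
because the difference of two solutions, restricted to the events that it has stayed bounded,
satisfies a Gronwall estimate in mean square, which is iterated
(`IsBrownianMotionSL.integral_nsq_boundedUpTo_le`). For existence, the dyadic Euler schemes converge
in mean square at a geometric rate, hence, by Doob's inequality and Borel–Cantelli, almost surely
locally uniformly (`IsBrownianMotionSL.exists_limit_euler`). The limit `eulerSolution` solves the
equation. It is a measurable functional of the path of the driving process, which commutes with
conjugations, and its moments are limits of explicit ones.

*The three properties.* The Itô and Stratonovich integrals coincide if and only if `𝔼 B₁ B₁ = 0`
(`IsStratonovichSolution.quadDrift_eq_zero`, `IsStratonovichSolution.itoEqStratonovich`). In that case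
the solution is an equivariant functional of `B`, so it is orthogonally invariant if `C` is. Moreover
each step of length `δ` of the Euler scheme multiplies `𝔼 F F*` by `1 + δ` if `𝔼 B₁ B₁* = 1`, so the
solution is normalized. Conversely, `C` is the limit of `t⁻¹ 𝔼 (F_t - 1) ⊗ (F_t - 1)` as `t → 0`
(`IsBrownianMotionSL.tendsto_covariance_eulerSolution`), so that invariance of `F` gives invariance of
`C`, and the normalization gives `𝔼 B₁ B₁* = 1`.

*The tensor.* Invariant tensors of order four are the combinations of the three pairings of the
indices (`IsInvariantTensor.eq_pairings`), and the conditions `tr B₁ = 0`, `𝔼 B₁ B₁ = 0` and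
`𝔼 B₁ B₁* = 1` determine the three coefficients (`IsInvariantTensor.eq_invariantCov`). The result
`invariantCov` is positive semidefinite: it has an explicit square root
(`exists_sqrt_invariantCov`), with which a Brownian motion of this covariance is obtained from
independent real ones (`exists_brownianMotionSL`). These are constructed from the isonormal process of
`L²(ℝ × κ)` and Kolmogorov's continuity theorem.
-/

namespace GeomBM

/-! ### Convergence in probability -/

section InMeasure

variable {ι Ω : Type*} {mΩ : MeasurableSpace Ω} {P : Measure Ω} {l : Filter ι}

theorem tendstoInMeasure_real_iff {f : ι → Ω → ℝ} {g : Ω → ℝ} :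
    TendstoInMeasure P f l g ↔
      ∀ ε : ℝ, 0 < ε → Tendsto (fun i => P {ω | ε ≤ |f i ω - g ω|}) l (𝓝 0) := by
  rw [tendstoInMeasure_iff_norm]
  simp only [Real.norm_eq_abs]

theorem tendstoInMeasure_add {f f' : ι → Ω → ℝ} {g g' : Ω → ℝ} (h : TendstoInMeasure P f l g)
    (h' : TendstoInMeasure P f' l g') :
    TendstoInMeasure P (fun i ω => f i ω + f' i ω) l (fun ω => g ω + g' ω) := by
  rw [tendstoInMeasure_real_iff] at *
  intro ε hε
  have h0 := (h (ε / 2) (by positivity)).add (h' (ε / 2) (by positivity))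
  rw [add_zero] at h0
  refine tendsto_of_tendsto_of_tendsto_of_le_of_le tendsto_const_nhds h0 (fun _ => zero_le)
    fun i => ?_
  refine (measure_mono ?_).trans (measure_union_le _ _)
  intro ω hω
  simp only [Set.mem_ofPred_eq, Set.mem_union] at *
  by_contra hc
  push Not at hc
  have := abs_add_le (f i ω - g ω) (f' i ω - g' ω)
  have e : f i ω + f' i ω - (g ω + g' ω) = f i ω - g ω + (f' i ω - g' ω) := by ring
  rw [e] at hω
  linarith [hc.1, hc.2]

theorem tendstoInMeasure_const_mul {f : ι → Ω → ℝ} {g : Ω → ℝ} (c : ℝ)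
    (h : TendstoInMeasure P f l g) :
    TendstoInMeasure P (fun i ω => c * f i ω) l (fun ω => c * g ω) := by
  rw [tendstoInMeasure_real_iff] at *
  intro ε hε
  refine tendsto_of_tendsto_of_tendsto_of_le_of_le tendsto_const_nhds
    (h (ε / (|c| + 1)) (by positivity)) (fun _ => zero_le) fun i => ?_
  refine measure_mono fun ω hω => ?_
  simp only [Set.mem_ofPred_eq] at *
  rw [← mul_sub, abs_mul] at hω
  rw [div_le_iff₀ (by positivity)]
  nlinarith [abs_nonneg (f i ω - g ω)]

theorem tendstoInMeasure_sub {f f' : ι → Ω → ℝ} {g g' : Ω → ℝ} (h : TendstoInMeasure P f l g)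
    (h' : TendstoInMeasure P f' l g') :
    TendstoInMeasure P (fun i ω => f i ω - f' i ω) l (fun ω => g ω - g' ω) := by
  have := tendstoInMeasure_add h (tendstoInMeasure_const_mul (-1) h')
  simpa [sub_eq_add_neg] using this

theorem tendstoInMeasure_const (g : Ω → ℝ) : TendstoInMeasure P (fun _ : ι => g) l g := by
  rw [tendstoInMeasure_real_iff]
  intro ε hε
  simpa [not_le.2 hε] using tendsto_const_nhds

theorem tendstoInMeasure_finsetSum {κ : Type*} (s : Finset κ) {f : κ → ι → Ω → ℝ} {g : κ → Ω → ℝ}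
    (h : ∀ k ∈ s, TendstoInMeasure P (f k) l (g k)) :
    TendstoInMeasure P (fun i ω => ∑ k ∈ s, f k i ω) l (fun ω => ∑ k ∈ s, g k ω) := by
  classical
  induction s using Finset.induction_on with
  | empty => simpa using tendstoInMeasure_const (P := P) (l := l) (fun _ : Ω => (0 : ℝ))
  | insert a s ha ih =>
    simp only [Finset.sum_insert ha]
    exact tendstoInMeasure_add (h a (by simp)) (ih fun k hk => h k (by simp [hk]))

/-- Convergence in measure along a countably generated filter may be tested on sequences. -/
theorem tendstoInMeasure_of_seq [l.IsCountablyGenerated] {f : ι → Ω → ℝ} {g : Ω → ℝ}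
    (h : ∀ x : ℕ → ι, Tendsto x atTop l → TendstoInMeasure P (fun m => f (x m)) atTop g) :
    TendstoInMeasure P f l g := by
  rw [tendstoInMeasure_real_iff]
  intro ε hε
  rw [tendsto_iff_seq_tendsto]
  intro x hx
  exact tendstoInMeasure_real_iff.1 (h x hx) ε hε

/-- Convergence to `0` in probability, with real bounds for the probabilities, so that an
exceptional event and a Chebyshev estimate can share the bound. -/
theorem tendstoInMeasure_zero_of_forall_le {f : ι → Ω → ℝ}
    (h : ∀ δ : ℝ, 0 < δ → ∀ η : ℝ, 0 < η →
      ∀ᶠ i in l, P {ω | δ ≤ |f i ω|} ≤ ENNReal.ofReal η) :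
    TendstoInMeasure P f l (fun _ => 0) := by
  rw [tendstoInMeasure_real_iff]
  intro ε hε
  simp only [sub_zero]
  rw [ENNReal.tendsto_nhds_zero]
  intro η hη
  rcases eq_or_ne η ⊤ with rfl | hη'
  · exact Eventually.of_forall fun _ => le_top
  · filter_upwards [h ε hε η.toReal (ENNReal.toReal_pos hη.ne' hη')] with i hi
    rwa [ENNReal.ofReal_toReal hη'] at hi

/-- Chebyshev's inequality. -/
theorem measure_le_of_integral_sq_le [IsProbabilityMeasure P] {f : Ω → ℝ} (hf : MemLp f 2 P) {v ε : ℝ}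
    (hv : ∫ ω, f ω ^ 2 ∂P ≤ v) (hε : 0 < ε) :
    P {ω | ε ≤ |f ω|} ≤ ENNReal.ofReal (v / ε ^ 2) := by
  have h1 := mul_meas_ge_le_integral_of_nonneg (μ := P) (f := fun ω => f ω ^ 2)
    (Eventually.of_forall fun ω => sq_nonneg _) hf.integrable_sq (ε ^ 2)
  have h2 : {ω | ε ≤ |f ω|} = {ω | ε ^ 2 ≤ f ω ^ 2} := by
    ext ω
    simp only [Set.mem_ofPred_eq]
    rw [← sq_abs (f ω)]
    exact (pow_le_pow_iff_left₀ hε.le (abs_nonneg _) two_ne_zero).symm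
  rw [h2, ← ofReal_measureReal]
  apply ENNReal.ofReal_le_ofReal
  rw [le_div_iff₀ (by positivity)]
  linarith

/-- Markov's inequality. -/
theorem measure_le_of_integral_le [IsProbabilityMeasure P] {f : Ω → ℝ} (hf : Integrable f P) {v ε : ℝ}
    (h0 : ∀ ω, 0 ≤ f ω) (hv : ∫ ω, f ω ∂P ≤ v) (hε : 0 < ε) :
    P {ω | ε ≤ f ω} ≤ ENNReal.ofReal (v / ε) := by
  have h1 := mul_meas_ge_le_integral_of_nonneg (μ := P) (f := f)
    (Eventually.of_forall fun ω => h0 _) hf ε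
  rw [← ofReal_measureReal]
  apply ENNReal.ofReal_le_ofReal
  rw [le_div_iff₀ (by positivity)]
  linarith

end InMeasure

/-! ### Martingale differences and their maximal inequality -/

section Martingale

variable {Ω : Type*} {mΩ : MeasurableSpace Ω}

/-- Square integrable martingale differences `d k`, known at time `k + 1`. The martingale property
is expressed as orthogonality to all square integrable functions known at time `k`. -/
structure IsOrthDiff (P : Measure Ω) (𝒢 : Filtration ℕ mΩ) (d : ℕ → Ω → ℝ) : Prop where
  meas : ∀ k, Measurable[𝒢 (k + 1)] (d k)
  memLp : ∀ k, MemLp (d k) 2 P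
  orth : ∀ k (G : Ω → ℝ), Measurable[𝒢 k] G → MemLp G 2 P → ∫ ω, G ω * d k ω ∂P = 0

/-- Centered square integrable variables `ξ k`, known at time `k + 1`, independent of the past up to
time `k`, with variance at most `v k`. -/
structure IsNoise (P : Measure Ω) (𝒢 : Filtration ℕ mΩ) (ξ : ℕ → Ω → ℝ) (v : ℕ → ℝ) : Prop where
  meas : ∀ k, Measurable[𝒢 (k + 1)] (ξ k)
  indep : ∀ k, Indep (MeasurableSpace.comap (ξ k) inferInstance) (𝒢 k) P
  memLp : ∀ k, MemLp (ξ k) 2 P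
  mean : ∀ k, ∫ ω, ξ k ω ∂P = 0
  var : ∀ k, ∫ ω, ξ k ω ^ 2 ∂P ≤ v k

variable {P : Measure Ω} {𝒢 : Filtration ℕ mΩ}

theorem indepFun_of_indep_of_measurable {m : MeasurableSpace Ω} {G ξ : Ω → ℝ}
    (h : Indep (MeasurableSpace.comap ξ inferInstance) m P) (hG : Measurable[m] G) :
    IndepFun G ξ P :=
  (indep_of_indep_of_le_right h hG.comap_le).symm

theorem integral_mul_of_indep [IsProbabilityMeasure P] {m : MeasurableSpace Ω} (hm : m ≤ mΩ)
    {G ξ : Ω → ℝ} (h : Indep (MeasurableSpace.comap ξ inferInstance) m P)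
    (hG : Measurable[m] G) (hξ : MemLp ξ 2 P) :
    ∫ ω, G ω * ξ ω ∂P = (∫ ω, G ω ∂P) * ∫ ω, ξ ω ∂P :=
  (indepFun_of_indep_of_measurable h hG).integral_fun_mul_eq_mul_integral
    (hG.mono hm le_rfl).aestronglyMeasurable hξ.aestronglyMeasurable

theorem memLp_two_mul_of_indep [IsProbabilityMeasure P] {m : MeasurableSpace Ω}
    {G ξ : Ω → ℝ} (h : Indep (MeasurableSpace.comap ξ inferInstance) m P)
    (hG : Measurable[m] G) (hGL : MemLp G 2 P) (hξ : MemLp ξ 2 P) :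
    MemLp (fun ω => G ω * ξ ω) 2 P := by
  have hi := indepFun_of_indep_of_measurable h hG
  refine (memLp_two_iff_integrable_sq (hGL.aestronglyMeasurable.mul hξ.aestronglyMeasurable)).2 ?_
  have h1 : IndepFun (fun ω => G ω ^ 2) (fun ω => ξ ω ^ 2) P :=
    hi.comp (φ := fun x => x ^ 2) (ψ := fun x => x ^ 2) (by fun_prop) (by fun_prop)
  have h2 := h1.integrable_mul hGL.integrable_sq hξ.integrable_sq
  refine h2.congr (Eventually.of_forall fun ω => ?_)
  simp [mul_pow]

theorem integral_sq_mul_of_indep [IsProbabilityMeasure P] {m : MeasurableSpace Ω} (hm : m ≤ mΩ)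
    {G ξ : Ω → ℝ} (h : Indep (MeasurableSpace.comap ξ inferInstance) m P)
    (hG : Measurable[m] G) (hξ : MemLp ξ 2 P) :
    ∫ ω, (G ω * ξ ω) ^ 2 ∂P = (∫ ω, G ω ^ 2 ∂P) * ∫ ω, ξ ω ^ 2 ∂P := by
  have hi := indepFun_of_indep_of_measurable h hG
  have h1 : IndepFun (fun ω => G ω ^ 2) (fun ω => ξ ω ^ 2) P :=
    hi.comp (φ := fun x => x ^ 2) (ψ := fun x => x ^ 2) (by fun_prop) (by fun_prop)
  simp only [mul_pow]
  exact h1.integral_fun_mul_eq_mul_integral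
    ((hG.mono hm le_rfl).aestronglyMeasurable.pow 2) (hξ.aestronglyMeasurable.pow 2)

theorem IsNoise.orthDiff [IsProbabilityMeasure P] {ξ : ℕ → Ω → ℝ} {v : ℕ → ℝ}
    (hξ : IsNoise P 𝒢 ξ v) {H : ℕ → Ω → ℝ} (hH : ∀ k, Measurable[𝒢 k] (H k))
    (hL : ∀ k, MemLp (H k) 2 P) : IsOrthDiff P 𝒢 fun k ω => H k ω * ξ k ω where
  meas k := ((hH k).mono (𝒢.mono (Nat.le_succ k)) le_rfl).mul (hξ.meas k)
  memLp k := memLp_two_mul_of_indep (hξ.indep k) (hH k) (hL k) (hξ.memLp k)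
  orth k G hG hGL := by
    have := integral_mul_of_indep (𝒢.le k) (hξ.indep k) (hG.mul (hH k))
      (hξ.memLp k)
    rw [hξ.mean k, mul_zero] at this
    rw [← this]
    congr 1; ext ω; simp [mul_assoc]

theorem IsOrthDiff.partialSum_meas {d : ℕ → Ω → ℝ} (h : IsOrthDiff P 𝒢 d) (m : ℕ) :
    Measurable[𝒢 m] fun ω => ∑ k ∈ Finset.range m, d k ω :=
  Finset.measurable_fun_sum _ fun k hk =>
    (h.meas k).mono (𝒢.mono (Finset.mem_range.1 hk)) le_rfl

theorem IsOrthDiff.partialSum_memLp {d : ℕ → Ω → ℝ} (h : IsOrthDiff P 𝒢 d) (m : ℕ) :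
    MemLp (fun ω => ∑ k ∈ Finset.range m, d k ω) 2 P :=
  memLp_finsetSum _ fun k _ => h.memLp k

theorem IsOrthDiff.integral_sq_sum {d : ℕ → Ω → ℝ} (h : IsOrthDiff P 𝒢 d) (m : ℕ) :
    ∫ ω, (∑ k ∈ Finset.range m, d k ω) ^ 2 ∂P = ∑ k ∈ Finset.range m, ∫ ω, d k ω ^ 2 ∂P := by
  induction m with
  | zero => simp
  | succ m ih =>
    rw [Finset.sum_range_succ, ← ih]
    simp only [Finset.sum_range_succ]
    have hS := h.partialSum_memLp m
    have e : ∀ ω, (∑ k ∈ Finset.range m, d k ω + d m ω) ^ 2 =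
        (∑ k ∈ Finset.range m, d k ω) ^ 2 +
          2 * ((∑ k ∈ Finset.range m, d k ω) * d m ω) + d m ω ^ 2 := fun ω => by ring
    simp only [e]
    have i1 := hS.integrable_sq
    have i2 : Integrable (fun ω => (∑ k ∈ Finset.range m, d k ω) * d m ω) P :=
      hS.integrable_mul (h.memLp m)
    have i3 := (h.memLp m).integrable_sq
    have i4 : Integrable (fun ω => (∑ k ∈ Finset.range m, d k ω) ^ 2 +
        2 * ((∑ k ∈ Finset.range m, d k ω) * d m ω)) P := i1.add (i2.const_mul 2)
    rw [integral_add i4 i3, integral_add i1 (i2.const_mul 2),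
      integral_const_mul, h.orth m _ (h.partialSum_meas m) hS]
    ring

/-- **Doob's maximal inequality**, applied to the squares of the partial sums. -/
theorem IsOrthDiff.maximal [IsProbabilityMeasure P] {d : ℕ → Ω → ℝ} (h : IsOrthDiff P 𝒢 d) (m : ℕ)
    {ε : ℝ} (hε : 0 < ε) :
    P {ω | ∃ j ≤ m, ε ≤ |∑ k ∈ Finset.range j, d k ω|} ≤
      ENNReal.ofReal ((∑ k ∈ Finset.range m, ∫ ω, d k ω ^ 2 ∂P) / ε ^ 2) := by
  set S : ℕ → Ω → ℝ := fun j ω => ∑ k ∈ Finset.range j, d k ω with hS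
  -- the squares of the partial sums form a submartingale
  have hsub : Submartingale (fun j ω => S j ω ^ 2) 𝒢 P := by
    refine submartingale_of_setIntegral_le_succ ?_ ?_ ?_
    · intro j
      exact ((h.partialSum_meas j).pow_const 2).stronglyMeasurable
    · intro j
      exact (h.partialSum_memLp j).integrable_sq
    · intro j s hs
      have hs' := 𝒢.le j s hs
      have e : ∀ ω, S (j + 1) ω ^ 2 = S j ω ^ 2 + 2 * (S j ω * d j ω) + d j ω ^ 2 := by
        intro ω; simp only [hS, Finset.sum_range_succ]; ring
      simp only [e]
      have i1 : Integrable (fun ω => S j ω ^ 2) P := (h.partialSum_memLp j).integrable_sq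
      have i2 : Integrable (fun ω => S j ω * d j ω) P :=
        (h.partialSum_memLp j).integrable_mul (h.memLp j)
      have i3 := (h.memLp j).integrable_sq
      have i4 : Integrable (fun ω => S j ω ^ 2 + 2 * (S j ω * d j ω)) P :=
        i1.add (i2.const_mul 2)
      rw [integral_add i4.integrableOn i3.integrableOn,
        integral_add i1.integrableOn (i2.const_mul 2).integrableOn, integral_const_mul]
      have h0 : ∫ ω in s, S j ω * d j ω ∂P = 0 := by
        have hi := h.orth j (s.indicator (S j)) ((h.partialSum_meas j).indicator hs)
          ((h.partialSum_memLp j).indicator hs')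
        rw [← integral_indicator hs', ← hi]
        congr 1; ext ω
        by_cases hω : ω ∈ s <;> simp [hω]
      have h1 : 0 ≤ ∫ ω in s, d j ω ^ 2 ∂P := integral_nonneg fun ω => sq_nonneg _
      rw [h0]; linarith
  have hmax := maximal_ineq hsub (fun j ω => sq_nonneg _) (ε := (ε ^ 2).toNNReal) m
  rw [Real.coe_toNNReal _ (by positivity)] at hmax
  have hset : {ω | ∃ j ≤ m, ε ≤ |S j ω|} ⊆ {ω | ε ^ 2 ≤
      (Finset.range (m + 1)).sup' Finset.nonempty_range_add_one fun k => S k ω ^ 2} := by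
    rintro ω ⟨j, hj, hj'⟩
    simp only [Set.mem_ofPred_eq]
    refine le_trans ?_ (Finset.le_sup' (fun k => S k ω ^ 2)
      (Finset.mem_range.2 (Nat.lt_succ_of_le hj)))
    rw [← sq_abs (S j ω)]
    exact pow_le_pow_left₀ hε.le hj' 2
  have hle : (∫ ω in {ω | ε ^ 2 ≤
      (Finset.range (m + 1)).sup' Finset.nonempty_range_add_one fun k => S k ω ^ 2},
        S m ω ^ 2 ∂P) ≤ ∑ k ∈ Finset.range m, ∫ ω, d k ω ^ 2 ∂P := by
    rw [← h.integral_sq_sum m]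
    exact setIntegral_le_integral (h.partialSum_memLp m).integrable_sq
      (Eventually.of_forall fun ω => sq_nonneg _)
  refine (measure_mono hset).trans ?_
  rw [ENNReal.ofReal_div_of_pos (by positivity), ENNReal.le_div_iff_mul_le (by simp [hε.ne'])
    (by simp), mul_comm]
  exact le_trans hmax (ENNReal.ofReal_le_ofReal hle)

/-- The second moment of a martingale transform with weights bounded by `ε`: its terms are
orthogonal. -/
theorem IsNoise.memLp_integral_sq_le [IsProbabilityMeasure P] {ξ : ℕ → Ω → ℝ}
    {v : ℕ → ℝ} (hξ : IsNoise P 𝒢 ξ v) {H : ℕ → Ω → ℝ} (hH : ∀ k, Measurable[𝒢 k] (H k)) {ε : ℝ}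
    (hb : ∀ k ω, |H k ω| ≤ ε) (m : ℕ) :
    MemLp (fun ω => ∑ k ∈ Finset.range m, H k ω * ξ k ω) 2 P ∧
      ∫ ω, (∑ k ∈ Finset.range m, H k ω * ξ k ω) ^ 2 ∂P ≤ ε ^ 2 * ∑ k ∈ Finset.range m, v k := by
  have hL : ∀ k, MemLp (H k) 2 P := fun k =>
    MemLp.of_bound ((hH k).mono (𝒢.le k) le_rfl).aestronglyMeasurable ε
      (Eventually.of_forall fun ω => hb k ω)
  have hd := hξ.orthDiff hH hL
  refine ⟨hd.partialSum_memLp m, ?_⟩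
  rw [hd.integral_sq_sum, Finset.mul_sum]
  refine Finset.sum_le_sum fun k _ => ?_
  rw [integral_sq_mul_of_indep (𝒢.le k) (hξ.indep k) (hH k) (hξ.memLp k)]
  have h1 : ∫ ω, H k ω ^ 2 ∂P ≤ ε ^ 2 := by
    have : ∫ ω, H k ω ^ 2 ∂P ≤ ∫ _, ε ^ 2 ∂P := by
      refine integral_mono (hL k).integrable_sq (integrable_const _) fun ω => ?_
      exact sq_le_sq' (abs_le.1 (hb k ω)).1 (abs_le.1 (hb k ω)).2
    simpa using this
  have h2 : 0 ≤ ∫ ω, ξ k ω ^ 2 ∂P := integral_nonneg fun ω => sq_nonneg _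
  exact mul_le_mul h1 (hξ.var k) h2 (sq_nonneg _)

/-- Chebyshev's inequality for a martingale transform, after truncation of the weights at `K`. -/
theorem IsNoise.measure_sum_le [IsProbabilityMeasure P] {ξ : ℕ → Ω → ℝ} {v : ℕ → ℝ}
    (hξ : IsNoise P 𝒢 ξ v) {H : ℕ → Ω → ℝ} (hH : ∀ k, Measurable[𝒢 k] (H k)) (m : ℕ) {K δ : ℝ}
    (hK : 0 ≤ K) (hδ : 0 < δ) :
    P {ω | δ ≤ |∑ k ∈ Finset.range m, H k ω * ξ k ω|} ≤
      P {ω | ∃ k < m, K < |H k ω|} +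
        ENNReal.ofReal (K ^ 2 * (∑ k ∈ Finset.range m, v k) / δ ^ 2) := by
  set H' : ℕ → Ω → ℝ := fun k ω => if |H k ω| ≤ K then H k ω else 0 with hH'
  have hb : ∀ k ω, |H' k ω| ≤ K := by
    intro k ω; simp only [hH']; split_ifs with h
    · exact h
    · simpa using hK
  have hm : ∀ k, Measurable[𝒢 k] (H' k) := by
    intro k
    refine Measurable.ite ?_ (hH k) measurable_const
    exact measurableSet_le (continuous_abs.measurable.comp (hH k)) measurable_const
  have hv := hξ.memLp_integral_sq_le hm hb m
  refine le_trans (measure_mono ?_) ((measure_union_le _ _).trans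
    (add_le_add le_rfl (measure_le_of_integral_sq_le hv.1 hv.2 hδ)))
  intro ω hω
  by_cases hc : ∃ k < m, K < |H k ω|
  · exact Or.inl hc
  · right
    push Not at hc
    have : ∑ k ∈ Finset.range m, H' k ω * ξ k ω = ∑ k ∈ Finset.range m, H k ω * ξ k ω :=
      Finset.sum_congr rfl fun k hk => by
        simp only [hH', if_pos (hc k (Finset.mem_range.1 hk))]
    simp only [Set.mem_ofPred_eq] at *
    rwa [this]

end Martingale

/-! ### Moments of the increments -/

section BrownianMoments

variable {n : ℕ}

theorem measurable_entry (i j : Fin n) : Measurable fun A : Mat n => A i j :=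
  (measurable_pi_apply j).comp (measurable_pi_apply (X := fun _ : Fin n => Fin n → ℝ) i)

theorem measurable_mat_iff {α : Type*} {m : MeasurableSpace α} {f : α → Mat n} :
    Measurable f ↔ ∀ i j, Measurable fun ω => f ω i j := by
  refine ⟨fun h i j => (measurable_entry i j).comp h, fun h => ?_⟩
  refine measurable_pi_iff.2 fun i => measurable_pi_iff.2 fun j => h i j

theorem measurable_mat_add {α : Type*} {m : MeasurableSpace α} {f g : α → Mat n} (hf : Measurable f)
    (hg : Measurable g) : Measurable fun ω => f ω + g ω :=
  measurable_mat_iff.2 fun i j =>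
    (measurable_mat_iff.1 hf i j).add (measurable_mat_iff.1 hg i j)

theorem measurable_mat_sub {α : Type*} {m : MeasurableSpace α} {f g : α → Mat n} (hf : Measurable f)
    (hg : Measurable g) : Measurable fun ω => f ω - g ω :=
  measurable_mat_iff.2 fun i j =>
    (measurable_mat_iff.1 hf i j).sub (measurable_mat_iff.1 hg i j)

theorem measurable_mat_mul {α : Type*} {m : MeasurableSpace α} {f g : α → Mat n} (hf : Measurable f)
    (hg : Measurable g) : Measurable fun ω => f ω * g ω := by
  refine measurable_mat_iff.2 fun i j => ?_
  simp only [Matrix.mul_apply]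
  exact Finset.measurable_fun_sum _ fun k _ =>
    (measurable_mat_iff.1 hf i k).mul (measurable_mat_iff.1 hg k j)

/-- The linear functional `A ↦ x * A i j + y * A k l`. -/
def twoEntries (x y : ℝ) (i j k l : Fin n) : Mat n →L[ℝ] ℝ where
  toFun A := x * A i j + y * A k l
  map_add' A B := by simp only [Matrix.add_apply]; ring
  map_smul' c A := by simp only [Matrix.smul_apply, smul_eq_mul, RingHom.id_apply]; ring
  cont := by fun_prop

variable {Ω : Type u} {mΩ : MeasurableSpace Ω} {P : Measure Ω} {ℱ : Filtration ℝ≥0 mΩ}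
  {B : ℝ≥0 → Ω → Mat n}

theorem _root_.MeasureTheory.Adapted.entry {F : ℝ≥0 → Ω → Mat n} (hF : Adapted ℱ F) (t : ℝ≥0)
    (i j : Fin n) : Measurable[ℱ t] fun ω => F t ω i j :=
  (measurable_entry i j).comp (hF t)

theorem _root_.MeasureTheory.Adapted.entry' {F : ℝ≥0 → Ω → Mat n} (hF : Adapted ℱ F) (t : ℝ≥0)
    (i j : Fin n) : Measurable fun ω => F t ω i j :=
  (hF.entry t i j).mono (ℱ.le t) le_rfl

theorem IsBrownianMotionSL.hasGaussianLaw_twoEntries (hB : IsBrownianMotionSL P ℱ B) (t : ℝ≥0)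
    (x y : ℝ) (i j k l : Fin n) :
    HasGaussianLaw (fun ω => x * B t ω i j + y * B t ω k l) P :=
  (hB.gaussian t).map_of_measurable (twoEntries x y i j k l)
    (((measurable_entry i j).const_mul x).add ((measurable_entry k l).const_mul y))

theorem IsBrownianMotionSL.hasGaussianLaw_entry (hB : IsBrownianMotionSL P ℱ B) (t : ℝ≥0)
    (i j : Fin n) : HasGaussianLaw (fun ω => B t ω i j) P := by
  simpa using hB.hasGaussianLaw_twoEntries t 1 0 i j i j

theorem IsBrownianMotionSL.memLp_entry (hB : IsBrownianMotionSL P ℱ B) (t : ℝ≥0)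
    (i j : Fin n) {p : ℝ≥0∞} (hp : p ≠ ⊤) : MemLp (fun ω => B t ω i j) p P :=
  (hB.hasGaussianLaw_entry t i j).memLp hp

/-- The covariance tensor `𝔼 B₁ ⊗ B₁`. -/
noncomputable def covTensor (P : Measure Ω) (B : ℝ≥0 → Ω → Mat n) (i j k l : Fin n) : ℝ :=
  ∫ ω, B 1 ω i j * B 1 ω k l ∂P

theorem IsBrownianMotionSL.identDistrib_incr (hB : IsBrownianMotionSL P ℱ B) {s t : ℝ≥0}
    (hst : s ≤ t) : IdentDistrib (fun ω => B t ω - B s ω) (B (t - s)) P P := by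
  have := hB.stationary s (t - s)
  rwa [add_tsub_cancel_of_le hst] at this

theorem IsBrownianMotionSL.indep_incr (hB : IsBrownianMotionSL P ℱ B) {s t : ℝ≥0} (hst : s ≤ t)
    {φ : Mat n → ℝ} (hφ : Measurable φ) :
    Indep (MeasurableSpace.comap (fun ω => φ (B t ω - B s ω)) inferInstance) (ℱ s) P := by
  have := hB.indep s (t - s)
  rw [add_tsub_cancel_of_le hst] at this
  refine indep_of_indep_of_le_left this ?_
  rw [show (fun ω => φ (B t ω - B s ω)) = φ ∘ (fun ω => B t ω - B s ω) from rfl,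
    ← MeasurableSpace.comap_comp]
  exact MeasurableSpace.comap_mono hφ.comap_le

theorem IsBrownianMotionSL.integral_incr (hB : IsBrownianMotionSL P ℱ B) {s t : ℝ≥0} (hst : s ≤ t)
    {φ : Mat n → ℝ} (hφ : Measurable φ) :
    ∫ ω, φ (B t ω - B s ω) ∂P = ∫ ω, φ (B (t - s) ω) ∂P :=
  ((hB.identDistrib_incr hst).comp hφ).integral_eq

theorem IsBrownianMotionSL.memLp_incr (hB : IsBrownianMotionSL P ℱ B) (s t : ℝ≥0)
    (i j : Fin n) {p : ℝ≥0∞} (hp : p ≠ ⊤) : MemLp (fun ω => B t ω i j - B s ω i j) p P :=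
  (hB.memLp_entry t i j hp).sub (hB.memLp_entry s i j hp)

/-- A nonnegative additive function on `[0, ∞)` is linear. -/
theorem additive_nonneg_linear {q : ℝ≥0 → ℝ} (h0 : ∀ t, 0 ≤ q t)
    (hadd : ∀ s t, q (s + t) = q s + q t) (t : ℝ≥0) : q t = t * q 1 := by
  have hmono : Monotone q := by
    intro s t hst
    have := hadd s (t - s)
    rw [add_tsub_cancel_of_le hst] at this
    linarith [h0 (t - s)]
  have hz : q 0 = 0 := by simpa using hadd 0 0
  have hnat : ∀ (m : ℕ) (s : ℝ≥0), q (m * s) = m * q s := by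
    intro m s
    induction m with
    | zero => simp [hz]
    | succ m ih => rw [Nat.cast_succ, add_mul, one_mul, hadd, ih]; push_cast; ring
  -- `m * t` lies between consecutive integers, at which `q` is known
  have key : ∀ m : ℕ, (m : ℝ) * |q t - t * q 1| ≤ q 1 := by
    intro m
    have h1 : ((⌊(m : ℝ≥0) * t⌋₊ : ℕ) : ℝ≥0) ≤ m * t := Nat.floor_le (by positivity)
    have h2 : (m : ℝ≥0) * t ≤ ((⌊(m : ℝ≥0) * t⌋₊ + 1 : ℕ) : ℝ≥0) := by
      push_cast; exact (Nat.lt_floor_add_one _).le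
    have e1 := hmono h1
    have e2 := hmono h2
    have f1 := hnat ⌊(m : ℝ≥0) * t⌋₊ 1
    have f2 := hnat (⌊(m : ℝ≥0) * t⌋₊ + 1) 1
    rw [mul_one] at f1 f2
    rw [f1, hnat] at e1
    rw [f2, hnat] at e2
    have g1 : ((⌊(m : ℝ≥0) * t⌋₊ : ℕ) : ℝ) ≤ m * t := by exact_mod_cast h1
    have g2 : (m : ℝ) * t ≤ (⌊(m : ℝ≥0) * t⌋₊ : ℕ) + 1 := by exact_mod_cast h2
    have hm : (0 : ℝ) ≤ m := by positivity
    have e3 : (m : ℝ) * |q t - t * q 1| = |(m : ℝ) * (q t - t * q 1)| := by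
      rw [abs_mul, abs_of_nonneg hm]
    rw [e3, abs_le]
    push_cast at e2
    have hq := h0 1
    constructor <;> nlinarith
  by_contra hne
  have hpos : 0 < |q t - t * q 1| := abs_pos.2 (sub_ne_zero.2 hne)
  obtain ⟨m, hm⟩ := exists_nat_gt (q 1 / |q t - t * q 1|)
  rw [div_lt_iff₀ hpos] at hm
  linarith [key m]

theorem IsBrownianMotionSL.integral_incr_entry (hB : IsBrownianMotionSL P ℱ B) {s t : ℝ≥0}
    (hst : s ≤ t) (i j : Fin n) : ∫ ω, (B t ω i j - B s ω i j) ∂P = 0 := by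
  have := hB.integral_incr hst (φ := fun A => A i j) (measurable_entry i j)
  simp only [Matrix.sub_apply] at this
  rw [this, hB.centered]

theorem covTensor_self_nonneg (i j : Fin n) : 0 ≤ covTensor P B i j i j :=
  integral_nonneg fun _ => mul_self_nonneg _

/-- Fourth moment of the standard Gaussian distribution. -/
noncomputable def gaussianFourth : ℝ := ∫ x, x ^ 4 ∂gaussianReal 0 1

theorem gaussianFourth_nonneg : 0 ≤ gaussianFourth := integral_nonneg fun x => by positivity

theorem IsBrownianMotionSL.measurable_incr (hB : IsBrownianMotionSL P ℱ B) {s t : ℝ≥0}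
    (hst : s ≤ t) (i j : Fin n) : Measurable[ℱ t] fun ω => B t ω i j - B s ω i j :=
  (hB.adapted.entry t i j).sub ((hB.adapted.entry s i j).mono (ℱ.mono hst) le_rfl)

/-- A bound for the variance of the products of two entries of `B₁`. -/
noncomputable def quadConst (P : Measure Ω) (B : ℝ≥0 → Ω → Mat n) (i j k l : Fin n) : ℝ :=
  (covTensor P B i j i j ^ 2 + covTensor P B k l k l ^ 2) * gaussianFourth

theorem quadConst_nonneg (i j k l : Fin n) : 0 ≤ quadConst P B i j k l :=
  mul_nonneg (by positivity) gaussianFourth_nonneg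

theorem IsBrownianMotionSL.memLp_incr_mul (hB : IsBrownianMotionSL P ℱ B) (s t : ℝ≥0)
    (i j k l : Fin n) :
    MemLp (fun ω => (B t ω i j - B s ω i j) * (B t ω k l - B s ω k l)) 2 P := by
  have h1 := hB.memLp_incr s t i j (p := 4) (by simp)
  have h2 := hB.memLp_incr s t k l (p := 4) (by simp)
  have : ENNReal.HolderTriple 4 4 2 := ⟨by
    rw [← two_mul, show (4 : ℝ≥0∞) = 2 * 2 by norm_num, ENNReal.mul_inv (by simp) (by simp),
      ← mul_assoc, ENNReal.mul_inv_cancel (by simp) (by simp), one_mul]⟩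
  exact h2.mul h1

section

variable [IsProbabilityMeasure P]

theorem IsBrownianMotionSL.integral_sq_twoEntries (hB : IsBrownianMotionSL P ℱ B) (t : ℝ≥0)
    (x y : ℝ) (i j k l : Fin n) :
    ∫ ω, (x * B t ω i j + y * B t ω k l) ^ 2 ∂P =
      t * ∫ ω, (x * B 1 ω i j + y * B 1 ω k l) ^ 2 ∂P := by
  set L : Mat n → ℝ := fun A => x * A i j + y * A k l with hL
  have hLm : Measurable L := ((measurable_entry i j).const_mul x).add
    ((measurable_entry k l).const_mul y)
  have hLp : ∀ t, MemLp (fun ω => L (B t ω)) 2 P := fun t =>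
    (hB.hasGaussianLaw_twoEntries t x y i j k l).memLp (by simp)
  refine additive_nonneg_linear (q := fun t => ∫ ω, (L (B t ω)) ^ 2 ∂P)
    (fun t => integral_nonneg fun ω => sq_nonneg _) (fun s h => ?_) t
  have hs : s ≤ s + h := le_self_add
  have hLi : MemLp (fun ω => L (B (s + h) ω - B s ω)) 2 P := by
    refine ((hLp (s + h)).sub (hLp s)).ae_eq (Eventually.of_forall fun ω => ?_)
    simp only [hL, Pi.sub_apply, Matrix.sub_apply]; ring
  have e : ∀ ω, L (B (s + h) ω) ^ 2 = L (B s ω) ^ 2 +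
      2 * (L (B s ω) * L (B (s + h) ω - B s ω)) + L (B (s + h) ω - B s ω) ^ 2 := by
    intro ω; simp only [hL, Matrix.sub_apply]; ring
  have hc : ∫ ω, L (B s ω) * L (B (s + h) ω - B s ω) ∂P = 0 := by
    rw [integral_mul_of_indep (G := fun ω => L (B s ω)) (ℱ.le s) (hB.indep_incr hs hLm)
      (hLm.comp (hB.adapted s)) hLi,
      hB.integral_incr hs hLm]
    have : ∫ ω, L (B (s + h - s) ω) ∂P = 0 := by
      simp only [hL]
      rw [integral_add, integral_const_mul, integral_const_mul, hB.centered, hB.centered]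
      · simp
      · exact ((hB.memLp_entry _ i j (p := 1) (by simp)).integrable le_rfl).const_mul x
      · exact ((hB.memLp_entry _ k l (p := 1) (by simp)).integrable le_rfl).const_mul y
    rw [this, mul_zero]
  have i1 : Integrable (fun ω => L (B s ω) ^ 2) P := (hLp s).integrable_sq
  have i2 : Integrable (fun ω => L (B s ω) * L (B (s + h) ω - B s ω)) P :=
    (hLp s).integrable_mul hLi
  have i3 : Integrable (fun ω => L (B s ω) ^ 2 + 2 * (L (B s ω) * L (B (s + h) ω - B s ω))) P :=
    i1.add (i2.const_mul 2)
  simp only [e]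
  rw [integral_add i3 hLi.integrable_sq, integral_add i1 (i2.const_mul 2), integral_const_mul, hc,
    hB.integral_incr hs (hLm.pow_const 2)]
  simp

theorem IsBrownianMotionSL.integral_mul_entry (hB : IsBrownianMotionSL P ℱ B) (t : ℝ≥0)
    (i j k l : Fin n) : ∫ ω, B t ω i j * B t ω k l ∂P = t * covTensor P B i j k l := by
  have hp : ∀ t, ∫ ω, B t ω i j * B t ω k l ∂P =
      ((∫ ω, (1 * B t ω i j + 1 * B t ω k l) ^ 2 ∂P) -
        ∫ ω, (1 * B t ω i j + (-1) * B t ω k l) ^ 2 ∂P) / 4 := by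
    intro t
    rw [← integral_sub, ← integral_div]
    · congr 1; ext ω; ring
    · exact ((hB.hasGaussianLaw_twoEntries t 1 1 i j k l).memLp (p := 2) (by simp)).integrable_sq
    · exact ((hB.hasGaussianLaw_twoEntries t 1 (-1) i j k l).memLp (p := 2) (by simp)).integrable_sq
  rw [covTensor, hp, hp, hB.integral_sq_twoEntries t, hB.integral_sq_twoEntries t]
  ring

theorem IsBrownianMotionSL.integral_incr_mul (hB : IsBrownianMotionSL P ℱ B) {s t : ℝ≥0}
    (hst : s ≤ t) (i j k l : Fin n) :
    ∫ ω, (B t ω i j - B s ω i j) * (B t ω k l - B s ω k l) ∂P =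
      ((t : ℝ) - s) * covTensor P B i j k l := by
  have := hB.integral_incr hst (φ := fun A => A i j * A k l)
    ((measurable_entry i j).mul (measurable_entry k l))
  simp only [Matrix.sub_apply] at this
  rw [this, hB.integral_mul_entry, NNReal.coe_sub hst]

theorem integral_pow_four_gaussianReal (v : ℝ≥0) :
    ∫ x, x ^ 4 ∂gaussianReal 0 v = v ^ 2 * gaussianFourth := by
  have h := gaussianReal_map_const_mul (μ := 0) (v := 1) (Real.sqrt v)
  have hv : (NNReal.mk (Real.sqrt v ^ 2) (sq_nonneg _)) * 1 = v := by
    ext; simp [Real.sq_sqrt]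
  rw [mul_zero, hv] at h
  rw [← h, integral_map (by fun_prop) (by fun_prop), gaussianFourth, ← integral_const_mul]
  congr 1; ext x
  rw [mul_pow, show (4 : ℕ) = 2 * 2 from rfl, pow_mul (Real.sqrt _), Real.sq_sqrt v.coe_nonneg]

theorem IsBrownianMotionSL.integral_pow_four (hB : IsBrownianMotionSL P ℱ B) (t : ℝ≥0)
    (i j : Fin n) :
    ∫ ω, B t ω i j ^ 4 ∂P = (t * covTensor P B i j i j) ^ 2 * gaussianFourth := by
  have hg := hB.hasGaussianLaw_entry t i j
  have hvar : Var[fun ω => B t ω i j; P] = t * covTensor P B i j i j := by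
    rw [variance_of_integral_eq_zero hg.aemeasurable (hB.centered t i j), ← hB.integral_mul_entry]
    simp only [sq]
  have hm := hg.map_eq_gaussianReal
  rw [hB.centered t i j, hvar] at hm
  have h1 : ∫ ω, B t ω i j ^ 4 ∂P = ∫ x, x ^ 4 ∂(P.map fun ω => B t ω i j) :=
    (integral_map (f := fun x : ℝ => x ^ 4) hg.aemeasurable (by fun_prop)).symm
  rw [h1, hm, integral_pow_four_gaussianReal,
    Real.coe_toNNReal _ (mul_nonneg t.coe_nonneg (covTensor_self_nonneg i j))]

theorem IsBrownianMotionSL.integral_incr_pow_four (hB : IsBrownianMotionSL P ℱ B) {s t : ℝ≥0}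
    (hst : s ≤ t) (i j : Fin n) :
    ∫ ω, (B t ω i j - B s ω i j) ^ 4 ∂P =
      (((t : ℝ) - s) * covTensor P B i j i j) ^ 2 * gaussianFourth := by
  have := hB.integral_incr hst (φ := fun A => A i j ^ 4) ((measurable_entry i j).pow_const 4)
  simp only [Matrix.sub_apply] at this
  rw [this, hB.integral_pow_four, NNReal.coe_sub hst]

/-- The filtration `ℱ` along a nondecreasing sequence of times. -/
def discreteFiltration (ℱ : Filtration ℝ≥0 mΩ) {pt : ℕ → ℝ≥0} (hpt : Monotone pt) :
    Filtration ℕ mΩ where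
  seq k := ℱ (pt k)
  mono' _ _ h := ℱ.mono (hpt h)
  le' k := ℱ.le (pt k)

theorem IsBrownianMotionSL.isNoise_incr (hB : IsBrownianMotionSL P ℱ B) {pt : ℕ → ℝ≥0}
    (hpt : Monotone pt) (i j : Fin n) :
    IsNoise P (discreteFiltration ℱ hpt) (fun k ω => B (pt (k + 1)) ω i j - B (pt k) ω i j)
      (fun k => ((pt (k + 1) : ℝ) - pt k) * covTensor P B i j i j) where
  meas k := hB.measurable_incr (hpt (Nat.le_succ k)) i j
  indep k := hB.indep_incr (hpt (Nat.le_succ k)) (measurable_entry i j)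
  memLp k := hB.memLp_incr _ _ i j (by simp)
  mean k := hB.integral_incr_entry (hpt (Nat.le_succ k)) i j
  var k := by
    rw [← hB.integral_incr_mul (hpt (Nat.le_succ k)) i j i j]
    simp only [sq, le_refl]

/-- The products of the entries of the increments, once compensated by their means, are noise whose
variances are quadratic in the lengths of the intervals. -/
theorem IsBrownianMotionSL.isNoise_incr_mul (hB : IsBrownianMotionSL P ℱ B) {pt : ℕ → ℝ≥0}
    (hpt : Monotone pt) (i j k l : Fin n) :
    IsNoise P (discreteFiltration ℱ hpt)
      (fun m ω => (B (pt (m + 1)) ω i j - B (pt m) ω i j) * (B (pt (m + 1)) ω k l - B (pt m) ω k l)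
        - ((pt (m + 1) : ℝ) - pt m) * covTensor P B i j k l)
      (fun m => ((pt (m + 1) : ℝ) - pt m) ^ 2 * quadConst P B i j k l) where
  meas m := ((hB.measurable_incr (hpt (Nat.le_succ m)) i j).mul
    (hB.measurable_incr (hpt (Nat.le_succ m)) k l)).sub_const _
  indep m := hB.indep_incr (hpt (Nat.le_succ m))
    (φ := fun A => A i j * A k l - ((pt (m + 1) : ℝ) - pt m) * covTensor P B i j k l)
    (((measurable_entry i j).mul (measurable_entry k l)).sub_const _)
  memLp m := (hB.memLp_incr_mul _ _ i j k l).sub (memLp_const _)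
  mean m := by
    rw [integral_sub ((hB.memLp_incr_mul _ _ i j k l).integrable (by simp)) (integrable_const _),
      hB.integral_incr_mul (hpt (Nat.le_succ m))]
    simp
  var m := by
    have hst := hpt (Nat.le_succ m)
    set s := pt m
    set t := pt (m + 1)
    have hL := hB.memLp_incr_mul s t i j k l
    set c := ((t : ℝ) - s) * covTensor P B i j k l with hc
    have hi : ∀ i j, Integrable (fun ω => (B t ω i j - B s ω i j) ^ 4) P := fun i j =>
      (hB.memLp_incr s t i j (p := 4) (by simp)).integrable_norm_pow (p := 4) (by simp) |>.congr
        (Eventually.of_forall fun ω => by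
          simp only [Real.norm_eq_abs]; exact Even.pow_abs (by decide) _)
    have e : ∀ ω, ((B t ω i j - B s ω i j) * (B t ω k l - B s ω k l) - c) ^ 2 =
        ((B t ω i j - B s ω i j) * (B t ω k l - B s ω k l)) ^ 2 -
          2 * c * ((B t ω i j - B s ω i j) * (B t ω k l - B s ω k l)) + c ^ 2 := fun ω => by ring
    have h1 : ∫ ω, ((B t ω i j - B s ω i j) * (B t ω k l - B s ω k l) - c) ^ 2 ∂P =
        (∫ ω, ((B t ω i j - B s ω i j) * (B t ω k l - B s ω k l)) ^ 2 ∂P) - c ^ 2 := by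
      simp only [e]
      have i1 := hL.integrable_sq
      have i2 : Integrable (fun ω => 2 * c * ((B t ω i j - B s ω i j) * (B t ω k l - B s ω k l))) P :=
        (hL.integrable (by simp)).const_mul _
      have i3 : Integrable (fun ω => ((B t ω i j - B s ω i j) * (B t ω k l - B s ω k l)) ^ 2 -
          2 * c * ((B t ω i j - B s ω i j) * (B t ω k l - B s ω k l))) P := i1.sub i2
      rw [integral_add i3 (integrable_const _), integral_sub i1 i2, integral_const_mul,
        hB.integral_incr_mul hst, ← hc]
      simp; ring
    -- `x² y² ≤ x⁴ + y⁴`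
    have h2 : ∫ ω, ((B t ω i j - B s ω i j) * (B t ω k l - B s ω k l)) ^ 2 ∂P ≤
        ∫ ω, ((B t ω i j - B s ω i j) ^ 4 + (B t ω k l - B s ω k l) ^ 4) ∂P := by
      refine integral_mono hL.integrable_sq ((hi i j).add (hi k l)) fun ω => ?_
      simp only
      nlinarith [sq_nonneg ((B t ω i j - B s ω i j) ^ 2 - (B t ω k l - B s ω k l) ^ 2),
        sq_nonneg ((B t ω i j - B s ω i j) ^ 2), sq_nonneg ((B t ω k l - B s ω k l) ^ 2)]
    rw [integral_add (hi i j) (hi k l), hB.integral_incr_pow_four hst,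
      hB.integral_incr_pow_four hst] at h2
    rw [h1]
    have : ((t : ℝ) - s) ^ 2 * quadConst P B i j k l =
      (((t : ℝ) - s) * covTensor P B i j i j) ^ 2 * gaussianFourth +
      (((t : ℝ) - s) * covTensor P B k l k l) ^ 2 * gaussianFourth := by
      rw [quadConst]; ring
    rw [this]
    linarith [sq_nonneg c]

end

end BrownianMoments

/-! ### The law and the covariance of a Brownian motion -/

section Law

variable {n : ℕ} {Ω Ω' : Type u} {mΩ : MeasurableSpace Ω} {mΩ' : MeasurableSpace Ω'}
  {P : Measure Ω} {P' : Measure Ω'} {ℱ : Filtration ℝ≥0 mΩ} {ℱ' : Filtration ℝ≥0 mΩ'}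
  {B : ℝ≥0 → Ω → Mat n} {B' : ℝ≥0 → Ω' → Mat n}

theorem linear_apply_eq_sum (L : Mat n →ₗ[ℝ] ℝ) (A : Mat n) :
    L A = ∑ q : Fin n × Fin n, A q.1 q.2 * L (Matrix.single q.1 q.2 1) := by
  conv_lhs => rw [Matrix.matrix_eq_sum_single A]
  rw [map_sum, Fintype.sum_prod_type]
  refine Finset.sum_congr rfl fun i _ => ?_
  rw [map_sum]
  refine Finset.sum_congr rfl fun j _ => ?_
  rw [← smul_eq_mul (A i j), ← map_smul, Matrix.smul_single, smul_eq_mul, mul_one]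

/-- Cramér–Wold: a law on a finite-dimensional space is determined by its images under linear
functionals. -/
theorem ext_of_map_linear {μ ν : Measure (Fin n → Fin n → ℝ)} (hμ : IsProbabilityMeasure μ)
    (hν : IsProbabilityMeasure ν)
    (h : ∀ L : (Fin n → Fin n → ℝ) →L[ℝ] ℝ, μ.map L = ν.map L) : μ = ν := by
  refine Measure.ext_of_charFunDual ?_
  ext L
  rw [charFunDual_eq_charFun_map_one, charFunDual_eq_charFun_map_one, h]

theorem measurable_process (hB : Adapted ℱ B) : Measurable fun ω t => B t ω :=
  measurable_pi_iff.2 fun t => (hB t).mono (ℱ.le t) le_rfl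

theorem IsBrownianMotionSL.integral_linear_sq [IsProbabilityMeasure P]
    (hB : IsBrownianMotionSL P ℱ B) (t : ℝ≥0) (L : Mat n →ₗ[ℝ] ℝ) :
    ∫ ω, L (B t ω) ^ 2 ∂P = ∑ q : Fin n × Fin n, ∑ r : Fin n × Fin n,
      L (Matrix.single q.1 q.2 1) * L (Matrix.single r.1 r.2 1) *
        (t * covTensor P B q.1 q.2 r.1 r.2) := by
  have hint : ∀ q r : Fin n × Fin n, Integrable (fun ω => L (Matrix.single q.1 q.2 1) *
      L (Matrix.single r.1 r.2 1) * (B t ω q.1 q.2 * B t ω r.1 r.2)) P := fun q r =>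
    ((hB.memLp_entry t q.1 q.2 (p := 2) (by simp)).integrable_mul
      (hB.memLp_entry t r.1 r.2 (p := 2) (by simp))).const_mul _
  have e : ∀ ω, L (B t ω) ^ 2 = ∑ q : Fin n × Fin n, ∑ r : Fin n × Fin n,
      L (Matrix.single q.1 q.2 1) * L (Matrix.single r.1 r.2 1) *
        (B t ω q.1 q.2 * B t ω r.1 r.2) := by
    intro ω
    rw [linear_apply_eq_sum L, sq, Finset.sum_mul_sum]
    exact Finset.sum_congr rfl fun q _ => Finset.sum_congr rfl fun r _ => by ring
  simp only [e]
  rw [integral_finsetSum _ fun q _ => integrable_finsetSum _ fun r _ => hint q r]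
  refine Finset.sum_congr rfl fun q _ => ?_
  rw [integral_finsetSum _ fun r _ => hint q r]
  refine Finset.sum_congr rfl fun r _ => ?_
  rw [integral_const_mul, hB.integral_mul_entry]

theorem IsBrownianMotionSL.integral_linear [IsProbabilityMeasure P] (hB : IsBrownianMotionSL P ℱ B) (t : ℝ≥0)
    (L : Mat n →ₗ[ℝ] ℝ) : ∫ ω, L (B t ω) ∂P = 0 := by
  have e : ∀ ω, L (B t ω) = ∑ q : Fin n × Fin n, B t ω q.1 q.2 * L (Matrix.single q.1 q.2 1) :=
    fun ω => linear_apply_eq_sum L _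
  rw [integral_congr_ae (Eventually.of_forall e), integral_finsetSum]
  · refine Finset.sum_eq_zero fun q _ => ?_
    rw [integral_mul_const, hB.centered, zero_mul]
  · intro q _
    exact ((hB.memLp_entry t q.1 q.2 (p := 1) (by simp)).integrable le_rfl).mul_const _

/-- The image of the law of `B_t` under a linear functional is a centered Gaussian law, whose
variance is determined by the covariance tensor. -/
theorem IsBrownianMotionSL.map_eval_eq [IsProbabilityMeasure P] [IsProbabilityMeasure P']
    (hB : IsBrownianMotionSL P ℱ B) (hB' : IsBrownianMotionSL P' ℱ' B')
    (hC : ∀ i j k l, covTensor P B i j k l = covTensor P' B' i j k l) (t : ℝ≥0) :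
    P.map (B t) = P'.map (B' t) := by
  have key : ∀ L : Mat n →L[ℝ] ℝ, Measurable L → (P.map (B t)).map L = (P'.map (B' t)).map L := by
    intro L hL
    have g := ((hB.gaussian t).map_of_measurable L hL).map_eq_gaussianReal
    have g' := ((hB'.gaussian t).map_of_measurable L hL).map_eq_gaussianReal
    have m : ∫ ω, (⇑L ∘ B t) ω ∂P = 0 := hB.integral_linear t L.toLinearMap
    have m' : ∫ ω, (⇑L ∘ B' t) ω ∂P' = 0 := hB'.integral_linear t L.toLinearMap
    have v : Var[⇑L ∘ B t; P] = Var[⇑L ∘ B' t; P'] := by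
      rw [variance_of_integral_eq_zero (hL.comp_aemeasurable (hB.gaussian t).aemeasurable) m,
        variance_of_integral_eq_zero (hL.comp_aemeasurable (hB'.gaussian t).aemeasurable) m']
      have q := hB.integral_linear_sq t L.toLinearMap
      have q' := hB'.integral_linear_sq t L.toLinearMap
      simp only [← hC] at q'
      exact q.trans q'.symm
    rw [m, v] at g
    rw [m'] at g'
    rw [Measure.map_map hL ((hB.adapted t).mono (ℱ.le t) le_rfl),
      Measure.map_map hL ((hB'.adapted t).mono (ℱ'.le t) le_rfl), g, g']
  have fin : IsProbabilityMeasure (P.map (B t)) := (hB.gaussian t).isGaussian_map.toIsProbabilityMeasure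
  have fin' : IsProbabilityMeasure (P'.map (B' t)) :=
    (hB'.gaussian t).isGaussian_map.toIsProbabilityMeasure
  exact ext_of_map_linear fin fin' fun L => key L L.continuous.measurable

/-- The law of a Brownian motion is determined by its covariance: conditionally on the past, each
increment is Gaussian with a covariance proportional to `covTensor`. -/
theorem IsBrownianMotionSL.processLaw_eq [IsProbabilityMeasure P] [IsProbabilityMeasure P']
    (hB : IsBrownianMotionSL P ℱ B) (hB' : IsBrownianMotionSL P' ℱ' B')
    (hC : ∀ i j k l, covTensor P B i j k l = covTensor P' B' i j k l) :
    processLaw P B = processLaw P' B' := by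
  have hm := measurable_process hB.adapted
  have hm' := measurable_process hB'.adapted
  have hmt : ∀ t, Measurable (B t) := fun t => (hB.adapted t).mono (ℱ.le t) le_rfl
  have hmt' : ∀ t, Measurable (B' t) := fun t => (hB'.adapted t).mono (ℱ'.le t) le_rfl
  -- laws of processes agree if the marginals at finitely many times do; these are built up by
  -- adding the largest time
  suffices hfin : ∀ I : Finset ℝ≥0, P.map (fun ω => I.restrict (fun t => B t ω)) =
      P'.map (fun ω => I.restrict (fun t => B' t ω)) by
    have h1 := isProjectiveLimit_map hm.aemeasurable (P := P)
    have h2 := isProjectiveLimit_map hm'.aemeasurable (P := P')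
    simp_rw [hfin] at h1
    exact h1.unique h2
  intro I
  induction I using Finset.induction_on_max with
  | empty =>
    have : IsProbabilityMeasure (P.map (fun ω => (∅ : Finset ℝ≥0).restrict (fun t => B t ω))) :=
      Measure.isProbabilityMeasure_map ((Finset.measurable_restrict _).comp hm).aemeasurable
    have : IsProbabilityMeasure (P'.map (fun ω => (∅ : Finset ℝ≥0).restrict (fun t => B' t ω))) :=
      Measure.isProbabilityMeasure_map ((Finset.measurable_restrict _).comp hm').aemeasurable
    ext s hs
    rcases Set.eq_empty_or_nonempty s with rfl | hne
    · simp
    · rw [Subsingleton.eq_univ_of_nonempty hne]; simp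
  | insert t J hJt ih =>
    rcases J.eq_empty_or_nonempty with rfl | hJ
    · let Ψ : Mat n → (↥(insert t (∅ : Finset ℝ≥0) : Finset ℝ≥0) → Mat n) := fun x _ => x
      have hΨ : Measurable Ψ := measurable_pi_iff.2 fun _ => measurable_id
      have e : (fun ω => (insert t (∅ : Finset ℝ≥0)).restrict (fun t => B t ω)) = Ψ ∘ B t := by
        ext ω ⟨r, hr⟩ : 2
        simp only [insert_empty_eq, Finset.mem_singleton] at hr
        subst hr; rfl
      have e' : (fun ω => (insert t (∅ : Finset ℝ≥0)).restrict (fun t => B' t ω)) = Ψ ∘ B' t := by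
        ext ω ⟨r, hr⟩ : 2
        simp only [insert_empty_eq, Finset.mem_singleton] at hr
        subst hr; rfl
      rw [e, e', ← Measure.map_map hΨ (hmt t), ← Measure.map_map hΨ (hmt' t),
        hB.map_eval_eq hB' hC t]
    · set s := J.max' hJ with hs
      have hsJ : s ∈ J := J.max'_mem hJ
      have hst : s ≤ t := (hJt s hsJ).le
      let Ψ : (↥J → Mat n) × Mat n → (↥(insert t J : Finset ℝ≥0) → Mat n) := fun x r =>
        if h : (r : ℝ≥0) ∈ J then x.1 ⟨r, h⟩ else x.1 ⟨s, hsJ⟩ + x.2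
      have hΨ : Measurable Ψ := by
        refine measurable_pi_iff.2 fun r => ?_
        by_cases h : (r : ℝ≥0) ∈ J
        · simp only [Ψ, h, dite_true]
          exact (measurable_pi_apply _).comp measurable_fst
        · simp only [Ψ, h, dite_false]
          exact measurable_mat_add ((measurable_pi_apply _).comp measurable_fst) measurable_snd
      -- the increment up to the new time is independent of the values at the earlier times
      have gen : ∀ {Ω : Type u} {mΩ : MeasurableSpace Ω} {P : Measure Ω} [IsProbabilityMeasure P]
          {ℱ : Filtration ℝ≥0 mΩ} {B : ℝ≥0 → Ω → Mat n} (_ : IsBrownianMotionSL P ℱ B),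
          P.map (fun ω => (insert t J).restrict (fun t => B t ω)) =
            ((P.map (fun ω => J.restrict (fun t => B t ω))).prod (P.map (B (t - s)))).map Ψ := by
        intro Ω mΩ P _ ℱ B hB
        have hmt : ∀ t, Measurable (B t) := fun t => (hB.adapted t).mono (ℱ.le t) le_rfl
        have m1 : Measurable[ℱ s] (fun ω => J.restrict (fun t => B t ω)) := by
          refine @measurable_pi_lambda _ _ _ (ℱ s) _ _ fun r => ?_
          exact (hB.adapted r).mono (ℱ.mono (J.le_max' r r.2)) le_rfl
        have m1' : Measurable (fun ω => J.restrict (fun t => B t ω)) := m1.mono (ℱ.le s) le_rfl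
        have m2 : Measurable (fun ω => B t ω - B s ω) := measurable_mat_sub (hmt t) (hmt s)
        have hind : IndepFun (fun ω => J.restrict (fun t => B t ω)) (fun ω => B t ω - B s ω) P := by
          have := hB.indep s (t - s)
          rw [add_tsub_cancel_of_le hst] at this
          exact (indep_of_indep_of_le_right this m1.comap_le).symm
        rw [indepFun_iff_map_prod_eq_prod_map_map m1'.aemeasurable m2.aemeasurable,
          (hB.identDistrib_incr hst).map_eq] at hind
        rw [← hind, Measure.map_map hΨ (m1'.prodMk m2)]
        congr 1
        ext ω ⟨r, hr⟩ : 2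
        by_cases h : r ∈ J
        · simp [Ψ, h]
        · have : r = t := by
            rcases Finset.mem_insert.1 hr with h' | h'
            · exact h'
            · exact absurd h' h
          subst this
          simp [Ψ, h]
      rw [gen hB, gen hB', ih, hB.map_eval_eq hB' hC]

/-- Conversely, the law of a Brownian motion determines its covariance. -/
theorem covTensor_eq_of_processLaw_eq (hB : Adapted ℱ B) (hB' : Adapted ℱ' B')
    (h : processLaw P B = processLaw P' B') (i j k l : Fin n) :
    covTensor P B i j k l = covTensor P' B' i j k l := by
  have e : ∀ {Ω : Type u} {mΩ : MeasurableSpace Ω} {P : Measure Ω} {ℱ : Filtration ℝ≥0 mΩ}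
      {B : ℝ≥0 → Ω → Mat n} (_ : Adapted ℱ B),
      covTensor P B i j k l = ∫ b, b 1 i j * b 1 k l ∂(processLaw P B) := by
    intro Ω mΩ P ℱ B hB
    rw [processLaw, integral_map (measurable_process hB).aemeasurable, covTensor]
    exact (((measurable_entry i j).comp (measurable_pi_apply 1)).mul
      ((measurable_entry k l).comp (measurable_pi_apply 1))).aestronglyMeasurable
  rw [e hB, e hB', h]

end Law

/-! ### The isonormal Gaussian process -/

section Isonormal

variable {Ω : Type*} {mΩ : MeasurableSpace Ω} {P : Measure Ω}

theorem integral_sq_eq_norm_sq (f : Lp ℝ 2 P) : ∫ ω, f ω ^ 2 ∂P = ‖f‖ ^ 2 := by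
  rw [← real_inner_self_eq_norm_sq, L2.inner_def]
  refine integral_congr_ae (Eventually.of_forall fun ω => ?_)
  simp [pow_two]

theorem coeFn_sum_smul {ι : Type*} (S : Finset ι) (c : ι → ℝ) (f : ι → Lp ℝ 2 P) :
    (∑ i ∈ S, c i • f i : Lp ℝ 2 P) =ᵐ[P] fun ω => ∑ i ∈ S, c i * f i ω := by
  have h2 : ∀ᵐ ω ∂P, ∀ i ∈ S, (c i • f i : Lp ℝ 2 P) ω = c i * f i ω :=
    (Finset.eventually_all S).2 fun i _ => Lp.coeFn_smul (c i) (f i)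
  filter_upwards [Lp.coeFn_finsetSum S fun i => c i • f i, h2] with ω h1 h2
  rw [h1, Finset.sum_apply]
  exact Finset.sum_congr rfl h2

/-- At each point, the characteristic function is a Lipschitz function of the random variable in
`L²`. -/
theorem norm_charFun_sub_le [IsProbabilityMeasure P] (f g : Lp ℝ 2 P) (s : ℝ) :
    ‖charFun (P.map f) s - charFun (P.map g) s‖ ≤ |s| * ‖f - g‖ := by
  have hfm := (Lp.stronglyMeasurable f).measurable
  have hgm := (Lp.stronglyMeasurable g).measurable
  have hi : ∀ h : Lp ℝ 2 P, Integrable (fun ω => Complex.exp (s * h ω * Complex.I)) P := by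
    intro h
    have hm := (Lp.stronglyMeasurable h).measurable
    refine Integrable.of_bound (C := 1) (by fun_prop) (Eventually.of_forall fun ω => ?_)
    rw [← Complex.ofReal_mul, Complex.norm_exp_ofReal_mul_I]
  rw [charFun_apply_real, charFun_apply_real, integral_map hfm.aemeasurable (by fun_prop),
    integral_map hgm.aemeasurable (by fun_prop), ← integral_sub (hi f) (hi g)]
  have hfg : MemLp (fun ω => f ω - g ω) 2 P := (Lp.memLp f).sub (Lp.memLp g)
  have h1 : ∀ ω, ‖Complex.exp (s * f ω * Complex.I) - Complex.exp (s * g ω * Complex.I)‖ ≤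
      |s| * |f ω - g ω| := by
    intro ω
    have e : Complex.exp (s * f ω * Complex.I) - Complex.exp (s * g ω * Complex.I) =
        Complex.exp ((s * g ω : ℝ) * Complex.I) *
          (Complex.exp (Complex.I * (s * (f ω - g ω) : ℝ)) - 1) := by
      rw [mul_sub, ← Complex.exp_add, mul_one]
      congr 2 <;> push_cast <;> ring
    rw [e, norm_mul, Complex.norm_exp_ofReal_mul_I, one_mul, ← abs_mul]
    exact Real.norm_exp_I_mul_ofReal_sub_one_le
  have h2 : (∫ ω, |f ω - g ω| ∂P) ^ 2 ≤ ‖f - g‖ ^ 2 := by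
    rw [← integral_sq_eq_norm_sq]
    have e : ∫ ω, (f - g) ω ^ 2 ∂P = ∫ ω, |f ω - g ω| ^ 2 ∂P := by
      refine integral_congr_ae ?_
      filter_upwards [Lp.coeFn_sub f g] with ω hω
      rw [hω, sq_abs]; rfl
    rw [e]
    have hv := variance_nonneg (fun ω => |f ω - g ω|) P
    have hv2 := variance_eq_sub (X := fun ω => |f ω - g ω|) hfg.abs
    have e2 : ∫ ω, ((fun ω => |f ω - g ω|) ^ 2) ω ∂P = ∫ ω, |f ω - g ω| ^ 2 ∂P := rfl
    rw [e2] at hv2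
    linarith
  have h3 : ∫ ω, |f ω - g ω| ∂P ≤ ‖f - g‖ :=
    (sq_le_sq₀ (integral_nonneg fun _ => abs_nonneg _) (norm_nonneg _)).1 h2
  calc _ ≤ ∫ ω, |s| * |f ω - g ω| ∂P :=
        norm_integral_le_of_norm_le ((hfg.integrable one_le_two).abs.const_mul _)
          (Eventually.of_forall h1)
    _ ≤ _ := by
        rw [integral_const_mul]
        exact mul_le_mul_of_nonneg_left h3 (abs_nonneg s)

/-- Centered Gaussian variables form a closed subset of `L²`. -/
theorem map_eq_gaussianReal_of_tendsto [IsProbabilityMeasure P] {ι : Type*} {l : Filter ι} [l.NeBot]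
    {f : ι → Lp ℝ 2 P} {g : Lp ℝ 2 P} (h : Tendsto f l (𝓝 g))
    (hf : ∀ i, P.map (f i) = gaussianReal 0 (‖f i‖₊ ^ 2)) :
    P.map g = gaussianReal 0 (‖g‖₊ ^ 2) := by
  have : IsProbabilityMeasure (P.map g) :=
    Measure.isProbabilityMeasure_map (Lp.stronglyMeasurable g).measurable.aemeasurable
  refine Measure.ext_of_charFun ?_
  ext s
  have h1 : Tendsto (fun i => charFun (P.map (f i)) s) l (𝓝 (charFun (P.map g) s)) := by
    rw [tendsto_iff_norm_sub_tendsto_zero]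
    refine squeeze_zero (fun _ => norm_nonneg _) (fun i => norm_charFun_sub_le (f i) g s) ?_
    have := (tendsto_iff_norm_sub_tendsto_zero.1 h).const_mul |s|
    simpa using this
  have h2 : Tendsto (fun i => charFun (P.map (f i)) s) l
      (𝓝 (charFun (gaussianReal 0 (‖g‖₊ ^ 2)) s)) := by
    simp only [hf, charFun_gaussianReal]
    have : Tendsto (fun i => ‖f i‖) l (𝓝 ‖g‖) := h.norm
    have h3 : Continuous fun x : ℝ => Complex.exp (s * (0 : ℝ) * Complex.I - (x : ℂ) ^ 2 * s ^ 2 / 2) := by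
      fun_prop
    exact (by simpa [Function.comp_def] using (h3.tendsto ‖g‖).comp this)
  exact tendsto_nhds_unique h1 h2

/-- **The isonormal Gaussian process** of a real Hilbert space `H`: a centered Gaussian process
indexed by `H` whose covariance is the inner product. -/
theorem exists_isonormal (H : Type) [NormedAddCommGroup H] [InnerProductSpace ℝ H]
    [CompleteSpace H] :
    ∃ (Ω : Type u) (_ : MeasurableSpace Ω) (P : Measure Ω) (_ : IsProbabilityMeasure P)
      (X : H → Ω → ℝ), (∀ h, Measurable (X h)) ∧ IsGaussianProcess X P ∧
        (∀ h, ∫ ω, X h ω ∂P = 0) ∧ ∀ h h', cov[X h, X h'; P] = inner ℝ h h' := by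
  classical
  obtain ⟨w, b, -⟩ := exists_hilbertBasis ℝ H
  -- `ULift` puts the probability space into the universe `u`
  obtain ⟨Ω, mΩ, P, ξ, hm, hlaw, hind, hP⟩ := exists_iid (ULift.{u} w) (gaussianReal 0 1)
  refine ⟨Ω, mΩ, P, hP, ?_⟩
  have hg : ∀ i, HasGaussianLaw (ξ i) P := fun i => (hlaw i).hasGaussianLaw
  have hL2 : ∀ i, MemLp (ξ i) 2 P := fun i => (hg i).memLp_two
  have hmean : ∀ i, ∫ ω, ξ i ω ∂P = 0 := fun i => by
    have := (hlaw i).integral_eq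
    simpa using this
  have hvar : ∀ i, ∫ ω, ξ i ω * ξ i ω ∂P = 1 := fun i => by
    have h1 := (hlaw i).variance_eq
    rw [variance_id_gaussianReal, variance_of_integral_eq_zero (hm i).aemeasurable (hmean i)] at h1
    simpa [pow_two] using h1
  set e : w → Lp ℝ 2 P := fun i => (hL2 ⟨i⟩).toLp (ξ ⟨i⟩) with he
  have hinner : ∀ i j, inner ℝ (e i) (e j) = ∫ ω, ξ ⟨i⟩ ω * ξ ⟨j⟩ ω ∂P := by
    intro i j
    rw [L2.inner_def]
    refine integral_congr_ae ?_
    filter_upwards [(hL2 ⟨i⟩).coeFn_toLp, (hL2 ⟨j⟩).coeFn_toLp] with ω h1 h2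
    simp only [he, h1, h2]
    exact mul_comm _ _
  have hon : Orthonormal ℝ e := by
    rw [orthonormal_iff_ite]
    intro i j
    rw [hinner]
    split_ifs with hij
    · subst hij; exact hvar _
    · have hij' : (⟨i⟩ : ULift w) ≠ ⟨j⟩ := fun h => hij (by simpa using h)
      rw [(hind.indepFun hij').integral_fun_mul_eq_mul_integral
        (hm _).aestronglyMeasurable (hm _).aestronglyMeasurable, hmean, zero_mul]
  -- the isometry that sends the Hilbert basis to independent standard normal variables
  set J : H →ₗᵢ[ℝ] Lp ℝ 2 P :=
    hon.orthogonalFamily.linearIsometry.comp b.repr.toLinearIsometry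
  obtain ⟨c, hsum⟩ : ∃ c : H → w → ℝ, ∀ h, HasSum (fun i => c h i • e i) (J h) :=
    ⟨fun h => b.repr h, fun h => hon.orthogonalFamily.hasSum_linearIsometry (b.repr h)⟩
  -- each value is an `L²` limit of finite sums of independent Gaussian variables
  have hmap : ∀ h, P.map (J h) = gaussianReal 0 (‖h‖₊ ^ 2) := by
    intro h
    have := map_eq_gaussianReal_of_tendsto (hsum h) (fun S => ?_)
    · rw [this]; congr 2; exact NNReal.eq (J.norm_map h)
    · set y : Lp ℝ 2 P := ∑ i ∈ S, c h i • e i with hy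
      have hae : (fun ω => ∑ i : S, c h i * ξ ⟨i⟩ ω) =ᵐ[P] y := by
        have h2 : ∀ᵐ ω ∂P, ∀ i ∈ S, e i ω = ξ ⟨i⟩ ω :=
          (Finset.eventually_all S).2 fun i _ => (hL2 ⟨i⟩).coeFn_toLp
        filter_upwards [coeFn_sum_smul S (c h) e, h2] with ω h1 h2
        rw [h1, Finset.sum_coe_sort S fun i => c h i * ξ ⟨i⟩ ω]
        exact Finset.sum_congr rfl fun i hi => by rw [h2 i hi]
      have hgy : HasGaussianLaw y P := by
        refine HasGaussianLaw.congr ?_ hae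
        have hi : iIndepFun (fun i : S => fun ω => c h i * ξ ⟨i⟩ ω) P := by
          have h1 : iIndepFun (fun i : S => ξ ⟨i⟩) P :=
            hind.precomp (g := fun i : S => (⟨i⟩ : ULift w)) fun i j hij =>
              Subtype.ext (ULift.up_injective hij)
          exact h1.comp (fun i x => c h i * x) fun i => by fun_prop
        refine iIndepFun.hasGaussianLaw_fun_sum (fun i => ?_) hi
        exact (hg _).fun_smul _
      have hy0 : ∫ ω, y ω ∂P = 0 := by
        rw [← integral_congr_ae hae, integral_finsetSum _ fun i _ =>
          ((hL2 _).integrable one_le_two).const_mul _]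
        refine Finset.sum_eq_zero fun i _ => ?_
        rw [integral_const_mul, hmean, mul_zero]
      rw [hgy.map_eq_gaussianReal, hy0, variance_of_integral_eq_zero hgy.aemeasurable hy0]
      congr 1
      rw [integral_sq_eq_norm_sq]
      refine NNReal.eq ?_
      rw [Real.coe_toNNReal _ (by positivity)]
      rfl
  have hJ0 : ∀ h, ∫ ω, J h ω ∂P = 0 := by
    intro h
    have h1 : ∫ x, x ∂(P.map (J h)) = 0 := by rw [hmap]; exact integral_id_gaussianReal
    rwa [integral_map (Lp.stronglyMeasurable _).measurable.aemeasurable (by fun_prop)] at h1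
  refine ⟨fun h => J h, fun h => (Lp.stronglyMeasurable _).measurable, ⟨fun I => ⟨?_⟩⟩, ?_, ?_⟩
  · have hmI : Measurable fun ω => I.restrict fun h => J h ω :=
      measurable_pi_iff.2 fun h => (Lp.stronglyMeasurable _).measurable
    refine isGaussian_of_map_eq_gaussianReal fun L => ?_
    -- a linear combination of the values of `J` is the value of `J` at a linear combination
    set g : H := ∑ h : I, L (Pi.single h 1) • (h : H) with hgdef
    refine ⟨0, ‖g‖₊ ^ 2, ?_⟩
    rw [← hmap g, Measure.map_map L.continuous.measurable hmI]
    refine Measure.map_congr ?_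
    have hJg : J g = ∑ h : I, L (Pi.single h 1) • J h := by
      rw [hgdef, map_sum]
      exact Finset.sum_congr rfl fun h _ => J.map_smul _ _
    rw [hJg]
    filter_upwards [coeFn_sum_smul Finset.univ (fun h : I => L (Pi.single h 1)) fun h => J h]
      with ω hω
    rw [hω, Function.comp_apply]
    refine (LinearMap.pi_apply_eq_sum_univ (L : (I → ℝ) →ₗ[ℝ] ℝ) _).trans
      (Finset.sum_congr rfl fun h _ => ?_)
    have hs : (fun j => if h = j then (1 : ℝ) else 0) = Pi.single h 1 := by
      ext j
      simp [Pi.single_apply, eq_comm]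
    rw [smul_eq_mul, mul_comm, hs]
    rfl
  · exact hJ0
  · intro h h'
    rw [covariance_eq_sub (Lp.memLp _) (Lp.memLp _), hJ0, zero_mul, sub_zero, ← J.inner_map_map,
      L2.inner_def]
    refine integral_congr_ae (Eventually.of_forall fun ω => ?_)
    exact mul_comm _ _

end Isonormal

/-! ### Kolmogorov's criterion on dyadic times -/

section Dyadic

/-- The largest multiple of `2⁻ᴺ` that is at most `t`. -/
noncomputable def dyadicFloor (N : ℕ) (t : ℝ≥0) : ℝ≥0 := (⌊t * 2 ^ N⌋₊ : ℝ≥0) / 2 ^ N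

theorem dyadicFloor_le (N : ℕ) (t : ℝ≥0) : dyadicFloor N t ≤ t := by
  rw [dyadicFloor, div_le_iff₀ (by positivity)]
  exact Nat.floor_le zero_le

theorem lt_dyadicFloor_add (N : ℕ) (t : ℝ≥0) : t < dyadicFloor N t + (1 / 2) ^ N := by
  have h := Nat.lt_floor_add_one (t * 2 ^ N)
  rw [dyadicFloor, one_div, inv_pow, ← one_div, ← add_div, lt_div_iff₀ (by positivity)]
  exact h

theorem floor_two_pow_succ (N : ℕ) (t : ℝ≥0) :
    ⌊t * 2 ^ (N + 1)⌋₊ = 2 * ⌊t * 2 ^ N⌋₊ ∨ ⌊t * 2 ^ (N + 1)⌋₊ = 2 * ⌊t * 2 ^ N⌋₊ + 1 := by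
  have h : t * 2 ^ N = t * 2 ^ (N + 1) / (2 : ℕ) := by
    rw [pow_succ]; push_cast; field_simp
  rw [h, Nat.floor_div_natCast]
  omega

theorem floor_two_pow_of_le {N : ℕ} {s t : ℝ≥0} (hst : s ≤ t) (h : t < s + (1 / 2) ^ N) :
    ⌊t * 2 ^ N⌋₊ = ⌊s * 2 ^ N⌋₊ ∨ ⌊t * 2 ^ N⌋₊ = ⌊s * 2 ^ N⌋₊ + 1 := by
  have h1 : ⌊s * 2 ^ N⌋₊ ≤ ⌊t * 2 ^ N⌋₊ := Nat.floor_mono (by gcongr)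
  have h2 : t * 2 ^ N < s * 2 ^ N + 1 := by
    calc t * 2 ^ N < (s + (1 / 2) ^ N) * 2 ^ N := by gcongr
      _ = s * 2 ^ N + 1 := by
        rw [add_mul, ← mul_pow]; norm_num
  have h3 : ⌊t * 2 ^ N⌋₊ < ⌊s * 2 ^ N⌋₊ + 2 := by
    rw [Nat.floor_lt zero_le]
    have := Nat.lt_floor_add_one (s * 2 ^ N)
    push_cast
    calc t * 2 ^ N < s * 2 ^ N + 1 := h2
      _ < (⌊s * 2 ^ N⌋₊ + 1 : ℝ≥0) + 1 := by gcongr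
      _ = _ := by ring
  omega

/-- Kolmogorov's criterion for a single path: if, locally uniformly, the increments of `f` over the
dyadic intervals of length `2⁻ᴺ` are at most `ηᴺ` for large `N`, then the step functions
`t ↦ f (dyadicFloor N t)` converge to a continuous function. -/
theorem exists_continuous_limit_dyadic {f : ℝ≥0 → ℝ} {η : ℝ} (h0 : 0 < η) (h1 : η < 1)
    (hf : ∀ T : ℕ, ∀ᶠ N : ℕ in atTop, ∀ k < T * 2 ^ N,
      |f (((k + 1 : ℕ) : ℝ≥0) / 2 ^ N) - f ((k : ℝ≥0) / 2 ^ N)| ≤ η ^ N) :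
    ∃ y : ℝ≥0 → ℝ, Continuous y ∧ ∀ t, Tendsto (fun N => f (dyadicFloor N t)) atTop (𝓝 (y t)) := by
  have key : ∀ T : ℕ, ∃ N₀ : ℕ, ∀ N ≥ N₀, ∀ k < T * 2 ^ N,
      |f (((k + 1 : ℕ) : ℝ≥0) / 2 ^ N) - f ((k : ℝ≥0) / 2 ^ N)| ≤ η ^ N := fun T =>
    eventually_atTop.1 (hf T)
  choose N₀ hN₀ using key
  have hfl : ∀ {T : ℕ} {t : ℝ≥0} (N : ℕ), t < T → ⌊t * 2 ^ N⌋₊ < T * 2 ^ N := by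
    intro T t N ht
    rw [Nat.floor_lt zero_le]
    push_cast
    gcongr
  -- `dyadicFloor N t` and `dyadicFloor (N + 1) t` agree or are neighbours on the finer grid
  have hstep : ∀ (T : ℕ) (t : ℝ≥0), t < T → ∀ N ≥ N₀ T,
      dist (f (dyadicFloor N t)) (f (dyadicFloor (N + 1) t)) ≤ η ^ N := by
    intro T t ht N hN
    rw [dist_comm, Real.dist_eq]
    have hlt := hfl (N + 1) ht
    have e : (⌊t * 2 ^ N⌋₊ : ℝ≥0) / 2 ^ N = ((2 * ⌊t * 2 ^ N⌋₊ : ℕ) : ℝ≥0) / 2 ^ (N + 1) := by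
      push_cast; rw [pow_succ']; field_simp
    rw [dyadicFloor, dyadicFloor, e]
    rcases floor_two_pow_succ N t with h | h
    · rw [h, sub_self, abs_zero]; positivity
    · rw [h] at hlt ⊢
      refine (hN₀ T (N + 1) (by omega) _ (by omega)).trans ?_
      exact pow_le_pow_of_le_one h0.le h1.le (Nat.le_succ N)
  have hstep' : ∀ (T : ℕ) (t : ℝ≥0), t < T → ∀ N ≥ N₀ T, ∀ m : ℕ,
      dist (f (dyadicFloor (N + m) t)) (f (dyadicFloor (N + (m + 1)) t)) ≤ η ^ N * η ^ m := by
    intro T t ht N hN m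
    rw [← pow_add]
    exact hstep T t ht (N + m) (by omega)
  have hlim : ∀ t : ℝ≥0, ∃ y, Tendsto (fun N => f (dyadicFloor N t)) atTop (𝓝 y) := by
    intro t
    obtain ⟨T, hT⟩ := exists_nat_gt t
    obtain ⟨y, hy⟩ := cauchySeq_tendsto_of_complete
      (cauchySeq_of_le_geometric η _ h1 (hstep' T t hT (N₀ T) le_rfl))
    refine ⟨y, ?_⟩
    rw [← tendsto_add_atTop_iff_nat (N₀ T)]
    simpa only [add_comm] using hy
  choose y hy using hlim
  refine ⟨y, ?_, hy⟩
  have hdist : ∀ (T : ℕ) (t : ℝ≥0), t < T → ∀ N ≥ N₀ T,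
      dist (f (dyadicFloor N t)) (y t) ≤ η ^ N / (1 - η) := by
    intro T t ht N hN
    refine dist_le_of_le_geometric_of_tendsto₀ η _ h1 (hstep' T t ht N hN) ?_
    have := (tendsto_add_atTop_iff_nat N).2 (hy t)
    simpa only [add_comm] using this
  -- the dyadic approximations of two points at a distance below `2⁻ᴺ` agree or are neighbours
  have hclose : ∀ (T : ℕ) (s t : ℝ≥0), s ≤ t → t < T → ∀ N ≥ N₀ T, t < s + (1 / 2) ^ N →
      dist (y s) (y t) ≤ η ^ N * (1 + 2 / (1 - η)) := by
    intro T s t hst ht N hN hlt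
    have hs := hst.trans_lt ht
    have h3 : dist (f (dyadicFloor N s)) (f (dyadicFloor N t)) ≤ η ^ N := by
      rw [dist_comm, Real.dist_eq, dyadicFloor, dyadicFloor]
      rcases floor_two_pow_of_le hst hlt with h | h
      · rw [h, sub_self, abs_zero]; positivity
      · rw [h]
        exact hN₀ T N hN _ (hfl N hs)
    calc dist (y s) (y t) ≤ dist (y s) (f (dyadicFloor N s)) +
          dist (f (dyadicFloor N s)) (f (dyadicFloor N t)) + dist (f (dyadicFloor N t)) (y t) :=
          dist_triangle4 _ _ _ _
      _ ≤ η ^ N / (1 - η) + η ^ N + η ^ N / (1 - η) := by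
          gcongr
          · rw [dist_comm]; exact hdist T s hs N hN
          · exact hdist T t ht N hN
      _ = _ := by ring
  rw [Metric.continuous_iff]
  intro t ε hε
  obtain ⟨T, hT⟩ := exists_nat_gt (t + 1)
  have hlim0 : Tendsto (fun N : ℕ => η ^ N * (1 + 2 / (1 - η))) atTop (𝓝 0) := by
    simpa using (tendsto_pow_atTop_nhds_zero_of_lt_one h0.le h1).mul_const (1 + 2 / (1 - η))
  obtain ⟨N, hN, hNε⟩ := ((eventually_ge_atTop (N₀ T)).and
    (hlim0.eventually (gt_mem_nhds hε))).exists
  refine ⟨(1 / 2) ^ N, by positivity, fun s hs => lt_of_le_of_lt ?_ hNε⟩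
  have hle : ((1 : ℝ) / 2) ^ N ≤ 1 := pow_le_one₀ (by norm_num) (by norm_num)
  rw [NNReal.dist_eq] at hs
  have hs' := abs_lt.1 hs
  rcases le_total s t with hst | hst
  · refine hclose T s t hst ?_ N hN ?_
    · exact lt_of_le_of_lt (by simp) hT
    · rw [← NNReal.coe_lt_coe]; push_cast; linarith
  · rw [dist_comm]
    refine hclose T t s hst ?_ N hN ?_
    · refine lt_trans ?_ hT
      rw [← NNReal.coe_lt_coe]; push_cast; linarith
    · rw [← NNReal.coe_lt_coe]; push_cast; linarith

end Dyadic

/-! ### Continuous modifications -/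

section Modification

variable {Ω : Type*} {mΩ : MeasurableSpace Ω} {P : Measure Ω}

/-- **Kolmogorov's continuity theorem** for fourth moments, the form needed for Gaussian processes.
The modification is continuous at every `ω`, not just almost surely. -/
theorem exists_continuous_modification [IsProbabilityMeasure P] {X : ℝ≥0 → Ω → ℝ} {K : ℝ}
    (hX : ∀ t, Measurable (X t)) (hint : ∀ s t, Integrable (fun ω => (X t ω - X s ω) ^ 4) P)
    (hK : ∀ s t, s ≤ t → ∫ ω, (X t ω - X s ω) ^ 4 ∂P ≤ K * ((t : ℝ) - s) ^ 2) :
    ∃ Y : ℝ≥0 → Ω → ℝ, (∀ t, Measurable (Y t)) ∧ (∀ ω, Continuous fun t => Y t ω) ∧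
      ∀ t, Y t =ᵐ[P] X t := by
  have hcheb : ∀ (s t : ℝ≥0), s ≤ t → ∀ ε : ℝ, 0 < ε →
      P {ω | ε ≤ |X t ω - X s ω|} ≤ ENNReal.ofReal (K * ((t : ℝ) - s) ^ 2 / ε ^ 4) := by
    intro s t hst ε hε
    have := measure_le_of_integral_le (hint s t) (fun ω => by positivity) (hK s t hst)
      (ε := ε ^ 4) (by positivity)
    refine (measure_mono fun ω hω => ?_).trans this
    simp only [Set.mem_ofPred_eq] at hω ⊢
    calc ε ^ 4 ≤ |X t ω - X s ω| ^ 4 := by gcongr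
      _ = _ := by rw [pow_abs, abs_of_nonneg (by positivity)]
  have hK0 : 0 ≤ K := by
    have h1 := hK 0 1 zero_le_one
    have h2 : 0 ≤ ∫ ω, (X 1 ω - X 0 ω) ^ 4 ∂P := integral_nonneg fun ω => by positivity
    norm_num at h1
    linarith
  -- any `η < 1` with `2 η⁴ > 1` makes the Borel–Cantelli series below converge: at level `N` there
  -- are `T 2ᴺ` increments, each exceeding `ηᴺ` with probability at most `K (4 η⁴)⁻ᴺ`
  set η : ℝ := 9 / 10 with hη
  have hη0 : 0 < η := by norm_num [hη]
  have hgood : ∀ᵐ ω ∂P, ∀ T : ℕ, ∀ᶠ N : ℕ in atTop, ∀ k < T * 2 ^ N,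
      |X (((k + 1 : ℕ) : ℝ≥0) / 2 ^ N) ω - X ((k : ℝ≥0) / 2 ^ N) ω| ≤ η ^ N := by
    rw [ae_all_iff]
    intro T
    set s : ℕ → Set Ω := fun N => {ω | ∃ k < T * 2 ^ N,
      η ^ N ≤ |X (((k + 1 : ℕ) : ℝ≥0) / 2 ^ N) ω - X ((k : ℝ≥0) / 2 ^ N) ω|} with hs
    have hr : (0 : ℝ) ≤ 1 / (2 * η ^ 4) ∧ 1 / (2 * η ^ 4) < 1 := by norm_num [hη]
    have hle : ∀ N, P (s N) ≤ ENNReal.ofReal (T * K * (1 / (2 * η ^ 4)) ^ N) := by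
      intro N
      have hsub : s N ⊆ ⋃ k ∈ Finset.range (T * 2 ^ N),
          {ω | η ^ N ≤ |X (((k + 1 : ℕ) : ℝ≥0) / 2 ^ N) ω - X ((k : ℝ≥0) / 2 ^ N) ω|} := by
        rintro ω ⟨k, hk, hω⟩
        simp only [Set.mem_iUnion, Finset.mem_range]
        exact ⟨k, hk, hω⟩
      refine (measure_mono hsub).trans ((measure_biUnion_finset_le _ _).trans ?_)
      have hk : ∀ k ∈ Finset.range (T * 2 ^ N),
          P {ω | η ^ N ≤ |X (((k + 1 : ℕ) : ℝ≥0) / 2 ^ N) ω - X ((k : ℝ≥0) / 2 ^ N) ω|} ≤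
            ENNReal.ofReal (K * (1 / 2 ^ N) ^ 2 / (η ^ N) ^ 4) := by
        intro k _
        refine (hcheb _ _ ?_ _ (by positivity)).trans (le_of_eq ?_)
        · gcongr; simp
        · congr 4
          push_cast
          ring
      refine (Finset.sum_le_sum hk).trans (le_of_eq ?_)
      rw [Finset.sum_const, Finset.card_range, ← ENNReal.ofReal_nsmul]
      congr 1
      rw [nsmul_eq_mul]
      push_cast
      rw [div_pow 1 (2 * η ^ 4), mul_pow, ← pow_mul, ← pow_mul, mul_comm N 4]
      field_simp
      simp
    have hsumm : ∑' N, P (s N) ≠ ⊤ := by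
      refine ne_top_of_le_ne_top ?_ (ENNReal.tsum_le_tsum hle)
      exact ((summable_geometric_of_lt_one hr.1 hr.2).mul_left (T * K)).tsum_ofReal_ne_top
    filter_upwards [ae_eventually_notMem hsumm] with ω hω
    filter_upwards [hω] with N hN k hk
    by_contra hc
    exact hN ⟨k, hk, (not_le.1 hc).le⟩
  -- outside the measurable event `G` the process is replaced by `0`, so that the limit exists
  -- everywhere
  obtain ⟨G, hGsub, hGm, hGP⟩ : ∃ G : Set Ω, (∀ ω ∈ G, ∀ T : ℕ, ∀ᶠ N : ℕ in atTop, ∀ k < T * 2 ^ N,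
      |X (((k + 1 : ℕ) : ℝ≥0) / 2 ^ N) ω - X ((k : ℝ≥0) / 2 ^ N) ω| ≤ η ^ N) ∧
      MeasurableSet G ∧ ∀ᵐ ω ∂P, ω ∈ G := by
    obtain ⟨G, h1, h2, h3⟩ := hgood.exists_measurable_mem
    exact ⟨G, h3, h2, h1⟩
  have hex : ∀ ω, ∃ y : ℝ≥0 → ℝ, Continuous y ∧
      ∀ t, Tendsto (fun N => G.indicator (X (dyadicFloor N t)) ω) atTop (𝓝 (y t)) := by
    intro ω
    by_cases hω : ω ∈ G
    · simp only [Set.indicator_of_mem hω]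
      exact exists_continuous_limit_dyadic (f := fun t => X t ω) hη0 (by norm_num [hη]) (hGsub ω hω)
    · simp only [Set.indicator_of_notMem hω]
      exact ⟨fun _ => 0, continuous_const, fun _ => tendsto_const_nhds⟩
  choose y hyc hy using hex
  have hYm : ∀ t, Measurable fun ω => y ω t := fun t =>
    measurable_of_tendsto_metrizable (fun N => (hX (dyadicFloor N t)).indicator hGm)
      (tendsto_pi_nhds.2 fun ω => hy ω t)
  refine ⟨fun t ω => y ω t, hYm, hyc, fun t => ?_⟩
  have h1 : TendstoInMeasure P (fun N => X (dyadicFloor N t)) atTop fun ω => y ω t := by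
    refine tendstoInMeasure_of_tendsto_ae (fun N => (hX _).aestronglyMeasurable) ?_
    filter_upwards [hGP] with ω hω
    simpa only [Set.indicator_of_mem hω] using hy ω t
  have h2 : TendstoInMeasure P (fun N => X (dyadicFloor N t)) atTop (X t) := by
    rw [tendstoInMeasure_real_iff]
    intro ε hε
    have hlim : Tendsto (fun N : ℕ => ENNReal.ofReal (K * ((1 / 2) ^ N) ^ 2 / ε ^ 4)) atTop (𝓝 0) := by
      have h3 : Tendsto (fun N : ℕ => K * (((1 : ℝ) / 2) ^ N) ^ 2 / ε ^ 4) atTop (𝓝 0) := by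
        have := (((tendsto_pow_atTop_nhds_zero_of_lt_one (r := (1 : ℝ) / 2)
          (by norm_num) (by norm_num)).pow 2).const_mul K).div_const (ε ^ 4)
        simpa using this
      simpa using ENNReal.tendsto_ofReal h3
    refine tendsto_of_tendsto_of_tendsto_of_le_of_le tendsto_const_nhds hlim
      (fun _ => zero_le) fun N => ?_
    have hle := dyadicFloor_le N t
    have hlt : (t : ℝ) < dyadicFloor N t + (1 / 2) ^ N := by
      exact_mod_cast lt_dyadicFloor_add N t
    have hle' : (dyadicFloor N t : ℝ) ≤ t := hle
    simp only [abs_sub_comm _ (X t _)]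
    refine (hcheb _ _ hle ε hε).trans (ENNReal.ofReal_le_ofReal ?_)
    gcongr
    linarith
  exact tendstoInMeasure_ae_unique h1 h2

end Modification

/-! ### Construction of Brownian motions -/

section Wiener

/-- The law of a centered Gaussian vector is determined by its covariance matrix. -/
theorem map_eq_of_covariance_eq {Ω κ : Type*} [Fintype κ] [DecidableEq κ] {mΩ : MeasurableSpace Ω}
    {P : Measure Ω} {X Y : κ → Ω → ℝ} (hX : HasGaussianLaw (fun ω q => X q ω) P)
    (hY : HasGaussianLaw (fun ω q => Y q ω) P) (hX0 : ∀ q, ∫ ω, X q ω ∂P = 0)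
    (hY0 : ∀ q, ∫ ω, Y q ω ∂P = 0) (h : ∀ q r, cov[X q, X r; P] = cov[Y q, Y r; P]) :
    P.map (fun ω q => X q ω) = P.map (fun ω q => Y q ω) := by
  have := hX.isProbabilityMeasure
  have hp : IsProbabilityMeasure (P.map fun ω q => X q ω) :=
    hX.isGaussian_map.toIsProbabilityMeasure
  have hp' : IsProbabilityMeasure (P.map fun ω q => Y q ω) :=
    hY.isGaussian_map.toIsProbabilityMeasure
  have key : ∀ {Z : κ → Ω → ℝ} (hZ : HasGaussianLaw (fun ω q => Z q ω) P)
      (_ : ∀ q, ∫ ω, Z q ω ∂P = 0) (L : StrongDual ℝ (κ → ℝ)),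
      (P.map (fun ω q => Z q ω)).map L = gaussianReal 0 (∑ q, ∑ r,
        L (Pi.single q 1) * (L (Pi.single r 1) * cov[Z q, Z r; P])).toNNReal := by
    intro Z hZ hZ0 L
    have hL2 : ∀ q, MemLp (Z q) 2 P := fun q => (hZ.eval q).memLp_two
    have e : L ∘ (fun ω q => Z q ω) = fun ω => ∑ q, L (Pi.single q 1) * Z q ω := by
      ext ω
      rw [Function.comp_apply]
      refine (LinearMap.pi_apply_eq_sum_univ (L : (κ → ℝ) →ₗ[ℝ] ℝ) _).trans
        (Finset.sum_congr rfl fun q _ => ?_)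
      have hs : (fun j => if q = j then (1 : ℝ) else 0) = Pi.single q 1 := by
        ext j
        simp [Pi.single_apply, eq_comm]
      rw [smul_eq_mul, mul_comm, hs]
      rfl
    have hm : AEMeasurable (fun ω q => Z q ω) P := hZ.aemeasurable
    rw [AEMeasurable.map_map_of_aemeasurable (by fun_prop) hm, (hZ.map L).map_eq_gaussianReal, e]
    congr 1
    · rw [integral_finsetSum _ fun q _ => ((hL2 q).integrable one_le_two).const_mul _]
      exact Finset.sum_eq_zero fun q _ => by rw [integral_const_mul, hZ0, mul_zero]
    · congr 1
      rw [← covariance_self (by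
        exact Finset.aemeasurable_fun_sum _ fun q _ => (hL2 q).aestronglyMeasurable.aemeasurable.const_mul _)]
      rw [covariance_fun_sum_fun_sum (fun q => (hL2 q).const_mul _) (fun q => (hL2 q).const_mul _)]
      simp only [covariance_const_mul_left, covariance_const_mul_right]
      exact Finset.sum_congr rfl fun q _ => Finset.sum_congr rfl fun r _ => mul_left_comm _ _ _
  refine Measure.ext_of_charFunDual ?_
  ext L
  rw [charFunDual_eq_charFun_map_one, charFunDual_eq_charFun_map_one, key hX hX0, key hY hY0]
  simp only [h]

/-- A finite family of independent real Brownian motions with continuous paths. -/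
theorem exists_wiener (κ : Type) [Fintype κ] [DecidableEq κ] :
    ∃ (Ω : Type u) (_ : MeasurableSpace Ω) (P : Measure Ω) (_ : IsProbabilityMeasure P)
      (W : ℝ≥0 × κ → Ω → ℝ), (∀ p, Measurable (W p)) ∧ (∀ ω q, Continuous fun t => W (t, q) ω) ∧
        IsGaussianProcess W P ∧ (∀ p, ∫ ω, W p ω ∂P = 0) ∧
        ∀ p p', cov[W p, W p'; P] = if p.2 = p'.2 then ((min p.1 p'.1 : ℝ≥0) : ℝ) else 0 := by
  let mκ : MeasurableSpace κ := ⊤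
  set ρ : Measure (ℝ × κ) := (volume : Measure ℝ).prod Measure.count with hρ
  obtain ⟨Ω, mΩ, P, hP, X, hXm, hXg, hX0, hXc⟩ := exists_isonormal.{u} (Lp ℝ 2 ρ)
  -- the indicators of `(0, t] × {q}` and `(0, t′] × {q′}` in `L²(ℝ × κ)` have the inner product
  -- `min t t′` if `q = q′`, and `0` otherwise
  set S : ℝ≥0 × κ → Set (ℝ × κ) := fun p => Set.Ioc 0 (p.1 : ℝ) ×ˢ {p.2} with hS
  have hSm : ∀ p, MeasurableSet (S p) := fun p =>
    measurableSet_Ioc.prod (measurableSet_singleton _)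
  have hSρ : ∀ p, ρ (S p) ≠ ⊤ := by
    intro p
    rw [hρ, hS, Measure.prod_prod]
    exact ENNReal.mul_ne_top (by simp) (by simp)
  set Z : ℝ≥0 × κ → Ω → ℝ := fun p => X (indicatorConstLp 2 (hSm p) (hSρ p) 1) with hZ
  have hZg : IsGaussianProcess Z P :=
    hXg.comp_right fun p => indicatorConstLp 2 (hSm p) (hSρ p) (1 : ℝ)
  have hZc : ∀ p p', cov[Z p, Z p'; P] = if p.2 = p'.2 then ((min p.1 p'.1 : ℝ≥0) : ℝ) else 0 := by
    intro p p'
    rw [hZ]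
    simp only
    rw [hXc, L2.real_inner_indicatorConstLp_one_indicatorConstLp_one (hSm p) (hSm p') (hSρ p) (hSρ p'),
      hS, Set.prod_inter_prod, Set.Ioc_inter_Ioc, hρ, measureReal_prod_prod]
    split_ifs with hpp
    · rw [hpp]
      simp only [Measure.real, Real.volume_Ioc, Set.inter_self, Measure.count_singleton]
      rw [max_self, sub_zero, ENNReal.toReal_ofReal (by positivity), ENNReal.toReal_one, mul_one]
      simp
    · rw [Set.singleton_inter_eq_empty.2 (by simpa using hpp)]
      simp
  have hZm : ∀ p, Measurable (Z p) := fun p => hXm _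
  have hZ0 : ∀ p, ∫ ω, Z p ω ∂P = 0 := fun p => hX0 _
  have hZL : ∀ p, MemLp (Z p) 2 P := fun p => (hZg.hasGaussianLaw_eval p).memLp_two
  have hincr : ∀ (q : κ) (s t : ℝ≥0), s ≤ t →
      P.map (fun ω => Z (t, q) ω - Z (s, q) ω) = gaussianReal 0 (t - s) := by
    intro q s t hst
    have hg : HasGaussianLaw (fun ω => Z (t, q) ω - Z (s, q) ω) P := hZg.hasGaussianLaw_fun_sub
    rw [hg.map_eq_gaussianReal, integral_sub ((hZL _).integrable one_le_two)
      ((hZL _).integrable one_le_two), hZ0, hZ0, sub_zero, variance_fun_sub (hZL _) (hZL _),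
      ← covariance_self (hZm _).aemeasurable, ← covariance_self (hZm _).aemeasurable, hZc, hZc, hZc]
    congr 1
    simp only [if_true, min_self, min_eq_right hst]
    refine NNReal.eq ?_
    have h3 : (s : ℝ) ≤ t := hst
    rw [Real.coe_toNNReal _ (by linarith), NNReal.coe_sub hst]
    ring
  have hmod : ∀ q, ∃ Y : ℝ≥0 → Ω → ℝ, (∀ t, Measurable (Y t)) ∧ (∀ ω, Continuous fun t => Y t ω) ∧
      ∀ t, Y t =ᵐ[P] Z (t, q) := by
    intro q
    refine exists_continuous_modification (X := fun t => Z (t, q)) (K := gaussianFourth)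
      (fun t => hZm _) (fun s t => ?_) fun s t hst => ?_
    · have hg : HasGaussianLaw (fun ω => Z (t, q) ω - Z (s, q) ω) P := hZg.hasGaussianLaw_fun_sub
      have := (hg.memLp (p := (4 : ℕ)) (by simp)).integrable_norm_pow (by norm_num)
      refine this.congr (Eventually.of_forall fun ω => ?_)
      simp only [Real.norm_eq_abs]
      rw [pow_abs, abs_of_nonneg (by positivity)]
    · have e : ∫ ω, (Z (t, q) ω - Z (s, q) ω) ^ 4 ∂P =
          ∫ x, x ^ 4 ∂(P.map fun ω => Z (t, q) ω - Z (s, q) ω) := by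
        rw [integral_map (φ := fun ω => Z (t, q) ω - Z (s, q) ω)
          ((hZm _).sub (hZm _)).aemeasurable (by fun_prop)]
      rw [e, hincr q s t hst, integral_pow_four_gaussianReal, NNReal.coe_sub hst, mul_comm]
  choose Y hYm hYc hYZ using hmod
  refine ⟨Ω, mΩ, P, hP, fun p => Y p.2 p.1, fun p => hYm _ _, fun ω q => hYc q ω,
    hZg.congr fun p => (hYZ p.2 p.1).symm, fun p => ?_, fun p p' => ?_⟩
  · rw [integral_congr_ae (hYZ p.2 p.1)]; exact hZ0 p
  · rw [← hZc, covariance, covariance, integral_congr_ae (hYZ p.2 p.1),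
      integral_congr_ae (hYZ p'.2 p'.1)]
    refine integral_congr_ae ?_
    filter_upwards [hYZ p.2 p.1, hYZ p'.2 p'.1] with ω h1 h2
    rw [h1, h2]

/-- A Brownian motion on `𝔰𝔩(n)` whose coordinates are given linear combinations of independent real
Brownian motions. -/
theorem exists_brownianMotionSL {n : ℕ} (κ : Type) [Fintype κ] [DecidableEq κ]
    (T : Fin n → Fin n → κ → ℝ) (hT : ∀ q, ∑ i, T i i q = 0) :
    ∃ (Ω : Type u) (mΩ : MeasurableSpace Ω) (P : Measure Ω) (_ : IsProbabilityMeasure P)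
      (ℱ : Filtration ℝ≥0 mΩ) (B : ℝ≥0 → Ω → Mat n), IsBrownianMotionSL P ℱ B ∧
        ∀ i j k l, covTensor P B i j k l = ∑ q, T i j q * T k l q := by
  obtain ⟨Ω, mΩ, P, hP, W, hWm, hWc, hWg, hW0, hWcov⟩ := exists_wiener.{u} κ
  -- the natural filtration of the real Brownian motions
  let ℱ : Filtration ℝ≥0 mΩ :=
    { seq t := MeasurableSpace.comap (fun ω (p : Set.Iic t × κ) => W (p.1, p.2) ω) MeasurableSpace.pi
      mono' := by
        intro s t hst
        have h1 : Measurable fun (x : Set.Iic t × κ → ℝ) (p : Set.Iic s × κ) =>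
            x (⟨p.1, p.1.2.trans hst⟩, p.2) :=
          measurable_pi_iff.2 fun p => measurable_pi_apply _
        have e : (fun ω (p : Set.Iic s × κ) => W (p.1, p.2) ω) =
            (fun (x : Set.Iic t × κ → ℝ) (p : Set.Iic s × κ) =>
              x (⟨p.1, p.1.2.trans hst⟩, p.2)) ∘ fun ω (p : Set.Iic t × κ) => W (p.1, p.2) ω := rfl
        simp only
        rw [e, ← MeasurableSpace.comap_comp]
        exact MeasurableSpace.comap_mono h1.comap_le
      le' t := Measurable.comap_le (measurable_pi_iff.2 fun p => hWm _) }
  have hWℱ : ∀ t q, Measurable[ℱ t] (W (t, q)) := by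
    intro t q
    have h1 := measurable_pi_apply (X := fun _ : Set.Iic t × κ => ℝ) (⟨t, Set.mem_Iic.2 le_rfl⟩, q)
    exact h1.comp (comap_measurable _)
  have hWL : ∀ p, MemLp (W p) 2 P := fun p => (hWg.hasGaussianLaw_eval p).memLp_two
  -- the linear map that sends the values of the real Brownian motions to the matrix
  let Φ : (κ → ℝ) →L[ℝ] Mat n :=
    { toFun w := Matrix.of fun i j => ∑ q, T i j q * w q
      map_add' x y := by
        ext i j
        simp [mul_add, Finset.sum_add_distrib]
      map_smul' c x := by
        ext i j
        simp [Finset.mul_sum, mul_left_comm]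
      cont := by
        refine continuous_matrix fun i j => ?_
        simp only [Matrix.of_apply]
        fun_prop }
  have hΦm : Measurable Φ := by
    refine measurable_mat_iff.2 fun i j => ?_
    exact Finset.measurable_fun_sum _ fun q _ => (measurable_pi_apply q).const_mul _
  have hΦ : ∀ w i j, Φ w i j = ∑ q, T i j q * w q := fun w i j => rfl
  set B : ℝ≥0 → Ω → Mat n := fun t ω => Φ fun q => W (t, q) ω with hB
  have hBsub : ∀ s t ω, B t ω - B s ω = Φ fun q => W (t, q) ω - W (s, q) ω := fun s t ω =>
    (map_sub Φ _ _).symm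
  -- the increments of all coordinates over `[s, t]`
  have hincrg : ∀ s t, IsGaussianProcess (fun q ω => W (t, q) ω - W (s, q) ω) P := by
    intro s t
    refine hWg.of_isGaussianProcess fun q => ⟨{(t, q), (s, q)},
      { toFun x := x ⟨(t, q), by simp⟩ - x ⟨(s, q), by simp⟩
        map_add' x y := by simp; abel
        map_smul' c x := by simp; ring },
      fun ω => rfl⟩
  have hvec : ∀ {Z : κ → Ω → ℝ}, IsGaussianProcess Z P → HasGaussianLaw (fun ω q => Z q ω) P := by
    intro Z hZ
    let L : (↥(Finset.univ : Finset κ) → ℝ) →L[ℝ] (κ → ℝ) :=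
      { toFun x q := x ⟨q, Finset.mem_univ q⟩
        map_add' _ _ := rfl
        map_smul' _ _ := rfl }
    exact (hZ.hasGaussianLaw Finset.univ).map L
  have hincr0 : ∀ s t q, ∫ ω, (W (t, q) ω - W (s, q) ω) ∂P = 0 := by
    intro s t q
    rw [integral_sub ((hWL _).integrable one_le_two) ((hWL _).integrable one_le_two), hW0, hW0,
      sub_zero]
  have hz : ∀ q, W (0, q) =ᵐ[P] 0 := by
    intro q
    have hg := hWg.hasGaussianLaw_eval (0, q)
    have h1 : ∫ ω, W (0, q) ω ^ 2 ∂P = 0 := by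
      have h2 := hWcov (0, q) (0, q)
      rw [covariance_self (hWm _).aemeasurable,
        variance_of_integral_eq_zero (hWm _).aemeasurable (hW0 _)] at h2
      simpa using h2
    have h2 := (integral_eq_zero_iff_of_nonneg (fun ω => sq_nonneg _) (hWL (0, q)).integrable_sq).1 h1
    filter_upwards [h2] with ω hω
    simpa using hω
  refine ⟨Ω, mΩ, P, hP, ℱ, B, ?_, ?_⟩
  · refine ⟨fun t => ?_, ae_of_all _ fun ω t => ?_, ae_of_all _ fun ω => ?_, ?_, fun s h => ?_,
      fun s h => ?_, fun t => ?_, fun t i j => ?_⟩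
    · exact hΦm.comp (@measurable_pi_lambda _ _ _ (ℱ t) _ _ fun q => hWℱ t q)
    · have htr : (B t ω).trace = 0 := by
        rw [Matrix.trace]
        simp only [Matrix.diag_apply, hB, hΦ]
        rw [Finset.sum_comm]
        exact Finset.sum_eq_zero fun q _ => by rw [← Finset.sum_mul, hT, zero_mul]
      exact htr
    · exact Φ.continuous.comp (continuous_pi fun q => hWc ω q)
    · filter_upwards [ae_all_iff.2 hz] with ω hω
      have : (fun q => W (0, q) ω) = 0 := funext fun q => hω q
      rw [hB]
      simp only [this, map_zero]
    -- for jointly Gaussian families, independence follows from vanishing covariances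
    · have hind : IndepFun (fun ω q => W (s + h, q) ω - W (s, q) ω)
          (fun ω (p : Set.Iic s × κ) => W (p.1, p.2) ω) P := by
        refine IsGaussianProcess.indepFun_of_covariance_eq_zero
          (X := fun q ω => W (s + h, q) ω - W (s, q) ω)
          (Y := fun (p : Set.Iic s × κ) ω => W (p.1, p.2) ω) ?_
          (fun q => ((hWm _).sub (hWm _)).aemeasurable) (fun p => (hWm _).aemeasurable) ?_
        · refine hWg.of_isGaussianProcess fun r => ?_
          rcases r with q | p
          · exact ⟨{(s + h, q), (s, q)},
              { toFun x := x ⟨(s + h, q), by simp⟩ - x ⟨(s, q), by simp⟩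
                map_add' x y := by simp; abel
                map_smul' c x := by simp; ring },
              fun ω => rfl⟩
          · exact ⟨{((p.1 : ℝ≥0), p.2)},
              { toFun x := x ⟨((p.1 : ℝ≥0), p.2), by simp⟩
                map_add' x y := rfl
                map_smul' c x := rfl },
              fun ω => rfl⟩
        · intro q p
          have hp : (p.1 : ℝ≥0) ≤ s := p.1.2
          rw [covariance_fun_sub_left (hWL _) (hWL _) (hWL _), hWcov, hWcov]
          simp only
          rw [min_eq_right hp, min_eq_right (hp.trans le_self_add), sub_self]
      have hi := (IndepFun_iff_Indep _ _ _).1 hind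
      refine indep_of_indep_of_le_left hi ?_
      have e : (fun ω => B (s + h) ω - B s ω) = Φ ∘ fun ω q => W (s + h, q) ω - W (s, q) ω :=
        funext fun ω => hBsub s (s + h) ω
      rw [e, ← MeasurableSpace.comap_comp]
      exact MeasurableSpace.comap_mono hΦm.comap_le
    · have e : (fun ω => B (s + h) ω - B s ω) = Φ ∘ fun ω q => W (s + h, q) ω - W (s, q) ω :=
        funext fun ω => hBsub s (s + h) ω
      have hid : IdentDistrib (fun ω q => W (s + h, q) ω - W (s, q) ω) (fun ω q => W (h, q) ω) P P := by
        refine ⟨(measurable_pi_iff.2 fun q => (hWm _).sub (hWm _)).aemeasurable,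
          (measurable_pi_iff.2 fun q => hWm _).aemeasurable, ?_⟩
        refine map_eq_of_covariance_eq (X := fun q ω => W (s + h, q) ω - W (s, q) ω)
          (Y := fun q ω => W (h, q) ω) (hvec (hincrg s (s + h)))
          (hvec (hWg.comp_right fun q => (h, q))) (hincr0 s (s + h)) (fun q => hW0 _) fun q r => ?_
        rw [covariance_fun_sub_left (Z := fun ω => W (s + h, r) ω - W (s, r) ω) (hWL _) (hWL _)
            ((hWL _).sub (hWL _)),
          covariance_fun_sub_right (hWL _) (hWL _) (hWL _),
          covariance_fun_sub_right (hWL _) (hWL _) (hWL _), hWcov, hWcov, hWcov, hWcov, hWcov]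
        simp only
        split_ifs
        · simp
        · simp
      rw [e]
      exact hid.comp hΦm
    · exact (hvec (hWg.comp_right fun q => (t, q))).map_of_measurable Φ hΦm
    · simp only [hB, hΦ]
      rw [integral_finsetSum _ fun q _ => ((hWL _).integrable one_le_two).const_mul _]
      exact Finset.sum_eq_zero fun q _ => by rw [integral_const_mul, hW0, mul_zero]
  · intro i j k l
    rw [covTensor]
    have hint : ∀ q r, Integrable (fun ω => T i j q * T k l r * (W (1, q) ω * W (1, r) ω)) P :=
      fun q r => ((hWL _).integrable_mul (hWL _)).const_mul _
    have e : ∀ ω, B 1 ω i j * B 1 ω k l =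
        ∑ q, ∑ r, T i j q * T k l r * (W (1, q) ω * W (1, r) ω) := by
      intro ω
      simp only [hB, hΦ]
      rw [Finset.sum_mul_sum]
      exact Finset.sum_congr rfl fun q _ => Finset.sum_congr rfl fun r _ => by ring
    simp only [e]
    rw [integral_finsetSum _ fun q _ => integrable_finsetSum _ fun r _ => hint q r]
    refine Finset.sum_congr rfl fun q _ => ?_
    rw [integral_finsetSum _ fun r _ => hint q r]
    have hc : ∀ r, ∫ ω, W (1, q) ω * W (1, r) ω ∂P = if q = r then 1 else 0 := by
      intro r
      have h1 := hWcov (1, q) (1, r)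
      rw [covariance_eq_sub (hWL _) (hWL _), hW0, zero_mul, sub_zero] at h1
      simpa using h1
    simp only [integral_const_mul, hc]
    simp

end Wiener

/-! ### Riemann sums and bounded variation along partitions -/

section Partitions

namespace TimePartition

variable {t : ℝ≥0}

theorem sub_le_mesh (π : TimePartition t) {k : ℕ} (hk : k < π.size) :
    π.pt (k + 1) - π.pt k ≤ π.mesh :=
  Finset.le_sup (f := fun k => π.pt (k + 1) - π.pt k) (Finset.mem_range.2 hk)

theorem pt_le (π : TimePartition t) {k : ℕ} (hk : k ≤ π.size) : π.pt k ≤ t :=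
  (π.mono hk).trans_eq π.pt_size

theorem coe_sub_nonneg (π : TimePartition t) (k : ℕ) : 0 ≤ (π.pt (k + 1) : ℝ) - π.pt k :=
  sub_nonneg.2 (π.mono (Nat.le_succ k))

theorem coe_sub_le_mesh (π : TimePartition t) {k : ℕ} (hk : k < π.size) :
    (π.pt (k + 1) : ℝ) - π.pt k ≤ π.mesh := by
  rw [← NNReal.coe_sub (π.mono (Nat.le_succ k))]
  exact π.sub_le_mesh hk

theorem sum_sub (π : TimePartition t) :
    ∑ k ∈ Finset.range π.size, ((π.pt (k + 1) : ℝ) - π.pt k) = t := by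
  rw [Finset.sum_range_sub fun k => (π.pt k : ℝ), π.pt_size, π.pt_zero]
  simp

theorem mesh_le {π : TimePartition t} {δ : ℝ≥0}
    (h : ∀ k < π.size, π.pt (k + 1) ≤ π.pt k + δ) : π.mesh ≤ δ :=
  Finset.sup_le fun k hk => tsub_le_iff_left.2 (h k (Finset.mem_range.1 hk))

/-- The partition of `[0, t]` into `m + 1` intervals of equal length. -/
noncomputable def uniform (t : ℝ≥0) (m : ℕ) : TimePartition t where
  size := m + 1
  pt k := k * (t / (m + 1))
  mono j k h := by simp only; gcongr
  pt_zero := by simp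
  pt_size := by push_cast; field_simp

theorem mesh_uniform_le (t : ℝ≥0) (m : ℕ) : (uniform t m).mesh ≤ t / (m + 1) :=
  mesh_le fun k _ => by
    simp only [uniform]
    push_cast
    rw [add_mul, one_mul]

theorem tendsto_div_add_one (t : ℝ≥0) : Tendsto (fun m : ℕ => t / ((m : ℝ≥0) + 1)) atTop (𝓝 0) := by
  rw [← NNReal.tendsto_coe]
  push_cast
  exact tendsto_const_div_atTop_nhds_zero_nat (t : ℝ) |>.comp (tendsto_add_atTop_nat 1) |>.congr
    fun m => by simp

theorem tendsto_meshToZero_iff {ι : Type*} {l : Filter ι} {π : ι → TimePartition t} :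
    Tendsto π l (meshToZero t) ↔ Tendsto (fun i => (π i).mesh) l (𝓝 0) :=
  tendsto_comap_iff

theorem tendsto_meshToZero_of_le {ι : Type*} {l : Filter ι} {π : ι → TimePartition t} {δ : ι → ℝ≥0}
    (h : ∀ i, (π i).mesh ≤ δ i) (hδ : Tendsto δ l (𝓝 0)) : Tendsto π l (meshToZero t) :=
  tendsto_meshToZero_iff.2 (tendsto_of_tendsto_of_tendsto_of_le_of_le tendsto_const_nhds hδ
    (fun _ => zero_le) h)

theorem tendsto_uniform (t : ℝ≥0) : Tendsto (uniform t) atTop (meshToZero t) :=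
  tendsto_meshToZero_of_le (mesh_uniform_le t) (tendsto_div_add_one t)

instance (t : ℝ≥0) : (meshToZero t).NeBot := (tendsto_uniform t).neBot

instance (t : ℝ≥0) : (meshToZero t).IsCountablyGenerated := by
  unfold meshToZero; infer_instance

end TimePartition

/-- Uniform continuity on `[0, t]` of a continuous function. -/
theorem exists_modulus {f : ℝ≥0 → ℝ} (hf : Continuous f) (t : ℝ≥0) {ε : ℝ} (hε : 0 < ε) :
    ∃ δ : ℝ, 0 < δ ∧ ∀ r s : ℝ≥0, r ≤ s → s ≤ t → (s : ℝ) ≤ r + δ → |f s - f r| ≤ ε := by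
  have hu := (isCompact_Icc (a := (0 : ℝ≥0)) (b := t)).uniformContinuousOn_of_continuous
    hf.continuousOn
  rw [Metric.uniformContinuousOn_iff_le] at hu
  obtain ⟨δ, hδ, h⟩ := hu ε hε
  refine ⟨δ, hδ, fun r s hrs hst hsr => ?_⟩
  have h1 := h s ⟨zero_le, hst⟩ r ⟨zero_le, hrs.trans hst⟩ ?_
  · rwa [Real.dist_eq] at h1
  · have h2 : (r : ℝ) ≤ s := hrs
    rw [NNReal.dist_eq, abs_of_nonneg (by linarith)]
    linarith

theorem eventually_forall_sub_le {f : ℝ≥0 → ℝ} (hf : Continuous f) {t : ℝ≥0} {ε : ℝ} (hε : 0 < ε) :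
    ∀ᶠ π in TimePartition.meshToZero t, ∀ k < π.size, ∀ s, π.pt k ≤ s → s ≤ π.pt (k + 1) →
      |f s - f (π.pt k)| ≤ ε := by
  obtain ⟨δ, hδ, h⟩ := exists_modulus hf t hε
  have h1 : ∀ᶠ π in TimePartition.meshToZero t, (π.mesh : ℝ) < δ := by
    have h2 : Tendsto (fun π : TimePartition t => (π.mesh : ℝ)) (TimePartition.meshToZero t) (𝓝 0) :=
      NNReal.tendsto_coe.2 tendsto_comap
    exact h2.eventually (gt_mem_nhds hδ)
  filter_upwards [h1] with π hπ k hk s hs hs'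
  refine h _ _ hs (hs'.trans (π.pt_le hk)) ?_
  have h2 := π.coe_sub_le_mesh hk
  have h3 : (s : ℝ) ≤ π.pt (k + 1) := hs'
  linarith

/-- Convergence of Riemann sums. -/
theorem tendsto_riemannSum {f : ℝ≥0 → ℝ} (hf : Continuous f) (t : ℝ≥0) :
    Tendsto (fun π : TimePartition t => ∑ k ∈ Finset.range π.size,
      f (π.pt k) * ((π.pt (k + 1) : ℝ) - π.pt k)) (TimePartition.meshToZero t)
      (𝓝 (∫ s in (0 : ℝ)..t, f s.toNNReal)) := by
  have hc : Continuous fun s : ℝ => f s.toNNReal := hf.comp continuous_real_toNNReal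
  rw [Metric.tendsto_nhds]
  intro ε hε
  have hε' : 0 < ε / (t + 1) := by positivity
  filter_upwards [eventually_forall_sub_le hf (t := t) hε'] with π hπ
  have e1 : ∫ s in (0 : ℝ)..t, f s.toNNReal = ∑ k ∈ Finset.range π.size,
      ∫ s in (π.pt k : ℝ)..(π.pt (k + 1)), f s.toNNReal := by
    rw [intervalIntegral.sum_integral_adjacent_intervals fun k _ => hc.intervalIntegrable _ _,
      π.pt_size, π.pt_zero, NNReal.coe_zero]
  have e2 : ∀ k, f (π.pt k) * ((π.pt (k + 1) : ℝ) - π.pt k) =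
      ∫ _ in (π.pt k : ℝ)..(π.pt (k + 1)), f (π.pt k) := by
    intro k
    rw [intervalIntegral.integral_const, smul_eq_mul, mul_comm]
  rw [Real.dist_eq, e1]
  simp only [e2]
  rw [← Finset.sum_sub_distrib]
  calc |∑ k ∈ Finset.range π.size, ((∫ _ in (π.pt k : ℝ)..(π.pt (k + 1)), f (π.pt k)) -
          ∫ s in (π.pt k : ℝ)..(π.pt (k + 1)), f s.toNNReal)|
      ≤ ∑ k ∈ Finset.range π.size, ε / (t + 1) * ((π.pt (k + 1) : ℝ) - π.pt k) := by
        refine (Finset.abs_sum_le_sum_abs _ _).trans (Finset.sum_le_sum fun k hk => ?_)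
        rw [← intervalIntegral.integral_sub intervalIntegrable_const (hc.intervalIntegrable _ _),
          ← abs_of_nonneg (π.coe_sub_nonneg k)]
        refine intervalIntegral.norm_integral_le_of_norm_le_const (E := ℝ)
          (f := fun s => f (π.pt k) - f s.toNNReal) fun s hs => ?_
        have hle : (π.pt k : ℝ) ≤ π.pt (k + 1) := π.mono (Nat.le_succ k)
        rw [Set.uIoc_of_le hle] at hs
        rw [Real.norm_eq_abs, abs_sub_comm]
        refine hπ k (Finset.mem_range.1 hk) _ ?_ ?_
        · exact NNReal.le_toNNReal_of_coe_le hs.1.le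
        · exact Real.toNNReal_le_iff_le_coe.2 hs.2
    _ = ε / (t + 1) * t := by rw [← Finset.mul_sum, π.sum_sub]
    _ < ε := by
        rw [div_mul_eq_mul_div, div_lt_iff₀ (by positivity)]
        have := t.coe_nonneg
        nlinarith

/-- Products of the increments of a function of bounded variation with those of a continuous
function are negligible. -/
theorem tendsto_sum_mul_of_boundedVariation {A b : ℝ≥0 → ℝ}
    (hA : LocallyBoundedVariationOn A Set.univ) (hb : Continuous b) (t : ℝ≥0) :
    Tendsto (fun π : TimePartition t => ∑ k ∈ Finset.range π.size,
      (A (π.pt (k + 1)) - A (π.pt k)) * (b (π.pt (k + 1)) - b (π.pt k)))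
      (TimePartition.meshToZero t) (𝓝 0) := by
  have hfin := hA 0 t (Set.mem_univ _) (Set.mem_univ _)
  set v := (eVariationOn A (Set.univ ∩ Set.Icc 0 t)).toReal with hv
  have hsum : ∀ π : TimePartition t,
      ∑ k ∈ Finset.range π.size, |A (π.pt (k + 1)) - A (π.pt k)| ≤ v := by
    intro π
    have h1 := eVariationOn.sum_le_of_monotoneOn_Iic (f := A) (s := Set.univ ∩ Set.Icc 0 t)
      (n := π.size) (u := π.pt) (π.mono.monotoneOn _)
      fun k hk => ⟨Set.mem_univ _, zero_le, π.pt_le hk⟩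
    have h2 := ENNReal.toReal_mono hfin h1
    rw [ENNReal.toReal_sum fun k _ => edist_ne_top _ _] at h2
    simpa only [← dist_edist, Real.dist_eq] using h2
  rw [Metric.tendsto_nhds]
  intro ε hε
  have hv0 : 0 ≤ v := ENNReal.toReal_nonneg
  have hε' : 0 < ε / (v + 1) := by positivity
  filter_upwards [eventually_forall_sub_le hb (t := t) hε'] with π hπ
  rw [Real.dist_eq, sub_zero]
  calc |∑ k ∈ Finset.range π.size,
          (A (π.pt (k + 1)) - A (π.pt k)) * (b (π.pt (k + 1)) - b (π.pt k))|
      ≤ ∑ k ∈ Finset.range π.size, |A (π.pt (k + 1)) - A (π.pt k)| * (ε / (v + 1)) := by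
        refine (Finset.abs_sum_le_sum_abs _ _).trans (Finset.sum_le_sum fun k hk => ?_)
        rw [abs_mul]
        exact mul_le_mul_of_nonneg_left (hπ k (Finset.mem_range.1 hk) _ (π.mono (Nat.le_succ k)) le_rfl)
          (abs_nonneg _)
    _ ≤ v * (ε / (v + 1)) := by
        rw [← Finset.sum_mul]
        exact mul_le_mul_of_nonneg_right (hsum π) hε'.le
    _ < ε := by
        rw [mul_div_assoc', div_lt_iff₀ (by positivity)]
        nlinarith

end Partitions

/-! ### Continuous processes on compact intervals -/

section ContinuousProcesses

variable {Ω : Type*} {mΩ : MeasurableSpace Ω} {P : Measure Ω}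

theorem tendsto_measure_of_ae_eventually_notMem [IsProbabilityMeasure P] {E : ℕ → Set Ω}
    (hE : ∀ i, MeasurableSet (E i)) (h : ∀ᵐ ω ∂P, ∀ᶠ i in atTop, ω ∉ E i) :
    Tendsto (fun i => P (E i)) atTop (𝓝 0) := by
  have h1 : TendstoInMeasure P (fun i => (E i).indicator fun _ => (1 : ℝ)) atTop fun _ => 0 := by
    refine tendstoInMeasure_of_tendsto_ae
      (fun i => (measurable_const.indicator (hE i)).aestronglyMeasurable) ?_
    filter_upwards [h] with ω hω
    refine tendsto_const_nhds.congr' ?_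
    filter_upwards [hω] with i hi
    rw [Set.indicator_of_notMem hi]
  refine (tendstoInMeasure_real_iff.1 h1 1 one_pos).congr fun i => ?_
  congr 1
  ext ω
  by_cases hω : ω ∈ E i <;> simp [hω]

/-- Almost sure convergence along a countably generated filter (not only along sequences) implies
convergence in probability. -/
theorem tendstoInMeasure_of_ae_tendsto [IsProbabilityMeasure P] {ι : Type*} {l : Filter ι}
    [l.IsCountablyGenerated] {f : ι → Ω → ℝ} {g : Ω → ℝ} (hf : ∀ i, AEStronglyMeasurable (f i) P)
    (h : ∀ᵐ ω ∂P, Tendsto (fun i => f i ω) l (𝓝 (g ω))) : TendstoInMeasure P f l g :=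
  tendstoInMeasure_of_seq fun x hx => tendstoInMeasure_of_tendsto_ae (fun i => hf (x i)) <| by
    filter_upwards [h] with ω hω
    exact hω.comp hx

theorem exists_measure_lt_abs_le [IsProbabilityMeasure P] {b : Ω → ℝ} (hb : Measurable b)
    {η : ℝ≥0∞} (hη : 0 < η) : ∃ K : ℝ, 0 < K ∧ P {ω | K < |b ω|} ≤ η := by
  have h := tendsto_measure_of_ae_eventually_notMem (P := P)
    (E := fun i : ℕ => {ω | (i : ℝ) + 1 < |b ω|})
    (fun i => measurableSet_lt measurable_const hb.abs) (ae_of_all _ fun ω => by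
      obtain ⟨N, hN⟩ := exists_nat_gt |b ω|
      filter_upwards [eventually_ge_atTop N] with i hi
      simp only [not_lt]
      have : (N : ℝ) ≤ i := by exact_mod_cast hi
      linarith)
  obtain ⟨i, hi⟩ := ((tendsto_order.1 h).2 η hη).exists
  exact ⟨i + 1, by positivity, hi.le⟩

/-- A fixed random factor is bounded outside an event of small probability. -/
theorem tendstoInMeasure_mul_fixed [IsProbabilityMeasure P] {ι : Type*} {l : Filter ι}
    {f : ι → Ω → ℝ} {g b : Ω → ℝ} (h : TendstoInMeasure P f l g) (hb : Measurable b) :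
    TendstoInMeasure P (fun i ω => f i ω * b ω) l fun ω => g ω * b ω := by
  rw [tendstoInMeasure_real_iff] at *
  intro ε hε
  rw [ENNReal.tendsto_nhds_zero]
  intro η hη
  obtain ⟨K, hK, hKη⟩ := exists_measure_lt_abs_le (P := P) hb (ENNReal.half_pos hη.ne')
  filter_upwards [ENNReal.tendsto_nhds_zero.1 (h (ε / K) (by positivity)) (η / 2)
    (ENNReal.half_pos hη.ne')] with i hi
  refine (measure_mono (t := {ω | ε / K ≤ |f i ω - g ω|} ∪ {ω | K < |b ω|}) fun ω hω => ?_).trans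
    ((measure_union_le _ _).trans ((add_le_add hi hKη).trans (ENNReal.add_halves η).le))
  simp only [Set.mem_ofPred_eq, Set.mem_union] at *
  by_contra hc
  push Not at hc
  rw [← sub_mul, abs_mul] at hω
  have h1 := (lt_div_iff₀ hK).1 hc.1
  have h2 : |f i ω - g ω| * |b ω| ≤ |f i ω - g ω| * K :=
    mul_le_mul_of_nonneg_left hc.2 (abs_nonneg _)
  linarith

/-- Bounds on probabilities pass to the limit, at the price of a factor in the threshold. -/
theorem measure_le_of_tendstoInMeasure {ι : Type*} {l : Filter ι} [l.NeBot]
    {f : ι → Ω → ℝ} {g : Ω → ℝ} (h : TendstoInMeasure P f l g) {δ : ℝ} (hδ : 0 < δ) {c : ℝ≥0∞}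
    (hc : ∀ i, P {ω | δ ≤ |f i ω|} ≤ c) : P {ω | 2 * δ ≤ |g ω|} ≤ c := by
  have h1 : Tendsto (fun i => c + P {ω | δ ≤ |f i ω - g ω|}) l (𝓝 (c + 0)) :=
    tendsto_const_nhds.add (tendstoInMeasure_real_iff.1 h δ hδ)
  rw [add_zero] at h1
  refine ge_of_tendsto' h1 fun i => ?_
  refine (measure_mono fun ω hω => ?_).trans ((measure_union_le _ _).trans
    (add_le_add (hc i) le_rfl))
  simp only [Set.mem_ofPred_eq, Set.mem_union] at *
  by_contra hcon
  push Not at hcon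
  have := abs_sub_abs_le_abs_sub (g ω) (f i ω)
  rw [abs_sub_comm] at this
  linarith [hcon.1, hcon.2]

variable {f : ℝ≥0 → Ω → ℝ}

/-- A process with continuous paths is bounded in probability on compact intervals. -/
theorem exists_measure_sup_le [IsProbabilityMeasure P] (hm : ∀ t, Measurable (f t))
    (hc : ∀ᵐ ω ∂P, Continuous fun t => f t ω) (t : ℝ≥0) {η : ℝ≥0∞} (hη : 0 < η) :
    ∃ K : ℝ, 0 < K ∧ P {ω | ∃ s ≤ t, K < |f s ω|} ≤ η := by
  set d := TopologicalSpace.denseSeq ℝ≥0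
  have hd : DenseRange d := TopologicalSpace.denseRange_denseSeq ℝ≥0
  have h := tendsto_measure_of_ae_eventually_notMem (P := P)
    (E := fun i : ℕ => ⋃ m, {ω | (i : ℝ) + 1 < |f (min (d m) t) ω|})
    (fun i => MeasurableSet.iUnion fun m => measurableSet_lt measurable_const (hm _).abs) (by
      filter_upwards [hc] with ω hω
      have hbdd := (isCompact_Icc (a := (0 : ℝ≥0)) (b := t)).bddAbove_image hω.abs.continuousOn
      obtain ⟨M, hM⟩ := hbdd
      obtain ⟨N, hN⟩ := exists_nat_gt M
      filter_upwards [eventually_ge_atTop N] with i hi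
      simp only [Set.mem_iUnion, Set.mem_ofPred_eq, not_exists, not_lt]
      intro m
      have h1 : |f (min (d m) t) ω| ≤ M := hM ⟨_, ⟨zero_le, min_le_right _ _⟩, rfl⟩
      have : (N : ℝ) ≤ i := by exact_mod_cast hi
      linarith)
  obtain ⟨i, hi⟩ := ((tendsto_order.1 h).2 η hη).exists
  refine ⟨i + 1, by positivity, le_trans (measure_mono_ae ?_) hi.le⟩
  filter_upwards [hc] with ω hω
  rintro ⟨s, hs, hlt⟩
  have hopen : IsOpen {r : ℝ≥0 | (i : ℝ) + 1 < |f (min r t) ω|} :=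
    isOpen_lt continuous_const (hω.comp (by fun_prop : Continuous fun r : ℝ≥0 => min r t)).abs
  obtain ⟨m, hm'⟩ := hd.exists_mem_open hopen ⟨s, by simpa only [Set.mem_ofPred_eq, min_eq_left hs]⟩
  exact Set.mem_iUnion.2 ⟨m, hm'⟩

/-- A process with continuous paths is uniformly continuous in probability on compact intervals. -/
theorem exists_measure_modulus_le [IsProbabilityMeasure P] (hm : ∀ t, Measurable (f t))
    (hc : ∀ᵐ ω ∂P, Continuous fun t => f t ω) (t : ℝ≥0) {ε : ℝ} (hε : 0 < ε) {η : ℝ≥0∞}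
    (hη : 0 < η) :
    ∃ δ : ℝ, 0 < δ ∧
      P {ω | ∃ r s : ℝ≥0, r ≤ s ∧ s ≤ t ∧ (s : ℝ) ≤ r + δ ∧ ε < |f s ω - f r ω|} ≤ η := by
  set d := TopologicalSpace.denseSeq (ℝ≥0 × ℝ≥0)
  have hd : DenseRange d := TopologicalSpace.denseRange_denseSeq (ℝ≥0 × ℝ≥0)
  have h := tendsto_measure_of_ae_eventually_notMem (P := P)
    (E := fun i : ℕ => ⋃ m, {ω | |((min (d m).2 t : ℝ≥0) : ℝ) - (min (d m).1 t : ℝ≥0)| < 1 / (i + 1) ∧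
      ε < |f (min (d m).2 t) ω - f (min (d m).1 t) ω|})
    (fun i => MeasurableSet.iUnion fun m => (MeasurableSet.const _).inter
      (measurableSet_lt measurable_const ((hm _).sub (hm _)).abs)) (by
      filter_upwards [hc] with ω hω
      obtain ⟨δ, hδ, hδ'⟩ := exists_modulus hω t hε
      obtain ⟨N, hN⟩ := exists_nat_one_div_lt hδ
      filter_upwards [eventually_ge_atTop N] with i hi
      simp only [Set.mem_iUnion, Set.mem_ofPred_eq, not_exists, not_and, not_lt]
      intro m hm1
      have h1 : (1 : ℝ) / (i + 1) ≤ 1 / (N + 1) := Nat.one_div_le_one_div hi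
      have h2 := abs_lt.1 hm1
      rcases le_total (min (d m).1 t) (min (d m).2 t) with hle | hle
      · exact hδ' _ _ hle (min_le_right _ _) (by linarith [h2.2])
      · rw [abs_sub_comm]
        exact hδ' _ _ hle (min_le_right _ _) (by linarith [h2.1]))
  obtain ⟨i, hi⟩ := ((tendsto_order.1 h).2 η hη).exists
  have hpos : (0 : ℝ) < 1 / (i + 1) := by positivity
  refine ⟨1 / (i + 1) / 2, by positivity, le_trans (measure_mono_ae ?_) hi.le⟩
  filter_upwards [hc] with ω hω
  rintro ⟨r, s, hrs, hst, hsr, hlt⟩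
  have hc1 : Continuous fun p : ℝ≥0 × ℝ≥0 =>
      |((min p.2 t : ℝ≥0) : ℝ) - (min p.1 t : ℝ≥0)| := by fun_prop
  have hc2 : Continuous fun p : ℝ≥0 × ℝ≥0 => |f (min p.2 t) ω - f (min p.1 t) ω| :=
    ((hω.comp (by fun_prop : Continuous fun p : ℝ≥0 × ℝ≥0 => min p.2 t)).sub
      (hω.comp (by fun_prop : Continuous fun p : ℝ≥0 × ℝ≥0 => min p.1 t))).abs
  have hopen := (isOpen_lt hc1 (continuous_const (y := (1 : ℝ) / (i + 1)))).inter
    (isOpen_lt (continuous_const (y := ε)) hc2)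
  obtain ⟨m, hm'⟩ := hd.exists_mem_open hopen ⟨(r, s), by
    have h1 : (r : ℝ) ≤ s := hrs
    simp only [Set.mem_inter_iff, Set.mem_ofPred_eq, min_eq_left hst, min_eq_left (hrs.trans hst)]
    refine ⟨?_, hlt⟩
    rw [abs_of_nonneg (by linarith)]
    linarith⟩
  exact Set.mem_iUnion.2 ⟨m, hm'⟩

end ContinuousProcesses

/-! ### Covariation with a Brownian motion -/

section Covariation

variable {n : ℕ} {Ω : Type u} {mΩ : MeasurableSpace Ω} {P : Measure Ω} {ℱ : Filtration ℝ≥0 mΩ}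
  {B : ℝ≥0 → Ω → Mat n}

/-- The matrix `𝔼 B₁ B₁`, the density of the covariation `[B B]_t`. -/
noncomputable def quadDrift (P : Measure Ω) (B : ℝ≥0 → Ω → Mat n) : Mat n :=
  Matrix.of fun i j => ∑ l, covTensor P B i l l j

/-- The matrix `∫₀ᵗ F_s ds`, entry by entry. -/
noncomputable def timeIntegral (F : ℝ≥0 → Ω → Mat n) (t : ℝ≥0) (ω : Ω) : Mat n :=
  Matrix.of fun i j => ∫ s in (0 : ℝ)..t, F s.toNNReal ω i j

theorem TimePartition.sum_sq_le {t : ℝ≥0} (π : TimePartition t) :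
    ∑ k ∈ Finset.range π.size, ((π.pt (k + 1) : ℝ) - π.pt k) ^ 2 ≤ π.mesh * t := by
  rw [← π.sum_sub, Finset.mul_sum]
  refine Finset.sum_le_sum fun k hk => ?_
  rw [sq]
  exact mul_le_mul_of_nonneg_right (π.coe_sub_le_mesh (Finset.mem_range.1 hk)) (π.coe_sub_nonneg k)

/-- Reduces a bound at the points of a partition to a bound that does not depend on the partition.
-/
theorem measure_exists_partition_le {f : ℝ≥0 → Ω → ℝ} {t : ℝ≥0} (π : TimePartition t) (K : ℝ) :
    P {ω | ∃ k < π.size, K < |f (π.pt k) ω|} ≤ P {ω | ∃ s ≤ t, K < |f s ω|} :=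
  measure_mono fun _ ⟨_, hk, h⟩ => ⟨_, π.pt_le hk.le, h⟩

/-- The weighted quadratic variation of the entries of `B`. -/
theorem IsBrownianMotionSL.tendsto_sum_mul_incr_mul [IsProbabilityMeasure P]
    (hB : IsBrownianMotionSL P ℱ B) {f : ℝ≥0 → Ω → ℝ} (hf : ∀ t, Measurable[ℱ t] (f t))
    (hc : ∀ᵐ ω ∂P, Continuous fun t => f t ω) (i j k l : Fin n) (t : ℝ≥0) :
    TendstoInMeasure P (fun (π : TimePartition t) ω => ∑ m ∈ Finset.range π.size,
      f (π.pt m) ω * ((B (π.pt (m + 1)) ω i j - B (π.pt m) ω i j) *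
        (B (π.pt (m + 1)) ω k l - B (π.pt m) ω k l))) (TimePartition.meshToZero t)
      fun ω => covTensor P B i j k l * ∫ s in (0 : ℝ)..t, f s.toNNReal ω := by
  have hfm : ∀ t, Measurable (f t) := fun t => (hf t).mono (ℱ.le t) le_rfl
  -- the compensated sums have variance of order `mesh`, once the weights are truncated
  have h1 : TendstoInMeasure P (fun (π : TimePartition t) ω => ∑ m ∈ Finset.range π.size,
      f (π.pt m) ω * ((B (π.pt (m + 1)) ω i j - B (π.pt m) ω i j) *
        (B (π.pt (m + 1)) ω k l - B (π.pt m) ω k l) -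
          ((π.pt (m + 1) : ℝ) - π.pt m) * covTensor P B i j k l))
      (TimePartition.meshToZero t) fun _ => 0 := by
    refine tendstoInMeasure_zero_of_forall_le fun δ hδ η hη => ?_
    obtain ⟨K, hK, hKη⟩ := exists_measure_sup_le hfm hc t
      (ENNReal.ofReal_pos.2 (half_pos hη))
    have hlim : Tendsto (fun π : TimePartition t =>
        K ^ 2 * (π.mesh * t * quadConst P B i j k l) / δ ^ 2) (TimePartition.meshToZero t) (𝓝 0) := by
      have h2 : Tendsto (fun π : TimePartition t => (π.mesh : ℝ)) (TimePartition.meshToZero t) (𝓝 0) :=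
        NNReal.tendsto_coe.2 tendsto_comap
      simpa using (((h2.mul_const (t : ℝ)).mul_const (quadConst P B i j k l)).const_mul
        (K ^ 2)).div_const (δ ^ 2)
    filter_upwards [hlim.eventually (ge_mem_nhds (half_pos hη))] with π hπ
    refine ((hB.isNoise_incr_mul π.mono i j k l).measure_sum_le (fun m => hf (π.pt m)) π.size hK.le
      hδ).trans ?_
    rw [← add_halves η, ENNReal.ofReal_add (half_pos hη).le (half_pos hη).le]
    refine add_le_add ((measure_exists_partition_le π K).trans hKη)
      (ENNReal.ofReal_le_ofReal (le_trans ?_ hπ))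
    rw [← Finset.sum_mul]
    have := quadConst_nonneg (P := P) (B := B) i j k l
    gcongr
    exact π.sum_sq_le
  -- the compensators form Riemann sums
  have h2 : TendstoInMeasure P (fun (π : TimePartition t) ω => ∑ m ∈ Finset.range π.size,
      f (π.pt m) ω * ((π.pt (m + 1) : ℝ) - π.pt m)) (TimePartition.meshToZero t)
      fun ω => ∫ s in (0 : ℝ)..t, f s.toNNReal ω := by
    refine tendstoInMeasure_of_ae_tendsto (fun π => ?_) ?_
    · exact (Finset.measurable_fun_sum _ fun m _ => (hfm _).mul_const _).aestronglyMeasurable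
    · filter_upwards [hc] with ω hω
      exact tendsto_riemannSum hω t
  have h3 := tendstoInMeasure_add h1 (tendstoInMeasure_const_mul (covTensor P B i j k l) h2)
  refine (h3.congr_left fun π => Eventually.of_forall fun ω => ?_).congr_right
    (Eventually.of_forall fun ω => zero_add _)
  rw [Finset.mul_sum, ← Finset.sum_add_distrib]
  exact Finset.sum_congr rfl fun m _ => by ring

/-- The point number `j` when `[s, t]` is divided into `m + 1` intervals of equal length. -/
noncomputable def subdivision (s t : ℝ≥0) (m j : ℕ) : ℝ≥0 := s + j * ((t - s) / (m + 1))

theorem subdivision_mono (s t : ℝ≥0) (m : ℕ) : Monotone (subdivision s t m) := fun j k h => by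
  simp only [subdivision]; gcongr

theorem subdivision_zero (s t : ℝ≥0) (m : ℕ) : subdivision s t m 0 = s := by simp [subdivision]

theorem subdivision_end {s t : ℝ≥0} (h : s ≤ t) (m : ℕ) : subdivision s t m (m + 1) = t := by
  have e : ((m + 1 : ℕ) : ℝ≥0) * ((t - s) / (m + 1)) = t - s := by push_cast; field_simp
  rw [subdivision, e, add_tsub_cancel_of_le h]

/-- The partition of `[0, t]` that divides both `[0, s]` and `[s, t]` into `m + 1` intervals. -/
noncomputable def TimePartition.concat {s t : ℝ≥0} (h : s ≤ t) (m : ℕ) : TimePartition t where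
  size := (m + 1) + (m + 1)
  pt j := ((min j (m + 1) : ℕ) : ℝ≥0) * (s / (m + 1)) + ((j - (m + 1) : ℕ) : ℝ≥0) * ((t - s) / (m + 1))
  mono j k hjk := by
    simp only
    gcongr
  pt_zero := by simp
  pt_size := by
    simp only [add_tsub_cancel_right, Nat.min_eq_right (Nat.le_add_left (m + 1) (m + 1))]
    push_cast
    have e1 : ((m : ℝ≥0) + 1) * (s / (m + 1)) = s := by field_simp
    have e2 : ((m : ℝ≥0) + 1) * ((t - s) / (m + 1)) = t - s := by field_simp
    rw [e1, e2, add_tsub_cancel_of_le h]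

theorem TimePartition.concat_pt_add {s t : ℝ≥0} (h : s ≤ t) (m j : ℕ) :
    (concat h m).pt (m + 1 + j) = subdivision s t m j := by
  simp only [concat, subdivision, add_tsub_cancel_left, Nat.min_eq_right (Nat.le_add_right (m + 1) j)]
  congr 1
  push_cast
  field_simp

theorem TimePartition.concat_pt_of_le {s t : ℝ≥0} (h : s ≤ t) {m j : ℕ} (hj : j ≤ m + 1) :
    (concat h m).pt j = (uniform s m).pt j := by
  simp only [concat, uniform, Nat.min_eq_left hj, Nat.sub_eq_zero_of_le hj, Nat.cast_zero, zero_mul,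
    add_zero]

theorem TimePartition.mesh_concat_le {s t : ℝ≥0} (h : s ≤ t) (m : ℕ) :
    (concat h m).mesh ≤ t / (m + 1) := by
  refine mesh_le fun k hk => ?_
  rcases lt_or_ge k (m + 1) with hk' | hk'
  · rw [concat_pt_of_le h hk', concat_pt_of_le h hk'.le]
    simp only [uniform]
    push_cast
    rw [add_mul, one_mul]
    gcongr
  · obtain ⟨j, rfl⟩ := Nat.exists_eq_add_of_le hk'
    rw [add_assoc, concat_pt_add, concat_pt_add]
    simp only [subdivision]
    push_cast
    rw [add_mul, one_mul, ← add_assoc]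
    gcongr
    exact tsub_le_self

/-- Left-point sums over the subdivisions of `[s, t]` converge to the increment over `[s, t]`. -/
theorem tendsto_sum_subdivision {F : ℝ≥0 → Ω → Mat n} {M : ℝ≥0 → Ω → ℝ} {i l : Fin n}
    (hM : ∀ t, TendstoInMeasure P (fun (π : TimePartition t) ω => π.leftSum F B ω i l)
      (TimePartition.meshToZero t) (M t)) {s t : ℝ≥0} (h : s ≤ t) :
    TendstoInMeasure P (fun m ω => ∑ j ∈ Finset.range (m + 1), (F (subdivision s t m j) ω *
      (B (subdivision s t m (j + 1)) ω - B (subdivision s t m j) ω)) i l) atTop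
      fun ω => M t ω - M s ω := by
  have h1 := (hM t).comp (TimePartition.tendsto_meshToZero_of_le
    (TimePartition.mesh_concat_le h) (TimePartition.tendsto_div_add_one t))
  have h2 := (hM s).comp (TimePartition.tendsto_uniform s)
  refine (tendstoInMeasure_sub h1 h2).congr_left fun m => Eventually.of_forall fun ω => ?_
  simp only [Function.comp_apply, TimePartition.leftSum, Matrix.sum_apply]
  have e : (TimePartition.concat h m).size = (m + 1) + (m + 1) := rfl
  have e' : (TimePartition.uniform s m).size = m + 1 := rfl
  rw [e, e', Finset.sum_range_add]
  rw [sub_eq_iff_eq_add, add_comm (Finset.sum _ _)]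
  congr 1
  · refine Finset.sum_congr rfl fun j _ => ?_
    rw [add_assoc (m + 1) j 1, TimePartition.concat_pt_add, TimePartition.concat_pt_add]
  · refine Finset.sum_congr rfl fun j hj => ?_
    have hj' := Finset.mem_range.1 hj
    rw [TimePartition.concat_pt_of_le h hj', TimePartition.concat_pt_of_le h hj'.le]

/-- A continuous process oscillates little on the intervals of a fine partition, in probability. -/
theorem eventually_measure_osc_le [IsProbabilityMeasure P] {f : ℝ≥0 → Ω → ℝ}
    (hm : ∀ t, Measurable (f t)) (hc : ∀ᵐ ω ∂P, Continuous fun t => f t ω) (t : ℝ≥0) {ε : ℝ}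
    (hε : 0 < ε) {η : ℝ≥0∞} (hη : 0 < η) :
    ∀ᶠ π in TimePartition.meshToZero t, P {ω | ∃ k < π.size, ∃ s, π.pt k ≤ s ∧ s ≤ π.pt (k + 1) ∧
      ε < |f s ω - f (π.pt k) ω|} ≤ η := by
  obtain ⟨δ, hδ, h⟩ := exists_measure_modulus_le hm hc t hε hη
  have h1 : ∀ᶠ π in TimePartition.meshToZero t, (π.mesh : ℝ) < δ := by
    have h2 : Tendsto (fun π : TimePartition t => (π.mesh : ℝ)) (TimePartition.meshToZero t) (𝓝 0) :=
      NNReal.tendsto_coe.2 tendsto_comap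
    exact h2.eventually (gt_mem_nhds hδ)
  filter_upwards [h1] with π hπ
  refine (measure_mono ?_).trans h
  rintro ω ⟨k, hk, s, hs, hs', hlt⟩
  refine ⟨π.pt k, s, hs, hs'.trans (π.pt_le hk), ?_, hlt⟩
  have h2 := π.coe_sub_le_mesh hk
  have h3 : (s : ℝ) ≤ π.pt (k + 1) := hs'
  linarith

/-- If `M` is the limit of the left-point sums of `F`, then the increments of `M` differ from
`F_{t_k} (B_{t_{k+1}} - B_{t_k})` by quantities that do not contribute to the covariation with `B`:
they are limits of sums `∑ (F_s - F_{t_k}) dB_s`, whose weights are small by continuity. -/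
theorem IsBrownianMotionSL.tendsto_sum_remainder_mul [IsProbabilityMeasure P]
    (hB : IsBrownianMotionSL P ℱ B) {F : ℝ≥0 → Ω → Mat n} (hF : Adapted ℱ F)
    (hc : ∀ᵐ ω ∂P, Continuous fun t => F t ω) {M : ℝ≥0 → Ω → ℝ} {i l : Fin n}
    (hM : ∀ t, TendstoInMeasure P (fun (π : TimePartition t) ω => π.leftSum F B ω i l)
      (TimePartition.meshToZero t) (M t)) (k j : Fin n) (t : ℝ≥0) :
    TendstoInMeasure P (fun (π : TimePartition t) ω => ∑ m ∈ Finset.range π.size,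
      (M (π.pt (m + 1)) ω - M (π.pt m) ω -
        (F (π.pt m) ω * (B (π.pt (m + 1)) ω - B (π.pt m) ω)) i l) *
        (B (π.pt (m + 1)) ω k j - B (π.pt m) ω k j)) (TimePartition.meshToZero t) fun _ => 0 := by
  refine tendstoInMeasure_zero_of_forall_le fun δ₂ hδ₂ η hη => ?_
  -- `ε` bounds the oscillation of `F` on the intervals of the partition. It is chosen so that the
  -- expectation `ε Γ t / 2`, divided by `δ`, is at most `η / 2` at the end; the other `η / 2`
  -- bounds the probability that the oscillation exceeds `ε`.
  set Γ : ℝ := covTensor P B k j k j + n * ∑ p, covTensor P B p l p l with hΓ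
  have hΓ0 : 0 ≤ Γ := add_nonneg (covTensor_self_nonneg _ _)
    (mul_nonneg (by positivity) (Finset.sum_nonneg fun p _ => covTensor_self_nonneg _ _))
  obtain ⟨δ, hδ, rfl⟩ : ∃ δ : ℝ, 0 < δ ∧ δ₂ = 2 * δ := ⟨δ₂ / 2, by positivity, by ring⟩
  set ε : ℝ := η * δ / (Γ * t + 1) with hε_def
  have hden : 0 < Γ * t + 1 := by positivity
  have hε : 0 < ε := by positivity
  have hη' : 0 < ENNReal.ofReal (η / (2 * (n + 1))) := ENNReal.ofReal_pos.2 (by positivity)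
  have hosc : ∀ᶠ π in TimePartition.meshToZero t, ∀ p : Fin n,
      P {ω | ∃ k < π.size, ∃ s, π.pt k ≤ s ∧ s ≤ π.pt (k + 1) ∧
        ε < |F s ω i p - F (π.pt k) ω i p|} ≤ ENNReal.ofReal (η / (2 * (n + 1))) := by
    rw [eventually_all]
    intro p
    refine eventually_measure_osc_le (f := fun t ω => F t ω i p) (fun t => hF.entry' t i p) ?_ t hε hη'
    filter_upwards [hc] with ω hω
    exact hω.matrix_elem i p
  filter_upwards [hosc] with π hπ
  set q : ℕ → ℕ → ℕ → ℝ≥0 := fun r m => subdivision (π.pt m) (π.pt (m + 1)) r with hq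
  have hqm : ∀ r m, Monotone (q r m) := fun r m => subdivision_mono _ _ _
  have hq0 : ∀ r m, q r m 0 = π.pt m := fun r m => subdivision_zero _ _ _
  have hq1 : ∀ r m, q r m (r + 1) = π.pt (m + 1) := fun r m =>
    subdivision_end (π.mono (Nat.le_succ m)) _
  -- approximation of the increments of `M` by sums over subdivisions of the intervals
  have hconv : TendstoInMeasure P (fun r ω => ∑ m ∈ Finset.range π.size,
      (∑ a ∈ Finset.range (r + 1), ((F (q r m a) ω - F (π.pt m) ω) *
        (B (q r m (a + 1)) ω - B (q r m a) ω)) i l) *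
        (B (π.pt (m + 1)) ω k j - B (π.pt m) ω k j)) atTop
      fun ω => ∑ m ∈ Finset.range π.size,
      (M (π.pt (m + 1)) ω - M (π.pt m) ω -
        (F (π.pt m) ω * (B (π.pt (m + 1)) ω - B (π.pt m) ω)) i l) *
        (B (π.pt (m + 1)) ω k j - B (π.pt m) ω k j) := by
    refine tendstoInMeasure_finsetSum _ fun m _ => ?_
    refine tendstoInMeasure_mul_fixed ?_ ((hB.adapted.entry' _ k j).sub (hB.adapted.entry' _ k j))
    have h1 := tendstoInMeasure_sub (tendsto_sum_subdivision hM (π.mono (Nat.le_succ m)))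
      (tendstoInMeasure_const fun ω => (F (π.pt m) ω * (B (π.pt (m + 1)) ω - B (π.pt m) ω)) i l)
    refine h1.congr_left fun r => Eventually.of_forall fun ω => ?_
    have e : B (π.pt (m + 1)) ω - B (π.pt m) ω =
        ∑ a ∈ Finset.range (r + 1), (B (q r m (a + 1)) ω - B (q r m a) ω) := by
      rw [Finset.sum_range_sub fun a => B (q r m a) ω, hq0, hq1]
    rw [e, Finset.mul_sum, Matrix.sum_apply, ← Finset.sum_sub_distrib]
    refine Finset.sum_congr rfl fun a _ => ?_
    rw [← Matrix.sub_apply, ← sub_mul]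
  refine measure_le_of_tendstoInMeasure hconv hδ fun r => ?_
  -- truncation of the weights at `ε`
  set T : ℝ → ℝ := fun x => if |x| ≤ ε then x else 0 with hT
  have hTb : ∀ x, |T x| ≤ ε := by
    intro x; simp only [hT]; split_ifs with h
    · exact h
    · simpa using hε.le
  have hTm : Measurable T :=
    Measurable.ite (measurableSet_le continuous_abs.measurable measurable_const) measurable_id
      measurable_const
  set Y : ℕ → Fin n → Ω → ℝ := fun m p ω => ∑ a ∈ Finset.range (r + 1),
    T (F (q r m a) ω i p - F (π.pt m) ω i p) * (B (q r m (a + 1)) ω p l - B (q r m a) ω p l) with hY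
  have hYsq : ∀ m p, MemLp (Y m p) 2 P ∧ ∫ ω, Y m p ω ^ 2 ∂P ≤
      ε ^ 2 * (((π.pt (m + 1) : ℝ) - π.pt m) * covTensor P B p l p l) := by
    intro m p
    have hmeas : ∀ a, Measurable[discreteFiltration ℱ (hqm r m) a] fun ω =>
        T (F (q r m a) ω i p - F (π.pt m) ω i p) := by
      intro a
      refine hTm.comp ((hF.entry (q r m a) i p).sub ((hF.entry (π.pt m) i p).mono (ℱ.mono ?_) le_rfl))
      rw [← hq0 r m]
      exact hqm r m (Nat.zero_le a)
    have h := (hB.isNoise_incr (hqm r m) p l).memLp_integral_sq_le hmeas (fun a ω => hTb _) (r + 1)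
    refine ⟨h.1, h.2.trans (le_of_eq ?_)⟩
    rw [← Finset.sum_mul, Finset.sum_range_sub fun a => (q r m a : ℝ), hq0, hq1]
  have hb2 : ∀ m, MemLp (fun ω => B (π.pt (m + 1)) ω k j - B (π.pt m) ω k j) 2 P := fun m =>
    hB.memLp_incr _ _ k j (by simp)
  have hYs : ∀ m, MemLp (fun ω => ∑ p, Y m p ω) 2 P := fun m =>
    memLp_finsetSum _ fun p _ => (hYsq m p).1
  have hint : ∀ m, ∫ ω, |(∑ p, Y m p ω) * (B (π.pt (m + 1)) ω k j - B (π.pt m) ω k j)| ∂P ≤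
      ε / 2 * Γ * ((π.pt (m + 1) : ℝ) - π.pt m) := by
    intro m
    have hp : ∀ ω, |(∑ p, Y m p ω) * (B (π.pt (m + 1)) ω k j - B (π.pt m) ω k j)| ≤
        ε / 2 * (B (π.pt (m + 1)) ω k j - B (π.pt m) ω k j) ^ 2 +
          ∑ p, n / (2 * ε) * Y m p ω ^ 2 := by
      intro ω
      have h1 : (∑ p, Y m p ω) ^ 2 ≤ n * ∑ p, Y m p ω ^ 2 := by
        simpa using sq_sum_le_card_mul_sum_sq (s := (Finset.univ : Finset (Fin n)))
          (f := fun p => Y m p ω)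
      rw [← Finset.mul_sum, abs_mul]
      set y := ∑ p, Y m p ω
      set b := B (π.pt (m + 1)) ω k j - B (π.pt m) ω k j
      have h2 : y ^ 2 / (2 * ε) ≤ n / (2 * ε) * ∑ p, Y m p ω ^ 2 := by
        rw [div_mul_eq_mul_div]
        gcongr
      -- Young's inequality
      have h3 : |y| * |b| ≤ ε / 2 * b ^ 2 + y ^ 2 / (2 * ε) := by
        have h4 := sq_nonneg (ε * |b| - |y|)
        have h5 : ε / 2 * b ^ 2 + y ^ 2 / (2 * ε) = (ε ^ 2 * |b| ^ 2 + |y| ^ 2) / (2 * ε) := by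
          rw [sq_abs, sq_abs]; field_simp
        rw [h5, le_div_iff₀ (by positivity)]
        nlinarith
      linarith
    have hi1 : Integrable (fun ω => ε / 2 * (B (π.pt (m + 1)) ω k j - B (π.pt m) ω k j) ^ 2) P :=
      (hb2 m).integrable_sq.const_mul _
    have hi2 : ∀ p, Integrable (fun ω => n / (2 * ε) * Y m p ω ^ 2) P := fun p =>
      (hYsq m p).1.integrable_sq.const_mul _
    refine (integral_mono ((hYs m).integrable_mul (hb2 m)).abs
      (hi1.add (integrable_finsetSum _ fun p _ => hi2 p)) hp).trans ?_
    simp only [Pi.add_apply]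
    rw [integral_add hi1 (integrable_finsetSum _ fun p _ => hi2 p),
      integral_finsetSum _ fun p _ => hi2 p, integral_const_mul]
    simp only [integral_const_mul]
    rw [← Finset.mul_sum]
    have h1 : ∫ ω, (B (π.pt (m + 1)) ω k j - B (π.pt m) ω k j) ^ 2 ∂P =
        ((π.pt (m + 1) : ℝ) - π.pt m) * covTensor P B k j k j := by
      rw [← hB.integral_incr_mul (π.mono (Nat.le_succ m)) k j k j]
      simp only [sq]
    have h2 : ∑ p, ∫ ω, Y m p ω ^ 2 ∂P ≤
        ε ^ 2 * (((π.pt (m + 1) : ℝ) - π.pt m) * ∑ p, covTensor P B p l p l) := by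
      rw [Finset.mul_sum, Finset.mul_sum]
      exact Finset.sum_le_sum fun p _ => (hYsq m p).2
    calc _ ≤ ε / 2 * (((π.pt (m + 1) : ℝ) - π.pt m) * covTensor P B k j k j) + n / (2 * ε) *
          (ε ^ 2 * (((π.pt (m + 1) : ℝ) - π.pt m) * ∑ p, covTensor P B p l p l)) := by
          rw [h1]; gcongr
      _ = _ := by
          rw [hΓ]; field_simp
  have htail : P {ω | δ ≤ ∑ m ∈ Finset.range π.size,
      |(∑ p, Y m p ω) * (B (π.pt (m + 1)) ω k j - B (π.pt m) ω k j)|} ≤ ENNReal.ofReal (η / 2) := by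
    have hi : ∀ m, Integrable (fun ω => |(∑ p, Y m p ω) *
        (B (π.pt (m + 1)) ω k j - B (π.pt m) ω k j)|) P := fun m =>
      ((hYs m).integrable_mul (hb2 m)).abs
    refine (measure_le_of_integral_le (v := ε / 2 * Γ * t) (integrable_finsetSum _ fun m _ => hi m)
      (fun ω => Finset.sum_nonneg fun m _ => abs_nonneg _) ?_ hδ).trans (ENNReal.ofReal_le_ofReal ?_)
    · rw [integral_finsetSum _ fun m _ => hi m, ← π.sum_sub, Finset.mul_sum]
      exact Finset.sum_le_sum fun m _ => hint m
    · rw [hε_def, div_le_iff₀ hδ]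
      have h1 : η * δ / (Γ * t + 1) / 2 * Γ * t = η / 2 * δ * (Γ * t / (Γ * t + 1)) := by
        field_simp
      rw [h1]
      refine mul_le_of_le_one_right (by positivity) ?_
      rw [div_le_one hden]
      linarith
  -- unless the oscillation exceeds `ε`, the truncation changes nothing
  calc _ ≤ P ((⋃ p : Fin n, {ω | ∃ k < π.size, ∃ s, π.pt k ≤ s ∧ s ≤ π.pt (k + 1) ∧
          ε < |F s ω i p - F (π.pt k) ω i p|}) ∪ {ω | δ ≤ ∑ m ∈ Finset.range π.size,
          |(∑ p, Y m p ω) * (B (π.pt (m + 1)) ω k j - B (π.pt m) ω k j)|}) := by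
        refine measure_mono fun ω hω => ?_
        by_cases hE : ω ∈ ⋃ p : Fin n, {ω | ∃ k < π.size, ∃ s, π.pt k ≤ s ∧ s ≤ π.pt (k + 1) ∧
          ε < |F s ω i p - F (π.pt k) ω i p|}
        · exact Or.inl hE
        · right
          simp only [Set.mem_iUnion, Set.mem_ofPred_eq, not_exists, not_and, not_lt] at hE hω ⊢
          refine hω.trans ((Finset.abs_sum_le_sum_abs _ _).trans (le_of_eq ?_))
          refine Finset.sum_congr rfl fun m hm => ?_
          congr 2
          simp only [hY, Matrix.mul_apply, Matrix.sub_apply]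
          rw [Finset.sum_comm]
          refine Finset.sum_congr rfl fun p _ => Finset.sum_congr rfl fun a ha => ?_
          congr 1
          refine (if_pos (hE p m (Finset.mem_range.1 hm) _ ?_ ?_)).symm
          · rw [← hq0 r m]; exact hqm r m (Nat.zero_le a)
          · rw [← hq1 r m]; exact hqm r m (Finset.mem_range.1 ha).le
    _ ≤ ∑ _p : Fin n, ENNReal.ofReal (η / (2 * (n + 1))) + ENNReal.ofReal (η / 2) := by
        refine (measure_union_le _ _).trans (add_le_add ?_ htail)
        exact (measure_iUnion_fintype_le _ _).trans (Finset.sum_le_sum fun p _ => hπ p)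
    _ ≤ ENNReal.ofReal η := by
        rw [Finset.sum_const, Finset.card_univ, Fintype.card_fin, ← ENNReal.ofReal_nsmul,
          ← ENNReal.ofReal_add (by positivity) (by positivity)]
        refine ENNReal.ofReal_le_ofReal ?_
        rw [nsmul_eq_mul]
        have : (n : ℝ) * (η / (2 * (n + 1))) ≤ η / 2 := by
          rw [mul_div_assoc', div_le_div_iff₀ (by positivity) (by positivity)]
          nlinarith
        linarith

/-- The covariation of `F = F₀ + ∫ F dB + A` and `B`, where `A` has locally bounded variation: it is
`∫ F_s ds` times `𝔼 B₁ B₁`. -/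
theorem IsBrownianMotionSL.tendsto_covSum [IsProbabilityMeasure P]
    (hB : IsBrownianMotionSL P ℱ B) {F A : ℝ≥0 → Ω → Mat n} (hF : Adapted ℱ F)
    (hc : ∀ᵐ ω ∂P, Continuous fun t => F t ω)
    (hA : ∀ᵐ ω ∂P, ∀ i j, LocallyBoundedVariationOn (fun t => A t ω i j) Set.univ)
    (hM : TendstoAlongPartitions P (fun _ π => π.leftSum F B) fun t ω => F t ω - F 0 ω - A t ω) :
    TendstoAlongPartitions P (fun _ π => π.covSum F B)
      fun t ω => timeIntegral F t ω * quadDrift P B := by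
  intro t i j
  -- `A` is not assumed to be adapted, but it is a limit of measurable functions up to terms in `F`
  have hAm : ∀ s l, AEMeasurable (fun ω => A s ω i l) P := by
    intro s l
    have h1 : AEMeasurable (fun ω => (F s ω - F 0 ω - A s ω) i l) P := by
      refine (hM s i l).aemeasurable fun π => ?_
      simp only [TimePartition.leftSum, Matrix.sum_apply, Matrix.mul_apply, Matrix.sub_apply]
      exact (Finset.measurable_fun_sum _ fun k _ => Finset.measurable_fun_sum _ fun p _ =>
        (hF.entry' _ i p).mul ((hB.adapted.entry' _ p l).sub (hB.adapted.entry' _ p l))).aemeasurable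
    refine (((hF.entry' s i l).sub (hF.entry' 0 i l)).aemeasurable.sub h1).congr
      (Eventually.of_forall fun ω => ?_)
    simp only [Matrix.sub_apply, Pi.sub_apply]
    ring
  -- the increment of `F` is the sum of the increment of `A` (`h1`), the product of `F` at the left
  -- point and the increment of `B` (`h3`), and a remainder (`h2`)
  have key : ∀ l, TendstoInMeasure P (fun (π : TimePartition t) ω => ∑ m ∈ Finset.range π.size,
      (F (π.pt (m + 1)) ω i l - F (π.pt m) ω i l) * (B (π.pt (m + 1)) ω l j - B (π.pt m) ω l j))
      (TimePartition.meshToZero t)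
      fun ω => ∑ p, covTensor P B p l l j * ∫ s in (0 : ℝ)..t, F s.toNNReal ω i p := by
    intro l
    have h1 : TendstoInMeasure P (fun (π : TimePartition t) ω => ∑ m ∈ Finset.range π.size,
        (A (π.pt (m + 1)) ω i l - A (π.pt m) ω i l) * (B (π.pt (m + 1)) ω l j - B (π.pt m) ω l j))
        (TimePartition.meshToZero t) fun _ => 0 := by
      refine tendstoInMeasure_of_ae_tendsto (fun π => ?_) ?_
      · exact (Finset.aemeasurable_fun_sum _ fun m _ => ((hAm _ l).sub (hAm _ l)).mul
          ((hB.adapted.entry' _ l j).sub (hB.adapted.entry' _ l j)).aemeasurable).aestronglyMeasurable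
      · filter_upwards [hA, hB.continuous] with ω hω hω'
        exact tendsto_sum_mul_of_boundedVariation (hω i l) (hω'.matrix_elem l j) t
    have h2 := hB.tendsto_sum_remainder_mul hF hc (fun s => hM s i l) l j t
    have h3 : TendstoInMeasure P (fun (π : TimePartition t) ω => ∑ p, ∑ m ∈ Finset.range π.size,
        F (π.pt m) ω i p * ((B (π.pt (m + 1)) ω p l - B (π.pt m) ω p l) *
          (B (π.pt (m + 1)) ω l j - B (π.pt m) ω l j))) (TimePartition.meshToZero t)
        fun ω => ∑ p, covTensor P B p l l j * ∫ s in (0 : ℝ)..t, F s.toNNReal ω i p := by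
      refine tendstoInMeasure_finsetSum _ fun p _ => ?_
      refine hB.tendsto_sum_mul_incr_mul (f := fun t ω => F t ω i p) (fun t => hF.entry t i p) ?_ _ _ _ _ t
      filter_upwards [hc] with ω hω
      exact hω.matrix_elem i p
    refine ((tendstoInMeasure_add (tendstoInMeasure_add h1 h2) h3).congr_left fun π =>
      Eventually.of_forall fun ω => ?_).congr_right (Eventually.of_forall fun ω => ?_)
    · rw [Finset.sum_comm, ← Finset.sum_add_distrib, ← Finset.sum_add_distrib]
      refine Finset.sum_congr rfl fun m _ => ?_
      simp only [Matrix.sub_apply, Matrix.mul_apply, ← mul_assoc]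
      rw [← Finset.sum_mul]
      ring
    · simp only [zero_add]
  refine ((tendstoInMeasure_finsetSum Finset.univ fun l _ => key l).congr_left fun π =>
    Eventually.of_forall fun ω => ?_).congr_right (Eventually.of_forall fun ω => ?_)
  · simp only [TimePartition.covSum, Matrix.sum_apply, Matrix.mul_apply, Matrix.sub_apply]
    rw [Finset.sum_comm]
  · simp only [timeIntegral, quadDrift, Matrix.mul_apply, Matrix.of_apply]
    rw [Finset.sum_comm]
    refine Finset.sum_congr rfl fun p _ => ?_
    rw [Finset.mul_sum]
    exact Finset.sum_congr rfl fun l _ => mul_comm _ _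

end Covariation

/-! ### The Itô form of the Stratonovich equation -/

section ItoForm

theorem locallyBoundedVariationOn_integral {g : ℝ≥0 → ℝ} (hg : Continuous g) :
    LocallyBoundedVariationOn (fun t : ℝ≥0 => ∫ s in (0 : ℝ)..t, g s.toNNReal) Set.univ := by
  intro a b ha hb
  have hc : Continuous fun s : ℝ => g s.toNNReal := hg.comp continuous_real_toNNReal
  obtain ⟨C, hC⟩ := (isCompact_Icc (a := (0 : ℝ)) (b := b)).exists_bound_of_continuousOn
    hc.continuousOn
  have hlip : LipschitzOnWith C.toNNReal (fun t : ℝ => ∫ s in (0 : ℝ)..t, g s.toNNReal)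
      (Set.Icc (0 : ℝ) b) := by
    refine LipschitzOnWith.of_dist_le_mul fun x hx y hy => ?_
    rw [Real.dist_eq, Real.dist_eq, intervalIntegral.integral_interval_sub_left
      (hc.intervalIntegrable _ _) (hc.intervalIntegrable _ _)]
    refine intervalIntegral.norm_integral_le_of_norm_le_const (E := ℝ)
      (f := fun s : ℝ => g s.toNNReal) fun s hs => ?_
    refine (hC s ?_).trans (Real.le_coe_toNNReal C)
    have h1 := Set.uIoc_subset_uIcc hs
    exact (Set.uIcc_subset_Icc hy hx) h1
  have hmono : MonotoneOn (fun t : ℝ≥0 => (t : ℝ)) (Set.univ ∩ Set.Icc a b) :=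
    fun x _ y _ h => h
  have hmaps : Set.MapsTo (fun t : ℝ≥0 => (t : ℝ)) (Set.univ ∩ Set.Icc a b) (Set.Icc (0 : ℝ) b) :=
    fun x hx => ⟨x.coe_nonneg, hx.2.2⟩
  refine hlip.comp_boundedVariationOn hmaps ?_
  have h1 : LocallyBoundedVariationOn (fun t : ℝ≥0 => (t : ℝ)) Set.univ :=
    MonotoneOn.locallyBoundedVariationOn fun x _ y _ h => h
  exact h1 a b ha hb

variable {n : ℕ} {Ω : Type u} {mΩ : MeasurableSpace Ω} {P : Measure Ω} {ℱ : Filtration ℝ≥0 mΩ}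
  {B F : ℝ≥0 → Ω → Mat n}

theorem timeIntegral_mul_apply {ω : Ω} (hF : Continuous fun t => F t ω) (A : Mat n) (t : ℝ≥0)
    (i j : Fin n) :
    (timeIntegral F t ω * A) i j = ∫ s in (0 : ℝ)..t, (F s.toNNReal ω * A) i j := by
  have hc : ∀ l, Continuous fun s : ℝ => F s.toNNReal ω i l := fun l =>
    (hF.matrix_elem i l).comp continuous_real_toNNReal
  simp only [Matrix.mul_apply, timeIntegral, Matrix.of_apply]
  rw [intervalIntegral.integral_finsetSum fun l _ => ((hc l).mul_const _).intervalIntegrable _ _]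
  exact Finset.sum_congr rfl fun l _ => (intervalIntegral.integral_mul_const _ _).symm

theorem continuous_timeIntegral {ω : Ω} (hF : Continuous fun t => F t ω) :
    Continuous fun t => timeIntegral F t ω := by
  refine continuous_matrix fun i j => ?_
  have hc : Continuous fun s : ℝ => F s.toNNReal ω i j :=
    (hF.matrix_elem i j).comp continuous_real_toNNReal
  exact (intervalIntegral.continuous_primitive (fun a b => hc.intervalIntegrable a b) 0).comp
    NNReal.continuous_coe

/-- The drift `½ 𝔼 B₁ B₁` of the Itô form of the equation. -/
noncomputable def itoDrift (P : Measure Ω) (B : ℝ≥0 → Ω → Mat n) : Mat n :=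
  (1 / 2 : ℝ) • quadDrift P B

/-- The Itô form `F_t = F₀ + ∫ F dB + ∫ F a ds` of the equation, where `a = ½ 𝔼 B₁ B₁`. -/
def SolvesItoEquation (P : Measure Ω) (B F : ℝ≥0 → Ω → Mat n) : Prop :=
  TendstoAlongPartitions P (fun _ π => π.leftSum F B)
    fun t ω => F t ω - F 0 ω - timeIntegral F t ω * itoDrift P B

theorem TimePartition.symmSum_eq {t : ℝ≥0} (π : TimePartition t) (ω : Ω) :
    π.symmSum F B ω = π.leftSum F B ω + (1 / 2 : ℝ) • π.covSum F B ω := by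
  rw [symmSum, leftSum, covSum, Finset.smul_sum, ← Finset.sum_add_distrib]
  refine Finset.sum_congr rfl fun k _ => ?_
  rw [← Matrix.smul_mul, ← add_mul]
  congr 1
  module

/-- The half covariation part of a Stratonovich solution is the drift of the Itô equation. -/
theorem IsStratonovichSolution.solvesIto [IsProbabilityMeasure P] (hB : IsBrownianMotionSL P ℱ B)
    (hF : IsStratonovichSolution P ℱ B F) : SolvesItoEquation P B F := by
  obtain ⟨V, hV⟩ := hF.equation.exists_covariation
  have hleft : TendstoAlongPartitions P (fun _ π => π.leftSum F B)
      fun t ω => F t ω - F 0 ω - (1 / 2 : ℝ) • V t ω := by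
    intro t i j
    refine (tendstoInMeasure_sub (hF.equation.tendsto t i j) (tendstoInMeasure_const_mul (1 / 2)
      (hV.tendsto t i j))).congr_left fun π => Eventually.of_forall fun ω => ?_
    simp only [TimePartition.symmSum_eq, Matrix.add_apply, Matrix.smul_apply, smul_eq_mul]
    ring
  have hcov := hB.tendsto_covSum hF.adapted hF.continuous (A := fun t ω => (1 / 2 : ℝ) • V t ω) (by
    filter_upwards [hV.finite_variation] with ω hω i j
    have h1 : LocallyBoundedVariationOn (fun _ : ℝ≥0 => (1 / 2 : ℝ)) Set.univ :=
      MonotoneOn.locallyBoundedVariationOn fun x _ y _ _ => le_rfl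
    exact h1.mul (hω i j)) hleft
  intro t i j
  refine (hleft t i j).congr_right ?_
  filter_upwards [tendstoInMeasure_ae_unique (hV.tendsto t i j) (hcov t i j)] with ω hω
  simp only [Matrix.sub_apply, Matrix.smul_apply, itoDrift, Matrix.mul_smul, hω]

/-- The covariation of a solution of the Itô equation with the driving process is `∫ F ds` times `𝔼
B₁ B₁`. -/
theorem SolvesItoEquation.covSum [IsProbabilityMeasure P] (hB : IsBrownianMotionSL P ℱ B)
    (hF : Adapted ℱ F) (hc : ∀ᵐ ω ∂P, Continuous fun t => F t ω) (h : SolvesItoEquation P B F) :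
    TendstoAlongPartitions P (fun _ π => π.covSum F B)
      fun t ω => timeIntegral F t ω * quadDrift P B := by
  refine hB.tendsto_covSum hF hc (A := fun t ω => timeIntegral F t ω * itoDrift P B) ?_ h
  filter_upwards [hc] with ω hω i j
  simp only [timeIntegral_mul_apply hω]
  exact locallyBoundedVariationOn_integral (g := fun s => (F s ω * itoDrift P B) i j)
    ((hω.matrix_mul continuous_const).matrix_elem i j)

/-- Converse of `IsStratonovichSolution.solvesIto`: the drift of the Itô equation is half the
covariation. -/
theorem SolvesItoEquation.isStratonovichSolution [IsProbabilityMeasure P]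
    (hB : IsBrownianMotionSL P ℱ B) (hF : Adapted ℱ F) (hc : ∀ᵐ ω ∂P, Continuous fun t => F t ω)
    (h0 : ∀ᵐ ω ∂P, F 0 ω = 1) (h : SolvesItoEquation P B F) : IsStratonovichSolution P ℱ B F := by
  have hcov := h.covSum hB hF hc
  refine ⟨hF, hc, h0, ⟨fun t ω => timeIntegral F t ω * quadDrift P B, ?_, ?_, hcov⟩, ?_⟩
  · filter_upwards [hc] with ω hω
    exact (continuous_timeIntegral hω).matrix_mul continuous_const
  · filter_upwards [hc] with ω hω i j
    simp only [timeIntegral_mul_apply hω]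
    exact locallyBoundedVariationOn_integral (g := fun s => (F s ω * quadDrift P B) i j)
      ((hω.matrix_mul continuous_const).matrix_elem i j)
  · intro t i j
    refine ((tendstoInMeasure_add (h t i j) (tendstoInMeasure_const_mul (1 / 2)
      (hcov t i j))).congr_left fun π => Eventually.of_forall fun ω => ?_).congr_right
      (Eventually.of_forall fun ω => ?_)
    · simp only [TimePartition.symmSum_eq, Matrix.add_apply, Matrix.smul_apply, smul_eq_mul]
    · simp only [itoDrift, Matrix.mul_smul, Matrix.sub_apply, Matrix.smul_apply, smul_eq_mul]
      ring

end ItoForm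

/-! ### Second moments of stochastic sums -/

section SecondMoments

variable {n : ℕ}

/-- The squared Hilbert–Schmidt norm of a matrix. -/
def nsq (A : Mat n) : ℝ := ∑ i, ∑ j, A i j ^ 2

theorem nsq_nonneg (A : Mat n) : 0 ≤ nsq A :=
  Finset.sum_nonneg fun _ _ => Finset.sum_nonneg fun _ _ => sq_nonneg _

theorem sq_entry_le_nsq (A : Mat n) (i j : Fin n) : A i j ^ 2 ≤ nsq A :=
  (Finset.single_le_sum (f := fun j => A i j ^ 2) (fun _ _ => sq_nonneg _) (Finset.mem_univ j)).trans
    (Finset.single_le_sum (f := fun i => ∑ j, A i j ^ 2)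
      (fun _ _ => Finset.sum_nonneg fun _ _ => sq_nonneg _) (Finset.mem_univ i))

theorem nsq_add_le (A A' : Mat n) : nsq (A + A') ≤ 2 * nsq A + 2 * nsq A' := by
  simp only [nsq, Finset.mul_sum, ← Finset.sum_add_distrib, Matrix.add_apply]
  refine Finset.sum_le_sum fun i _ => Finset.sum_le_sum fun j _ => ?_
  nlinarith [sq_nonneg (A i j - A' i j)]

theorem nsq_neg (A : Mat n) : nsq (-A) = nsq A := by simp [nsq]

theorem nsq_sub_le (A A' : Mat n) : nsq (A - A') ≤ 2 * nsq A + 2 * nsq A' := by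
  rw [sub_eq_add_neg, ← nsq_neg A']
  exact nsq_add_le _ _

theorem measurable_nsq {α : Type*} {m : MeasurableSpace α} {f : α → Mat n} (hf : Measurable f) :
    Measurable fun x => nsq (f x) :=
  Finset.measurable_fun_sum _ fun i _ => Finset.measurable_fun_sum _ fun j _ =>
    ((measurable_mat_iff.1 hf i j).pow_const 2)

theorem continuous_nsq : Continuous (nsq : Mat n → ℝ) := by
  unfold nsq
  exact continuous_finsetSum _ fun i _ => continuous_finsetSum _ fun j _ =>
    (continuous_id.matrix_elem i j).pow 2

variable {Ω : Type u} {mΩ : MeasurableSpace Ω} {P : Measure Ω} {ℱ : Filtration ℝ≥0 mΩ}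
  {B : ℝ≥0 → Ω → Mat n}

theorem integrable_nsq {H : Ω → Mat n} (h : ∀ i j, MemLp (fun ω => H ω i j) 2 P) :
    Integrable (fun ω => nsq (H ω)) P :=
  integrable_finsetSum _ fun i _ => integrable_finsetSum _ fun j _ => (h i j).integrable_sq

theorem integral_nsq {H : Ω → Mat n} (h : ∀ i j, MemLp (fun ω => H ω i j) 2 P) :
    ∫ ω, nsq (H ω) ∂P = ∑ i, ∑ j, ∫ ω, H ω i j ^ 2 ∂P := by
  simp only [nsq]
  rw [integral_finsetSum _ fun i _ => integrable_finsetSum _ fun j _ => (h i j).integrable_sq]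
  exact Finset.sum_congr rfl fun i _ => integral_finsetSum _ fun j _ => (h i j).integrable_sq

theorem memLp_of_integrable_nsq {H : Ω → Mat n} (hm : Measurable H)
    (h : Integrable (fun ω => nsq (H ω)) P) (i j : Fin n) : MemLp (fun ω => H ω i j) 2 P := by
  have hm' := measurable_mat_iff.1 hm i j
  refine (memLp_two_iff_integrable_sq hm'.aestronglyMeasurable).2 ?_
  refine h.mono' (hm'.pow_const 2).aestronglyMeasurable (Eventually.of_forall fun ω => ?_)
  rw [Real.norm_eq_abs, abs_of_nonneg (sq_nonneg _)]
  exact sq_entry_le_nsq _ _ _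

/-- Lower semicontinuity of second moments under convergence in probability. -/
theorem memLp_integral_sq_le_of_tendstoInMeasure [IsProbabilityMeasure P] {ι : Type*} {l : Filter ι}
    [l.NeBot] [l.IsCountablyGenerated] {f : ι → Ω → ℝ} {g : Ω → ℝ} (h : TendstoInMeasure P f l g)
    (hf : ∀ i, MemLp (f i) 2 P) {c : ℝ} (hc : ∀ᶠ i in l, ∫ ω, f i ω ^ 2 ∂P ≤ c) :
    MemLp g 2 P ∧ ∫ ω, g ω ^ 2 ∂P ≤ c := by
  have key : ∀ {f : Ω → ℝ}, MemLp f 2 P →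
      eLpNorm f 2 P = ENNReal.ofReal (Real.sqrt (∫ ω, f ω ^ 2 ∂P)) := by
    intro f hf
    rw [hf.eLpNorm_eq_integral_rpow_norm two_ne_zero ENNReal.ofNat_ne_top, Real.sqrt_eq_rpow]
    simp
  have h1 : eLpNorm g 2 P ≤ ENNReal.ofReal (Real.sqrt c) := by
    refine eLpNorm_le_of_tendstoInMeasure (hc.mono fun i hi => ?_) h
      fun i => (hf i).aestronglyMeasurable
    rw [key (hf i)]
    exact ENNReal.ofReal_le_ofReal (Real.sqrt_le_sqrt hi)
  have hg : MemLp g 2 P :=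
    ⟨h.aestronglyMeasurable fun i => (hf i).aestronglyMeasurable,
      h1.trans_lt ENNReal.ofReal_lt_top⟩
  refine ⟨hg, ?_⟩
  rw [key hg] at h1
  obtain ⟨i, hi⟩ := hc.exists
  have hc0 : 0 ≤ c := le_trans (integral_nonneg fun ω => sq_nonneg _) hi
  rw [ENNReal.ofReal_le_ofReal_iff (Real.sqrt_nonneg _)] at h1
  exact (Real.sqrt_le_sqrt_iff hc0).1 h1

/-- The constant of the estimates for sums `∑ H_k (B_{t_{k+1}} - B_{t_k} + (t_{k+1} - t_k) a)` over
an interval of length at most `T`. -/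
noncomputable def itoConst (P : Measure Ω) (B : ℝ≥0 → Ω → Mat n) (T : ℝ) : ℝ :=
  4 * ((n : ℝ) + 1) ^ 5 * ∑ l, ∑ j, (covTensor P B l j l j + T * itoDrift P B l j ^ 2)

theorem itoConst_nonneg {T : ℝ} (hT : 0 ≤ T) : 0 ≤ itoConst P B T :=
  mul_nonneg (by positivity) (Finset.sum_nonneg fun l _ => Finset.sum_nonneg fun j _ =>
    add_nonneg (covTensor_self_nonneg _ _) (by positivity))

/-- The increment `B_{t_{k+1}} - B_{t_k} + (t_{k+1} - t_k) a` of the driving process with drift. -/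
noncomputable def driftIncr (P : Measure Ω) (B : ℝ≥0 → Ω → Mat n) (s t : ℝ≥0) (ω : Ω) : Mat n :=
  B t ω - B s ω + ((t : ℝ) - s) • itoDrift P B

/-- The sums `∑ H_k (B_{t_{k+1}} - B_{t_k} + (t_{k+1} - t_k) a)`. -/
noncomputable def itoSum (P : Measure Ω) (B : ℝ≥0 → Ω → Mat n) (pt : ℕ → ℝ≥0) (H : ℕ → Ω → Mat n)
    (m : ℕ) (ω : Ω) : Mat n :=
  ∑ k ∈ Finset.range m, H k ω * driftIncr P B (pt k) (pt (k + 1)) ω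

section

variable {pt : ℕ → ℝ≥0} {H : ℕ → Ω → Mat n}

/-- A bound at every `ω` for a partial sum by the sums for single entries. The drift part is
estimated by the Cauchy–Schwarz inequality, with a bound that does not depend on the end `r` of the
sum. -/
theorem nsq_itoSum_le (hpt : Monotone pt) {T : ℝ} {m r : ℕ} (hr : r ≤ m)
    (hT : (pt m : ℝ) - pt 0 ≤ T) (ω : Ω) :
    nsq (itoSum P B pt H r ω) ≤ 2 * n * (∑ i, ∑ j, ∑ l,
      ((∑ k ∈ Finset.range r, H k ω i l * (B (pt (k + 1)) ω l j - B (pt k) ω l j)) ^ 2 +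
        T * itoDrift P B l j ^ 2 *
          ∑ k ∈ Finset.range m, ((pt (k + 1) : ℝ) - pt k) * H k ω i l ^ 2)) := by
  have hδ : ∀ k, 0 ≤ (pt (k + 1) : ℝ) - pt k := fun k => sub_nonneg.2 (hpt (Nat.le_succ k))
  rw [nsq, Finset.mul_sum]
  refine Finset.sum_le_sum fun i _ => ?_
  rw [Finset.mul_sum]
  refine Finset.sum_le_sum fun j _ => ?_
  set U : Fin n → ℝ := fun l =>
    ∑ k ∈ Finset.range r, H k ω i l * (B (pt (k + 1)) ω l j - B (pt k) ω l j) with hU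
  set W : Fin n → ℝ := fun l =>
    itoDrift P B l j * ∑ k ∈ Finset.range r, ((pt (k + 1) : ℝ) - pt k) * H k ω i l with hW
  have e : itoSum P B pt H r ω i j = ∑ l, (U l + W l) := by
    simp only [itoSum, driftIncr, Matrix.sum_apply, Matrix.mul_apply, Matrix.add_apply,
      Matrix.sub_apply, Matrix.smul_apply, smul_eq_mul, hU, hW]
    rw [Finset.sum_comm]
    refine Finset.sum_congr rfl fun l _ => ?_
    rw [Finset.mul_sum, ← Finset.sum_add_distrib]
    exact Finset.sum_congr rfl fun k _ => by ring
  have hW2 : ∀ l, W l ^ 2 ≤ T * itoDrift P B l j ^ 2 *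
      ∑ k ∈ Finset.range m, ((pt (k + 1) : ℝ) - pt k) * H k ω i l ^ 2 := by
    intro l
    have h1 : (∑ k ∈ Finset.range r, ((pt (k + 1) : ℝ) - pt k) * H k ω i l) ^ 2 ≤
        (∑ k ∈ Finset.range r, ((pt (k + 1) : ℝ) - pt k)) *
          ∑ k ∈ Finset.range r, ((pt (k + 1) : ℝ) - pt k) * H k ω i l ^ 2 :=
      Finset.sum_sq_le_sum_mul_sum_of_sq_le_mul _ (fun k _ => hδ k)
        (fun k _ => mul_nonneg (hδ k) (sq_nonneg _)) fun k _ => (by ring : _ = _).le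
    have h2 : ∑ k ∈ Finset.range r, ((pt (k + 1) : ℝ) - pt k) ≤ T := by
      rw [Finset.sum_range_sub fun k => (pt k : ℝ)]
      have : (pt r : ℝ) ≤ pt m := hpt hr
      linarith
    have h3 : ∑ k ∈ Finset.range r, ((pt (k + 1) : ℝ) - pt k) * H k ω i l ^ 2 ≤
        ∑ k ∈ Finset.range m, ((pt (k + 1) : ℝ) - pt k) * H k ω i l ^ 2 :=
      Finset.sum_le_sum_of_subset_of_nonneg (Finset.range_mono hr)
        fun k _ _ => mul_nonneg (hδ k) (sq_nonneg _)
    have h0 : 0 ≤ ∑ k ∈ Finset.range r, ((pt (k + 1) : ℝ) - pt k) * H k ω i l ^ 2 :=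
      Finset.sum_nonneg fun k _ => mul_nonneg (hδ k) (sq_nonneg _)
    have h00 : 0 ≤ ∑ k ∈ Finset.range r, ((pt (k + 1) : ℝ) - pt k) :=
      Finset.sum_nonneg fun k _ => hδ k
    calc W l ^ 2 = itoDrift P B l j ^ 2 *
          (∑ k ∈ Finset.range r, ((pt (k + 1) : ℝ) - pt k) * H k ω i l) ^ 2 := by
          rw [hW]; ring
      _ ≤ itoDrift P B l j ^ 2 *
          (T * ∑ k ∈ Finset.range m, ((pt (k + 1) : ℝ) - pt k) * H k ω i l ^ 2) := by
          refine mul_le_mul_of_nonneg_left (h1.trans ?_) (sq_nonneg _)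
          exact mul_le_mul h2 h3 h0 (h00.trans h2)
      _ = _ := by ring
  rw [e]
  calc (∑ l, (U l + W l)) ^ 2 ≤ n * ∑ l, (U l + W l) ^ 2 := by
        simpa using sq_sum_le_card_mul_sum_sq (s := (Finset.univ : Finset (Fin n)))
          (f := fun l => U l + W l)
    _ ≤ n * ∑ l, 2 * (U l ^ 2 + T * itoDrift P B l j ^ 2 *
          ∑ k ∈ Finset.range m, ((pt (k + 1) : ℝ) - pt k) * H k ω i l ^ 2) := by
        refine mul_le_mul_of_nonneg_left (Finset.sum_le_sum fun l _ => ?_) (by positivity)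
        nlinarith [hW2 l, sq_nonneg (U l - W l)]
    _ = _ := by rw [← Finset.mul_sum]; ring

theorem integral_driftPart_le (hpt : Monotone pt)
    (hL : ∀ k i j, MemLp (fun ω => H k ω i j) 2 P) {τ : ℝ} (hτ : 0 ≤ τ) (i l : Fin n) (m : ℕ) :
    ∫ ω, τ * ∑ k ∈ Finset.range m, ((pt (k + 1) : ℝ) - pt k) * H k ω i l ^ 2 ∂P ≤
      τ * ∑ k ∈ Finset.range m, ((pt (k + 1) : ℝ) - pt k) * ∫ ω, nsq (H k ω) ∂P := by
  rw [integral_const_mul, integral_finsetSum _ fun k _ => ((hL k i l).integrable_sq).const_mul _]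
  refine mul_le_mul_of_nonneg_left (Finset.sum_le_sum fun k _ => ?_) hτ
  rw [integral_const_mul]
  refine mul_le_mul_of_nonneg_left ?_ (sub_nonneg.2 (hpt (Nat.le_succ k)))
  exact integral_mono (hL k i l).integrable_sq (integrable_nsq (hL k))
    fun ω => sq_entry_le_nsq _ _ _

theorem sum_mul_integral_nsq_nonneg (hpt : Monotone pt) (m : ℕ) :
    0 ≤ ∑ k ∈ Finset.range m, ((pt (k + 1) : ℝ) - pt k) * ∫ ω, nsq (H k ω) ∂P :=
  Finset.sum_nonneg fun k _ => mul_nonneg (sub_nonneg.2 (hpt (Nat.le_succ k)))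
    (integral_nonneg fun _ => nsq_nonneg _)

variable [IsProbabilityMeasure P]

theorem IsBrownianMotionSL.orthDiff_entry (hB : IsBrownianMotionSL P ℱ B) (hpt : Monotone pt)
    (hH : ∀ k, Measurable[ℱ (pt k)] (H k)) (hL : ∀ k i j, MemLp (fun ω => H k ω i j) 2 P)
    (i l j : Fin n) : IsOrthDiff P (discreteFiltration ℱ hpt)
      fun k ω => H k ω i l * (B (pt (k + 1)) ω l j - B (pt k) ω l j) :=
  (hB.isNoise_incr hpt l j).orthDiff (H := fun k ω => H k ω i l)
    (fun k => (measurable_entry i l).comp (hH k)) fun k => hL k i l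

theorem IsBrownianMotionSL.integral_sq_entry_le (hB : IsBrownianMotionSL P ℱ B) (hpt : Monotone pt)
    (hH : ∀ k, Measurable[ℱ (pt k)] (H k)) (i l j : Fin n) (k : ℕ) :
    ∫ ω, (H k ω i l * (B (pt (k + 1)) ω l j - B (pt k) ω l j)) ^ 2 ∂P ≤
      ((pt (k + 1) : ℝ) - pt k) * covTensor P B l j l j * ∫ ω, H k ω i l ^ 2 ∂P := by
  have hN := hB.isNoise_incr hpt l j
  have hHm : Measurable[discreteFiltration ℱ hpt k] fun ω => H k ω i l :=
    (measurable_entry i l).comp (hH k)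
  rw [integral_sq_mul_of_indep ((discreteFiltration ℱ hpt).le k) (hN.indep k) hHm (hN.memLp k),
    mul_comm]
  exact mul_le_mul_of_nonneg_right (hN.var k) (integral_nonneg fun _ => sq_nonneg _)

theorem IsBrownianMotionSL.memLp_mul_driftIncr (hB : IsBrownianMotionSL P ℱ B)
    {s t : ℝ≥0} (hst : s ≤ t) {G : Ω → Mat n}
    (hG : Measurable[ℱ s] G) (hL : ∀ i j, MemLp (fun ω => G ω i j) 2 P) (i j : Fin n) :
    MemLp (fun ω => (G ω * driftIncr P B s t ω) i j) 2 P := by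
  simp only [driftIncr, Matrix.mul_apply, Matrix.add_apply, Matrix.sub_apply, Matrix.smul_apply,
    smul_eq_mul, mul_add]
  refine memLp_finsetSum _ fun l _ => MemLp.add ?_ ((hL i l).mul_const _)
  exact memLp_two_mul_of_indep (hB.indep_incr hst (measurable_entry l j))
    ((measurable_entry i l).comp hG) (hL i l) (hB.memLp_incr _ _ l j (by simp))

theorem IsBrownianMotionSL.memLp_itoSum (hB : IsBrownianMotionSL P ℱ B) (hpt : Monotone pt)
    (hH : ∀ k, Measurable[ℱ (pt k)] (H k)) (hL : ∀ k i j, MemLp (fun ω => H k ω i j) 2 P)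
    (m : ℕ) (i j : Fin n) : MemLp (fun ω => itoSum P B pt H m ω i j) 2 P := by
  simp only [itoSum, Matrix.sum_apply]
  exact memLp_finsetSum _ fun k _ =>
    hB.memLp_mul_driftIncr (hpt (Nat.le_succ k)) (hH k) (hL k) i j

/-- The part of the estimate of `itoSum` that comes from one pair of entries. -/
theorem IsBrownianMotionSL.integral_entry_le (hB : IsBrownianMotionSL P ℱ B) (hpt : Monotone pt)
    (hH : ∀ k, Measurable[ℱ (pt k)] (H k)) (hL : ∀ k i j, MemLp (fun ω => H k ω i j) 2 P)
    (i l j : Fin n) (m : ℕ) :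
    ∑ k ∈ Finset.range m,
      ∫ ω, (H k ω i l * (B (pt (k + 1)) ω l j - B (pt k) ω l j)) ^ 2 ∂P ≤
      covTensor P B l j l j *
        ∑ k ∈ Finset.range m, ((pt (k + 1) : ℝ) - pt k) * ∫ ω, nsq (H k ω) ∂P := by
  rw [Finset.mul_sum]
  refine Finset.sum_le_sum fun k _ => ?_
  refine (hB.integral_sq_entry_le hpt hH i l j k).trans ?_
  have h1 : ∫ ω, H k ω i l ^ 2 ∂P ≤ ∫ ω, nsq (H k ω) ∂P :=
    integral_mono (hL k i l).integrable_sq (integrable_nsq (hL k)) fun ω => sq_entry_le_nsq _ _ _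
  have h2 : 0 ≤ (pt (k + 1) : ℝ) - pt k := sub_nonneg.2 (hpt (Nat.le_succ k))
  calc _ ≤ ((pt (k + 1) : ℝ) - pt k) * covTensor P B l j l j * ∫ ω, nsq (H k ω) ∂P :=
        mul_le_mul_of_nonneg_left h1 (mul_nonneg h2 (covTensor_self_nonneg _ _))
    _ = _ := by ring

/-- **Itô's estimate** for sums against the driving process with drift. -/
theorem IsBrownianMotionSL.integral_nsq_itoSum_le (hB : IsBrownianMotionSL P ℱ B)
    (hpt : Monotone pt) (hH : ∀ k, Measurable[ℱ (pt k)] (H k))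
    (hL : ∀ k i j, MemLp (fun ω => H k ω i j) 2 P) {T : ℝ} {m : ℕ}
    (hT : (pt m : ℝ) - pt 0 ≤ T) :
    ∫ ω, nsq (itoSum P B pt H m ω) ∂P ≤ itoConst P B T *
      ∑ k ∈ Finset.range m, ((pt (k + 1) : ℝ) - pt k) * ∫ ω, nsq (H k ω) ∂P := by
  have hT0 : 0 ≤ T := le_trans (sub_nonneg.2 (hpt (Nat.zero_le m))) hT
  have hS := sum_mul_integral_nsq_nonneg (P := P) (H := H) hpt m
  set S := ∑ k ∈ Finset.range m, ((pt (k + 1) : ℝ) - pt k) * ∫ ω, nsq (H k ω) ∂P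
  have i1 : ∀ i j l, Integrable (fun ω =>
      (∑ k ∈ Finset.range m, H k ω i l * (B (pt (k + 1)) ω l j - B (pt k) ω l j)) ^ 2) P :=
    fun i j l => ((hB.orthDiff_entry hpt hH hL i l j).partialSum_memLp m).integrable_sq
  have i2 : ∀ i j l, Integrable (fun ω => T * itoDrift P B l j ^ 2 *
      ∑ k ∈ Finset.range m, ((pt (k + 1) : ℝ) - pt k) * H k ω i l ^ 2) P := fun i j l =>
    (integrable_finsetSum _ fun k _ => ((hL k i l).integrable_sq).const_mul _).const_mul _
  have i3 : ∀ i j l, Integrable (fun ω =>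
      (∑ k ∈ Finset.range m, H k ω i l * (B (pt (k + 1)) ω l j - B (pt k) ω l j)) ^ 2 +
      T * itoDrift P B l j ^ 2 *
        ∑ k ∈ Finset.range m, ((pt (k + 1) : ℝ) - pt k) * H k ω i l ^ 2) P :=
    fun i j l => (i1 i j l).add (i2 i j l)
  have hb : ∀ i j l, ∫ ω, ((∑ k ∈ Finset.range m,
      H k ω i l * (B (pt (k + 1)) ω l j - B (pt k) ω l j)) ^ 2 + T * itoDrift P B l j ^ 2 *
        ∑ k ∈ Finset.range m, ((pt (k + 1) : ℝ) - pt k) * H k ω i l ^ 2) ∂P ≤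
      (covTensor P B l j l j + T * itoDrift P B l j ^ 2) * S := fun i j l => by
    rw [integral_add (i1 i j l) (i2 i j l), add_mul,
      (hB.orthDiff_entry hpt hH hL i l j).integral_sq_sum m]
    exact add_le_add (hB.integral_entry_le hpt hH hL i l j m)
      (integral_driftPart_le hpt hL (by positivity) i l m)
  calc ∫ ω, nsq (itoSum P B pt H m ω) ∂P ≤ _ :=
        integral_mono (integrable_nsq (hB.memLp_itoSum hpt hH hL m))
          ((integrable_finsetSum _ fun i _ => integrable_finsetSum _ fun j _ =>
            integrable_finsetSum _ fun l _ => i3 i j l).const_mul (2 * n))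
          (fun ω => nsq_itoSum_le hpt le_rfl hT ω)
    _ ≤ 2 * n * ∑ _i : Fin n, ∑ j, ∑ l,
          (covTensor P B l j l j + T * itoDrift P B l j ^ 2) * S := by
        rw [integral_const_mul, integral_finsetSum _ fun i _ => integrable_finsetSum _ fun j _ =>
          integrable_finsetSum _ fun l _ => i3 i j l]
        refine mul_le_mul_of_nonneg_left (Finset.sum_le_sum fun i _ => ?_) (by positivity)
        rw [integral_finsetSum _ fun j _ => integrable_finsetSum _ fun l _ => i3 i j l]
        refine Finset.sum_le_sum fun j _ => ?_
        rw [integral_finsetSum _ fun l _ => i3 i j l]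
        exact Finset.sum_le_sum fun l _ => hb i j l
    _ = 2 * n ^ 2 * ((∑ l, ∑ j, (covTensor P B l j l j + T * itoDrift P B l j ^ 2)) * S) := by
        rw [Finset.sum_comm (f := fun l j => covTensor P B l j l j + T * itoDrift P B l j ^ 2)]
        simp only [← Finset.sum_mul, Finset.sum_const, Finset.card_univ, Fintype.card_fin,
          nsmul_eq_mul]
        ring
    _ ≤ 4 * ((n : ℝ) + 1) ^ 5 *
          ((∑ l, ∑ j, (covTensor P B l j l j + T * itoDrift P B l j ^ 2)) * S) := by
        refine mul_le_mul_of_nonneg_right ?_ (mul_nonneg (Finset.sum_nonneg fun l _ =>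
          Finset.sum_nonneg fun j _ => add_nonneg (covTensor_self_nonneg _ _) (by positivity)) hS)
        have h0 : (0 : ℝ) ≤ n := by positivity
        have h1 : (n : ℝ) ^ 2 ≤ (n + 1) ^ 2 := by nlinarith
        have h2 : ((n : ℝ) + 1) ^ 2 ≤ (n + 1) ^ 5 := pow_le_pow_right₀ (by linarith) (by norm_num)
        nlinarith [sq_nonneg ((n : ℝ) + 1)]
    _ = _ := by rw [itoConst]; ring

/-- Itô's estimate for the maximum of the sums, from Doob's inequality. -/
theorem IsBrownianMotionSL.measure_nsq_itoSum_le (hB : IsBrownianMotionSL P ℱ B)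
    (hpt : Monotone pt) (hH : ∀ k, Measurable[ℱ (pt k)] (H k))
    (hL : ∀ k i j, MemLp (fun ω => H k ω i j) 2 P) {T : ℝ} {m : ℕ}
    (hT : (pt m : ℝ) - pt 0 ≤ T) {ε : ℝ} (hε : 0 < ε) :
    P {ω | ∃ r ≤ m, ε ≤ nsq (itoSum P B pt H r ω)} ≤ ENNReal.ofReal (itoConst P B T / ε *
      ∑ k ∈ Finset.range m, ((pt (k + 1) : ℝ) - pt k) * ∫ ω, nsq (H k ω) ∂P) := by
  have hT0 : 0 ≤ T := le_trans (sub_nonneg.2 (hpt (Nat.zero_le m))) hT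
  have hS := sum_mul_integral_nsq_nonneg (P := P) (H := H) hpt m
  set S := ∑ k ∈ Finset.range m, ((pt (k + 1) : ℝ) - pt k) * ∫ ω, nsq (H k ω) ∂P
  -- if every one of the `n³` entry sums and drift parts is below `θ²`, then the total is below `ε`
  set θ : ℝ := Real.sqrt (ε / (4 * ((n : ℝ) + 1) ^ 4)) with hθ
  have hn : (0 : ℝ) < 4 * ((n : ℝ) + 1) ^ 4 := by positivity
  have hθ0 : 0 < θ := Real.sqrt_pos.2 (by positivity)
  have hθ2 : θ ^ 2 = ε / (4 * ((n : ℝ) + 1) ^ 4) := Real.sq_sqrt (by positivity)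
  set E : Fin n × Fin n × Fin n → Set Ω := fun q =>
    {ω | ∃ r ≤ m, θ ≤ |∑ k ∈ Finset.range r,
      H k ω q.1 q.2.2 * (B (pt (k + 1)) ω q.2.2 q.2.1 - B (pt k) ω q.2.2 q.2.1)|} ∪
    {ω | θ ^ 2 ≤ T * itoDrift P B q.2.2 q.2.1 ^ 2 *
      ∑ k ∈ Finset.range m, ((pt (k + 1) : ℝ) - pt k) * H k ω q.1 q.2.2 ^ 2} with hE
  have hsub : {ω | ∃ r ≤ m, ε ≤ nsq (itoSum P B pt H r ω)} ⊆ ⋃ q, E q := by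
    rintro ω ⟨r, hr, hω⟩
    by_contra hc
    simp only [hE, Set.mem_iUnion, Set.mem_union, Set.mem_ofPred_eq, not_exists, not_or, not_and,
      not_le] at hc
    have h1 : nsq (itoSum P B pt H r ω) ≤ 2 * n * ∑ _i : Fin n, ∑ _j : Fin n, ∑ _l : Fin n,
        (θ ^ 2 + θ ^ 2) := by
      refine (nsq_itoSum_le hpt hr hT ω).trans (mul_le_mul_of_nonneg_left
        (Finset.sum_le_sum fun i _ => Finset.sum_le_sum fun j _ => Finset.sum_le_sum fun l _ =>
          add_le_add ?_ (hc (i, j, l)).2.le) (by positivity))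
      rw [← sq_abs]
      exact pow_le_pow_left₀ (abs_nonneg _) ((hc (i, j, l)).1 r hr).le 2
    have h2 : nsq (itoSum P B pt H r ω) ≤ 4 * (n : ℝ) ^ 4 * θ ^ 2 := by
      refine h1.trans (le_of_eq ?_)
      simp only [Finset.sum_const, Finset.card_univ, Fintype.card_fin, nsmul_eq_mul]
      ring
    have h3 : 4 * (n : ℝ) ^ 4 * θ ^ 2 < 4 * ((n : ℝ) + 1) ^ 4 * θ ^ 2 := by
      have : (n : ℝ) ^ 4 < (n + 1) ^ 4 := pow_lt_pow_left₀ (by linarith) (by positivity) (by norm_num)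
      have := pow_pos hθ0 2
      nlinarith
    rw [hθ2, mul_div_cancel₀ _ hn.ne'] at h3
    rw [hθ2] at h2
    linarith
  have hq : ∀ q, P (E q) ≤ ENNReal.ofReal
      ((covTensor P B q.2.2 q.2.1 q.2.2 q.2.1 + T * itoDrift P B q.2.2 q.2.1 ^ 2) * S / θ ^ 2) := by
    rintro ⟨i, j, l⟩
    refine (measure_union_le _ _).trans ?_
    rw [add_mul, add_div, ENNReal.ofReal_add
      (div_nonneg (mul_nonneg (covTensor_self_nonneg _ _) hS) (by positivity)) (by positivity)]
    refine add_le_add (((hB.orthDiff_entry hpt hH hL i l j).maximal m hθ0).trans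
      (ENNReal.ofReal_le_ofReal (div_le_div_of_nonneg_right
        (hB.integral_entry_le hpt hH hL i l j m) (by positivity)))) ?_
    refine measure_le_of_integral_le
      ((integrable_finsetSum _ fun k _ => ((hL k i l).integrable_sq).const_mul _).const_mul _)
      (fun ω => mul_nonneg (by positivity) (Finset.sum_nonneg fun k _ =>
        mul_nonneg (sub_nonneg.2 (hpt (Nat.le_succ k))) (sq_nonneg _)))
      (integral_driftPart_le hpt hL (by positivity) i l m) (by positivity)
  refine (measure_mono hsub).trans ((measure_iUnion_fintype_le _ _).trans
    ((Finset.sum_le_sum fun q _ => hq q).trans ?_))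
  rw [← ENNReal.ofReal_sum_of_nonneg fun q _ => div_nonneg (mul_nonneg (add_nonneg
    (covTensor_self_nonneg _ _) (by positivity)) hS) (by positivity)]
  refine ENNReal.ofReal_le_ofReal ?_
  rw [← Finset.sum_div, ← Finset.sum_mul, Fintype.sum_prod_type]
  simp only [Fintype.sum_prod_type, Finset.sum_const, Finset.card_univ, Fintype.card_fin,
    nsmul_eq_mul]
  rw [Finset.sum_comm, hθ2, itoConst]
  have hA : 0 ≤ ∑ l, ∑ j, (covTensor P B l j l j + T * itoDrift P B l j ^ 2) :=
    Finset.sum_nonneg fun l _ => Finset.sum_nonneg fun j _ =>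
      add_nonneg (covTensor_self_nonneg _ _) (by positivity)
  set A := ∑ l, ∑ j, (covTensor P B l j l j + T * itoDrift P B l j ^ 2)
  have e1 : (n : ℝ) * A * S / (ε / (4 * ((n : ℝ) + 1) ^ 4)) =
      (4 * ((n : ℝ) + 1) ^ 4 * (A * S / ε)) * n := by
    field_simp
  have e2 : 4 * ((n : ℝ) + 1) ^ 5 * A / ε * S =
      (4 * ((n : ℝ) + 1) ^ 4 * (A * S / ε)) * (n + 1) := by
    field_simp
  rw [e1, e2]
  exact mul_le_mul_of_nonneg_left (by linarith) (by positivity)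

end

/-- Discrete Gronwall inequality. -/
theorem le_of_discrete_gronwall {u δ : ℕ → ℝ} {κ ρ : ℝ} (hδ : ∀ k, 0 ≤ δ k) (hκ : 0 ≤ κ)
    {M : ℕ} (h : ∀ m ≤ M, u m ≤ κ * ∑ k ∈ Finset.range m, δ k * (u k + ρ)) (hρ : 0 ≤ ρ) :
    ∀ m ≤ M, u m + ρ ≤ ρ * Real.exp (κ * ∑ k ∈ Finset.range m, δ k) := by
  -- the majorant `ρ + κ ∑ δ (u + ρ)` grows by the factor `1 + κ δ` at each step
  have key : ∀ m ≤ M, ρ + κ * ∑ k ∈ Finset.range m, δ k * (u k + ρ) ≤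
      ρ * Real.exp (κ * ∑ k ∈ Finset.range m, δ k) := by
    intro m
    induction m with
    | zero => simp
    | succ m ih =>
      intro hm
      have h1 := ih (by omega)
      have h2 := h m (by omega)
      rw [Finset.sum_range_succ, Finset.sum_range_succ, mul_add κ (∑ k ∈ Finset.range m, δ k),
        Real.exp_add, mul_add κ]
      set A := κ * ∑ k ∈ Finset.range m, δ k * (u k + ρ)
      set e := Real.exp (κ * ∑ k ∈ Finset.range m, δ k)
      have h3 : κ * δ m + 1 ≤ Real.exp (κ * δ m) := Real.add_one_le_exp _
      have h4 : 0 ≤ κ * δ m := mul_nonneg hκ (hδ m)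
      have h5 : 0 ≤ ρ * e := mul_nonneg hρ (Real.exp_pos _).le
      have h6 : κ * (δ m * (u m + ρ)) ≤ (κ * δ m) * (ρ * e) := by
        rw [← mul_assoc]
        exact mul_le_mul_of_nonneg_left (by linarith) h4
      calc ρ + (A + κ * (δ m * (u m + ρ))) ≤ (ρ * e) * (κ * δ m + 1) := by linarith
        _ ≤ (ρ * e) * Real.exp (κ * δ m) := mul_le_mul_of_nonneg_left h3 h5
        _ = _ := by ring
  intro m hm
  linarith [key m hm, h m hm]

end SecondMoments

/-! ### Pathwise uniqueness -/

section Uniqueness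

variable {n : ℕ} {Ω : Type u} {mΩ : MeasurableSpace Ω} {P : Measure Ω} {ℱ : Filtration ℝ≥0 mΩ}
  {B F F' D : ℝ≥0 → Ω → Mat n}

theorem itoSum_eq_leftSum_add {t : ℝ≥0} (π : TimePartition t) (ω : Ω) (i j : Fin n) :
    itoSum P B π.pt (fun k => F (π.pt k)) π.size ω i j = π.leftSum F B ω i j +
      ∑ k ∈ Finset.range π.size,
        (F (π.pt k) ω * itoDrift P B) i j * ((π.pt (k + 1) : ℝ) - π.pt k) := by
  simp only [itoSum, TimePartition.leftSum, driftIncr, Matrix.sum_apply, mul_add,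
    Finset.sum_add_distrib, Matrix.mul_smul, Matrix.add_apply, Matrix.smul_apply, smul_eq_mul]
  congr 1
  exact Finset.sum_congr rfl fun k _ => mul_comm _ _

theorem tendstoInMeasure_driftSum [IsProbabilityMeasure P] (hF : Adapted ℱ F)
    (hc : ∀ᵐ ω ∂P, Continuous fun t => F t ω) (A : Mat n) (t : ℝ≥0) (i j : Fin n) :
    TendstoInMeasure P (fun (π : TimePartition t) ω => ∑ k ∈ Finset.range π.size,
      (F (π.pt k) ω * A) i j * ((π.pt (k + 1) : ℝ) - π.pt k))
      (TimePartition.meshToZero t) fun ω => (timeIntegral F t ω * A) i j := by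
  refine tendstoInMeasure_of_ae_tendsto (fun π => ?_) ?_
  · refine (Finset.measurable_fun_sum _ fun k _ => Measurable.mul_const ?_ _).aestronglyMeasurable
    exact measurable_mat_iff.1 (measurable_mat_mul (measurable_mat_iff.2 fun i j =>
      hF.entry' (π.pt k) i j) measurable_const) i j
  · filter_upwards [hc] with ω hω
    rw [timeIntegral_mul_apply hω]
    exact tendsto_riemannSum (f := fun s => (F s ω * A) i j)
      ((hω.matrix_mul continuous_const).matrix_elem i j) t

/-- The Itô equation, with the drift included in the sums. -/
theorem solvesItoEquation_iff [IsProbabilityMeasure P] (hF : Adapted ℱ F)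
    (hc : ∀ᵐ ω ∂P, Continuous fun t => F t ω) :
    SolvesItoEquation P B F ↔ ∀ t i j, TendstoInMeasure P
      (fun (π : TimePartition t) ω => itoSum P B π.pt (fun k => F (π.pt k)) π.size ω i j)
      (TimePartition.meshToZero t) fun ω => F t ω i j - F 0 ω i j := by
  refine ⟨fun h t i j => ?_, fun h t i j => ?_⟩
  · refine ((tendstoInMeasure_add (h t i j) (tendstoInMeasure_driftSum hF hc
      (itoDrift P B) t i j)).congr_left fun π => Eventually.of_forall fun ω => ?_).congr_right (Eventually.of_forall fun ω => ?_)
    · exact (itoSum_eq_leftSum_add π ω i j).symm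
    · simp only [Matrix.sub_apply]
      ring
  · refine ((tendstoInMeasure_sub (h t i j) (tendstoInMeasure_driftSum hF hc
      (itoDrift P B) t i j)).congr_left fun π => Eventually.of_forall fun ω => ?_).congr_right
      (Eventually.of_forall fun ω => ?_)
    · simp only [itoSum_eq_leftSum_add]
      ring
    · simp only [Matrix.sub_apply]

/-- The event that `D` stays in a ball up to time `s`, tested on a countable dense set of times, so
that it is known at time `s` without any completion of the filtration. -/
def boundedUpTo (D : ℝ≥0 → Ω → Mat n) (K : ℝ) (s : ℝ≥0) : Set Ω :=
  {ω | ∀ m : ℕ, nsq (D (min (TopologicalSpace.denseSeq ℝ≥0 m) s) ω) ≤ K}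

theorem measurableSet_boundedUpTo (hD : Adapted ℱ D) (K : ℝ) (s : ℝ≥0) :
    MeasurableSet[ℱ s] (boundedUpTo D K s) := by
  have e : boundedUpTo D K s =
      ⋂ m : ℕ, {ω | nsq (D (min (TopologicalSpace.denseSeq ℝ≥0 m) s) ω) ≤ K} := by
    ext ω; simp [boundedUpTo]
  rw [e]
  refine MeasurableSet.iInter fun m => ?_
  exact measurableSet_le (measurable_nsq ((hD _).mono (ℱ.mono (min_le_right _ _)) le_rfl))
    measurable_const

theorem mem_boundedUpTo_iff {ω : Ω} (hω : Continuous fun t => D t ω) {K : ℝ} {s : ℝ≥0} :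
    ω ∈ boundedUpTo D K s ↔ ∀ r ≤ s, nsq (D r ω) ≤ K := by
  refine ⟨fun h r hr => ?_, fun h m => h _ (min_le_right _ _)⟩
  have hcl : IsClosed {x : ℝ≥0 | nsq (D (min x s) ω) ≤ K} :=
    isClosed_le (continuous_nsq.comp (hω.comp (continuous_id.min continuous_const)))
      continuous_const
  have h1 : (Set.univ : Set ℝ≥0) ⊆ {x : ℝ≥0 | nsq (D (min x s) ω) ≤ K} := by
    rw [← (TopologicalSpace.denseRange_denseSeq ℝ≥0).closure_range]
    refine closure_minimal ?_ hcl
    rintro _ ⟨m, rfl⟩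
    exact h m
  have h2 := h1 (Set.mem_univ r)
  simpa [min_eq_left hr] using h2

theorem sum_mul_exp_le {pt : ℕ → ℝ≥0} {c : ℝ} (hc : 0 < c) (m : ℕ) :
    ∑ k ∈ Finset.range m, ((pt (k + 1) : ℝ) - pt k) * Real.exp (c * pt k) ≤
      Real.exp (c * pt m) / c := by
  have h1 : ∀ k, ((pt (k + 1) : ℝ) - pt k) * Real.exp (c * pt k) ≤
      (Real.exp (c * pt (k + 1)) - Real.exp (c * pt k)) / c := fun k => by
    have e : Real.exp (c * pt (k + 1)) =
        Real.exp (c * pt k) * Real.exp (c * ((pt (k + 1) : ℝ) - pt k)) := by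
      rw [← Real.exp_add]; ring_nf
    rw [le_div_iff₀ hc, e]
    nlinarith [Real.add_one_le_exp (c * ((pt (k + 1) : ℝ) - pt k)), Real.exp_pos (c * pt k)]
  refine (Finset.sum_le_sum fun k _ => h1 k).trans ?_
  rw [← Finset.sum_div, Finset.sum_range_sub fun k => Real.exp (c * pt k)]
  exact div_le_div_of_nonneg_right (by linarith [Real.exp_pos (c * pt 0)]) hc.le

theorem nsq_indicator (A : Set Ω) (G : Ω → Mat n) (ω : Ω) :
    nsq (A.indicator G ω) = A.indicator (fun ω => nsq (G ω)) ω := by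
  by_cases h : ω ∈ A <;> simp [h, nsq]

/-- The localized second moments of a solution of the homogeneous equation satisfy an integral
inequality of Gronwall type, so they decay under iteration. -/
theorem IsBrownianMotionSL.integral_nsq_boundedUpTo_le [IsProbabilityMeasure P]
    (hB : IsBrownianMotionSL P ℱ B)
    (hD : Adapted ℱ D) (hc : ∀ᵐ ω ∂P, Continuous fun t => D t ω)
    (h : ∀ t i j, TendstoInMeasure P
      (fun (π : TimePartition t) ω => itoSum P B π.pt (fun k => D (π.pt k)) π.size ω i j)
      (TimePartition.meshToZero t) fun ω => D t ω i j) {K : ℝ} (hK : 0 ≤ K) (T : ℝ≥0) (r : ℕ) :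
    ∀ t ≤ T, ∫ ω, nsq ((boundedUpTo D K t).indicator (D t) ω) ∂P ≤
      K * (1 / 2) ^ r * Real.exp ((2 * n ^ 2 * itoConst P B T + 1) * t) := by
  have hDm : ∀ t, Measurable (D t) := fun t => (hD t).mono (ℱ.le t) le_rfl
  have hG : ∀ s, MeasurableSet (boundedUpTo D K s) := fun s =>
    ℱ.le s _ (measurableSet_boundedUpTo hD K s)
  have hm : ∀ s, Measurable[ℱ s] ((boundedUpTo D K s).indicator (D s)) := fun s =>
    (hD s).indicator (measurableSet_boundedUpTo hD K s)
  have hle : ∀ s, ∀ᵐ ω ∂P, nsq ((boundedUpTo D K s).indicator (D s) ω) ≤ K := fun s => by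
    filter_upwards [hc] with ω hω
    rw [nsq_indicator]
    refine Set.indicator_apply_le' (fun hx => (mem_boundedUpTo_iff hω).1 hx s le_rfl) fun _ => hK
  have hint : ∀ s, Integrable (fun ω => nsq ((boundedUpTo D K s).indicator (D s) ω)) P := fun s => by
    refine Integrable.of_bound
      (measurable_nsq ((hm s).mono (ℱ.le s) le_rfl)).aestronglyMeasurable K ?_
    filter_upwards [hle s] with ω hω
    rwa [Real.norm_eq_abs, abs_of_nonneg (nsq_nonneg _)]
  have hL : ∀ s i j, MemLp (fun ω => (boundedUpTo D K s).indicator (D s) ω i j) 2 P := fun s =>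
    memLp_of_integrable_nsq ((hm s).mono (ℱ.le s) le_rfl) (hint s)
  have hκ := itoConst_nonneg (P := P) (B := B) T.2
  set κ := itoConst P B T
  -- integration of `exp (c s)` gains the factor `1 / c`; `c` is so large that every iteration of
  -- the estimate halves the bound
  set c : ℝ := 2 * n ^ 2 * κ + 1 with hcdef
  have hc0 : 0 < c := by positivity
  induction r with
  | zero =>
    intro t _
    have h1 : ∫ ω, nsq ((boundedUpTo D K t).indicator (D t) ω) ∂P ≤ ∫ _, K ∂P :=
      integral_mono_ae (hint t) (integrable_const _) (hle t)
    simp only [integral_const, probReal_univ, smul_eq_mul, one_mul] at h1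
    have h2 : 1 ≤ Real.exp (c * t) := Real.one_le_exp (by positivity)
    rw [pow_zero, mul_one]
    nlinarith
  | succ r ih =>
    intro t ht
    -- the sums with the localized integrand, restricted to the event up to time `t`
    set H : TimePartition t → ℕ → Ω → Mat n := fun π k =>
      (boundedUpTo D K (π.pt k)).indicator (D (π.pt k)) with hH
    set S : TimePartition t → Ω → Mat n := fun π => itoSum P B π.pt (H π) π.size with hS
    have hSL : ∀ π i j, MemLp (fun ω => S π ω i j) 2 P := fun π i j =>
      hB.memLp_itoSum π.mono (fun k => hm _) (fun k => hL _) _ i j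
    have hSb : ∀ π, ∫ ω, nsq (S π ω) ∂P ≤ κ * (K * (1 / 2) ^ r * (Real.exp (c * t) / c)) := by
      intro π
      refine (hB.integral_nsq_itoSum_le π.mono (fun k => hm _) (fun k => hL _) (T := T) ?_).trans ?_
      · rw [π.pt_size, π.pt_zero, NNReal.coe_zero, sub_zero]; exact ht
      refine mul_le_mul_of_nonneg_left ?_ hκ
      calc _ ≤ ∑ k ∈ Finset.range π.size, ((π.pt (k + 1) : ℝ) - π.pt k) *
            (K * (1 / 2) ^ r * Real.exp (c * π.pt k)) :=
            Finset.sum_le_sum fun k hk => mul_le_mul_of_nonneg_left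
              (ih _ ((π.pt_le (Finset.mem_range.1 hk).le).trans ht)) (π.coe_sub_nonneg k)
        _ = K * (1 / 2) ^ r * ∑ k ∈ Finset.range π.size,
            ((π.pt (k + 1) : ℝ) - π.pt k) * Real.exp (c * π.pt k) := by
            rw [Finset.mul_sum]
            exact Finset.sum_congr rfl fun k _ => by ring
        _ ≤ _ := by
            refine mul_le_mul_of_nonneg_left ?_ (by positivity)
            have := sum_mul_exp_le (pt := π.pt) hc0 π.size
            rwa [π.pt_size] at this
    have hent : ∀ i j, ∫ ω, (boundedUpTo D K t).indicator (D t) ω i j ^ 2 ∂P ≤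
        κ * (K * (1 / 2) ^ r * (Real.exp (c * t) / c)) := by
      intro i j
      -- on the event up to time `t` the localization of the integrand is not felt
      have hconv : TendstoInMeasure P
          (fun (π : TimePartition t) ω => (boundedUpTo D K t).indicator (1 : Ω → ℝ) ω * S π ω i j)
          (TimePartition.meshToZero t)
          fun ω => (boundedUpTo D K t).indicator (D t) ω i j := by
        have hS2 : ∀ π : TimePartition t, ∀ᵐ ω ∂P, (boundedUpTo D K t).indicator (1 : Ω → ℝ) ω *
            itoSum P B π.pt (fun k => D (π.pt k)) π.size ω i j =
            (boundedUpTo D K t).indicator (1 : Ω → ℝ) ω * S π ω i j := by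
          intro π
          filter_upwards [hc] with ω hω
          by_cases hx : ω ∈ boundedUpTo D K t
          · have e : itoSum P B π.pt (fun k => D (π.pt k)) π.size ω = S π ω := by
              simp only [hS, itoSum]
              refine Finset.sum_congr rfl fun k hk => ?_
              have hx' : ω ∈ boundedUpTo D K (π.pt k) := (mem_boundedUpTo_iff hω).2 fun q hq =>
                (mem_boundedUpTo_iff hω).1 hx q (hq.trans (π.pt_le (Finset.mem_range.1 hk).le))
              simp only [hH, Set.indicator_of_mem hx']
            rw [e]
          · simp [hx]
        have h1 := h t i j
        rw [tendstoInMeasure_real_iff] at h1 ⊢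
        intro ε hε
        refine tendsto_of_tendsto_of_tendsto_of_le_of_le tendsto_const_nhds (h1 ε hε)
          (fun _ => zero_le) fun π => ?_
        refine measure_mono_ae ?_
        filter_upwards [hS2 π] with ω hω hle
        change ε ≤ |_| at hle
        change ε ≤ |_|
        rw [← hω] at hle
        by_cases hx : ω ∈ boundedUpTo D K t
        · simpa [hx] using hle
        · simp only [hx, not_false_eq_true, Set.indicator_of_notMem, zero_mul, Matrix.zero_apply,
            sub_zero, abs_zero] at hle
          linarith
      refine (memLp_integral_sq_le_of_tendstoInMeasure hconv (fun π => ?_)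
        (Eventually.of_forall fun π => ?_)).2
      · refine MemLp.of_le (hSL π i j) (((measurable_const.indicator (hG t)).aestronglyMeasurable).mul
          (hSL π i j).aestronglyMeasurable) (Eventually.of_forall fun ω => ?_)
        by_cases hx : ω ∈ boundedUpTo D K t <;> simp [hx]
      · refine (integral_mono_of_nonneg (Eventually.of_forall fun ω => sq_nonneg _)
          (integrable_nsq (hSL π)) (Eventually.of_forall fun ω => ?_)).trans (hSb π)
        by_cases hx : ω ∈ boundedUpTo D K t
        · simpa [hx] using sq_entry_le_nsq _ _ _
        · simpa [hx] using nsq_nonneg _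
    rw [integral_nsq (hL t)]
    calc _ ≤ ∑ _i : Fin n, ∑ _j : Fin n, κ * (K * (1 / 2) ^ r * (Real.exp (c * t) / c)) :=
          Finset.sum_le_sum fun i _ => Finset.sum_le_sum fun j _ => hent i j
      _ = (2 * n ^ 2 * κ) / c * (K * (1 / 2) ^ (r + 1) * Real.exp (c * t)) := by
          simp only [Finset.sum_const, Finset.card_univ, Fintype.card_fin, nsmul_eq_mul]
          field_simp
          ring
      _ ≤ 1 * (K * (1 / 2) ^ (r + 1) * Real.exp (c * t)) := by
          refine mul_le_mul_of_nonneg_right ((div_le_one hc0).2 ?_) (by positivity)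
          rw [hcdef]; linarith
      _ = _ := one_mul _

/-- The homogeneous equation `D_t = ∫ D dB + ∫ D a ds` has only the trivial solution. -/
theorem IsBrownianMotionSL.eq_zero_of_tendsto_itoSum [IsProbabilityMeasure P]
    (hB : IsBrownianMotionSL P ℱ B)
    (hD : Adapted ℱ D) (hc : ∀ᵐ ω ∂P, Continuous fun t => D t ω)
    (h : ∀ t i j, TendstoInMeasure P
      (fun (π : TimePartition t) ω => itoSum P B π.pt (fun k => D (π.pt k)) π.size ω i j)
      (TimePartition.meshToZero t) fun ω => D t ω i j) :
    ∀ᵐ ω ∂P, ∀ t, D t ω = 0 := by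
  have hDm : ∀ t, Measurable (D t) := fun t => (hD t).mono (ℱ.le t) le_rfl
  -- letting the number of iterations tend to infinity in `integral_nsq_boundedUpTo_le`
  have hloc : ∀ (K : ℕ) (t : ℝ≥0), ∀ᵐ ω ∂P, nsq ((boundedUpTo D K t).indicator (D t) ω) = 0 := by
    intro K t
    have hmeas : Measurable fun ω => nsq ((boundedUpTo D K t).indicator (D t) ω) :=
      measurable_nsq ((hDm t).indicator (ℱ.le t _ (measurableSet_boundedUpTo hD K t)))
    have hint : Integrable (fun ω => nsq ((boundedUpTo D K t).indicator (D t) ω)) P := by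
      refine Integrable.of_bound hmeas.aestronglyMeasurable K ?_
      filter_upwards [hc] with ω hω
      rw [Real.norm_eq_abs, abs_of_nonneg (nsq_nonneg _), nsq_indicator]
      exact Set.indicator_apply_le' (fun hx => (mem_boundedUpTo_iff hω).1 hx t le_rfl)
        fun _ => K.cast_nonneg
    have h1 : ∫ ω, nsq ((boundedUpTo D K t).indicator (D t) ω) ∂P ≤ 0 := by
      have hlim : Tendsto (fun r : ℕ => (K : ℝ) * (1 / 2) ^ r *
          Real.exp ((2 * n ^ 2 * itoConst P B t + 1) * t)) atTop (𝓝 0) := by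
        have := ((tendsto_pow_atTop_nhds_zero_of_lt_one (r := (1 / 2 : ℝ)) (by norm_num)
          (by norm_num)).const_mul (K : ℝ)).mul_const
            (Real.exp ((2 * n ^ 2 * itoConst P B t + 1) * t))
        simpa using this
      exact ge_of_tendsto' hlim fun r =>
        hB.integral_nsq_boundedUpTo_le hD hc h K.cast_nonneg t r t le_rfl
    have h2 := (integral_eq_zero_iff_of_nonneg (fun ω => nsq_nonneg _) hint).1
      (le_antisymm h1 (integral_nonneg fun ω => nsq_nonneg _))
    filter_upwards [h2] with ω hω using hω
  have hall : ∀ᵐ ω ∂P, ∀ m K : ℕ, nsq ((boundedUpTo D K (TopologicalSpace.denseSeq ℝ≥0 m)).indicator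
      (D (TopologicalSpace.denseSeq ℝ≥0 m)) ω) = 0 :=
    ae_all_iff.2 fun m => ae_all_iff.2 fun K => hloc K _
  filter_upwards [hall, hc] with ω hω hcω t
  -- a continuous path is bounded up to any time, so it lies in one of the localizing events
  have hz : ∀ m, nsq (D (TopologicalSpace.denseSeq ℝ≥0 m) ω) = 0 := by
    intro m
    obtain ⟨C, hC⟩ := (isCompact_Icc (a := 0) (b := TopologicalSpace.denseSeq ℝ≥0 m)).exists_bound_of_continuousOn
      (continuous_nsq.comp hcω).continuousOn
    have hmem : ω ∈ boundedUpTo D (⌈C⌉₊ : ℕ) (TopologicalSpace.denseSeq ℝ≥0 m) :=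
      (mem_boundedUpTo_iff hcω).2 fun r hr =>
        ((le_abs_self _).trans (hC r ⟨zero_le, hr⟩)).trans (Nat.le_ceil C)
    simpa [Set.indicator_of_mem hmem] using hω m ⌈C⌉₊
  have hz' : ∀ t, nsq (D t ω) = 0 := by
    have := (continuous_nsq.comp hcω).ext_on (TopologicalSpace.denseRange_denseSeq ℝ≥0)
      (continuous_const (y := (0 : ℝ))) (by rintro _ ⟨m, rfl⟩; exact hz m)
    exact fun t => congrFun this t
  ext i j
  have := sq_entry_le_nsq (D t ω) i j
  rw [hz' t] at this
  exact pow_eq_zero_iff two_ne_zero |>.1 (le_antisymm this (sq_nonneg _))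

/-- Pathwise uniqueness for the Itô equation. -/
theorem SolvesItoEquation.unique [IsProbabilityMeasure P] (hB : IsBrownianMotionSL P ℱ B)
    (hF : Adapted ℱ F) (hFc : ∀ᵐ ω ∂P, Continuous fun t => F t ω) (hF0 : ∀ᵐ ω ∂P, F 0 ω = 1)
    (h : SolvesItoEquation P B F)
    (hF' : Adapted ℱ F') (hFc' : ∀ᵐ ω ∂P, Continuous fun t => F' t ω) (hF0' : ∀ᵐ ω ∂P, F' 0 ω = 1)
    (h' : SolvesItoEquation P B F') : ∀ᵐ ω ∂P, ∀ t, F t ω = F' t ω := by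
  have key := hB.eq_zero_of_tendsto_itoSum (D := fun t ω => F t ω - F' t ω)
    (fun t => measurable_mat_sub (hF t) (hF' t))
    (by filter_upwards [hFc, hFc'] with ω h1 h2 using h1.sub h2)
    (fun t i j => by
      refine ((tendstoInMeasure_sub ((solvesItoEquation_iff hF hFc).1 h t i j)
        ((solvesItoEquation_iff hF' hFc').1 h' t i j)).congr_left
          fun π => Eventually.of_forall fun ω => ?_).congr_right ?_
      · simp only [itoSum, sub_mul, Finset.sum_sub_distrib, Matrix.sub_apply]
      · filter_upwards [hF0, hF0'] with ω h1 h2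
        rw [h1, h2, Matrix.sub_apply]
        ring)
  filter_upwards [key] with ω hω t
  exact sub_eq_zero.1 (hω t)

end Uniqueness

/-! ### Euler schemes along a path -/

section EulerPath

variable {n : ℕ}

/-- The values at the times `j 2⁻ᴺ` of the Euler scheme for `dF = F dx`, `F₀ = 1`. -/
noncomputable def eulerGrid (x : ℝ≥0 → Mat n) (N : ℕ) : ℕ → Mat n
  | 0 => 1
  | j + 1 => eulerGrid x N j * (1 + (x (((j + 1 : ℕ) : ℝ≥0) / 2 ^ N) - x ((j : ℝ≥0) / 2 ^ N)))

/-- The value of the Euler scheme at the last time `j 2⁻ᴺ` before `t`. -/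
noncomputable def eulerStep (x : ℝ≥0 → Mat n) (N : ℕ) (t : ℝ≥0) : Mat n :=
  eulerGrid x N ⌊t * 2 ^ N⌋₊

/-- The Euler scheme of step `2⁻ᴺ`, interpolated along the path `x` so that it is a continuous
function of time depending only on the past. -/
noncomputable def euler (x : ℝ≥0 → Mat n) (N : ℕ) (t : ℝ≥0) : Mat n :=
  eulerStep x N t * (1 + (x t - x (dyadicFloor N t)))

theorem euler_zero (x : ℝ≥0 → Mat n) (N : ℕ) : euler x N 0 = 1 := by
  simp [euler, eulerStep, dyadicFloor, eulerGrid]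

theorem floor_dyadicFloor (N : ℕ) (t : ℝ≥0) : ⌊dyadicFloor N t * 2 ^ N⌋₊ = ⌊t * 2 ^ N⌋₊ := by
  rw [dyadicFloor, div_mul_cancel₀ _ (by positivity), Nat.floor_natCast]

theorem euler_dyadicFloor (x : ℝ≥0 → Mat n) (N : ℕ) (t : ℝ≥0) :
    euler x N (dyadicFloor N t) = eulerStep x N t := by
  have e : dyadicFloor N (dyadicFloor N t) = dyadicFloor N t := by
    rw [dyadicFloor, floor_dyadicFloor, dyadicFloor]
  rw [euler, e, eulerStep, eulerStep, floor_dyadicFloor, sub_self, add_zero, mul_one]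

theorem eulerStep_dyadicFloor (x : ℝ≥0 → Mat n) (N : ℕ) (t : ℝ≥0) :
    eulerStep x N (dyadicFloor N t) = eulerStep x N t := by
  rw [eulerStep, floor_dyadicFloor, eulerStep]

/-- Between consecutive times of the grid, the scheme follows the path `x`. -/
theorem euler_sub_euler (x : ℝ≥0 → Mat n) {N : ℕ} {s t : ℝ≥0} (hst : s ≤ t)
    (ht : t ≤ dyadicFloor N s + (1 / 2) ^ N) :
    euler x N t - euler x N s = eulerStep x N s * (x t - x s) := by
  have e : dyadicFloor N s + (1 / 2) ^ N = ((⌊s * 2 ^ N⌋₊ + 1 : ℕ) : ℝ≥0) / 2 ^ N := by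
    rw [dyadicFloor, one_div, inv_pow, ← one_div, ← add_div]
    push_cast
    rfl
  rw [e] at ht
  rcases ht.lt_or_eq with h | h
  · have e1 : ⌊t * 2 ^ N⌋₊ = ⌊s * 2 ^ N⌋₊ := by
      refine le_antisymm ?_ (Nat.floor_mono (by gcongr))
      rw [lt_div_iff₀ (by positivity)] at h
      exact Nat.lt_succ_iff.1 ((Nat.floor_lt zero_le).2 h)
    rw [euler, euler, eulerStep, eulerStep, dyadicFloor, dyadicFloor, e1]
    noncomm_ring
  · have e1 : ⌊t * 2 ^ N⌋₊ = ⌊s * 2 ^ N⌋₊ + 1 := by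
      rw [h, div_mul_cancel₀ _ (by positivity), Nat.floor_natCast]
    have e2 : dyadicFloor N t = t := by rw [dyadicFloor, e1, h]
    rw [euler, e2, sub_self, add_zero, mul_one, euler, eulerStep, eulerStep, e1, eulerGrid, ← h,
      dyadicFloor]
    noncomm_ring

/-- The scheme is a discrete stochastic integral over every partition that refines the dyadic grid.
-/
theorem euler_eq_one_add_sum (x : ℝ≥0 → Mat n) {N : ℕ} {pt : ℕ → ℝ≥0} (hpt : Monotone pt)
    (h0 : pt 0 = 0) (h : ∀ k, pt (k + 1) ≤ dyadicFloor N (pt k) + (1 / 2) ^ N) (m : ℕ) :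
    euler x N (pt m) =
      1 + ∑ k ∈ Finset.range m, eulerStep x N (pt k) * (x (pt (k + 1)) - x (pt k)) := by
  rw [← Finset.sum_congr rfl fun k _ => euler_sub_euler x (hpt (Nat.le_succ k)) (h k),
    Finset.sum_range_sub fun k => euler x N (pt k), h0, euler_zero, add_sub_cancel]

/-- The points `j 2⁻ᴸ`, moved into the interval `[u, v]`. -/
noncomputable def clampGrid (L : ℕ) (u v : ℝ≥0) (k : ℕ) : ℝ≥0 := min (max u (k / 2 ^ L)) v

theorem clampGrid_mono (L : ℕ) (u v : ℝ≥0) : Monotone (clampGrid L u v) := fun j k h => by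
  simp only [clampGrid]; gcongr

theorem clampGrid_zero {u v : ℝ≥0} (h : u ≤ v) (L : ℕ) : clampGrid L u v 0 = u := by
  simp [clampGrid, h]

theorem clampGrid_le (L : ℕ) (u v : ℝ≥0) (k : ℕ) : clampGrid L u v k ≤ v := min_le_right _ _

theorem le_clampGrid {u v : ℝ≥0} (h : u ≤ v) (L k : ℕ) : u ≤ clampGrid L u v k :=
  le_min (le_max_left _ _) h

theorem clampGrid_end {L : ℕ} (u : ℝ≥0) {v : ℝ≥0} {m : ℕ} (hm : v * 2 ^ L ≤ m) :
    clampGrid L u v m = v :=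
  min_eq_right (le_max_of_le_right ((le_div_iff₀ (by positivity)).2 hm))

theorem dyadicFloor_mono (N : ℕ) : Monotone (dyadicFloor N) := fun s t h => by
  simp only [dyadicFloor]; gcongr

/-- Consecutive points of a finer clamped grid lie in the same closed dyadic interval of level `N`.
-/
theorem clampGrid_succ_le {N L : ℕ} (hNL : N ≤ L) (u v : ℝ≥0) (k : ℕ) :
    clampGrid L u v (k + 1) ≤ dyadicFloor N (clampGrid L u v k) + (1 / 2) ^ N := by
  have h1 : (((k + 1 : ℕ) : ℝ≥0) / 2 ^ L) ≤ dyadicFloor N ((k : ℝ≥0) / 2 ^ L) + (1 / 2) ^ N := by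
    obtain ⟨d, rfl⟩ := Nat.exists_eq_add_of_le hNL
    have e : (k : ℝ≥0) / 2 ^ (N + d) * 2 ^ N = (k : ℝ≥0) / ((2 ^ d : ℕ) : ℝ≥0) := by
      rw [pow_add]; push_cast; field_simp
    have e2 : dyadicFloor N ((k : ℝ≥0) / 2 ^ (N + d)) + (1 / 2) ^ N =
        ((k / 2 ^ d + 1 : ℕ) : ℝ≥0) / 2 ^ N := by
      rw [dyadicFloor, e, Nat.floor_div_eq_div, one_div, inv_pow, ← one_div, ← add_div]
      push_cast
      rfl
    rw [e2, div_le_div_iff₀ (by positivity) (by positivity), pow_add, mul_comm (2 ^ N : ℝ≥0) (2 ^ d),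
      ← mul_assoc]
    refine mul_le_mul_left ?_ _
    have h2 : k + 1 ≤ (k / 2 ^ d + 1) * 2 ^ d := by
      rw [add_mul, one_mul]
      exact Nat.lt_div_mul_add (by positivity)
    exact_mod_cast h2
  rcases le_total v (max u ((k : ℝ≥0) / 2 ^ L)) with h | h
  · have e : clampGrid L u v k = v := min_eq_right h
    rw [e]
    exact (clampGrid_le _ _ _ _).trans (lt_dyadicFloor_add N v).le
  · have e : clampGrid L u v k = max u ((k : ℝ≥0) / 2 ^ L) := min_eq_left h
    rw [e]
    refine (min_le_left _ _).trans (max_le ?_ ?_)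
    · exact (le_max_left _ _).trans (lt_dyadicFloor_add N _).le
    · exact h1.trans (add_le_add_left (dyadicFloor_mono N (le_max_right _ _)) _)

theorem continuous_euler {x : ℝ≥0 → Mat n} (hx : Continuous x) (N : ℕ) :
    Continuous (euler x N) := by
  -- on `[0, J]` the scheme is a finite sum of continuous functions
  have key : ∀ (J : ℕ) (t : ℝ≥0), t ≤ J → euler x N t = 1 + ∑ k ∈ Finset.range (J * 2 ^ N),
      eulerGrid x N k * (x (clampGrid N 0 t (k + 1)) - x (clampGrid N 0 t k)) := by
    intro J t ht
    have h1 := euler_eq_one_add_sum x (N := N) (clampGrid_mono N 0 t) (clampGrid_zero zero_le N)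
      (clampGrid_succ_le le_rfl 0 t) (J * 2 ^ N)
    rw [clampGrid_end 0 (by push_cast; gcongr)] at h1
    rw [h1]
    congr 1
    refine Finset.sum_congr rfl fun k _ => ?_
    rcases le_total ((k : ℝ≥0) / 2 ^ N) t with h | h
    · have e : clampGrid N 0 t k = (k : ℝ≥0) / 2 ^ N := by simp [clampGrid, h]
      rw [e, eulerStep, div_mul_cancel₀ _ (by positivity), Nat.floor_natCast]
    · have e1 : clampGrid N 0 t k = t := by simp [clampGrid, h]
      have e2 : clampGrid N 0 t (k + 1) = t :=
        le_antisymm (clampGrid_le _ _ _ _) (e1.ge.trans (clampGrid_mono N 0 t (Nat.le_succ k)))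
      rw [e1, e2, sub_self, mul_zero, mul_zero]
  rw [continuous_iff_continuousAt]
  intro t
  obtain ⟨J, hJ⟩ := exists_nat_gt t
  have hcont : Continuous fun t => 1 + ∑ k ∈ Finset.range (J * 2 ^ N),
      eulerGrid x N k * (x (clampGrid N 0 t (k + 1)) - x (clampGrid N 0 t k)) := by
    have hg : ∀ k, Continuous fun t => clampGrid N 0 t k := fun k =>
      continuous_const.min continuous_id
    exact continuous_const.add (continuous_finsetSum _ fun k _ =>
      continuous_const.matrix_mul ((hx.comp (hg _)).sub (hx.comp (hg _))))
  refine hcont.continuousAt.congr ?_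
  filter_upwards [gt_mem_nhds hJ] with s hs
  exact (key J s (le_of_lt hs)).symm

theorem measurable_eulerGrid {α : Type*} {m : MeasurableSpace α} {X : ℝ≥0 → α → Mat n} {N : ℕ} :
    ∀ {j : ℕ}, (∀ s : ℝ≥0, s ≤ j / 2 ^ N → Measurable (X s)) →
      Measurable fun ω => eulerGrid (fun s => X s ω) N j
  | 0, _ => measurable_const
  | j + 1, h => by
    have h1 : ((j : ℕ) : ℝ≥0) / 2 ^ N ≤ ((j + 1 : ℕ) : ℝ≥0) / 2 ^ N := by gcongr; simp
    exact measurable_mat_mul (measurable_eulerGrid fun s hs => h s (hs.trans h1))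
      (measurable_mat_add measurable_const (measurable_mat_sub (h _ le_rfl) (h _ h1)))

theorem measurable_eulerStep {α : Type*} {m : MeasurableSpace α} {X : ℝ≥0 → α → Mat n} {N : ℕ}
    {t : ℝ≥0} (h : ∀ s ≤ t, Measurable (X s)) :
    Measurable fun ω => eulerStep (fun s => X s ω) N t :=
  measurable_eulerGrid fun s hs => h s (hs.trans (dyadicFloor_le N t))

theorem measurable_euler {α : Type*} {m : MeasurableSpace α} {X : ℝ≥0 → α → Mat n} {N : ℕ}
    {t : ℝ≥0} (h : ∀ s ≤ t, Measurable (X s)) : Measurable fun ω => euler (fun s => X s ω) N t :=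
  measurable_mat_mul (measurable_eulerStep h) (measurable_mat_add measurable_const
    (measurable_mat_sub (h t le_rfl) (h _ (dyadicFloor_le N t))))

/-- The Euler scheme commutes with conjugations. -/
theorem euler_conj {O O' : Mat n} (h : O * O' = 1) (x : ℝ≥0 → Mat n) (N : ℕ) (t : ℝ≥0) :
    euler (fun s => O * x s * O') N t = O * euler x N t * O' := by
  have h' : O' * O = 1 := mul_eq_one_comm.1 h
  have e : ∀ A C : Mat n, O * A * O' * (1 + O * C * O') = O * (A * (1 + C)) * O' := fun A C => by
    calc _ = O * A * O' + O * A * (O' * O) * C * O' := by noncomm_ring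
      _ = _ := by rw [h']; noncomm_ring
  have e2 : ∀ A C : Mat n, O * A * O' - O * C * O' = O * (A - C) * O' := fun A C => by noncomm_ring
  have hg : ∀ j, eulerGrid (fun s => O * x s * O') N j = O * eulerGrid x N j * O' := by
    intro j
    induction j with
    | zero => simp [eulerGrid, h]
    | succ j ih => rw [eulerGrid, ih, eulerGrid, e2, e]
  rw [euler, eulerStep, hg, e2, e, euler, eulerStep]

end EulerPath

/-! ### Moments of the Euler schemes -/

section EulerMoments

variable {n : ℕ} {Ω : Type u} {mΩ : MeasurableSpace Ω} {P : Measure Ω} {ℱ : Filtration ℝ≥0 mΩ}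
  {B : ℝ≥0 → Ω → Mat n}

/-- The driving process `B_t + t a` of the Itô form of the equation. -/
noncomputable def drive (P : Measure Ω) (B : ℝ≥0 → Ω → Mat n) (ω : Ω) (t : ℝ≥0) : Mat n :=
  B t ω + (t : ℝ) • itoDrift P B

theorem drive_sub_drive (s t : ℝ≥0) (ω : Ω) :
    drive P B ω t - drive P B ω s = driftIncr P B s t ω := by
  simp only [drive, driftIncr, sub_smul]
  abel

theorem measurable_drive (hB : Adapted ℱ B) {s t : ℝ≥0} (h : s ≤ t) :
    Measurable[ℱ t] fun ω => drive P B ω s :=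
  measurable_mat_add ((hB s).mono (ℱ.mono h) le_rfl) measurable_const

theorem adapted_euler (hB : Adapted ℱ B) (N : ℕ) :
    Adapted ℱ fun t ω => euler (drive P B ω) N t := fun _ =>
  measurable_euler (X := fun s ω => drive P B ω s) fun _ hs => measurable_drive hB hs

theorem adapted_eulerStep (hB : Adapted ℱ B) (N : ℕ) :
    Adapted ℱ fun t ω => eulerStep (drive P B ω) N t := fun _ =>
  measurable_eulerStep (X := fun s ω => drive P B ω s) fun _ hs => measurable_drive hB hs

theorem euler_sub_one_eq_itoSum {N : ℕ} {pt : ℕ → ℝ≥0} (hpt : Monotone pt)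
    (h0 : pt 0 = 0) (h : ∀ k, pt (k + 1) ≤ dyadicFloor N (pt k) + (1 / 2) ^ N) (m : ℕ) (ω : Ω) :
    euler (drive P B ω) N (pt m) - 1 =
      itoSum P B pt (fun k ω => eulerStep (drive P B ω) N (pt k)) m ω := by
  simp only [euler_eq_one_add_sum _ hpt h0 h, add_sub_cancel_left, itoSum, drive_sub_drive]

/-- A bound for the second moments of the Euler schemes up to time `T`. -/
noncomputable def eulerBound (P : Measure Ω) (B : ℝ≥0 → Ω → Mat n) (T : ℝ≥0) : ℝ :=
  2 * n * Real.exp (2 * itoConst P B T * T)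

theorem eulerBound_nonneg (T : ℝ≥0) : 0 ≤ eulerBound P B T := by
  unfold eulerBound; positivity

theorem nsq_one : nsq (1 : Mat n) = n := by
  simp [nsq, Matrix.one_apply]

variable [IsProbabilityMeasure P]

theorem IsBrownianMotionSL.memLp_eulerGrid (hB : IsBrownianMotionSL P ℱ B) (N : ℕ) :
    ∀ (m : ℕ) (i j : Fin n), MemLp (fun ω => eulerGrid (drive P B ω) N m i j) 2 P
  | 0, i, j => memLp_const _
  | m + 1, i, j => by
    have h := hB.memLp_eulerGrid N m
    have h1 : ((m : ℕ) : ℝ≥0) / 2 ^ N ≤ ((m + 1 : ℕ) : ℝ≥0) / 2 ^ N := by gcongr; simp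
    have h2 := hB.memLp_mul_driftIncr h1 (G := fun ω => eulerGrid (drive P B ω) N m)
      (measurable_eulerGrid (X := fun s ω => drive P B ω s)
        fun s hs => measurable_drive hB.adapted hs) h i j
    simp only [eulerGrid, drive_sub_drive, mul_add, mul_one, Matrix.add_apply]
    exact (h i j).add h2

theorem IsBrownianMotionSL.memLp_eulerStep (hB : IsBrownianMotionSL P ℱ B) (N : ℕ) (t : ℝ≥0)
    (i j : Fin n) : MemLp (fun ω => eulerStep (drive P B ω) N t i j) 2 P :=
  hB.memLp_eulerGrid N _ i j

theorem IsBrownianMotionSL.memLp_euler (hB : IsBrownianMotionSL P ℱ B) (N : ℕ) (t : ℝ≥0)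
    (i j : Fin n) : MemLp (fun ω => euler (drive P B ω) N t i j) 2 P := by
  have h2 := hB.memLp_mul_driftIncr (dyadicFloor_le N t)
    (G := fun ω => eulerStep (drive P B ω) N (dyadicFloor N t))
      (adapted_eulerStep hB.adapted N _) (hB.memLp_eulerStep N _) i j
  simp only [eulerStep_dyadicFloor] at h2
  simp only [euler, drive_sub_drive, mul_add, mul_one, Matrix.add_apply]
  exact (hB.memLp_eulerStep N t i j).add h2

theorem sum_coe_sub_le {pt : ℕ → ℝ≥0} {T : ℝ≥0} (hT : ∀ k, pt k ≤ T) (m : ℕ) :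
    ∑ k ∈ Finset.range m, ((pt (k + 1) : ℝ) - pt k) ≤ T := by
  rw [Finset.sum_range_sub fun k => (pt k : ℝ)]
  have : (pt m : ℝ) ≤ T := hT m
  linarith [(pt 0).coe_nonneg]

/-- From Itô's estimate and the discrete Gronwall inequality. -/
theorem IsBrownianMotionSL.integral_nsq_eulerStep_le (hB : IsBrownianMotionSL P ℱ B) (N : ℕ)
    {s T : ℝ≥0} (hs : s ≤ T) :
    ∫ ω, nsq (eulerStep (drive P B ω) N s) ∂P ≤ eulerBound P B T := by
  set pt := clampGrid N 0 (dyadicFloor N s) with hptdef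
  have hpt : Monotone pt := clampGrid_mono _ _ _
  have h0 : pt 0 = 0 := clampGrid_zero zero_le N
  have hle : ∀ k, pt k ≤ T := fun k =>
    (clampGrid_le _ _ _ _).trans ((dyadicFloor_le N s).trans hs)
  have hκ := itoConst_nonneg (P := P) (B := B) T.2
  set u : ℕ → ℝ := fun m => ∫ ω, nsq (euler (drive P B ω) N (pt m) - 1) ∂P with hu
  have hmem : ∀ m i j, MemLp (fun ω => (euler (drive P B ω) N (pt m) - 1) i j) 2 P :=
    fun m i j => (hB.memLp_euler N _ i j).sub (memLp_const _)
  -- the points of the grid are multiples of `2⁻ᴺ`, where the scheme and its step function agree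
  have hfix : ∀ k, dyadicFloor N (pt k) = pt k := by
    intro k
    rcases le_total ((k : ℝ≥0) / 2 ^ N) (dyadicFloor N s) with h | h
    · have e : pt k = (k : ℝ≥0) / 2 ^ N := by simp [hptdef, clampGrid, h]
      rw [e, dyadicFloor, div_mul_cancel₀ _ (by positivity), Nat.floor_natCast]
    · have e : pt k = dyadicFloor N s := by simp [hptdef, clampGrid, h]
      rw [e, dyadicFloor, floor_dyadicFloor, dyadicFloor]
  have hV : ∀ k, ∫ ω, nsq (eulerStep (drive P B ω) N (pt k)) ∂P ≤ 2 * (u k + n) := by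
    intro k
    have e : ∀ ω, eulerStep (drive P B ω) N (pt k) = euler (drive P B ω) N (pt k) := fun ω => by
      rw [← euler_dyadicFloor, hfix]
    have h1 : ∀ ω, nsq (eulerStep (drive P B ω) N (pt k)) ≤
        2 * nsq (euler (drive P B ω) N (pt k) - 1) + 2 * n := fun ω => by
      have h2 := nsq_add_le (euler (drive P B ω) N (pt k) - 1) 1
      rw [sub_add_cancel, nsq_one] at h2
      rwa [e]
    have i1 : Integrable (fun ω => 2 * nsq (euler (drive P B ω) N (pt k) - 1)) P :=
      (integrable_nsq (hmem k)).const_mul 2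
    calc _ ≤ ∫ ω, (2 * nsq (euler (drive P B ω) N (pt k) - 1) + 2 * n) ∂P :=
          integral_mono (integrable_nsq (hB.memLp_eulerStep N _)) (i1.add (integrable_const _)) h1
      _ = 2 * (u k + n) := by
          rw [integral_add i1 (integrable_const _), integral_const_mul]
          simp [mul_add, hu]
  have hgr : ∀ m ≤ ⌊s * 2 ^ N⌋₊, u m ≤ (2 * itoConst P B T) *
      ∑ k ∈ Finset.range m, ((pt (k + 1) : ℝ) - pt k) * (u k + n) := by
    intro m _
    have h1 := hB.integral_nsq_itoSum_le hpt
      (H := fun k ω => eulerStep (drive P B ω) N (pt k)) (fun k => adapted_eulerStep hB.adapted N _)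
      (fun k => hB.memLp_eulerStep N _) (T := T) (m := m) (by
        rw [h0, NNReal.coe_zero, sub_zero]; exact hle m)
    simp only [← euler_sub_one_eq_itoSum hpt h0 (clampGrid_succ_le le_rfl _ _)] at h1
    refine h1.trans ?_
    rw [mul_comm 2, mul_assoc, Finset.mul_sum _ _ (2 : ℝ)]
    refine mul_le_mul_of_nonneg_left (Finset.sum_le_sum fun k _ => ?_) hκ
    have h2 : 0 ≤ (pt (k + 1) : ℝ) - pt k := sub_nonneg.2 (hpt (Nat.le_succ k))
    nlinarith [hV k]
  have hres := le_of_discrete_gronwall (u := u) (fun k => sub_nonneg.2 (hpt (Nat.le_succ k)))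
    (by positivity) hgr (Nat.cast_nonneg n) _ le_rfl
  have hend : pt ⌊s * 2 ^ N⌋₊ = dyadicFloor N s :=
    clampGrid_end 0 (by rw [dyadicFloor, div_mul_cancel₀ _ (by positivity)])
  have h3 := hV ⌊s * 2 ^ N⌋₊
  simp only [hend, eulerStep_dyadicFloor] at h3
  refine h3.trans ?_
  rw [eulerBound, mul_assoc]
  refine mul_le_mul_of_nonneg_left (hres.trans (mul_le_mul_of_nonneg_left
    (Real.exp_le_exp.2 (mul_le_mul_of_nonneg_left (sum_coe_sub_le hle _) (by positivity)))
    (Nat.cast_nonneg n))) (by norm_num)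

/-- The Euler schemes are `½`-Hölder continuous in mean square. -/
theorem IsBrownianMotionSL.integral_nsq_euler_sub_le (hB : IsBrownianMotionSL P ℱ B) (N : ℕ)
    {s t T : ℝ≥0} (hst : s ≤ t) (ht : t ≤ T) :
    ∫ ω, nsq (euler (drive P B ω) N t - euler (drive P B ω) N s) ∂P ≤
      itoConst P B T * eulerBound P B T * ((t : ℝ) - s) := by
  set pt := clampGrid N s t with hptdef
  have hpt : Monotone pt := clampGrid_mono _ _ _
  have h0 : pt 0 = s := clampGrid_zero hst N
  have hle : ∀ k, pt k ≤ T := fun k => (clampGrid_le _ _ _ _).trans ht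
  have hend : pt ⌈t * 2 ^ N⌉₊ = t := clampGrid_end s (Nat.le_ceil _)
  have e : ∀ ω, euler (drive P B ω) N t - euler (drive P B ω) N s =
      itoSum P B pt (fun k ω => eulerStep (drive P B ω) N (pt k)) ⌈t * 2 ^ N⌉₊ ω := by
    intro ω
    simp only [itoSum, ← drive_sub_drive]
    rw [← Finset.sum_congr rfl fun k _ => euler_sub_euler (drive P B ω) (hpt (Nat.le_succ k))
      (clampGrid_succ_le le_rfl s t k), Finset.sum_range_sub fun k => euler (drive P B ω) N (pt k),
      h0, hend]
  simp only [e]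
  refine (hB.integral_nsq_itoSum_le hpt
    (H := fun k ω => eulerStep (drive P B ω) N (pt k)) (fun k => adapted_eulerStep hB.adapted N _)
    (fun k => hB.memLp_eulerStep N _) (T := T) ?_).trans ?_
  · rw [hend, h0]
    have : (t : ℝ) ≤ T := ht
    linarith [s.coe_nonneg]
  · rw [mul_assoc]
    refine mul_le_mul_of_nonneg_left ?_ (itoConst_nonneg T.2)
    calc _ ≤ ∑ k ∈ Finset.range ⌈t * 2 ^ N⌉₊, ((pt (k + 1) : ℝ) - pt k) * eulerBound P B T :=
          Finset.sum_le_sum fun k _ => mul_le_mul_of_nonneg_left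
            (hB.integral_nsq_eulerStep_le N (hle k)) (sub_nonneg.2 (hpt (Nat.le_succ k)))
      _ = _ := by
          rw [← Finset.sum_mul, Finset.sum_range_sub fun k => (pt k : ℝ), hend, h0, mul_comm]

/-- The interpolated scheme is close to its step function. -/
theorem IsBrownianMotionSL.integral_nsq_euler_sub_eulerStep_le (hB : IsBrownianMotionSL P ℱ B)
    (N : ℕ) {t T : ℝ≥0} (ht : t ≤ T) :
    ∫ ω, nsq (euler (drive P B ω) N t - eulerStep (drive P B ω) N t) ∂P ≤
      itoConst P B T * eulerBound P B T * (1 / 2) ^ N := by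
  simp only [← euler_dyadicFloor]
  refine (hB.integral_nsq_euler_sub_le N (dyadicFloor_le N t) ht).trans
    (mul_le_mul_of_nonneg_left ?_ (mul_nonneg (itoConst_nonneg T.2) (eulerBound_nonneg T)))
  have h : (t : ℝ) < dyadicFloor N t + (1 / 2) ^ N := by exact_mod_cast lt_dyadicFloor_add N t
  linarith

end EulerMoments

/-! ### Convergence of the Euler schemes -/

section EulerConvergence

/-- A sequence of continuous functions with geometrically small differences, locally uniformly,
converges to a continuous function. -/
theorem exists_continuous_limit_of_geometric {f : ℕ → ℝ≥0 → ℝ} {η : ℝ} (h0 : 0 < η) (h1 : η < 1)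
    (hc : ∀ N, Continuous (f N))
    (hf : ∀ T : ℕ, ∀ᶠ N : ℕ in atTop, ∀ t ≤ (T : ℝ≥0), |f (N + 1) t - f N t| ≤ η ^ N) :
    ∃ y : ℝ≥0 → ℝ, Continuous y ∧ ∀ t, Tendsto (fun N => f N t) atTop (𝓝 (y t)) := by
  have key : ∀ T : ℕ, ∃ N₀ : ℕ, ∀ N ≥ N₀, ∀ t ≤ (T : ℝ≥0), |f (N + 1) t - f N t| ≤ η ^ N :=
    fun T => eventually_atTop.1 (hf T)
  choose N₀ hN₀ using key
  have hstep : ∀ (T : ℕ) (t : ℝ≥0), t ≤ T → ∀ N ≥ N₀ T, ∀ m,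
      dist (f (N + m) t) (f (N + (m + 1)) t) ≤ η ^ N * η ^ m := by
    intro T t ht N hN m
    rw [← pow_add, dist_comm, Real.dist_eq]
    exact hN₀ T (N + m) (by omega) t ht
  have hlim : ∀ t : ℝ≥0, ∃ y, Tendsto (fun N => f N t) atTop (𝓝 y) := by
    intro t
    obtain ⟨T, hT⟩ := exists_nat_ge t
    obtain ⟨y, hy⟩ := cauchySeq_tendsto_of_complete
      (cauchySeq_of_le_geometric η _ h1 (hstep T t hT (N₀ T) le_rfl))
    exact ⟨y, (tendsto_add_atTop_iff_nat (N₀ T)).1 (hy.congr fun m => by rw [add_comm])⟩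
  choose y hy using hlim
  refine ⟨y, ?_, hy⟩
  have hdist : ∀ (T : ℕ) (t : ℝ≥0), t ≤ T → ∀ N ≥ N₀ T, dist (f N t) (y t) ≤ η ^ N / (1 - η) := by
    intro T t ht N hN
    refine dist_le_of_le_geometric_of_tendsto₀ η _ h1 (hstep T t ht N hN) ?_
    exact ((tendsto_add_atTop_iff_nat N).2 (hy t)).congr fun m => by rw [add_comm]
  have hloc : TendstoLocallyUniformly f y atTop := by
    rw [Metric.tendstoLocallyUniformly_iff]
    intro ε hε x
    obtain ⟨T, hT⟩ := exists_nat_gt x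
    have hz : Tendsto (fun N : ℕ => η ^ N / (1 - η)) atTop (𝓝 0) := by
      simpa using (tendsto_pow_atTop_nhds_zero_of_lt_one h0.le h1).div_const (1 - η)
    refine ⟨Set.Iio (T : ℝ≥0), Iio_mem_nhds hT, ?_⟩
    filter_upwards [hz.eventually (gt_mem_nhds hε), eventually_ge_atTop (N₀ T)] with N hN hN' t ht
    rw [dist_comm]
    exact (hdist T t (le_of_lt ht) N hN').trans_lt hN
  exact hloc.continuous (Frequently.of_forall hc)

variable {n : ℕ} {Ω : Type u} {mΩ : MeasurableSpace Ω} {P : Measure Ω} {ℱ : Filtration ℝ≥0 mΩ}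
  {B : ℝ≥0 → Ω → Mat n}

/-- The discretization constant of the Euler scheme. -/
noncomputable def eulerError (P : Measure Ω) (B : ℝ≥0 → Ω → Mat n) (T : ℝ≥0) : ℝ :=
  4 * itoConst P B T * eulerBound P B T * Real.exp (2 * itoConst P B T * T)

theorem eulerError_nonneg (T : ℝ≥0) : 0 ≤ eulerError P B T :=
  mul_nonneg (mul_nonneg (mul_nonneg (by norm_num) (itoConst_nonneg T.coe_nonneg)) (eulerBound_nonneg T))
    (Real.exp_pos _).le

/-- The difference of two schemes is a discrete stochastic integral over a common refinement of
their grids. -/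
theorem euler_sub_eq_itoSum {M N : ℕ} {pt : ℕ → ℝ≥0} (hpt : Monotone pt) (h0 : pt 0 = 0)
    (hM : ∀ k, pt (k + 1) ≤ dyadicFloor M (pt k) + (1 / 2) ^ M)
    (hN : ∀ k, pt (k + 1) ≤ dyadicFloor N (pt k) + (1 / 2) ^ N) (m : ℕ) (ω : Ω) :
    euler (drive P B ω) M (pt m) - euler (drive P B ω) N (pt m) = itoSum P B pt
      (fun k ω => eulerStep (drive P B ω) M (pt k) - eulerStep (drive P B ω) N (pt k)) m ω := by
  rw [← sub_sub_sub_cancel_right _ _ (1 : Mat n), euler_sub_one_eq_itoSum hpt h0 hM,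
    euler_sub_one_eq_itoSum hpt h0 hN]
  simp only [itoSum, sub_mul, Finset.sum_sub_distrib]

variable [IsProbabilityMeasure P]

theorem IsBrownianMotionSL.memLp_euler_sub (hB : IsBrownianMotionSL P ℱ B) (M N : ℕ) (s t : ℝ≥0)
    (i j : Fin n) :
    MemLp (fun ω => (euler (drive P B ω) M s - euler (drive P B ω) N t) i j) 2 P :=
  (hB.memLp_euler M s i j).sub (hB.memLp_euler N t i j)

theorem IsBrownianMotionSL.memLp_euler_sub_eulerStep (hB : IsBrownianMotionSL P ℱ B) (M N : ℕ)
    (s t : ℝ≥0) (i j : Fin n) :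
    MemLp (fun ω => (euler (drive P B ω) M s - eulerStep (drive P B ω) N t) i j) 2 P :=
  (hB.memLp_euler M s i j).sub (hB.memLp_eulerStep N t i j)

theorem IsBrownianMotionSL.memLp_eulerStep_sub (hB : IsBrownianMotionSL P ℱ B) (M N : ℕ)
    (s t : ℝ≥0) (i j : Fin n) :
    MemLp (fun ω => (eulerStep (drive P B ω) M s - eulerStep (drive P B ω) N t) i j) 2 P :=
  (hB.memLp_eulerStep M s i j).sub (hB.memLp_eulerStep N t i j)

/-- Passes from the interpolated schemes to their step functions, which are the integrands. -/
theorem IsBrownianMotionSL.integral_nsq_eulerStep_sub_le_aux (hB : IsBrownianMotionSL P ℱ B)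
    {M N : ℕ} (hNM : N ≤ M) {s T : ℝ≥0} (hs : s ≤ T) :
    ∫ ω, nsq (eulerStep (drive P B ω) M s - eulerStep (drive P B ω) N s) ∂P ≤
      2 * (∫ ω, nsq (euler (drive P B ω) M s - euler (drive P B ω) N s) ∂P +
        4 * itoConst P B T * eulerBound P B T * (1 / 2) ^ N) := by
  have i1 : Integrable (fun ω => 2 * nsq (euler (drive P B ω) M s - euler (drive P B ω) N s)) P :=
    (integrable_nsq (hB.memLp_euler_sub M N s s)).const_mul 2
  have i2 : Integrable
      (fun ω => 4 * nsq (euler (drive P B ω) M s - eulerStep (drive P B ω) M s)) P :=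
    (integrable_nsq (hB.memLp_euler_sub_eulerStep M M s s)).const_mul 4
  have i3 : Integrable
      (fun ω => 4 * nsq (euler (drive P B ω) N s - eulerStep (drive P B ω) N s)) P :=
    (integrable_nsq (hB.memLp_euler_sub_eulerStep N N s s)).const_mul 4
  have i12 : Integrable (fun ω => 2 * nsq (euler (drive P B ω) M s - euler (drive P B ω) N s) +
      4 * nsq (euler (drive P B ω) M s - eulerStep (drive P B ω) M s)) P := i1.add i2
  have hp : ((1 : ℝ) / 2) ^ M ≤ (1 / 2) ^ N :=
    pow_le_pow_of_le_one (by norm_num) (by norm_num) hNM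
  have hκ : 0 ≤ itoConst P B T * eulerBound P B T :=
    mul_nonneg (itoConst_nonneg T.coe_nonneg) (eulerBound_nonneg T)
  calc _ ≤ ∫ ω, (2 * nsq (euler (drive P B ω) M s - euler (drive P B ω) N s) +
        4 * nsq (euler (drive P B ω) M s - eulerStep (drive P B ω) M s) +
        4 * nsq (euler (drive P B ω) N s - eulerStep (drive P B ω) N s)) ∂P := by
        refine integral_mono (integrable_nsq (hB.memLp_eulerStep_sub M N s s)) (i12.add i3)
          fun ω => ?_
        have e : eulerStep (drive P B ω) M s - eulerStep (drive P B ω) N s =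
            (euler (drive P B ω) M s - euler (drive P B ω) N s) +
            ((euler (drive P B ω) N s - eulerStep (drive P B ω) N s) -
              (euler (drive P B ω) M s - eulerStep (drive P B ω) M s)) := by abel
        have h1 := nsq_add_le (euler (drive P B ω) M s - euler (drive P B ω) N s)
          ((euler (drive P B ω) N s - eulerStep (drive P B ω) N s) -
              (euler (drive P B ω) M s - eulerStep (drive P B ω) M s))
        have h2 := nsq_sub_le (euler (drive P B ω) N s - eulerStep (drive P B ω) N s)
              (euler (drive P B ω) M s - eulerStep (drive P B ω) M s)
        simp only [e]
        linarith
    _ = 2 * ∫ ω, nsq (euler (drive P B ω) M s - euler (drive P B ω) N s) ∂P +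
        4 * ∫ ω, nsq (euler (drive P B ω) M s - eulerStep (drive P B ω) M s) ∂P +
        4 * ∫ ω, nsq (euler (drive P B ω) N s - eulerStep (drive P B ω) N s) ∂P := by
        rw [integral_add i12 i3, integral_add i1 i2, integral_const_mul, integral_const_mul,
          integral_const_mul]
    _ ≤ _ := by
        have h1 := hB.integral_nsq_euler_sub_eulerStep_le M hs
        have h2 := hB.integral_nsq_euler_sub_eulerStep_le N hs
        nlinarith

/-- The discrete Gronwall inequality for the difference of two schemes. The additive error term is
kept on the left, so that with `integral_nsq_eulerStep_sub_le_aux` the estimate applies to the step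
functions as well. -/
theorem IsBrownianMotionSL.integral_nsq_euler_sub_euler_add_le (hB : IsBrownianMotionSL P ℱ B)
    {M N : ℕ} (hNM : N ≤ M) {s T : ℝ≥0} (hs : s ≤ T) :
    ∫ ω, nsq (euler (drive P B ω) M s - euler (drive P B ω) N s) ∂P +
        4 * itoConst P B T * eulerBound P B T * (1 / 2) ^ N ≤ eulerError P B T * (1 / 2) ^ N := by
  set pt := clampGrid M 0 s with hptdef
  have hpt : Monotone pt := clampGrid_mono _ _ _
  have h0 : pt 0 = 0 := clampGrid_zero zero_le M
  have hle : ∀ k, pt k ≤ T := fun k => (clampGrid_le _ _ _ _).trans hs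
  have hκ := itoConst_nonneg (P := P) (B := B) T.coe_nonneg
  have hb := eulerBound_nonneg (P := P) (B := B) T
  set u : ℕ → ℝ := fun m =>
    ∫ ω, nsq (euler (drive P B ω) M (pt m) - euler (drive P B ω) N (pt m)) ∂P with hu
  set ρ := 4 * itoConst P B T * eulerBound P B T * (1 / 2) ^ N with hρdef
  have hρ : 0 ≤ ρ := by positivity
  have hgr : ∀ m ≤ ⌈s * 2 ^ M⌉₊, u m ≤ (2 * itoConst P B T) *
      ∑ k ∈ Finset.range m, ((pt (k + 1) : ℝ) - pt k) * (u k + ρ) := by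
    intro m _
    have h1 := hB.integral_nsq_itoSum_le hpt (H := fun k ω =>
        eulerStep (drive P B ω) M (pt k) - eulerStep (drive P B ω) N (pt k))
      (fun k => measurable_mat_sub (adapted_eulerStep hB.adapted M _)
        (adapted_eulerStep hB.adapted N _))
      (fun k => hB.memLp_eulerStep_sub M N _ _) (T := T) (m := m) (by
        rw [h0, NNReal.coe_zero, sub_zero]; exact hle m)
    simp only [← euler_sub_eq_itoSum hpt h0 (clampGrid_succ_le le_rfl _ _)
      (clampGrid_succ_le hNM _ _)] at h1
    refine h1.trans ?_
    rw [mul_comm 2, mul_assoc, Finset.mul_sum _ _ (2 : ℝ)]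
    refine mul_le_mul_of_nonneg_left (Finset.sum_le_sum fun k _ => ?_) hκ
    have h2 : 0 ≤ (pt (k + 1) : ℝ) - pt k := sub_nonneg.2 (hpt (Nat.le_succ k))
    have h3 := hB.integral_nsq_eulerStep_sub_le_aux hNM (hle k)
    calc _ ≤ ((pt (k + 1) : ℝ) - pt k) * (2 * (u k + ρ)) := mul_le_mul_of_nonneg_left h3 h2
      _ = _ := by ring
  have hres := le_of_discrete_gronwall (u := u) (fun k => sub_nonneg.2 (hpt (Nat.le_succ k)))
    (by positivity) hgr hρ _ le_rfl
  have hend : pt ⌈s * 2 ^ M⌉₊ = s := clampGrid_end 0 (Nat.le_ceil _)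
  simp only [hu, hend] at hres
  refine hres.trans ?_
  have e : eulerError P B T * (1 / 2) ^ N = ρ * Real.exp (2 * itoConst P B T * T) := by
    rw [eulerError, hρdef]; ring
  rw [e]
  exact mul_le_mul_of_nonneg_left (Real.exp_le_exp.2 (mul_le_mul_of_nonneg_left
    (sum_coe_sub_le hle _) (by positivity))) hρ

/-- The Euler schemes converge in mean square. -/
theorem IsBrownianMotionSL.integral_nsq_euler_sub_euler_le (hB : IsBrownianMotionSL P ℱ B)
    {M N : ℕ} (hNM : N ≤ M) {s T : ℝ≥0} (hs : s ≤ T) :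
    ∫ ω, nsq (euler (drive P B ω) M s - euler (drive P B ω) N s) ∂P ≤
      eulerError P B T * (1 / 2) ^ N := by
  have h := hB.integral_nsq_euler_sub_euler_add_le hNM hs
  have h1 : 0 ≤ 4 * itoConst P B T * eulerBound P B T * (1 / 2) ^ N :=
    mul_nonneg (mul_nonneg (mul_nonneg (by norm_num) (itoConst_nonneg T.coe_nonneg))
      (eulerBound_nonneg T)) (by positivity)
  linarith

/-- The maximal inequality for the difference of two Euler schemes, on a dyadic grid. -/
theorem IsBrownianMotionSL.measure_grid_euler_sub_le (hB : IsBrownianMotionSL P ℱ B)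
    {M N L : ℕ} (hNM : N ≤ M) (hML : M ≤ L) (T : ℝ≥0) {ε : ℝ} (hε : 0 < ε) :
    P {ω | ∃ r, ε ≤ nsq (euler (drive P B ω) M (clampGrid L 0 T r) -
        euler (drive P B ω) N (clampGrid L 0 T r))} ≤
      ENNReal.ofReal (itoConst P B T / ε * (T * (2 * (eulerError P B T * (1 / 2) ^ N)))) := by
  set pt := clampGrid L 0 T with hptdef
  have hpt : Monotone pt := clampGrid_mono _ _ _
  have h0 : pt 0 = 0 := clampGrid_zero zero_le L
  have hle : ∀ k, pt k ≤ T := fun k => clampGrid_le _ _ _ _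
  set m := ⌈T * 2 ^ L⌉₊ with hm
  have h1 := hB.measure_nsq_itoSum_le hpt (H := fun k ω =>
      eulerStep (drive P B ω) M (pt k) - eulerStep (drive P B ω) N (pt k))
    (fun k => measurable_mat_sub (adapted_eulerStep hB.adapted M _)
      (adapted_eulerStep hB.adapted N _))
    (fun k => hB.memLp_eulerStep_sub M N _ _) (T := T) (m := m) (by
      rw [h0, NNReal.coe_zero, sub_zero]; exact hle m) hε
  simp only [← euler_sub_eq_itoSum hpt h0 (clampGrid_succ_le hML _ _)
    (clampGrid_succ_le (hNM.trans hML) _ _)] at h1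
  refine (measure_mono ?_).trans (h1.trans (ENNReal.ofReal_le_ofReal ?_))
  · rintro ω ⟨r, hr⟩
    rcases le_total r m with h | h
    · exact ⟨r, h, hr⟩
    · refine ⟨m, le_rfl, ?_⟩
      have e1 : pt m = T := clampGrid_end 0 (Nat.le_ceil _)
      have e2 : pt r = T := clampGrid_end 0 ((Nat.le_ceil _).trans (Nat.cast_le.2 h))
      rwa [e2, ← e1] at hr
  · refine mul_le_mul_of_nonneg_left ?_ (div_nonneg (itoConst_nonneg T.coe_nonneg) hε.le)
    have hc : 0 ≤ eulerError P B T * (1 / 2) ^ N :=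
      mul_nonneg (eulerError_nonneg T) (by positivity)
    calc _ ≤ ∑ k ∈ Finset.range m,
          ((pt (k + 1) : ℝ) - pt k) * (2 * (eulerError P B T * (1 / 2) ^ N)) := by
          refine Finset.sum_le_sum fun k _ => mul_le_mul_of_nonneg_left ?_
            (sub_nonneg.2 (hpt (Nat.le_succ k)))
          have h3 := hB.integral_nsq_eulerStep_sub_le_aux hNM (hle k)
          have h4 := hB.integral_nsq_euler_sub_euler_add_le hNM (hle k)
          linarith
      _ ≤ _ := by
          rw [← Finset.sum_mul]
          exact mul_le_mul_of_nonneg_right (sum_coe_sub_le hle m) (by positivity)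

theorem tendsto_dyadicFloor (t : ℝ≥0) : Tendsto (fun N => dyadicFloor N t) atTop (𝓝 t) := by
  have h1 : Tendsto (fun N : ℕ => dyadicFloor N t + (1 / 2) ^ N - (1 / 2) ^ N) atTop (𝓝 t) := by
    have h2 : Tendsto (fun N : ℕ => t - (1 / 2 : ℝ≥0) ^ N) atTop (𝓝 t) := by
      have := (tendsto_const_nhds (x := t)).sub
        (tendsto_pow_atTop_nhds_zero_of_lt_one (r := (1 / 2 : ℝ≥0)) zero_le (by
          rw [div_lt_one (by norm_num)]; norm_num))
      rwa [tsub_zero] at this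
    refine tendsto_of_tendsto_of_tendsto_of_le_of_le h2 tendsto_const_nhds (fun N => ?_)
      fun N => ?_
    · exact tsub_le_tsub_right (lt_dyadicFloor_add N t).le _
    · simp only [add_tsub_cancel_right]
      exact dyadicFloor_le N t
  simpa using h1

/-- The maximal inequality for the difference of two Euler schemes, in continuous time. -/
theorem IsBrownianMotionSL.measure_euler_sub_le (hB : IsBrownianMotionSL P ℱ B)
    {M N : ℕ} (hNM : N ≤ M) (T : ℝ≥0) {ε : ℝ} (hε : 0 < ε) :
    P {ω | ∃ t ≤ T, ε < nsq (euler (drive P B ω) M t - euler (drive P B ω) N t)} ≤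
      ENNReal.ofReal (itoConst P B T / ε * (T * (2 * (eulerError P B T * (1 / 2) ^ N)))) := by
  set E : ℕ → Set Ω := fun L => {ω | ∃ r, ε ≤ nsq (euler (drive P B ω) M (clampGrid L 0 T r) -
        euler (drive P B ω) N (clampGrid L 0 T r))} with hE
  -- the grids are nested, so the events increase and the bound passes to their union
  have hmono : Monotone E := by
    refine monotone_nat_of_le_succ fun L => ?_
    rintro ω ⟨r, hr⟩
    refine ⟨2 * r, ?_⟩
    have e : clampGrid (L + 1) 0 T (2 * r) = clampGrid L 0 T r := by
      simp only [clampGrid]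
      congr 2
      rw [pow_succ]
      push_cast
      field_simp
    rwa [e]
  have hU : P (⋃ L, E L) ≤
      ENNReal.ofReal (itoConst P B T / ε * (T * (2 * (eulerError P B T * (1 / 2) ^ N)))) := by
    rw [hmono.measure_iUnion]
    refine iSup_le fun L => ?_
    exact (measure_mono (hmono (le_max_left L M))).trans
      (hB.measure_grid_euler_sub_le hNM (le_max_right L M) T hε)
  refine (measure_mono_ae ?_).trans hU
  filter_upwards [hB.continuous] with ω hω
  rintro ⟨t, ht, hlt⟩
  have hx : Continuous (drive P B ω) := hω.add (NNReal.continuous_coe.smul continuous_const)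
  have hcont : Continuous fun t => nsq (euler (drive P B ω) M t - euler (drive P B ω) N t) :=
    continuous_nsq.comp ((continuous_euler hx M).sub (continuous_euler hx N))
  have hev := ((hcont.tendsto t).comp (tendsto_dyadicFloor t)).eventually (lt_mem_nhds hlt)
  obtain ⟨L, hL⟩ := hev.exists
  refine Set.mem_iUnion.2 ⟨L, ⌊t * 2 ^ L⌋₊, ?_⟩
  have e : clampGrid L 0 T ⌊t * 2 ^ L⌋₊ = dyadicFloor L t := by
    rw [clampGrid, max_eq_right zero_le]
    exact min_eq_left ((dyadicFloor_le L t).trans ht)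
  rw [e]
  exact le_of_lt hL

/-- Almost surely, the Euler schemes converge locally uniformly. -/
theorem IsBrownianMotionSL.exists_limit_euler (hB : IsBrownianMotionSL P ℱ B) :
    ∀ᵐ ω ∂P, ∃ y : ℝ≥0 → Mat n, Continuous y ∧
      ∀ t i j, Tendsto (fun N => euler (drive P B ω) N t i j) atTop (𝓝 (y t i j)) := by
  -- the bound `(9/10)²ᴺ` is summable after taking square roots, and since `81/100 > 1/2` the
  -- probabilities that it fails are summable too
  have hBC : ∀ T : ℕ, ∀ᵐ ω ∂P, ∀ᶠ N : ℕ in atTop, ∀ t ≤ (T : ℝ≥0),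
      nsq (euler (drive P B ω) (N + 1) t - euler (drive P B ω) N t) ≤ (81 / 100) ^ N := by
    intro T
    have hsum : ∑' N : ℕ, P {ω | ∃ t ≤ (T : ℝ≥0), ((81 : ℝ) / 100) ^ N <
        nsq (euler (drive P B ω) (N + 1) t - euler (drive P B ω) N t)} ≠ ⊤ := by
      set C : ℝ := itoConst P B (T : ℝ≥0) * ((T : ℝ≥0) * (2 * eulerError P B (T : ℝ≥0))) with hC
      have hs : Summable fun N : ℕ => C * ((50 : ℝ) / 81) ^ N :=
        (summable_geometric_of_lt_one (by norm_num) (by norm_num)).mul_left C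
      refine ne_top_of_le_ne_top hs.tsum_ofReal_ne_top (ENNReal.tsum_le_tsum fun N => ?_)
      refine (hB.measure_euler_sub_le (Nat.le_succ N) T (by positivity)).trans
        (ENNReal.ofReal_le_ofReal (le_of_eq ?_))
      have e : ((50 : ℝ) / 81) ^ N = (1 / 2) ^ N / (81 / 100) ^ N := by
        rw [← div_pow]; norm_num
      rw [e, hC]
      field_simp
    filter_upwards [ae_eventually_notMem hsum] with ω hω
    filter_upwards [hω] with N hN t ht
    by_contra hc
    exact hN ⟨t, ht, not_le.1 hc⟩
  filter_upwards [ae_all_iff.2 hBC, hB.continuous] with ω hω hcω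
  have hx : Continuous (drive P B ω) := hcω.add (NNReal.continuous_coe.smul continuous_const)
  have hent : ∀ i j, ∃ y : ℝ≥0 → ℝ, Continuous y ∧
      ∀ t, Tendsto (fun N => euler (drive P B ω) N t i j) atTop (𝓝 (y t)) := by
    intro i j
    refine exists_continuous_limit_of_geometric (η := 9 / 10) (by norm_num) (by norm_num)
      (fun N => (continuous_euler hx N).matrix_elem i j) fun T => ?_
    filter_upwards [hω T] with N hN t ht
    have h1 := (sq_entry_le_nsq _ i j).trans (hN t ht)
    rw [Matrix.sub_apply] at h1
    refine abs_le_of_sq_le_sq (h1.trans (le_of_eq ?_)) (by positivity)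
    rw [← pow_mul, mul_comm, pow_mul]
    norm_num
  choose y hyc hy using hent
  exact ⟨fun t => Matrix.of fun i j => y i j t, continuous_matrix hyc, fun t i j => hy i j t⟩

end EulerConvergence

/-! ### Existence of the solution -/

section Solution

variable {n : ℕ} {Ω : Type u} {mΩ : MeasurableSpace Ω} {P : Measure Ω} {ℱ : Filtration ℝ≥0 mΩ}
  {B : ℝ≥0 → Ω → Mat n}

/-- The limit of the Euler schemes along the path `x`; its value at `t` depends only on `x` up to
`t`. The value of `limUnder` is meaningless where the schemes do not converge, which for the paths
of Brownian motion with drift is a null event (`IsBrownianMotionSL.exists_limit_euler`). -/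
noncomputable def eulerLimit (x : ℝ≥0 → Mat n) (t : ℝ≥0) : Mat n :=
  Matrix.of fun i j => limUnder atTop fun N => euler x N t i j

theorem measurable_eulerLimit {α : Type*} {m : MeasurableSpace α} {X : ℝ≥0 → α → Mat n} {t : ℝ≥0}
    (h : ∀ s ≤ t, Measurable (X s)) : Measurable fun ω => eulerLimit (fun s => X s ω) t :=
  measurable_mat_iff.2 fun i j => (StronglyMeasurable.limUnder fun _ =>
    (measurable_mat_iff.1 (measurable_euler h) i j).stronglyMeasurable).measurable

/-- The solution of the Itô equation, as the limit of the Euler schemes. -/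
noncomputable def eulerSolution (P : Measure Ω) (B : ℝ≥0 → Ω → Mat n) (t : ℝ≥0) (ω : Ω) : Mat n :=
  eulerLimit (drive P B ω) t

theorem adapted_eulerSolution (hB : Adapted ℱ B) : Adapted ℱ (eulerSolution P B) := fun _ =>
  measurable_eulerLimit (X := fun s ω => drive P B ω s) fun _ hs => measurable_drive hB hs

variable [IsProbabilityMeasure P]

theorem IsBrownianMotionSL.tendsto_euler (hB : IsBrownianMotionSL P ℱ B) : ∀ᵐ ω ∂P, ∀ t i j,
    Tendsto (fun N => euler (drive P B ω) N t i j) atTop (𝓝 (eulerSolution P B t ω i j)) := by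
  filter_upwards [hB.exists_limit_euler] with ω ⟨y, _, hy⟩ t i j
  have e : eulerSolution P B t ω i j = y t i j := (hy t i j).limUnder_eq
  rw [e]
  exact hy t i j

theorem IsBrownianMotionSL.continuous_eulerSolution (hB : IsBrownianMotionSL P ℱ B) :
    ∀ᵐ ω ∂P, Continuous fun t => eulerSolution P B t ω := by
  filter_upwards [hB.exists_limit_euler] with ω ⟨y, hyc, hy⟩
  have e : (fun t => eulerSolution P B t ω) = y := by
    ext t i j
    exact (hy t i j).limUnder_eq
  rwa [e]

theorem IsBrownianMotionSL.eulerSolution_zero (hB : IsBrownianMotionSL P ℱ B) :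
    ∀ᵐ ω ∂P, eulerSolution P B 0 ω = 1 := by
  filter_upwards [hB.tendsto_euler] with ω hω
  ext i j
  refine tendsto_nhds_unique (hω 0 i j) ?_
  simp only [euler_zero]
  exact tendsto_const_nhds

theorem sum_range_mul_add {M : Type*} [AddCommMonoid M] (f : ℕ → M) (s J : ℕ) :
    ∑ i ∈ Finset.range (s * J), f i =
      ∑ q ∈ Finset.range s, ∑ r ∈ Finset.range J, f (q * J + r) := by
  induction s with
  | zero => simp
  | succ s ih => rw [add_mul, one_mul, Finset.sum_range_add, ih, Finset.sum_range_succ]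

/-- The times `p q`, together with the dyadic times of level `N` between them; each interval
`[p q, p (q + 1)]` takes up `J` steps. -/
noncomputable def refineGrid (N J : ℕ) (p : ℕ → ℝ≥0) (i : ℕ) : ℝ≥0 :=
  clampGrid N (p (i / J)) (p (i / J + 1)) (i % J)

section RefineGrid

variable {N J : ℕ} {p : ℕ → ℝ≥0} {t : ℝ≥0}

theorem refineGrid_mul_add (hp : Monotone p) (hpt : ∀ k, p k ≤ t) (hJ : 0 < J) (hJt : t * 2 ^ N ≤ J)
    (q : ℕ) {r : ℕ} (hr : r ≤ J) :
    refineGrid N J p (q * J + r) = clampGrid N (p q) (p (q + 1)) r := by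
  rcases hr.lt_or_eq with h | rfl
  · have e1 : (q * J + r) / J = q := by
      rw [mul_comm, Nat.mul_add_div hJ, Nat.div_eq_of_lt h, add_zero]
    have e2 : (q * J + r) % J = r := by rw [mul_comm, Nat.mul_add_mod, Nat.mod_eq_of_lt h]
    rw [refineGrid, e1, e2]
  · have e0 : q * r + r = (q + 1) * r := by ring
    rw [e0, refineGrid, Nat.mul_div_cancel _ hJ, Nat.mul_mod_left,
      clampGrid_zero (hp (Nat.le_succ _)), clampGrid_end]
    exact (mul_le_mul_left (hpt _) _).trans hJt

theorem refineGrid_step (hp : Monotone p) (hpt : ∀ k, p k ≤ t) (hJ : 0 < J) (hJt : t * 2 ^ N ≤ J)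
    (i : ℕ) : refineGrid N J p i = clampGrid N (p (i / J)) (p (i / J + 1)) (i % J) ∧
      refineGrid N J p (i + 1) = clampGrid N (p (i / J)) (p (i / J + 1)) (i % J + 1) := by
  refine ⟨rfl, ?_⟩
  rw [← refineGrid_mul_add hp hpt hJ hJt (i / J) (Nat.mod_lt i hJ), Nat.succ_eq_add_one, ← add_assoc,
    Nat.div_add_mod']

end RefineGrid

/-- The left-point sums of an Euler scheme over a partition differ from the increments of the scheme
by a sum with small integrands over a common refinement of the partition and the grid. -/
theorem IsBrownianMotionSL.integral_nsq_itoSum_euler_sub_le (hB : IsBrownianMotionSL P ℱ B)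
    {t : ℝ≥0} (π : TimePartition t) (N : ℕ) :
    ∫ ω, nsq (itoSum P B π.pt (fun k ω => euler (drive P B ω) N (π.pt k)) π.size ω -
        (euler (drive P B ω) N t - 1)) ∂P ≤
      itoConst P B t * (t * (2 * (itoConst P B t * eulerBound P B t * (π.mesh + (1 / 2) ^ N)))) := by
  -- the points of the partition, continued by `t` beyond its size
  set p : ℕ → ℝ≥0 := fun k => min (π.pt k) t with hp
  have hpm : Monotone p := fun j k h => min_le_min_right _ (π.mono h)
  have hpt : ∀ k, p k ≤ t := fun k => min_le_right _ _
  have hpe : ∀ k ≤ π.size, p k = π.pt k := fun k hk => min_eq_left (π.pt_le hk)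
  set J := ⌈t * 2 ^ N⌉₊ + 1 with hJdef
  have hJ : 0 < J := Nat.succ_pos _
  have hJt : t * 2 ^ N ≤ (J : ℝ≥0) := (Nat.le_ceil _).trans (by simp [hJdef])
  set σ := refineGrid N J p with hσ
  have hstep := refineGrid_step (N := N) hpm hpt hJ hJt
  have hσm : Monotone σ := monotone_nat_of_le_succ fun i => by
    rw [hσ, (hstep i).1, (hstep i).2]
    exact clampGrid_mono _ _ _ (Nat.le_succ _)
  have hσ0 : σ 0 = 0 := by
    rw [hσ, (hstep 0).1, Nat.zero_mod, Nat.zero_div, clampGrid_zero (hpm (Nat.le_succ _)),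
      hpe 0 (Nat.zero_le _), π.pt_zero]
  have hσr : ∀ i, σ (i + 1) ≤ dyadicFloor N (σ i) + (1 / 2) ^ N := fun i => by
    rw [hσ, (hstep i).1, (hstep i).2]
    exact clampGrid_succ_le le_rfl _ _ _
  have hσle : ∀ i, σ i ≤ t := fun i => (clampGrid_le _ _ _ _).trans (hpt _)
  have hpσ : ∀ i, p (i / J) ≤ σ i := fun i => le_clampGrid (hpm (Nat.le_succ _)) _ _
  have hσend : σ (π.size * J) = t := by
    have := refineGrid_mul_add (N := N) hpm hpt hJ hJt π.size (Nat.zero_le J)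
    rw [add_zero] at this
    rw [hσ, this, clampGrid_zero (hpm (Nat.le_succ _)), hpe _ le_rfl, π.pt_size]
  -- the difference of the two integrands on the refined grid
  set H : ℕ → Ω → Mat n := fun i ω =>
    euler (drive P B ω) N (p (i / J)) - eulerStep (drive P B ω) N (σ i) with hH
  have hsum : ∀ ω, itoSum P B π.pt (fun k ω => euler (drive P B ω) N (π.pt k)) π.size ω -
      (euler (drive P B ω) N t - 1) = itoSum P B σ H (π.size * J) ω := by
    intro ω
    have e1 : euler (drive P B ω) N t - 1 =
        itoSum P B σ (fun i ω => eulerStep (drive P B ω) N (σ i)) (π.size * J) ω := by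
      rw [← euler_sub_one_eq_itoSum hσm hσ0 hσr, hσend]
    have e2 : itoSum P B π.pt (fun k ω => euler (drive P B ω) N (π.pt k)) π.size ω =
        itoSum P B σ (fun i ω => euler (drive P B ω) N (p (i / J))) (π.size * J) ω := by
      rw [itoSum, itoSum, sum_range_mul_add]
      refine Finset.sum_congr rfl fun q hq => ?_
      have hq' := Finset.mem_range.1 hq
      have e3 : ∀ r ∈ Finset.range J, euler (drive P B ω) N (p ((q * J + r) / J)) *
          driftIncr P B (σ (q * J + r)) (σ (q * J + r + 1)) ω =
          euler (drive P B ω) N (π.pt q) *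
            (drive P B ω (clampGrid N (p q) (p (q + 1)) (r + 1)) -
              drive P B ω (clampGrid N (p q) (p (q + 1)) r)) := by
        intro r hr
        have hr' := Finset.mem_range.1 hr
        have e1 : (q * J + r) / J = q := by
          rw [mul_comm, Nat.mul_add_div hJ, Nat.div_eq_of_lt hr', add_zero]
        rw [e1, hσ, refineGrid_mul_add hpm hpt hJ hJt q hr'.le, add_assoc,
          refineGrid_mul_add hpm hpt hJ hJt q hr', drive_sub_drive, hpe q hq'.le]
      rw [Finset.sum_congr rfl e3, ← Finset.mul_sum,
        Finset.sum_range_sub fun r => drive P B ω (clampGrid N (p q) (p (q + 1)) r),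
        clampGrid_zero (hpm (Nat.le_succ _)),
        clampGrid_end _ ((mul_le_mul_left (hpt _) _).trans hJt), drive_sub_drive, hpe q hq'.le,
        hpe (q + 1) hq']
    rw [e1, e2]
    simp only [itoSum, hH, sub_mul, Finset.sum_sub_distrib]
  simp only [hsum]
  have hκ : 0 ≤ itoConst P B t * eulerBound P B t :=
    mul_nonneg (itoConst_nonneg t.coe_nonneg) (eulerBound_nonneg t)
  have hHL : ∀ i a b, MemLp (fun ω => H i ω a b) 2 P := fun i =>
    hB.memLp_euler_sub_eulerStep N N _ _
  refine (hB.integral_nsq_itoSum_le hσm (H := H) (fun i => measurable_mat_sub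
    ((adapted_euler hB.adapted N _).mono (ℱ.mono (hpσ i)) le_rfl)
    (adapted_eulerStep hB.adapted N _)) hHL (T := t) ?_).trans ?_
  · rw [hσend, hσ0, NNReal.coe_zero, sub_zero]
  refine mul_le_mul_of_nonneg_left ?_ (itoConst_nonneg t.coe_nonneg)
  calc _ ≤ ∑ i ∈ Finset.range (π.size * J), ((σ (i + 1) : ℝ) - σ i) *
        (2 * (itoConst P B t * eulerBound P B t * (π.mesh + (1 / 2) ^ N))) := by
        refine Finset.sum_le_sum fun i hi => mul_le_mul_of_nonneg_left ?_
          (sub_nonneg.2 (hσm (Nat.le_succ i)))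
        have hi' : i / J < π.size := Nat.div_lt_of_lt_mul (by
          rw [mul_comm]; exact Finset.mem_range.1 hi)
        have i1 : Integrable (fun ω =>
            2 * nsq (euler (drive P B ω) N (σ i) - euler (drive P B ω) N (p (i / J)))) P :=
          (integrable_nsq (hB.memLp_euler_sub N N _ _)).const_mul 2
        have i2 : Integrable (fun ω =>
            2 * nsq (euler (drive P B ω) N (σ i) - eulerStep (drive P B ω) N (σ i))) P :=
          (integrable_nsq (hB.memLp_euler_sub_eulerStep N N _ _)).const_mul 2
        calc ∫ ω, nsq (H i ω) ∂P ≤ ∫ ω,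
              (2 * nsq (euler (drive P B ω) N (σ i) - euler (drive P B ω) N (p (i / J))) +
                2 * nsq (euler (drive P B ω) N (σ i) - eulerStep (drive P B ω) N (σ i))) ∂P := by
              refine integral_mono (integrable_nsq (hHL i)) (i1.add i2) fun ω => ?_
              have h1 := nsq_sub_le (euler (drive P B ω) N (σ i) - eulerStep (drive P B ω) N (σ i))
                (euler (drive P B ω) N (σ i) - euler (drive P B ω) N (p (i / J)))
              rw [sub_sub_sub_cancel_left] at h1
              simp only [hH]
              linarith
          _ ≤ _ := by
              rw [integral_add i1 i2, integral_const_mul, integral_const_mul]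
              have h1 := hB.integral_nsq_euler_sub_le N (hpσ i) (hσle i)
              have h2 := hB.integral_nsq_euler_sub_eulerStep_le N (hσle i)
              have h3 : (σ i : ℝ) - p (i / J) ≤ π.mesh := by
                have h4 : (σ i : ℝ) ≤ p (i / J + 1) := clampGrid_le _ _ _ _
                have h5 := π.coe_sub_le_mesh hi'
                rw [hpe _ hi'.le]
                rw [hpe _ hi'] at h4
                linarith
              nlinarith [mul_le_mul_of_nonneg_left h3 hκ]
    _ ≤ _ := by
        rw [← Finset.sum_mul]
        refine mul_le_mul_of_nonneg_right (sum_coe_sub_le hσle _) ?_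
        have : (0 : ℝ) ≤ π.mesh := π.mesh.2
        positivity

/-- The limit of the Euler schemes solves the Itô equation. -/
theorem IsBrownianMotionSL.solvesItoEquation_eulerSolution (hB : IsBrownianMotionSL P ℱ B) :
    SolvesItoEquation P B (eulerSolution P B) := by
  rw [solvesItoEquation_iff (adapted_eulerSolution hB.adapted) hB.continuous_eulerSolution]
  intro t i j
  set C : ℝ := itoConst P B t * (t * (2 * (itoConst P B t * eulerBound P B t))) with hC
  have hC0 : 0 ≤ C := by
    have h1 := itoConst_nonneg (P := P) (B := B) t.coe_nonneg
    have h2 := eulerBound_nonneg (P := P) (B := B) t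
    have h3 : (0 : ℝ) ≤ t := t.coe_nonneg
    positivity
  set S : TimePartition t → Ω → ℝ := fun π ω =>
    itoSum P B π.pt (fun k => eulerSolution P B (π.pt k)) π.size ω i j -
      (eulerSolution P B t ω i j - (1 : Mat n) i j) with hS
  -- let the level `N` of the scheme tend to infinity for a fixed partition, before the mesh tends
  -- to `0`
  have hbound : ∀ π : TimePartition t, MemLp (S π) 2 P ∧ ∫ ω, S π ω ^ 2 ∂P ≤ C * π.mesh := by
    intro π
    set SN : ℕ → Ω → Mat n := fun N ω =>
      itoSum P B π.pt (fun k ω => euler (drive P B ω) N (π.pt k)) π.size ω -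
        (euler (drive P B ω) N t - 1) with hSN
    have hSNL : ∀ N a b, MemLp (fun ω => SN N ω a b) 2 P := fun N a b =>
      (hB.memLp_itoSum π.mono (fun k => adapted_euler hB.adapted N _)
        (fun k => hB.memLp_euler N _) _ a b).sub ((hB.memLp_euler N t a b).sub (memLp_const _))
    have hconv : TendstoInMeasure P (fun N ω => SN N ω i j) atTop (S π) := by
      refine tendstoInMeasure_of_ae_tendsto (fun N => (hSNL N i j).aestronglyMeasurable) ?_
      filter_upwards [hB.tendsto_euler] with ω hω
      simp only [hSN, hS, Matrix.sub_apply, itoSum, Matrix.sum_apply, Matrix.mul_apply]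
      refine Tendsto.sub ?_ ((hω t i j).sub tendsto_const_nhds)
      exact tendsto_finsetSum _ fun k _ => tendsto_finsetSum _ fun l _ =>
        (hω _ i l).mul tendsto_const_nhds
    have hsmall : ∀ η : ℝ, 0 < η → MemLp (S π) 2 P ∧ ∫ ω, S π ω ^ 2 ∂P ≤ C * π.mesh + η := by
      intro η hη
      refine memLp_integral_sq_le_of_tendstoInMeasure hconv (fun N => hSNL N i j) ?_
      have hlim : Tendsto (fun N : ℕ => C * ((π.mesh : ℝ) + (1 / 2) ^ N)) atTop
          (𝓝 (C * (π.mesh + 0))) :=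
        (tendsto_const_nhds.add (tendsto_pow_atTop_nhds_zero_of_lt_one (by norm_num)
          (by norm_num))).const_mul C
      rw [add_zero] at hlim
      filter_upwards [hlim.eventually (gt_mem_nhds (lt_add_of_pos_right _ hη))] with N hN
      refine le_trans ?_ hN.le
      refine (integral_mono ((hSNL N i j).integrable_sq) (integrable_nsq (hSNL N))
        fun ω => sq_entry_le_nsq _ _ _).trans ?_
      refine (hB.integral_nsq_itoSum_euler_sub_le π N).trans (le_of_eq ?_)
      rw [hC]
      ring
    exact ⟨(hsmall 1 one_pos).1, le_of_forall_pos_le_add fun η hη => (hsmall η hη).2⟩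
  have hzero : TendstoInMeasure P S (TimePartition.meshToZero t) fun _ => 0 := by
    rw [tendstoInMeasure_real_iff]
    intro ε hε
    simp only [sub_zero]
    have hlim : Tendsto (fun π : TimePartition t => ENNReal.ofReal (C * π.mesh / ε ^ 2))
        (TimePartition.meshToZero t) (𝓝 0) := by
      have h2 : Tendsto (fun π : TimePartition t => (π.mesh : ℝ)) (TimePartition.meshToZero t)
          (𝓝 0) := NNReal.tendsto_coe.2 tendsto_comap
      have h3 := ENNReal.tendsto_ofReal ((h2.const_mul C).div_const (ε ^ 2))
      simpa using h3
    exact tendsto_of_tendsto_of_tendsto_of_le_of_le tendsto_const_nhds hlim (fun _ => zero_le)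
      fun π => measure_le_of_integral_sq_le (hbound π).1 (hbound π).2 hε
  have hfin := tendstoInMeasure_add hzero (tendstoInMeasure_const (P := P)
    (l := TimePartition.meshToZero t)
    fun ω => eulerSolution P B t ω i j - (1 : Mat n) i j)
  refine (hfin.congr_left fun π => Eventually.of_forall fun ω => ?_).congr_right ?_
  · simp only [hS]; ring
  · filter_upwards [hB.eulerSolution_zero] with ω hω
    rw [hω]; ring

/-- Existence of the solution. -/
theorem IsBrownianMotionSL.isStratonovichSolution_eulerSolution (hB : IsBrownianMotionSL P ℱ B) :
    IsStratonovichSolution P ℱ B (eulerSolution P B) :=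
  hB.solvesItoEquation_eulerSolution.isStratonovichSolution hB
    (adapted_eulerSolution hB.adapted) hB.continuous_eulerSolution hB.eulerSolution_zero

/-- Uniqueness of the solution, up to indistinguishability. -/
theorem IsStratonovichSolution.unique {F F' : ℝ≥0 → Ω → Mat n} (hB : IsBrownianMotionSL P ℱ B)
    (hF : IsStratonovichSolution P ℱ B F) (hF' : IsStratonovichSolution P ℱ B F') :
    ∀ᵐ ω ∂P, ∀ t, F t ω = F' t ω :=
  (hF.solvesIto hB).unique hB hF.adapted hF.continuous hF.init hF'.adapted hF'.continuous hF'.init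
    (hF'.solvesIto hB)

end Solution

/-! ### Mean square approximation of products -/

section MeanSquare

variable {Ω : Type*} {mΩ : MeasurableSpace Ω} {P : Measure Ω}

/-- The Cauchy–Schwarz inequality. -/
theorem sq_integral_mul_le {f g : Ω → ℝ} (hf : MemLp f 2 P) (hg : MemLp g 2 P) :
    (∫ ω, f ω * g ω ∂P) ^ 2 ≤ (∫ ω, f ω ^ 2 ∂P) * ∫ ω, g ω ^ 2 ∂P := by
  have key : ∀ x : ℝ, 0 ≤ (∫ ω, g ω ^ 2 ∂P) * (x * x) + (2 * ∫ ω, f ω * g ω ∂P) * x +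
      ∫ ω, f ω ^ 2 ∂P := by
    intro x
    have i1 : Integrable (fun ω => (x * x) * g ω ^ 2) P := hg.integrable_sq.const_mul _
    have i2 : Integrable (fun ω => (2 * x) * (f ω * g ω)) P := (hf.integrable_mul hg).const_mul _
    have i12 : Integrable (fun ω => (x * x) * g ω ^ 2 + (2 * x) * (f ω * g ω)) P := i1.add i2
    have h1 : ∫ ω, (f ω + x * g ω) ^ 2 ∂P =
        ∫ ω, ((x * x) * g ω ^ 2 + (2 * x) * (f ω * g ω) + f ω ^ 2) ∂P := by
      congr 1; ext ω; ring
    rw [integral_add i12 hf.integrable_sq, integral_add i1 i2, integral_const_mul,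
      integral_const_mul] at h1
    have h2 : 0 ≤ ∫ ω, (f ω + x * g ω) ^ 2 ∂P := integral_nonneg fun ω => sq_nonneg _
    linarith
  have := discrim_le_zero key
  rw [discrim] at this
  nlinarith

theorem tendsto_integral_mul_zero {a b : ℕ → Ω → ℝ} (ha : ∀ N, MemLp (a N) 2 P)
    (hb : ∀ N, MemLp (b N) 2 P) (h : Tendsto (fun N => ∫ ω, a N ω ^ 2 ∂P) atTop (𝓝 0)) {K : ℝ}
    (hK : ∀ᶠ N in atTop, ∫ ω, b N ω ^ 2 ∂P ≤ K) :
    Tendsto (fun N => ∫ ω, a N ω * b N ω ∂P) atTop (𝓝 0) := by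
  have h1 : Tendsto (fun N => (∫ ω, a N ω * b N ω ∂P) ^ 2) atTop (𝓝 0) := by
    refine tendsto_of_tendsto_of_tendsto_of_le_of_le' tendsto_const_nhds
      (by simpa using h.mul_const K) (Eventually.of_forall fun N => sq_nonneg _) ?_
    filter_upwards [hK] with N hN
    exact (sq_integral_mul_le (ha N) (hb N)).trans
      (mul_le_mul_of_nonneg_left hN (integral_nonneg fun ω => sq_nonneg _))
  have h2 := (Real.continuous_sqrt.tendsto 0).comp h1
  simp only [Real.sqrt_zero, Function.comp_def, Real.sqrt_sq_eq_abs] at h2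
  exact (tendsto_zero_iff_abs_tendsto_zero _).2 h2

/-- Mean square approximation of two factors entails approximation of the mean of the product. -/
theorem tendsto_integral_mul_sub {f f' g g' : ℕ → Ω → ℝ} (hf : ∀ N, MemLp (f N) 2 P)
    (hf' : ∀ N, MemLp (f' N) 2 P) (hg : ∀ N, MemLp (g N) 2 P) (hg' : ∀ N, MemLp (g' N) 2 P)
    (h1 : Tendsto (fun N => ∫ ω, (f N ω - f' N ω) ^ 2 ∂P) atTop (𝓝 0))
    (h2 : Tendsto (fun N => ∫ ω, (g N ω - g' N ω) ^ 2 ∂P) atTop (𝓝 0)) {K : ℝ}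
    (hf'K : ∀ N, ∫ ω, f' N ω ^ 2 ∂P ≤ K) (hg'K : ∀ N, ∫ ω, g' N ω ^ 2 ∂P ≤ K) :
    Tendsto (fun N => ∫ ω, f N ω * g N ω ∂P - ∫ ω, f' N ω * g' N ω ∂P) atTop (𝓝 0) := by
  have df : ∀ N, MemLp (fun ω => f N ω - f' N ω) 2 P := fun N => (hf N).sub (hf' N)
  have dg : ∀ N, MemLp (fun ω => g N ω - g' N ω) 2 P := fun N => (hg N).sub (hg' N)
  have e1 := tendsto_integral_mul_zero df dg h1 (K := 1)
    ((h2.eventually (gt_mem_nhds one_pos)).mono fun N hN => le_of_lt hN)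
  have e2 := tendsto_integral_mul_zero df hg' h1 (Eventually.of_forall hg'K)
  have e3 := tendsto_integral_mul_zero dg hf' h2 (Eventually.of_forall hf'K)
  have e := (e1.add e2).add e3
  simp only [add_zero] at e
  refine e.congr fun N => ?_
  have i1 : Integrable (fun ω => (f N ω - f' N ω) * (g N ω - g' N ω)) P :=
    (df N).integrable_mul (dg N)
  have i2 : Integrable (fun ω => (f N ω - f' N ω) * g' N ω) P := (df N).integrable_mul (hg' N)
  have i3 : Integrable (fun ω => (g N ω - g' N ω) * f' N ω) P := (dg N).integrable_mul (hf' N)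
  have i12 : Integrable (fun ω => (f N ω - f' N ω) * (g N ω - g' N ω) +
    (f N ω - f' N ω) * g' N ω) P := i1.add i2
  have i4 : Integrable (fun ω => f N ω * g N ω) P := (hf N).integrable_mul (hg N)
  have i5 : Integrable (fun ω => f' N ω * g' N ω) P := (hf' N).integrable_mul (hg' N)
  rw [← integral_add i1 i2, ← integral_add i12 i3, ← integral_sub i4 i5]
  congr 1; ext ω; ring

end MeanSquare

/-! ### Conjugation by orthogonal matrices -/

section Conjugation

variable {n : ℕ} {Ω : Type u} {mΩ : MeasurableSpace Ω} {P : Measure Ω} {ℱ : Filtration ℝ≥0 mΩ}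
  {B : ℝ≥0 → Ω → Mat n}

/-- The linear map `A ↦ O A O'`. -/
noncomputable def conjCLM (O O' : Mat n) : Mat n →L[ℝ] Mat n where
  toFun A := O * A * O'
  map_add' A C := by rw [mul_add, add_mul]
  map_smul' c A := by simp
  cont := (continuous_const.matrix_mul continuous_id).matrix_mul continuous_const

theorem conj_apply (O A O' : Mat n) (i j : Fin n) :
    (O * A * O') i j = ∑ p, ∑ q, O i p * O' q j * A p q := by
  simp only [Matrix.mul_apply, Finset.sum_mul]
  rw [Finset.sum_comm]
  exact Finset.sum_congr rfl fun p _ => Finset.sum_congr rfl fun q _ => by ring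

theorem measurable_conj (O O' : Mat n) : Measurable fun A : Mat n => O * A * O' :=
  measurable_mat_mul (measurable_mat_mul measurable_const measurable_id) measurable_const

/-- Conjugates of a Brownian motion on `𝔰𝔩(n)` are Brownian motions. -/
theorem IsBrownianMotionSL.conj (hB : IsBrownianMotionSL P ℱ B) {O O' : Mat n} (h : O * O' = 1) :
    IsBrownianMotionSL P ℱ fun t ω => O * B t ω * O' where
  adapted t := (measurable_conj O O').comp (hB.adapted t)
  mem_sl := by
    filter_upwards [hB.mem_sl] with ω hω t
    have h1 := hω t
    change (B t ω).trace = 0 at h1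
    change (O * B t ω * O').trace = 0
    rw [Matrix.trace_mul_comm, ← mul_assoc, mul_eq_one_comm.1 h, one_mul, h1]
  continuous := by
    filter_upwards [hB.continuous] with ω hω
    exact (continuous_const.matrix_mul hω).matrix_mul continuous_const
  zero := by
    filter_upwards [hB.zero] with ω hω
    simp [hω]
  indep s r := by
    refine indep_of_indep_of_le_left (hB.indep s r) ?_
    have e : (fun ω => O * B (s + r) ω * O' - O * B s ω * O') =
        (fun A : Mat n => O * A * O') ∘ fun ω => B (s + r) ω - B s ω := by
      ext1 ω
      simp only [Function.comp_apply, mul_sub, sub_mul]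
    rw [e, ← MeasurableSpace.comap_comp]
    exact MeasurableSpace.comap_mono (measurable_conj O O').comap_le
  stationary s r := by
    have := (hB.stationary s r).comp (measurable_conj O O')
    have e : (fun ω => O * B (s + r) ω * O' - O * B s ω * O') =
        (fun A : Mat n => O * A * O') ∘ fun ω => B (s + r) ω - B s ω := by
      ext1 ω
      simp only [Function.comp_apply, mul_sub, sub_mul]
    rw [e]
    exact this
  gaussian t := (hB.gaussian t).map_of_measurable (conjCLM O O') (measurable_conj O O')
  centered t i j := by
    simp only [conj_apply]
    have hi : ∀ p q, Integrable (fun ω => O i p * O' q j * B t ω p q) P := fun p q =>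
      (memLp_one_iff_integrable.1 (hB.memLp_entry t p q (by simp))).const_mul _
    rw [integral_finsetSum _ fun p _ => integrable_finsetSum _ fun q _ => hi p q]
    refine Finset.sum_eq_zero fun p _ => ?_
    rw [integral_finsetSum _ fun q _ => hi p q]
    refine Finset.sum_eq_zero fun q _ => ?_
    rw [integral_const_mul, hB.centered, mul_zero]

/-- Second moments of the entries of a conjugated matrix. -/
theorem integral_conj_mul {A : Ω → Mat n} (hA : ∀ i j, MemLp (fun ω => A ω i j) 2 P) (O O' : Mat n)
    (i j k l : Fin n) : ∫ ω, (O * A ω * O') i j * (O * A ω * O') k l ∂P =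
      ∑ p, ∑ q, ∑ r, ∑ s, (O i p * O' q j * (O k r * O' s l)) * ∫ ω, A ω p q * A ω r s ∂P := by
  have hi : ∀ p q r s, Integrable
      (fun ω => (O i p * O' q j * (O k r * O' s l)) * (A ω p q * A ω r s)) P := fun p q r s =>
    ((hA p q).integrable_mul (hA r s)).const_mul _
  have e : ∀ ω, (O * A ω * O') i j * (O * A ω * O') k l =
      ∑ p, ∑ q, ∑ r, ∑ s, (O i p * O' q j * (O k r * O' s l)) * (A ω p q * A ω r s) := fun ω => by
    rw [conj_apply, conj_apply, Finset.sum_mul]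
    refine Finset.sum_congr rfl fun p _ => ?_
    rw [Finset.sum_mul]
    refine Finset.sum_congr rfl fun q _ => ?_
    rw [Finset.mul_sum]
    refine Finset.sum_congr rfl fun r _ => ?_
    rw [Finset.mul_sum]
    exact Finset.sum_congr rfl fun s _ => by ring
  simp only [e]
  rw [integral_finsetSum _ fun p _ => integrable_finsetSum _ fun q _ =>
    integrable_finsetSum _ fun r _ => integrable_finsetSum _ fun s _ => hi p q r s]
  refine Finset.sum_congr rfl fun p _ => ?_
  rw [integral_finsetSum _ fun q _ =>
    integrable_finsetSum _ fun r _ => integrable_finsetSum _ fun s _ => hi p q r s]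
  refine Finset.sum_congr rfl fun q _ => ?_
  rw [integral_finsetSum _ fun r _ => integrable_finsetSum _ fun s _ => hi p q r s]
  refine Finset.sum_congr rfl fun r _ => ?_
  rw [integral_finsetSum _ fun s _ => hi p q r s]
  exact Finset.sum_congr rfl fun s _ => integral_const_mul _ _

/-- A 4-tensor is invariant if it is fixed by the orthogonal group acting on all four indices. -/
def IsInvariantTensor (C : Fin n → Fin n → Fin n → Fin n → ℝ) : Prop :=
  ∀ O : Mat n, O * O.transpose = 1 → ∀ i j k l,
    ∑ p, ∑ q, ∑ r, ∑ s, (O i p * O j q * (O k r * O l s)) * C p q r s = C i j k l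

theorem IsBrownianMotionSL.covTensor_conj (hB : IsBrownianMotionSL P ℱ B)
    (hC : IsInvariantTensor (covTensor P B)) {O : Mat n} (h : O * O.transpose = 1)
    (i j k l : Fin n) :
    covTensor P (fun t ω => O * B t ω * O.transpose) i j k l = covTensor P B i j k l := by
  rw [← hC O h i j k l, covTensor,
    integral_conj_mul (fun i j => hB.memLp_entry 1 i j (by simp)) O O.transpose]
  rfl

end Conjugation

/-! ### Equations without Itô correction -/

section Driftless

variable {n : ℕ} {Ω : Type u} {mΩ : MeasurableSpace Ω} {P : Measure Ω} {ℱ : Filtration ℝ≥0 mΩ}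
  {B F : ℝ≥0 → Ω → Mat n}

theorem itoDrift_eq_zero (h : quadDrift P B = 0) : itoDrift P B = 0 := by
  rw [itoDrift, h, smul_zero]

theorem drive_eq (h : quadDrift P B = 0) (ω : Ω) : drive P B ω = fun t => B t ω := by
  ext1 t
  rw [drive, itoDrift_eq_zero h, smul_zero, add_zero]

variable [IsProbabilityMeasure P]

/-- Without drift, the Itô equation says that the Itô integral of `F` is `F - F₀`, which is the
Stratonovich integral. -/
theorem IsStratonovichSolution.itoEqStratonovich (hB : IsBrownianMotionSL P ℱ B)
    (hF : IsStratonovichSolution P ℱ B F) (h : quadDrift P B = 0) : ItoEqStratonovich P F B := by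
  refine ⟨_, hF.equation, fun t i j => (hF.solvesIto hB t i j).congr_right
    (Eventually.of_forall fun ω => ?_)⟩
  simp only [itoDrift_eq_zero h, mul_zero, sub_zero]

/-- If the Itô and Stratonovich integrals coincide, then the covariation `∫ F c ds` vanishes, and
differentiating it at time `0` gives `c = 0`. -/
theorem IsStratonovichSolution.quadDrift_eq_zero (hB : IsBrownianMotionSL P ℱ B)
    (hF : IsStratonovichSolution P ℱ B F) (h : ItoEqStratonovich P F B) : quadDrift P B = 0 := by
  obtain ⟨I, hS, hI⟩ := h
  have hcov := (hF.solvesIto hB).covSum hB hF.adapted hF.continuous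
  have hzero : ∀ t i j, ∀ᵐ ω ∂P, (timeIntegral F t ω * quadDrift P B) i j = 0 := by
    intro t i j
    -- the covariation sums are twice the difference of the symmetric and the left-point sums
    have h1 : TendstoInMeasure P (fun (π : TimePartition t) ω => π.covSum F B ω i j)
        (TimePartition.meshToZero t) fun _ => 0 := by
      refine ((tendstoInMeasure_const_mul 2 (tendstoInMeasure_sub (hS.tendsto t i j)
        (hI t i j))).congr_left fun π => Eventually.of_forall fun ω => ?_).congr_right
        (Eventually.of_forall fun ω => ?_)
      · simp only [TimePartition.symmSum_eq, Matrix.add_apply, Matrix.smul_apply, smul_eq_mul]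
        ring
      · simp only [sub_self, mul_zero]
    exact tendstoInMeasure_ae_unique (hcov t i j) h1
  have hseq : ∀ᵐ ω ∂P, ∀ (m : ℕ) (i j : Fin n),
      (timeIntegral F (1 / ((m : ℝ≥0) + 1)) ω * quadDrift P B) i j = 0 :=
    ae_all_iff.2 fun m => ae_all_iff.2 fun i => ae_all_iff.2 fun j => hzero _ i j
  obtain ⟨ω, hω, hcω, h0⟩ := (hseq.and (hF.continuous.and hF.init)).exists
  ext i j
  set g : ℝ → ℝ := fun s => (F s.toNNReal ω * quadDrift P B) i j with hg
  have hgc : Continuous g :=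
    ((hcω.comp continuous_real_toNNReal).matrix_mul continuous_const).matrix_elem i j
  have hd : HasDerivAt (fun x => ∫ s in (0 : ℝ)..x, g s) (g 0) 0 :=
    intervalIntegral.integral_hasDerivAt_right (hgc.intervalIntegrable _ _)
      (hgc.stronglyMeasurableAtFilter _ _) hgc.continuousAt
  have hg0 : g 0 = quadDrift P B i j := by
    simp only [hg, Real.toNNReal_zero, h0, one_mul]
  rw [hasDerivAt_iff_tendsto_slope_zero] at hd
  have hlim : Tendsto (fun m : ℕ => 1 / ((m : ℝ) + 1)) atTop (𝓝[≠] 0) :=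
    tendsto_nhdsWithin_iff.2 ⟨tendsto_one_div_add_atTop_nhds_zero_nat,
      Eventually.of_forall fun m => (by positivity : (1 : ℝ) / (m + 1) ≠ 0)⟩
  have hd2 := hd.comp hlim
  rw [Matrix.zero_apply, ← hg0]
  refine tendsto_nhds_unique hd2 (tendsto_const_nhds.congr fun m => ?_)
  have h1 := hω m i j
  rw [timeIntegral_mul_apply hcω] at h1
  have e : ((1 / ((m : ℝ≥0) + 1) : ℝ≥0) : ℝ) = 1 / ((m : ℝ) + 1) := by push_cast; rfl
  rw [e] at h1
  simp only [Function.comp_apply, zero_add, intervalIntegral.integral_same, sub_zero, hg, h1,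
    smul_zero]

/-- The solution of a driftless equation inherits the orthogonal invariance of the law of the
driving process, being an equivariant functional of it. -/
theorem IsStratonovichSolution.isOrthogonallyInvariant (hB : IsBrownianMotionSL P ℱ B)
    (hF : IsStratonovichSolution P ℱ B F) (h : quadDrift P B = 0)
    (hC : IsInvariantTensor (covTensor P B)) : IsOrthogonallyInvariant P F := by
  intro O
  have hO : (O : Mat n) * (O : Mat n).transpose = 1 := by
    have := (Matrix.mem_orthogonalGroup_iff (Fin n) ℝ).1 O.2
    simpa [Matrix.star_eq_conjTranspose] using this
  have hOinv : ((O⁻¹ : Matrix.orthogonalGroup (Fin n) ℝ) : Mat n) = (O : Mat n).transpose := rfl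
  rw [hOinv]
  -- the solution as a measurable functional of the driving path
  set Ψ : (ℝ≥0 → Mat n) → ℝ≥0 → Mat n := fun x t => eulerLimit x t with hΨ
  have hΨm : Measurable Ψ := measurable_pi_iff.2 fun t =>
    measurable_eulerLimit (X := fun s (x : ℝ≥0 → Mat n) => x s) fun s _ => measurable_pi_apply s
  have hFΨ : ∀ᵐ ω ∂P, ∀ t, F t ω = Ψ (fun s => B s ω) t := by
    filter_upwards [hF.unique hB hB.isStratonovichSolution_eulerSolution] with ω hω t
    rw [hω t, eulerSolution, drive_eq h]
  -- conjugation of the driving path conjugates the solution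
  have hconj : ∀ᵐ ω ∂P, ∀ t, (O : Mat n) * F t ω * (O : Mat n).transpose =
      Ψ (fun s => (O : Mat n) * B s ω * (O : Mat n).transpose) t := by
    filter_upwards [hFΨ, hB.tendsto_euler] with ω hω hlim t
    ext i j
    simp only [hΨ, eulerLimit, Matrix.of_apply, euler_conj hO]
    refine (Tendsto.limUnder_eq ?_).symm
    simp only [conj_apply]
    refine tendsto_finsetSum _ fun p _ => tendsto_finsetSum _ fun q _ => ?_
    have h1 := hlim t p q
    rw [eulerSolution, drive_eq h] at h1
    rw [hω t]
    exact h1.const_mul _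
  have hBm := measurable_process hB.adapted
  have hBm' := measurable_process (hB.conj hO).adapted
  have hlaw : IdentDistrib (fun ω t => (O : Mat n) * B t ω * (O : Mat n).transpose)
      (fun ω t => B t ω) P P :=
    ⟨hBm'.aemeasurable, hBm.aemeasurable,
      (hB.conj hO).processLaw_eq hB (hB.covTensor_conj hC hO)⟩
  have h1 := hlaw.comp hΨm
  have ae1 : (Ψ ∘ fun ω t => (O : Mat n) * B t ω * (O : Mat n).transpose) =ᵐ[P]
      fun ω t => (O : Mat n) * F t ω * (O : Mat n).transpose := by
    filter_upwards [hconj] with ω hω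
    exact (funext hω).symm
  have ae2 : (Ψ ∘ fun ω t => B t ω) =ᵐ[P] fun ω t => F t ω := by
    filter_upwards [hFΨ] with ω hω
    exact (funext hω).symm
  refine ⟨h1.aemeasurable_fst.congr ae1, h1.aemeasurable_snd.congr ae2, ?_⟩
  rw [← Measure.map_congr ae1, ← Measure.map_congr ae2, h1.map_eq]

end Driftless

/-! ### Second moments of the solution -/

section SolutionMoments

variable {n : ℕ} {Ω : Type u} {mΩ : MeasurableSpace Ω} {P : Measure Ω} {ℱ : Filtration ℝ≥0 mΩ}
  {B : ℝ≥0 → Ω → Mat n}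

/-- Integration of a function of an increment against the past. -/
theorem IsBrownianMotionSL.integral_mul_incr (hB : IsBrownianMotionSL P ℱ B) {s t : ℝ≥0}
    (hst : s ≤ t) {G : Ω → ℝ} (hG : Measurable[ℱ s] G) (hGi : Integrable G P) {φ : Mat n → ℝ}
    (hφ : Measurable φ) (hφi : Integrable (fun ω => φ (B t ω - B s ω)) P) :
    Integrable (fun ω => G ω * φ (B t ω - B s ω)) P ∧
      ∫ ω, G ω * φ (B t ω - B s ω) ∂P = (∫ ω, G ω ∂P) * ∫ ω, φ (B t ω - B s ω) ∂P := by
  have hi := indepFun_of_indep_of_measurable (hB.indep_incr hst hφ) hG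
  exact ⟨hi.integrable_mul hGi hφi, hi.integral_fun_mul_eq_mul_integral hGi.aestronglyMeasurable
    hφi.aestronglyMeasurable⟩

theorem IsBrownianMotionSL.integral_mul_incr_entry (hB : IsBrownianMotionSL P ℱ B) {s t : ℝ≥0}
    (hst : s ≤ t) {G : Ω → ℝ} (hG : Measurable[ℱ s] G) (hGi : Integrable G P) (p q : Fin n) :
    Integrable (fun ω => G ω * (B t ω p q - B s ω p q)) P ∧
      ∫ ω, G ω * (B t ω p q - B s ω p q) ∂P = 0 := by
  have hi : Integrable (fun ω => B t ω p q - B s ω p q) P :=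
    memLp_one_iff_integrable.1 (hB.memLp_incr s t p q (by simp))
  have h := hB.integral_mul_incr hst hG hGi (φ := fun A => A p q) (measurable_entry p q) hi
  simp only [Matrix.sub_apply] at h
  rwa [hB.integral_incr_entry hst, mul_zero] at h

variable [IsProbabilityMeasure P]

theorem IsBrownianMotionSL.integral_sq_eulerSolution_sub_le (hB : IsBrownianMotionSL P ℱ B) (N : ℕ)
    (t : ℝ≥0) (i j : Fin n) :
    MemLp (fun ω => eulerSolution P B t ω i j - euler (drive P B ω) N t i j) 2 P ∧
      ∫ ω, (eulerSolution P B t ω i j - euler (drive P B ω) N t i j) ^ 2 ∂P ≤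
        eulerError P B t * (1 / 2) ^ N := by
  have hL : ∀ M, MemLp (fun ω => euler (drive P B ω) M t i j - euler (drive P B ω) N t i j) 2 P :=
    fun M => hB.memLp_euler_sub M N t t i j
  have hconv : TendstoInMeasure P
      (fun M ω => euler (drive P B ω) M t i j - euler (drive P B ω) N t i j) atTop
      fun ω => eulerSolution P B t ω i j - euler (drive P B ω) N t i j := by
    refine tendstoInMeasure_of_ae_tendsto (fun M => (hL M).aestronglyMeasurable) ?_
    filter_upwards [hB.tendsto_euler] with ω hω
    exact (hω t i j).sub tendsto_const_nhds
  refine memLp_integral_sq_le_of_tendstoInMeasure hconv hL ?_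
  filter_upwards [eventually_ge_atTop N] with M hM
  exact (integral_mono (hL M).integrable_sq (integrable_nsq (hB.memLp_euler_sub M N t t))
    fun ω => sq_entry_le_nsq (euler (drive P B ω) M t - euler (drive P B ω) N t) i j).trans
      (hB.integral_nsq_euler_sub_euler_le hM le_rfl)

theorem IsBrownianMotionSL.memLp_eulerSolution (hB : IsBrownianMotionSL P ℱ B) (t : ℝ≥0)
    (i j : Fin n) : MemLp (fun ω => eulerSolution P B t ω i j) 2 P := by
  have := (hB.integral_sq_eulerSolution_sub_le 0 t i j).1.add (hB.memLp_euler 0 t i j)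
  refine (memLp_congr_ae (Eventually.of_forall fun ω => ?_)).1 this
  simp

theorem IsBrownianMotionSL.tendsto_integral_sq_euler_sub (hB : IsBrownianMotionSL P ℱ B) (t : ℝ≥0)
    (i j : Fin n) : Tendsto (fun N => ∫ ω,
      (euler (drive P B ω) N t i j - eulerSolution P B t ω i j) ^ 2 ∂P) atTop (𝓝 0) := by
  have hlim : Tendsto (fun N : ℕ => eulerError P B t * (1 / 2) ^ N) atTop (𝓝 0) := by
    simpa using (tendsto_pow_atTop_nhds_zero_of_lt_one (r := (1 / 2 : ℝ)) (by norm_num)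
      (by norm_num)).const_mul (eulerError P B t)
  refine tendsto_of_tendsto_of_tendsto_of_le_of_le tendsto_const_nhds hlim
    (fun N => integral_nonneg fun ω => sq_nonneg _) fun N => ?_
  refine le_trans (le_of_eq ?_) (hB.integral_sq_eulerSolution_sub_le N t i j).2
  congr 1; ext ω; ring

theorem IsBrownianMotionSL.tendsto_integral_euler_mul (hB : IsBrownianMotionSL P ℱ B) (t : ℝ≥0)
    (i j k l : Fin n) : Tendsto (fun N => ∫ ω,
      euler (drive P B ω) N t i j * euler (drive P B ω) N t k l ∂P) atTop
      (𝓝 (∫ ω, eulerSolution P B t ω i j * eulerSolution P B t ω k l ∂P)) := by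
  have h := tendsto_integral_mul_sub (fun N => hB.memLp_euler N t i j)
    (fun _ => hB.memLp_eulerSolution t i j) (fun N => hB.memLp_euler N t k l)
    (fun _ => hB.memLp_eulerSolution t k l) (hB.tendsto_integral_sq_euler_sub t i j)
    (hB.tendsto_integral_sq_euler_sub t k l) (fun _ => le_max_left _ _) fun _ => le_max_right _ _
  simpa using h.add_const (∫ ω, eulerSolution P B t ω i j * eulerSolution P B t ω k l ∂P)

theorem IsBrownianMotionSL.tendsto_integral_euler (hB : IsBrownianMotionSL P ℱ B) (t : ℝ≥0)
    (i j : Fin n) : Tendsto (fun N => ∫ ω, euler (drive P B ω) N t i j ∂P) atTop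
      (𝓝 (∫ ω, eulerSolution P B t ω i j ∂P)) := by
  have h := tendsto_integral_mul_sub (g := fun _ _ => 1) (g' := fun _ _ => 1)
    (fun N => hB.memLp_euler N t i j)
    (fun _ => hB.memLp_eulerSolution t i j) (fun N => memLp_const 1) (fun _ => memLp_const 1)
    (hB.tendsto_integral_sq_euler_sub t i j) (by simp) (fun _ => le_max_left _ _)
    fun _ => le_max_right _ _
  simpa using h.add_const (∫ ω, eulerSolution P B t ω i j ∂P)

theorem IsBrownianMotionSL.integral_mul_incr_mul (hB : IsBrownianMotionSL P ℱ B) {s t : ℝ≥0}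
    (hst : s ≤ t) {G : Ω → ℝ} (hG : Measurable[ℱ s] G) (hGi : Integrable G P) (p q p' q' : Fin n) :
    Integrable (fun ω => G ω * ((B t ω p q - B s ω p q) * (B t ω p' q' - B s ω p' q'))) P ∧
      ∫ ω, G ω * ((B t ω p q - B s ω p q) * (B t ω p' q' - B s ω p' q')) ∂P =
        (∫ ω, G ω ∂P) * (((t : ℝ) - s) * covTensor P B p q p' q') := by
  have hi : Integrable
      (fun ω => (B t ω p q - B s ω p q) * (B t ω p' q' - B s ω p' q')) P :=
    (hB.memLp_incr s t p q (p := 2) (by simp)).integrable_mul (hB.memLp_incr s t p' q' (p := 2) (by simp))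
  have h := hB.integral_mul_incr hst hG hGi (φ := fun A => A p q * A p' q')
    ((measurable_entry p q).mul (measurable_entry p' q')) hi
  simp only [Matrix.sub_apply] at h
  rwa [hB.integral_incr_mul hst] at h

/-- One step of a driftless Euler scheme preserves the mean. -/
theorem IsBrownianMotionSL.integral_mul_one_add (hB : IsBrownianMotionSL P ℱ B) {s t : ℝ≥0}
    (hst : s ≤ t) {G : Ω → Mat n} (hG : Measurable[ℱ s] G)
    (hL : ∀ i j, MemLp (fun ω => G ω i j) 2 P) (i j : Fin n) :
    ∫ ω, (G ω * (1 + (B t ω - B s ω))) i j ∂P = ∫ ω, G ω i j ∂P := by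
  have hGi : ∀ p, Integrable (fun ω => G ω i p) P := fun p => (hL i p).integrable one_le_two
  have h := fun p => hB.integral_mul_incr_entry hst (G := fun ω => G ω i p)
    ((measurable_entry i p).comp hG) (hGi p) p j
  have e : ∀ ω, (G ω * (1 + (B t ω - B s ω))) i j =
      G ω i j + ∑ p, G ω i p * (B t ω p j - B s ω p j) := fun ω => by
    rw [mul_add, mul_one, Matrix.add_apply, Matrix.mul_apply]
    rfl
  simp only [e]
  rw [integral_add (hGi j) (integrable_finsetSum _ fun p _ => (h p).1),
    integral_finsetSum _ fun p _ => (h p).1, Finset.sum_eq_zero fun p _ => (h p).2, add_zero]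

/-- One step of a driftless Euler scheme multiplies the second moment matrix by `1 + (t - s)`, if
`𝔼 B₁ B₁* = 1`. -/
theorem IsBrownianMotionSL.integral_gram_mul_one_add (hB : IsBrownianMotionSL P ℱ B)
    (hD : ∀ p q, ∑ a, covTensor P B p a q a = (1 : Mat n) p q) {s t : ℝ≥0}
    (hst : s ≤ t) {G : Ω → Mat n} (hG : Measurable[ℱ s] G)
    (hL : ∀ i j, MemLp (fun ω => G ω i j) 2 P) (i j : Fin n) :
    ∫ ω, (G ω * (1 + (B t ω - B s ω)) * (G ω * (1 + (B t ω - B s ω))).transpose) i j ∂P =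
      (1 + ((t : ℝ) - s)) * ∫ ω, (G ω * (G ω).transpose) i j ∂P := by
  have hGm : ∀ i p, Measurable[ℱ s] fun ω => G ω i p := fun i p => (measurable_entry i p).comp hG
  have hGG : ∀ p q, Integrable (fun ω => G ω i p * G ω j q) P := fun p q =>
    (hL i p).integrable_mul (hL j q)
  have h1 := fun p q a => hB.integral_mul_incr_entry hst (G := fun ω => G ω i p * G ω j q)
    ((hGm i p).mul (hGm j q)) (hGG p q) q a
  have h2 := fun p q a => hB.integral_mul_incr_entry hst (G := fun ω => G ω i p * G ω j q)
    ((hGm i p).mul (hGm j q)) (hGG p q) p a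
  have h3 := fun p q a => hB.integral_mul_incr_mul hst (G := fun ω => G ω i p * G ω j q)
    ((hGm i p).mul (hGm j q)) (hGG p q) p a q a
  have e : ∀ ω, (G ω * (1 + (B t ω - B s ω)) * (G ω * (1 + (B t ω - B s ω))).transpose) i j =
      ∑ a, (G ω i a * G ω j a + ∑ q, G ω i a * G ω j q * (B t ω q a - B s ω q a) +
        ∑ p, G ω i p * G ω j a * (B t ω p a - B s ω p a) +
        ∑ p, ∑ q, G ω i p * G ω j q *
          ((B t ω p a - B s ω p a) * (B t ω q a - B s ω q a))) := fun ω => by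
    rw [Matrix.mul_apply]
    refine Finset.sum_congr rfl fun a _ => ?_
    have e1 : ∀ i, (G ω * (1 + (B t ω - B s ω))) i a =
        G ω i a + ∑ p, G ω i p * (B t ω p a - B s ω p a) := fun i => by
      rw [mul_add, mul_one, Matrix.add_apply, Matrix.mul_apply]
      rfl
    rw [Matrix.transpose_apply, e1, e1, mul_add, add_mul, add_mul, Finset.mul_sum, Finset.sum_mul,
      Finset.sum_mul_sum, ← add_assoc]
    congr 1
    · rw [add_assoc, add_assoc, add_comm (Finset.sum _ _)]
      congr 2
      · exact Finset.sum_congr rfl fun q _ => by ring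
      · exact Finset.sum_congr rfl fun q _ => by ring
    · exact Finset.sum_congr rfl fun p _ => Finset.sum_congr rfl fun q _ => by ring
  have I1 : ∀ a, Integrable (fun ω => ∑ q, G ω i a * G ω j q * (B t ω q a - B s ω q a)) P :=
    fun a => integrable_finsetSum _ fun q _ => (h1 a q a).1
  have I2 : ∀ a, Integrable (fun ω => ∑ p, G ω i p * G ω j a * (B t ω p a - B s ω p a)) P :=
    fun a => integrable_finsetSum _ fun p _ => (h2 p a a).1
  have I3 : ∀ a, Integrable (fun ω => ∑ p, ∑ q, G ω i p * G ω j q *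
      ((B t ω p a - B s ω p a) * (B t ω q a - B s ω q a))) P := fun a =>
    integrable_finsetSum _ fun p _ => integrable_finsetSum _ fun q _ => (h3 p q a).1
  have I01 : ∀ a, Integrable (fun ω => G ω i a * G ω j a +
      ∑ q, G ω i a * G ω j q * (B t ω q a - B s ω q a)) P := fun a => (hGG a a).add (I1 a)
  have I012 : ∀ a, Integrable (fun ω => G ω i a * G ω j a +
      ∑ q, G ω i a * G ω j q * (B t ω q a - B s ω q a) +
      ∑ p, G ω i p * G ω j a * (B t ω p a - B s ω p a)) P := fun a => (I01 a).add (I2 a)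
  have I0123 : ∀ a, Integrable (fun ω => G ω i a * G ω j a +
      ∑ q, G ω i a * G ω j q * (B t ω q a - B s ω q a) +
      ∑ p, G ω i p * G ω j a * (B t ω p a - B s ω p a) +
      ∑ p, ∑ q, G ω i p * G ω j q *
        ((B t ω p a - B s ω p a) * (B t ω q a - B s ω q a))) P := fun a => (I012 a).add (I3 a)
  have hgram : ∫ ω, (G ω * (G ω).transpose) i j ∂P = ∑ a, ∫ ω, G ω i a * G ω j a ∂P := by
    simp only [Matrix.mul_apply, Matrix.transpose_apply]
    exact integral_finsetSum _ fun a _ => hGG a a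
  simp only [e]
  rw [integral_finsetSum _ fun a _ => I0123 a, hgram]
  have hterm : ∀ a, ∫ ω, (G ω i a * G ω j a +
      ∑ q, G ω i a * G ω j q * (B t ω q a - B s ω q a) +
      ∑ p, G ω i p * G ω j a * (B t ω p a - B s ω p a) +
      ∑ p, ∑ q, G ω i p * G ω j q *
        ((B t ω p a - B s ω p a) * (B t ω q a - B s ω q a))) ∂P =
      ∫ ω, G ω i a * G ω j a ∂P + ∑ p, ∑ q, (∫ ω, G ω i p * G ω j q ∂P) *
        (((t : ℝ) - s) * covTensor P B p a q a) := fun a => by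
    rw [integral_add (I012 a) (I3 a), integral_add (I01 a) (I2 a), integral_add (hGG a a) (I1 a),
      integral_finsetSum _ fun q _ => (h1 a q a).1, integral_finsetSum _ fun p _ => (h2 p a a).1,
      Finset.sum_eq_zero fun q _ => (h1 a q a).2, Finset.sum_eq_zero fun p _ => (h2 p a a).2,
      add_zero, add_zero, integral_finsetSum _ fun p _ =>
        integrable_finsetSum _ fun q _ => (h3 p q a).1]
    congr 1
    refine Finset.sum_congr rfl fun p _ => ?_
    rw [integral_finsetSum _ fun q _ => (h3 p q a).1]
    exact Finset.sum_congr rfl fun q _ => (h3 p q a).2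
  rw [Finset.sum_congr rfl fun a _ => hterm a, Finset.sum_add_distrib, add_mul, one_mul]
  congr 1
  rw [Finset.sum_comm, Finset.mul_sum]
  refine Finset.sum_congr rfl fun p _ => ?_
  rw [Finset.sum_comm]
  have h4 : ∀ q, ∑ a, (∫ ω, G ω i p * G ω j q ∂P) * (((t : ℝ) - s) * covTensor P B p a q a) =
      (∫ ω, G ω i p * G ω j q ∂P) * (((t : ℝ) - s) * (1 : Mat n) p q) := fun q => by
    rw [← hD p q, Finset.mul_sum, Finset.mul_sum]
  rw [Finset.sum_congr rfl fun q _ => h4 q, Finset.sum_eq_single p]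
  · rw [Matrix.one_apply_eq, mul_one, mul_comm]
  · intro q _ hq
    rw [Matrix.one_apply_ne (Ne.symm hq), mul_zero, mul_zero]
  · intro hp
    exact absurd (Finset.mem_univ p) hp

theorem IsBrownianMotionSL.integral_euler_eq (hB : IsBrownianMotionSL P ℱ B)
    (hc : quadDrift P B = 0) (N : ℕ) (t : ℝ≥0) (i j : Fin n) :
    ∫ ω, euler (drive P B ω) N t i j ∂P = (1 : Mat n) i j := by
  have hd : ∀ s t ω, drive P B ω t - drive P B ω s = B t ω - B s ω := fun s t ω => by
    simp only [drive_eq hc]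
  have hg : ∀ m : ℕ, ∀ i j, ∫ ω, eulerGrid (drive P B ω) N m i j ∂P = (1 : Mat n) i j := by
    intro m
    induction m with
    | zero => intro i j; simp [eulerGrid]
    | succ m ih =>
      intro i j
      have h1 : ((m : ℕ) : ℝ≥0) / 2 ^ N ≤ ((m + 1 : ℕ) : ℝ≥0) / 2 ^ N := by gcongr; simp
      rw [← ih i j]
      simp only [eulerGrid, hd]
      exact hB.integral_mul_one_add h1 (measurable_eulerGrid (X := fun s ω => drive P B ω s)
        fun s hs => measurable_drive hB.adapted hs) (hB.memLp_eulerGrid N m) i j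
  rw [← hg ⌊t * 2 ^ N⌋₊ i j]
  simp only [euler, hd, eulerStep]
  exact hB.integral_mul_one_add (dyadicFloor_le N t) (measurable_eulerGrid
    (X := fun s ω => drive P B ω s) fun s hs => measurable_drive hB.adapted hs)
    (hB.memLp_eulerGrid N _) i j

theorem IsBrownianMotionSL.integral_eulerSolution_eq (hB : IsBrownianMotionSL P ℱ B)
    (hc : quadDrift P B = 0) (t : ℝ≥0) (i j : Fin n) :
    ∫ ω, eulerSolution P B t ω i j ∂P = (1 : Mat n) i j := by
  refine tendsto_nhds_unique (hB.tendsto_integral_euler t i j) ?_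
  simp only [hB.integral_euler_eq hc]
  exact tendsto_const_nhds

/-- The second moment matrix of a driftless Euler scheme, by induction over its steps. -/
theorem IsBrownianMotionSL.integral_gram_euler (hB : IsBrownianMotionSL P ℱ B)
    (hc : quadDrift P B = 0) (hD : ∀ p q, ∑ a, covTensor P B p a q a = (1 : Mat n) p q) (N : ℕ) (t : ℝ≥0) (i j : Fin n) :
    ∫ ω, (euler (drive P B ω) N t * (euler (drive P B ω) N t).transpose) i j ∂P =
      (1 + ((t : ℝ) - dyadicFloor N t)) * (1 + (1 / 2) ^ N) ^ ⌊t * 2 ^ N⌋₊ * (1 : Mat n) i j := by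
  have hd : ∀ s t ω, drive P B ω t - drive P B ω s = B t ω - B s ω := fun s t ω => by
    simp only [drive_eq hc]
  have hg : ∀ m : ℕ, ∫ ω, (eulerGrid (drive P B ω) N m *
      (eulerGrid (drive P B ω) N m).transpose) i j ∂P =
      (1 + (1 / 2) ^ N) ^ m * (1 : Mat n) i j := by
    intro m
    induction m with
    | zero => simp [eulerGrid]
    | succ m ih =>
      have h1 : ((m : ℕ) : ℝ≥0) / 2 ^ N ≤ ((m + 1 : ℕ) : ℝ≥0) / 2 ^ N := by gcongr; simp
      have hstep : ((((m + 1 : ℕ) : ℝ≥0) / 2 ^ N : ℝ≥0) : ℝ) - (((m : ℝ≥0) / 2 ^ N : ℝ≥0) : ℝ) =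
          (1 / 2) ^ N := by
        push_cast
        rw [← sub_div, add_sub_cancel_left, one_div, one_div, inv_pow]
      simp only [eulerGrid, hd]
      rw [hB.integral_gram_mul_one_add hD h1 (measurable_eulerGrid (X := fun s ω => drive P B ω s)
        fun s hs => measurable_drive hB.adapted hs) (hB.memLp_eulerGrid N m) i j, ih, hstep, pow_succ]
      ring
  simp only [euler, hd, eulerStep]
  rw [hB.integral_gram_mul_one_add hD (dyadicFloor_le N t) (measurable_eulerGrid
    (X := fun s ω => drive P B ω s) fun s hs => measurable_drive hB.adapted hs)
    (hB.memLp_eulerGrid N _) i j, hg, mul_assoc]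

/-- The lower bound that, with `1 + x ≤ exp x`, identifies the limit of products of factors `1 + x`.
-/
theorem exp_sub_sq_le_one_add {x : ℝ} (hx : 0 ≤ x) : Real.exp (x - x ^ 2) ≤ 1 + x := by
  have h1 := Real.one_sub_inv_le_log_of_pos (show 0 < 1 + x by linarith)
  have h2 : x - x ^ 2 ≤ 1 - (1 + x)⁻¹ := by
    have e : 1 - (1 + x)⁻¹ = x / (1 + x) := by field_simp; ring
    rw [e, le_div_iff₀ (by linarith)]
    nlinarith [pow_nonneg hx 3]
  rw [← Real.exp_log (show 0 < 1 + x by linarith)]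
  exact Real.exp_le_exp.2 (h2.trans h1)

/-- The second moments of the Euler schemes tend to `exp t`. The first factor belongs to the
incomplete last step. -/
theorem tendsto_one_add_pow_floor (t : ℝ≥0) :
    Tendsto (fun N : ℕ => (1 + ((t : ℝ) - dyadicFloor N t)) * (1 + (1 / 2 : ℝ) ^ N) ^ ⌊t * 2 ^ N⌋₊)
      atTop (𝓝 (Real.exp t)) := by
  have hfl : ∀ N : ℕ, (dyadicFloor N t : ℝ) = ⌊t * 2 ^ N⌋₊ * (1 / 2) ^ N := fun N => by
    rw [dyadicFloor, one_div, inv_pow]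
    push_cast
    rw [div_eq_mul_inv]
  have hp : Tendsto (fun N : ℕ => (1 / 2 : ℝ) ^ N) atTop (𝓝 0) :=
    tendsto_pow_atTop_nhds_zero_of_lt_one (by norm_num) (by norm_num)
  have hlow : Tendsto (fun N : ℕ => Real.exp (t - (t * (1 / 2) ^ N + ((1 / 2 : ℝ) ^ N) ^ 2))) atTop
      (𝓝 (Real.exp (t - (t * 0 + 0 ^ 2)))) :=
    (Real.continuous_exp.tendsto _).comp (tendsto_const_nhds.sub ((hp.const_mul _).add (hp.pow 2)))
  simp only [mul_zero, ne_eq, OfNat.ofNat_ne_zero, not_false_eq_true, zero_pow, add_zero,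
    sub_zero] at hlow
  refine tendsto_of_tendsto_of_tendsto_of_le_of_le hlow tendsto_const_nhds (fun N => ?_)
    fun N => ?_
  all_goals
    have h1 : (dyadicFloor N t : ℝ) ≤ t := dyadicFloor_le N t
    have h2 : (t : ℝ) < dyadicFloor N t + (1 / 2) ^ N := by exact_mod_cast lt_dyadicFloor_add N t
    have h3 : (0 : ℝ) < (1 / 2) ^ N := by positivity
    set δ : ℝ := (1 / 2) ^ N
    set r : ℝ := t - dyadicFloor N t with hr
    have hr0 : 0 ≤ r := by linarith
  · have h4 : Real.exp (t - (t * δ + δ ^ 2)) ≤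
        Real.exp (r - r ^ 2) * Real.exp (δ - δ ^ 2) ^ ⌊t * 2 ^ N⌋₊ := by
      rw [← Real.exp_nat_mul, ← Real.exp_add]
      refine Real.exp_le_exp.2 ?_
      have e : (⌊t * 2 ^ N⌋₊ : ℝ) * (δ - δ ^ 2) = dyadicFloor N t * (1 - δ) := by
        rw [hfl N]; ring
      rw [e]
      nlinarith
    refine h4.trans (mul_le_mul (exp_sub_sq_le_one_add hr0) (pow_le_pow_left₀ (Real.exp_pos _).le
      (exp_sub_sq_le_one_add h3.le) _) (by positivity) (by linarith))
  · have h4 : (1 + r) * (1 + δ) ^ ⌊t * 2 ^ N⌋₊ ≤ Real.exp r * Real.exp δ ^ ⌊t * 2 ^ N⌋₊ := by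
      have h5 := Real.add_one_le_exp r
      have h6 := Real.add_one_le_exp δ
      exact mul_le_mul (by linarith) (pow_le_pow_left₀ (by linarith) (by linarith) _)
        (by positivity) (Real.exp_pos _).le
    refine h4.trans (le_of_eq ?_)
    rw [← Real.exp_nat_mul, ← Real.exp_add, ← hfl N]
    congr 1
    ring

/-- If `𝔼 B₁ B₁* = 1` and there is no drift, then the solution is normalized. -/
theorem IsBrownianMotionSL.isNormalized_eulerSolution (hB : IsBrownianMotionSL P ℱ B)
    (hc : quadDrift P B = 0) (hD : ∀ p q, ∑ a, covTensor P B p a q a = (1 : Mat n) p q) :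
    IsNormalized P (eulerSolution P B) := by
  intro t i j
  have hi : ∀ a, Integrable (fun ω => eulerSolution P B t ω i a * eulerSolution P B t ω j a) P :=
    fun a => (hB.memLp_eulerSolution t i a).integrable_mul (hB.memLp_eulerSolution t j a)
  simp only [Matrix.mul_apply, Matrix.transpose_apply]
  refine ⟨integrable_finsetSum _ fun a _ => hi a, ?_⟩
  rw [integral_finsetSum _ fun a _ => hi a, Matrix.smul_apply, smul_eq_mul]
  refine tendsto_nhds_unique
    (tendsto_finsetSum Finset.univ fun a _ => hB.tendsto_integral_euler_mul t i a j a) ?_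
  refine ((tendsto_one_add_pow_floor t).mul_const ((1 : Mat n) i j)).congr fun N => ?_
  rw [← hB.integral_gram_euler hc hD]
  simp only [Matrix.mul_apply, Matrix.transpose_apply]
  exact integral_finsetSum _ fun a _ => (hB.memLp_euler N t i a).integrable_mul
    (hB.memLp_euler N t j a)

/-- In small time, the solution is the driving process up to an error of second order. -/
theorem IsBrownianMotionSL.integral_sq_eulerSolution_sub_one_sub_le
    (hB : IsBrownianMotionSL P ℱ B) (hc : quadDrift P B = 0) {t : ℝ≥0} (ht : t ≤ 1) (i j : Fin n) :
    ∫ ω, (eulerSolution P B t ω i j - (1 : Mat n) i j - B t ω i j) ^ 2 ∂P ≤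
      itoConst P B 1 * (itoConst P B 1 * eulerBound P B 1) * (t : ℝ) ^ 2 := by
  have hκ : 0 ≤ itoConst P B 1 := itoConst_nonneg zero_le_one
  have hκ' : itoConst P B ((1 : ℝ≥0) : ℝ) = itoConst P B 1 := rfl
  have hBm : ∀ i j, MemLp (fun ω => B t ω i j) 2 P := fun i j => hB.memLp_entry t i j (by simp)
  set S : ℕ → Ω → Mat n := fun N ω => euler (drive P B ω) N t - 1 - B t ω with hS
  have hSL : ∀ N i j, MemLp (fun ω => S N ω i j) 2 P := fun N i j =>
    ((hB.memLp_euler N t i j).sub (memLp_const _)).sub (hBm i j)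
  have hconv : TendstoInMeasure P (fun N ω => S N ω i j) atTop
      fun ω => eulerSolution P B t ω i j - (1 : Mat n) i j - B t ω i j := by
    refine tendstoInMeasure_of_ae_tendsto (fun N => (hSL N i j).aestronglyMeasurable) ?_
    filter_upwards [hB.tendsto_euler] with ω hω
    exact ((hω t i j).sub tendsto_const_nhds).sub tendsto_const_nhds
  refine (memLp_integral_sq_le_of_tendstoInMeasure hconv (fun N => hSL N i j)
    (Eventually.of_forall fun N => ?_)).2
  refine (integral_mono (hSL N i j).integrable_sq (integrable_nsq (hSL N))
    fun ω => sq_entry_le_nsq _ i j).trans ?_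
  set pt := clampGrid N 0 t with hptdef
  have hpt : Monotone pt := clampGrid_mono _ _ _
  have h0 : pt 0 = 0 := clampGrid_zero zero_le N
  have hle : ∀ k, pt k ≤ t := fun k => clampGrid_le _ _ _ _
  have hend : pt ⌈t * 2 ^ N⌉₊ = t := clampGrid_end 0 (Nat.le_ceil _)
  -- by definition of the scheme, `euler - 1 - B` is the discrete integral of `eulerStep - 1`, which
  -- is of order `√t` in mean square
  set H : ℕ → Ω → Mat n := fun k ω => eulerStep (drive P B ω) N (pt k) - 1 with hH
  have hHL : ∀ k i j, MemLp (fun ω => H k ω i j) 2 P := fun k i j =>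
    (hB.memLp_eulerStep N _ i j).sub (memLp_const _)
  have hHb : ∀ k, ∫ ω, nsq (H k ω) ∂P ≤ itoConst P B 1 * eulerBound P B 1 * t := by
    intro k
    have h1 := hB.integral_nsq_euler_sub_le N (zero_le (a := dyadicFloor N (pt k)))
      (((dyadicFloor_le N _).trans (hle k)).trans ht)
    simp only [euler_dyadicFloor, euler_zero, NNReal.coe_zero, sub_zero, hκ'] at h1
    refine h1.trans (mul_le_mul_of_nonneg_left ?_ (mul_nonneg hκ (eulerBound_nonneg 1)))
    exact_mod_cast (dyadicFloor_le N _).trans (hle k)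
  have e : ∀ᵐ ω ∂P, nsq (S N ω) = nsq (itoSum P B pt H ⌈t * 2 ^ N⌉₊ ω) := by
    filter_upwards [hB.zero] with ω hω
    congr 1
    have h1 := euler_sub_one_eq_itoSum (P := P) (B := B) (N := N) hpt h0
      (clampGrid_succ_le le_rfl _ _) ⌈t * 2 ^ N⌉₊ ω
    rw [hend] at h1
    have h2 : ∑ k ∈ Finset.range ⌈t * 2 ^ N⌉₊, driftIncr P B (pt k) (pt (k + 1)) ω = B t ω := by
      simp only [← drive_sub_drive, drive_eq hc]
      rw [Finset.sum_range_sub fun k => B (pt k) ω, h0, hend, hω, sub_zero]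
    simp only [hS, h1, itoSum, hH, sub_mul, one_mul, Finset.sum_sub_distrib, h2]
  rw [integral_congr_ae e]
  refine (hB.integral_nsq_itoSum_le hpt (H := H) (fun k => measurable_mat_sub
    (adapted_eulerStep hB.adapted N _) measurable_const) hHL (T := 1) ?_).trans ?_
  · rw [hend, h0, NNReal.coe_zero, sub_zero]; exact_mod_cast ht
  · rw [mul_assoc]
    refine mul_le_mul_of_nonneg_left ?_ hκ
    calc _ ≤ ∑ k ∈ Finset.range ⌈t * 2 ^ N⌉₊, ((pt (k + 1) : ℝ) - pt k) *
          (itoConst P B 1 * eulerBound P B 1 * t) := Finset.sum_le_sum fun k _ =>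
            mul_le_mul_of_nonneg_left (hHb k) (sub_nonneg.2 (hpt (Nat.le_succ k)))
      _ = _ := by
          rw [← Finset.sum_mul, Finset.sum_range_sub fun k => (pt k : ℝ), hend, h0]
          rw [NNReal.coe_zero, sub_zero]
          ring

/-- The covariance of the driving process is recovered from the solution in small time. -/
theorem IsBrownianMotionSL.tendsto_covariance_eulerSolution (hB : IsBrownianMotionSL P ℱ B)
    (hc : quadDrift P B = 0) (i j k l : Fin n) :
    Tendsto (fun m : ℕ => ((m : ℝ) + 1) * ∫ ω,
      (eulerSolution P B (1 / ((m : ℝ≥0) + 1)) ω i j - (1 : Mat n) i j) *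
        (eulerSolution P B (1 / ((m : ℝ≥0) + 1)) ω k l - (1 : Mat n) k l) ∂P) atTop
      (𝓝 (covTensor P B i j k l)) := by
  set τ : ℕ → ℝ≥0 := fun m => 1 / ((m : ℝ≥0) + 1) with hτ
  have hτ1 : ∀ m, τ m ≤ 1 := fun m => by
    rw [hτ]; exact div_le_one_of_le₀ (by simp) (by positivity)
  have hτr : ∀ m, (τ m : ℝ) = 1 / ((m : ℝ) + 1) := fun m => by simp [hτ]
  have hm0 : ∀ m : ℕ, (0 : ℝ) < (m : ℝ) + 1 := fun m => by positivity
  have hsq : ∀ m : ℕ, Real.sqrt ((m : ℝ) + 1) ^ 2 = (m : ℝ) + 1 := fun m =>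
    Real.sq_sqrt (hm0 m).le
  -- rescaling by `√(m + 1)`, the inverse square root of the time, gives `B` a fixed covariance
  set f : Fin n → Fin n → ℕ → Ω → ℝ := fun i j m ω =>
    Real.sqrt ((m : ℝ) + 1) * (eulerSolution P B (τ m) ω i j - (1 : Mat n) i j) with hf
  set f' : Fin n → Fin n → ℕ → Ω → ℝ := fun i j m ω =>
    Real.sqrt ((m : ℝ) + 1) * B (τ m) ω i j with hf'
  have hfL : ∀ i j m, MemLp (f i j m) 2 P := fun i j m =>
    ((hB.memLp_eulerSolution _ i j).sub (memLp_const _)).const_mul _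
  have hf'L : ∀ i j m, MemLp (f' i j m) 2 P := fun i j m =>
    (hB.memLp_entry _ i j (by simp)).const_mul _
  have hcov : ∀ i j k l m, ∫ ω, f' i j m ω * f' k l m ω ∂P = covTensor P B i j k l := by
    intro i j k l m
    have e : ∀ ω, f' i j m ω * f' k l m ω = ((m : ℝ) + 1) * (B (τ m) ω i j * B (τ m) ω k l) :=
      fun ω => by rw [← hsq m, hf']; ring
    simp only [e]
    rw [integral_const_mul, hB.integral_mul_entry, hτr]
    field_simp
  set C : ℝ := itoConst P B 1 * (itoConst P B 1 * eulerBound P B 1) with hC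
  have hdiff : ∀ i j, Tendsto (fun m => ∫ ω, (f i j m ω - f' i j m ω) ^ 2 ∂P) atTop (𝓝 0) := by
    intro i j
    have hlim : Tendsto (fun m : ℕ => C * (1 / ((m : ℝ) + 1))) atTop (𝓝 0) := by
      simpa using tendsto_one_div_add_atTop_nhds_zero_nat.const_mul C
    refine tendsto_of_tendsto_of_tendsto_of_le_of_le tendsto_const_nhds hlim
      (fun m => integral_nonneg fun ω => sq_nonneg _) fun m => ?_
    have e : ∀ ω, (f i j m ω - f' i j m ω) ^ 2 = ((m : ℝ) + 1) *
        (eulerSolution P B (τ m) ω i j - (1 : Mat n) i j - B (τ m) ω i j) ^ 2 := fun ω => by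
      rw [← hsq m, hf, hf']; ring
    simp only [e]
    rw [integral_const_mul]
    calc _ ≤ ((m : ℝ) + 1) * (C * (τ m : ℝ) ^ 2) := mul_le_mul_of_nonneg_left
          (hB.integral_sq_eulerSolution_sub_one_sub_le hc (hτ1 m) i j) (hm0 m).le
      _ = _ := by rw [hτr]; field_simp
  have h := tendsto_integral_mul_sub (hfL i j) (hf'L i j) (hfL k l) (hf'L k l) (hdiff i j)
    (hdiff k l) (K := max (covTensor P B i j i j) (covTensor P B k l k l))
    (fun m => by simp only [sq, hcov]; exact le_max_left _ _)
    (fun m => by simp only [sq, hcov]; exact le_max_right _ _)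
  simp only [hcov] at h
  have h2 := h.add_const (covTensor P B i j k l)
  rw [zero_add] at h2
  refine h2.congr fun m => ?_
  rw [sub_add_cancel, ← integral_const_mul]
  congr 1; ext ω
  rw [← hsq m, hf]; ring

/-- Orthogonal invariance of the solution passes to the covariance of the driving process, which is
a limit of second moments of the solution. -/
theorem IsBrownianMotionSL.isInvariantTensor_covTensor (hB : IsBrownianMotionSL P ℱ B)
    (hc : quadDrift P B = 0) (h : IsOrthogonallyInvariant P (eulerSolution P B)) :
    IsInvariantTensor (covTensor P B) := by
  intro O hO i j k l
  have hO' : O ∈ Matrix.orthogonalGroup (Fin n) ℝ := by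
    rw [Matrix.mem_orthogonalGroup_iff]
    simpa [Matrix.star_eq_conjTranspose] using hO
  refine tendsto_nhds_unique (tendsto_finsetSum _ fun p _ => tendsto_finsetSum _ fun q _ =>
    tendsto_finsetSum _ fun r _ => tendsto_finsetSum _ fun s _ =>
      (hB.tendsto_covariance_eulerSolution hc p q r s).const_mul _) ?_
  refine (hB.tendsto_covariance_eulerSolution hc i j k l).congr fun m => ?_
  set t : ℝ≥0 := 1 / ((m : ℝ≥0) + 1)
  have hid := (h ⟨O, hO'⟩).comp (measurable_pi_apply t)
  have hmeas : Measurable fun A : Mat n =>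
      (A i j - (1 : Mat n) i j) * (A k l - (1 : Mat n) k l) :=
    ((measurable_entry i j).sub_const _).mul ((measurable_entry k l).sub_const _)
  have h1 := (hid.comp hmeas).integral_eq
  have h2 : ∀ ω, (O * eulerSolution P B t ω * O.transpose) - 1 =
      O * (eulerSolution P B t ω - 1) * O.transpose := fun ω => by
    rw [mul_sub, mul_one, sub_mul, hO]
  have h3 := integral_conj_mul (P := P) (A := fun ω => eulerSolution P B t ω - 1)
    (fun i j => (hB.memLp_eulerSolution t i j).sub (memLp_const _)) O O.transpose i j k l
  simp only [← h2, Matrix.transpose_apply, Matrix.sub_apply] at h3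
  have h4 : ∫ ω, (eulerSolution P B t ω i j - (1 : Mat n) i j) *
      (eulerSolution P B t ω k l - (1 : Mat n) k l) ∂P =
      ∫ ω, ((O * eulerSolution P B t ω * O.transpose) i j - (1 : Mat n) i j) *
        ((O * eulerSolution P B t ω * O.transpose) k l - (1 : Mat n) k l) ∂P := h1.symm
  rw [h4, h3]
  simp only [Finset.mul_sum]
  refine Finset.sum_congr rfl fun p _ => Finset.sum_congr rfl fun q _ =>
    Finset.sum_congr rfl fun r _ => Finset.sum_congr rfl fun s _ => by ring

/-- The normalization of the solution, differentiated at time `0`. -/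
theorem IsBrownianMotionSL.sum_covTensor_eq_one (hB : IsBrownianMotionSL P ℱ B)
    (hc : quadDrift P B = 0) (h : IsNormalized P (eulerSolution P B)) (i j : Fin n) :
    ∑ a, covTensor P B i a j a = (1 : Mat n) i j := by
  refine tendsto_nhds_unique (tendsto_finsetSum _ fun a _ =>
    hB.tendsto_covariance_eulerSolution hc i a j a) ?_
  have hlim : Tendsto (fun m : ℕ => 1 / ((m : ℝ) + 1)) atTop (𝓝[≠] 0) :=
    tendsto_nhdsWithin_iff.2 ⟨tendsto_one_div_add_atTop_nhds_zero_nat,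
      Eventually.of_forall fun m => (by positivity : (1 : ℝ) / (m + 1) ≠ 0)⟩
  have hd := (hasDerivAt_iff_tendsto_slope_zero.1 (Real.hasDerivAt_exp 0)).comp hlim
  have hd2 := hd.mul_const ((1 : Mat n) i j)
  rw [Real.exp_zero, one_mul] at hd2
  refine hd2.congr fun m => ?_
  set t : ℝ≥0 := 1 / ((m : ℝ≥0) + 1) with ht
  have htr : (t : ℝ) = 1 / ((m : ℝ) + 1) := by simp [ht]
  set G : Ω → Mat n := eulerSolution P B t with hG
  have hL : ∀ i j, MemLp (fun ω => G ω i j) 2 P := hB.memLp_eulerSolution t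
  have hi : ∀ i j, Integrable (fun ω => G ω i j) P := fun i j => (hL i j).integrable one_le_two
  have h1 := (h t i j).2
  -- the solution has mean `1`, so centering its second moment matrix subtracts `1`
  have hsum : ∑ a, ∫ ω, (G ω i a - (1 : Mat n) i a) * (G ω j a - (1 : Mat n) j a) ∂P =
      (Real.exp t - 1) * (1 : Mat n) i j := by
    have hprod : ∀ a, Integrable
        (fun ω => (G ω i a - (1 : Mat n) i a) * (G ω j a - (1 : Mat n) j a)) P := fun a =>
      ((hL i a).sub (memLp_const _)).integrable_mul ((hL j a).sub (memLp_const _))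
    rw [← integral_finsetSum _ fun a _ => hprod a]
    have e : ∀ ω, ∑ a, (G ω i a - (1 : Mat n) i a) * (G ω j a - (1 : Mat n) j a) =
        (G ω * (G ω).transpose) i j - G ω i j - G ω j i + (1 : Mat n) i j := fun ω => by
      have e1 : ∑ a, (G ω i a - (1 : Mat n) i a) * (G ω j a - (1 : Mat n) j a) =
          ((G ω - 1) * (G ω - 1).transpose) i j := by
        simp only [Matrix.mul_apply, Matrix.transpose_apply, Matrix.sub_apply]
      rw [e1, Matrix.transpose_sub, Matrix.transpose_one, sub_mul, mul_sub, mul_one, one_mul]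
      simp only [Matrix.sub_apply, Matrix.transpose_apply]
      ring
    simp only [e]
    have J1 := (h t i j).1
    have J2 : Integrable (fun ω => (G ω * (G ω).transpose) i j - G ω i j) P := J1.sub (hi i j)
    have J3 : Integrable (fun ω => (G ω * (G ω).transpose) i j - G ω i j - G ω j i) P :=
      J2.sub (hi j i)
    rw [integral_add J3 (integrable_const _), integral_sub J2 (hi j i), integral_sub J1 (hi i j),
      h1, hG, hB.integral_eulerSolution_eq hc, hB.integral_eulerSolution_eq hc]
    have e2 : (1 : Mat n) j i = (1 : Mat n) i j := by
      rw [← Matrix.transpose_apply (1 : Mat n) i j, Matrix.transpose_one]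
    simp only [integral_const, probReal_univ, smul_eq_mul, one_mul, Matrix.smul_apply, e2]
    ring
  rw [← Finset.mul_sum, hsum]
  simp only [Function.comp_apply, smul_eq_mul, zero_add, htr, one_div, inv_inv]
  ring

end SolutionMoments

/-! ### Orthogonally invariant tensors of order four -/

section Classification

variable {n : ℕ} {C : Fin n → Fin n → Fin n → Fin n → ℝ}

/-- Signed permutation matrices are orthogonal. -/
theorem IsInvariantTensor.signedPerm (hC : IsInvariantTensor C) (σ : Equiv.Perm (Fin n))
    {f : Fin n → ℝ} (hf : ∀ i, f i * f i = 1) (i j k l : Fin n) :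
    f i * f j * (f k * f l) * C (σ i) (σ j) (σ k) (σ l) = C i j k l := by
  have hO : (Matrix.of fun i p => if p = σ i then f i else 0 : Mat n) *
      (Matrix.of fun i p => if p = σ i then f i else 0 : Mat n).transpose = 1 := by
    ext i j
    simp only [Matrix.mul_apply, Matrix.transpose_apply, Matrix.of_apply, mul_ite, mul_zero, ite_mul,
      zero_mul, Matrix.one_apply]
    by_cases h : i = j
    · subst h; simp [hf]
    · have h' : ∀ x : Fin n, ¬ (x = σ j ∧ x = σ i) := fun x hx =>
        h (σ.injective (hx.2.symm.trans hx.1))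
      rw [if_neg h]
      refine Finset.sum_eq_zero fun x _ => ?_
      by_cases h1 : x = σ j <;> by_cases h2 : x = σ i <;> simp_all
  have h := hC _ hO i j k l
  simpa [Matrix.of_apply, ite_mul, mul_ite, Finset.sum_ite_eq'] using h

theorem IsInvariantTensor.perm (hC : IsInvariantTensor C) (σ : Equiv.Perm (Fin n))
    (i j k l : Fin n) : C (σ i) (σ j) (σ k) (σ l) = C i j k l := by
  simpa using hC.signedPerm σ (f := fun _ => 1) (by simp) i j k l

/-- Changing the sign of one basis vector shows that an entry with an isolated index vanishes. -/
theorem IsInvariantTensor.flip (hC : IsInvariantTensor C) (a i j k l : Fin n) :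
    (if i = a then -1 else 1) * (if j = a then -1 else 1) *
      ((if k = a then -1 else 1) * (if l = a then -1 else 1)) * C i j k l = C i j k l := by
  simpa using hC.signedPerm 1 (f := fun x => if x = a then -1 else 1)
    (fun i => by by_cases h : i = a <;> simp [h]) i j k l

theorem exists_perm_of_ne {i j a b : Fin n} (hij : i ≠ j) (hab : a ≠ b) :
    ∃ σ : Equiv.Perm (Fin n), σ i = a ∧ σ j = b := by
  have h1 : Equiv.swap i a j ≠ a := fun h => hij (by
    have h2 : Equiv.swap i a j = Equiv.swap i a i := by rw [h, Equiv.swap_apply_left]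
    exact ((Equiv.swap i a).injective h2).symm)
  refine ⟨(Equiv.swap i a).trans (Equiv.swap (Equiv.swap i a j) b), ?_, ?_⟩
  · rw [Equiv.trans_apply, Equiv.swap_apply_left, Equiv.swap_apply_of_ne_of_ne h1.symm hab]
  · rw [Equiv.trans_apply, Equiv.swap_apply_left]

/-- A reflection of the plane of two basis vectors that does not permute the axes relates the
diagonal entry to the others. -/
theorem IsInvariantTensor.diag_eq (hC : IsInvariantTensor C) {a b : Fin n} (hab : a ≠ b) :
    C a a a a = C a a b b + C a b a b + C a b b a := by
  -- the reflection in the hyperplane orthogonal to `e_a - 2 e_b`, with row `a` equal to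
  -- `(3 e_a + 4 e_b) / 5`
  set v : Fin n → ℝ := fun i => if i = a then 1 else if i = b then -2 else 0 with hv
  have hv2 : ∑ i, v i * v i = 5 := by
    have h1 : ∀ i, v i * v i = (if i = a then 1 else 0) + (if i = b then 4 else 0) := fun i => by
      rw [hv]
      by_cases h1 : i = a
      · have h2 : ¬ i = b := fun h => hab (h1.symm.trans h)
        simp [h1, hab]
      · by_cases h2 : i = b
        · simp [h2, Ne.symm hab]; norm_num
        · simp [h1, h2]
    rw [Finset.sum_congr rfl fun i _ => h1 i, Finset.sum_add_distrib, Finset.sum_ite_eq',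
      Finset.sum_ite_eq']
    norm_num
  set O : Mat n := Matrix.of fun i p => (1 : Mat n) i p - 2 / 5 * (v i * v p) with hOdef
  have hO : O * O.transpose = 1 := by
    ext i j
    simp only [hOdef, Matrix.mul_apply, Matrix.transpose_apply, Matrix.of_apply, sub_mul, mul_sub,
      Finset.sum_sub_distrib]
    have e1 : ∑ x, (1 : Mat n) i x * (1 : Mat n) j x = (1 : Mat n) i j := by
      simp [Matrix.one_apply]
    have e2 : ∑ x, (1 : Mat n) i x * (2 / 5 * (v j * v x)) = 2 / 5 * (v j * v i) := by
      simp [Matrix.one_apply]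
    have e3 : ∑ x, 2 / 5 * (v i * v x) * (1 : Mat n) j x = 2 / 5 * (v i * v j) := by
      simp [Matrix.one_apply]
    have e4 : ∑ x, 2 / 5 * (v i * v x) * (2 / 5 * (v j * v x)) =
        4 / 25 * (v i * v j) * ∑ x, v x * v x := by
      rw [Finset.mul_sum]
      exact Finset.sum_congr rfl fun x _ => by ring
    rw [e1, e2, e3, e4, hv2]
    ring
  have hrow : ∀ g : Fin n → ℝ, ∑ p, O a p * g p = 3 / 5 * g a + 4 / 5 * g b := by
    intro g
    have h1 : ∀ p, O a p * g p =
        (if p = a then 3 / 5 * g a else 0) + (if p = b then 4 / 5 * g b else 0) := fun p => by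
      by_cases h1 : p = a
      · subst h1
        simp only [hOdef, hv, Matrix.of_apply, Matrix.one_apply_eq, if_true, if_neg hab]
        ring
      · by_cases h2 : p = b
        · subst h2
          simp only [hOdef, hv, Matrix.of_apply, Matrix.one_apply_ne hab, if_true, if_neg h1]
          ring
        · simp only [hOdef, hv, Matrix.of_apply, Matrix.one_apply_ne (Ne.symm h1), if_true,
            if_neg h1, if_neg h2]
          ring
    rw [Finset.sum_congr rfl fun p _ => h1 p, Finset.sum_add_distrib, Finset.sum_ite_eq',
      Finset.sum_ite_eq']
    simp
  have h := hC O hO a a a a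
  have e : ∑ p, ∑ q, ∑ r, ∑ s, (O a p * O a q * (O a r * O a s)) * C p q r s =
      ∑ p, O a p * ∑ q, O a q * ∑ r, O a r * ∑ s, O a s * C p q r s := by
    simp only [Finset.mul_sum]
    refine Finset.sum_congr rfl fun p _ => Finset.sum_congr rfl fun q _ =>
      Finset.sum_congr rfl fun r _ => Finset.sum_congr rfl fun s _ => by ring
  rw [e] at h
  simp only [hrow] at h
  have hba := Ne.symm hab
  -- among the sixteen terms only those with every index occurring an even number of times survive
  have odd : ∀ i j k l, (if i = a then (-1 : ℝ) else 1) * (if j = a then -1 else 1) *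
      ((if k = a then -1 else 1) * (if l = a then -1 else 1)) = -1 → C i j k l = 0 := by
    intro i j k l hs
    have h1 := hC.flip a i j k l
    rw [hs] at h1
    linarith
  have o1 := odd a a a b (by simp [hba])
  have o2 := odd a a b a (by simp [hba])
  have o3 := odd a b a a (by simp [hba])
  have o4 := odd b a a a (by simp [hba])
  have o5 := odd a b b b (by simp [hba])
  have o6 := odd b a b b (by simp [hba])
  have o7 := odd b b a b (by simp [hba])
  have o8 := odd b b b a (by simp [hba])
  have hsw := hC.perm (Equiv.swap a b)
  have s1 := hsw a a a a
  have s2 := hsw a a b b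
  have s3 := hsw a b a b
  have s4 := hsw a b b a
  simp only [Equiv.swap_apply_left, Equiv.swap_apply_right] at s1 s2 s3 s4
  rw [o1, o2, o3, o4, o5, o6, o7, o8, s1, s2, s3, s4] at h
  linarith

/-- Invariant 4-tensors are combinations of the three pairings of the indices. -/
theorem IsInvariantTensor.eq_pairings (hC : IsInvariantTensor C) {a b : Fin n} (hab : a ≠ b)
    (i j k l : Fin n) : C i j k l = C a a b b * ((1 : Mat n) i j * (1 : Mat n) k l) +
      C a b a b * ((1 : Mat n) i k * (1 : Mat n) j l) +
      C a b b a * ((1 : Mat n) i l * (1 : Mat n) j k) := by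
  -- an entry in which some index occurs an odd number of times vanishes
  have iso : ∀ x i j k l, (if i = x then (-1 : ℝ) else 1) * (if j = x then -1 else 1) *
      ((if k = x then -1 else 1) * (if l = x then -1 else 1)) = -1 → C i j k l = 0 := by
    intro x i j k l hs
    have h1 := hC.flip x i j k l
    rw [hs] at h1
    linarith
  have hdiag : ∀ i, C i i i i = C a a a a := fun i => by
    have := hC.perm (Equiv.swap i a) i i i i
    rw [Equiv.swap_apply_left] at this
    exact this.symm
  by_cases hij : i = j
  · subst hij
    by_cases hkl : k = l
    · subst hkl
      by_cases hik : i = k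
      · subst hik
        rw [hdiag, hC.diag_eq hab]
        simp
      · obtain ⟨σ, h1, h2⟩ := exists_perm_of_ne hik hab
        have := hC.perm σ i i k k
        rw [h1, h2] at this
        simp [this, Matrix.one_apply_ne hik]
    · by_cases hik : i = k
      · subst hik
        rw [iso l i i i l (by simp [hkl])]
        simp [Matrix.one_apply_ne hkl]
      · rw [iso k i i k l (by simp [hik, Ne.symm hkl])]
        simp [Matrix.one_apply_ne hkl, Matrix.one_apply_ne hik]
  · by_cases hik : i = k
    · subst hik
      by_cases hjl : j = l
      · subst hjl
        obtain ⟨σ, h1, h2⟩ := exists_perm_of_ne hij hab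
        have := hC.perm σ i j i j
        rw [h1, h2] at this
        simp [this, Matrix.one_apply_ne hij]
      · rw [iso j i j i l (by simp [hij, Ne.symm hjl])]
        simp [Matrix.one_apply_ne hij, Matrix.one_apply_ne hjl,
          Matrix.one_apply_ne (Ne.symm hij)]
    · by_cases hil : i = l
      · subst hil
        by_cases hjk : j = k
        · subst hjk
          obtain ⟨σ, h1, h2⟩ := exists_perm_of_ne hij hab
          have := hC.perm σ i j j i
          rw [h1, h2] at this
          simp [this, Matrix.one_apply_ne hij]
        · rw [iso j i j k i (by simp [hij, Ne.symm hjk])]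
          simp [Matrix.one_apply_ne hij, Matrix.one_apply_ne hik, Matrix.one_apply_ne hjk]
      · rw [iso i i j k l (by simp [Ne.symm hij, Ne.symm hik, Ne.symm hil])]
        simp [Matrix.one_apply_ne hij, Matrix.one_apply_ne hik, Matrix.one_apply_ne hil]

/-- The covariance tensor `(-δ_ij δ_kl + (n + 1) δ_ik δ_jl - δ_il δ_jk) / ((n + 2) (n - 1))` of the
Brownian motion that the three properties single out. -/
noncomputable def invariantCov (n : ℕ) (i j k l : Fin n) : ℝ :=
  (-((1 : Mat n) i j * (1 : Mat n) k l) + ((n : ℝ) + 1) * ((1 : Mat n) i k * (1 : Mat n) j l) -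
    (1 : Mat n) i l * (1 : Mat n) j k) / (((n : ℝ) + 2) * (n - 1))

theorem sum_one_mul_one (i j : Fin n) : ∑ x, (1 : Mat n) i x * (1 : Mat n) x j = (1 : Mat n) i j := by
  rw [← Matrix.mul_apply, mul_one]

theorem one_symm (i j : Fin n) : (1 : Mat n) i j = (1 : Mat n) j i := by
  rw [← Matrix.transpose_apply (1 : Mat n) j i, Matrix.transpose_one]

theorem sum_one_diag : ∑ x, (1 : Mat n) x x = n := by simp

/-- Orthogonal invariance leaves three coefficients. They are determined by three linear conditions:
the trace of the matrices is `0`, there is no Itô correction, and the solution is normalized. -/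
theorem IsInvariantTensor.eq_invariantCov (hn : 2 ≤ n) (hC : IsInvariantTensor C)
    (htr : ∀ k l, ∑ i, C i i k l = 0) (hc : ∀ i j, ∑ l, C i l l j = 0)
    (hD : ∀ i j, ∑ a, C i a j a = (1 : Mat n) i j) (i j k l : Fin n) :
    C i j k l = invariantCov n i j k l := by
  have hab : (⟨0, by omega⟩ : Fin n) ≠ ⟨1, by omega⟩ := by simp
  set a : Fin n := ⟨0, by omega⟩
  set b : Fin n := ⟨1, by omega⟩
  have h := hC.eq_pairings hab
  set α := C a a b b
  set β := C a b a b
  set γ := C a b b a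
  -- the traces of the three pairings turn the conditions into three linear equations
  have h1 : n * α + β + γ = 0 := by
    have h0 := htr a a
    rw [Finset.sum_congr rfl fun i _ => h i i a a] at h0
    have e1 : ∑ i, (1 : Mat n) i i * (1 : Mat n) a a = n := by
      simp
    have e2 : ∑ i, (1 : Mat n) i a * (1 : Mat n) i a = 1 := by
      simp [Matrix.one_apply]
    rw [Finset.sum_add_distrib, Finset.sum_add_distrib, ← Finset.mul_sum, ← Finset.mul_sum,
      ← Finset.mul_sum, e1, e2] at h0
    linarith
  have h2 : α + β + n * γ = 0 := by
    have h0 := hc a a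
    rw [Finset.sum_congr rfl fun l _ => h a l l a] at h0
    have e1 : ∑ l, (1 : Mat n) a l * (1 : Mat n) l a = 1 := by
      rw [sum_one_mul_one]; simp
    have e2 : ∑ l, (1 : Mat n) a a * (1 : Mat n) l l = n := by simp
    rw [Finset.sum_add_distrib, Finset.sum_add_distrib, ← Finset.mul_sum, ← Finset.mul_sum,
      ← Finset.mul_sum, e1, e2] at h0
    linarith
  have h3 : α + n * β + γ = 1 := by
    have h0 := hD a a
    rw [Finset.sum_congr rfl fun l _ => h a l a l] at h0
    have e1 : ∑ l, (1 : Mat n) a l * (1 : Mat n) a l = 1 := by simp [Matrix.one_apply]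
    have e2 : ∑ l, (1 : Mat n) a a * (1 : Mat n) l l = n := by simp
    have e3 : ∑ l, (1 : Mat n) a l * (1 : Mat n) l a = 1 := by
      rw [sum_one_mul_one]; simp
    rw [Finset.sum_add_distrib, Finset.sum_add_distrib,
      ← Finset.mul_sum _ _ α, ← Finset.mul_sum _ _ β, ← Finset.mul_sum _ _ γ, e1, e2, e3] at h0
    rw [Matrix.one_apply_eq] at h0
    linarith
  have hn' : (2 : ℝ) ≤ n := by exact_mod_cast hn
  have hne1 : ((n : ℝ) - 1) ≠ 0 := by linarith
  have hne2 : ((n : ℝ) + 2) ≠ 0 := by linarith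
  have hαγ : α = γ := by
    have : ((n : ℝ) - 1) * (α - γ) = 0 := by linarith
    rcases mul_eq_zero.1 this with h | h
    · exact absurd h hne1
    · linarith
  have hβ : β = -(n + 1) * α := by rw [← hαγ] at h1; linarith
  have hα : α = -1 / (((n : ℝ) + 2) * (n - 1)) := by
    rw [eq_div_iff (mul_ne_zero hne2 hne1)]
    rw [← hαγ, hβ] at h3
    linarith
  rw [h i j k l, hβ, ← hαγ, hα, invariantCov]
  field_simp
  ring

/-- Each of the three pairings is invariant, since the rows of an orthogonal matrix are orthonormal.
-/
theorem isInvariantTensor_invariantCov : IsInvariantTensor (invariantCov n) := by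
  intro O hO i j k l
  have hrow : ∀ i j, ∑ p, O i p * O j p = (1 : Mat n) i j := fun i j => by
    rw [← hO, Matrix.mul_apply]
    rfl
  set N : ℝ := ((n : ℝ) + 2) * (n - 1) with hN
  have e : ∀ p q r s, (O i p * O j q * (O k r * O l s)) * invariantCov n p q r s =
      (-1 / N) * ((O i p * O j q * (O k r * O l s)) * ((1 : Mat n) p q * (1 : Mat n) r s)) +
      ((n + 1) / N) * ((O i p * O j q * (O k r * O l s)) * ((1 : Mat n) p r * (1 : Mat n) q s)) +
      (-1 / N) * ((O i p * O j q * (O k r * O l s)) * ((1 : Mat n) p s * (1 : Mat n) q r)) :=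
    fun p q r s => by rw [invariantCov, ← hN]; ring
  have e1 : ∑ p, ∑ q, ∑ r, ∑ s,
      (O i p * O j q * (O k r * O l s)) * ((1 : Mat n) p q * (1 : Mat n) r s) =
      (1 : Mat n) i j * (1 : Mat n) k l := by
    rw [← hrow i j, ← hrow k l, Finset.sum_mul_sum]
    refine Finset.sum_congr rfl fun p _ => ?_
    rw [Finset.sum_eq_single p]
    · refine Finset.sum_congr rfl fun r _ => ?_
      rw [Finset.sum_eq_single r]
      · simp
      · intro s _ hs; simp [Matrix.one_apply_ne (Ne.symm hs)]
      · intro hr; exact absurd (Finset.mem_univ r) hr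
    · intro q _ hq; simp [Matrix.one_apply_ne (Ne.symm hq)]
    · intro hp; exact absurd (Finset.mem_univ p) hp
  have e2 : ∑ p, ∑ q, ∑ r, ∑ s,
      (O i p * O j q * (O k r * O l s)) * ((1 : Mat n) p r * (1 : Mat n) q s) =
      (1 : Mat n) i k * (1 : Mat n) j l := by
    rw [← hrow i k, ← hrow j l, Finset.sum_mul_sum]
    refine Finset.sum_congr rfl fun p _ => Finset.sum_congr rfl fun q _ => ?_
    rw [Finset.sum_eq_single p]
    · rw [Finset.sum_eq_single q]
      · simp; ring
      · intro s _ hs; simp [Matrix.one_apply_ne (Ne.symm hs)]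
      · intro hr; exact absurd (Finset.mem_univ q) hr
    · intro r _ hq; simp [Matrix.one_apply_ne (Ne.symm hq)]
    · intro hp; exact absurd (Finset.mem_univ p) hp
  have e3 : ∑ p, ∑ q, ∑ r, ∑ s,
      (O i p * O j q * (O k r * O l s)) * ((1 : Mat n) p s * (1 : Mat n) q r) =
      (1 : Mat n) i l * (1 : Mat n) j k := by
    rw [← hrow i l, ← hrow j k, Finset.sum_mul_sum]
    refine Finset.sum_congr rfl fun p _ => Finset.sum_congr rfl fun q _ => ?_
    rw [Finset.sum_eq_single q]
    · rw [Finset.sum_eq_single p]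
      · simp; ring
      · intro s _ hs; simp [Matrix.one_apply_ne (Ne.symm hs)]
      · intro hr; exact absurd (Finset.mem_univ p) hr
    · intro r _ hq; simp [Matrix.one_apply_ne (Ne.symm hq)]
    · intro hp; exact absurd (Finset.mem_univ q) hp
  simp only [e, Finset.sum_add_distrib, ← Finset.mul_sum, e1, e2, e3]
  rw [invariantCov, ← hN]
  ring

/-- A Brownian motion with this covariance has no Itô correction. -/
theorem sum_invariantCov_eq_zero (i j : Fin n) : ∑ l, invariantCov n i l l j = 0 := by
  simp only [invariantCov]
  rw [← Finset.sum_div, Finset.sum_sub_distrib, Finset.sum_add_distrib, Finset.sum_neg_distrib,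
    ← Finset.mul_sum, sum_one_mul_one, ← Finset.mul_sum, sum_one_diag]
  ring

/-- A Brownian motion with this covariance satisfies `𝔼 B₁ B₁* = 1`. -/
theorem sum_invariantCov_eq_one (hn : 2 ≤ n) (i j : Fin n) :
    ∑ a, invariantCov n i a j a = (1 : Mat n) i j := by
  have hn' : (2 : ℝ) ≤ n := by exact_mod_cast hn
  have hne1 : ((n : ℝ) - 1) ≠ 0 := by linarith
  have hne2 : ((n : ℝ) + 2) ≠ 0 := by linarith
  have e1 : ∑ a, (1 : Mat n) i a * (1 : Mat n) j a = (1 : Mat n) i j := by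
    simp [Matrix.one_apply]
  have e2 : ∑ a, (1 : Mat n) i j * (1 : Mat n) a a = (1 : Mat n) i j * n := by
    rw [← Finset.mul_sum, sum_one_diag]
  have e3 : ∑ a, (1 : Mat n) i a * (1 : Mat n) a j = (1 : Mat n) i j := sum_one_mul_one i j
  have e : ∑ a, invariantCov n i a j a = (-(∑ a, (1 : Mat n) i a * (1 : Mat n) j a) +
      (n + 1) * (∑ a, (1 : Mat n) i j * (1 : Mat n) a a) -
      ∑ a, (1 : Mat n) i a * (1 : Mat n) a j) / (((n : ℝ) + 2) * (n - 1)) := by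
    simp only [invariantCov]
    rw [← Finset.sum_div, Finset.sum_sub_distrib, Finset.sum_add_distrib, Finset.sum_neg_distrib,
      Finset.mul_sum]
  rw [e, e1, e2, e3]
  field_simp
  ring

end Classification

/-! ### The invariant Brownian motion -/

section InvariantBrownianMotion

variable {n : ℕ}

/-- A square root of the covariance tensor `invariantCov`, as the linear map
`W ↦ p W + q W* - ((p + q) / n) (tr W) 1` on matrices of independent entries; the symmetric and the
antisymmetric part of `W` are multiplied by `p + q` and `p - q`. -/
theorem exists_sqrt_invariantCov (hn : 2 ≤ n) : ∃ T : Fin n → Fin n → Fin n × Fin n → ℝ,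
    (∀ x, ∑ i, T i i x = 0) ∧ ∀ i j k l, ∑ x, T i j x * T k l x = invariantCov n i j k l := by
  have hn' : (2 : ℝ) ≤ n := by exact_mod_cast hn
  have hne0 : (n : ℝ) ≠ 0 := by linarith
  have hne1 : ((n : ℝ) - 1) ≠ 0 := by linarith
  have hne2 : ((n : ℝ) + 2) ≠ 0 := by linarith
  have hpos1 : 0 ≤ (n : ℝ) - 1 := by linarith
  -- on the trace-free symmetric and on the antisymmetric matrices `invariantCov` acts as the
  -- scalars `n / ((n + 2) (n - 1))` and `1 / (n - 1)`; the scalars `s = p + q` and `d = p - q` of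
  -- the square root are their roots
  obtain ⟨s, hs⟩ : ∃ s : ℝ, s ^ 2 = n / ((n + 2) * (n - 1)) :=
    ⟨√(n / ((n + 2) * (n - 1))), Real.sq_sqrt (by positivity)⟩
  obtain ⟨d, hd⟩ : ∃ d : ℝ, d ^ 2 = 1 / (n - 1) := ⟨√(1 / (n - 1)), Real.sq_sqrt (by positivity)⟩
  set p := (s + d) / 2 with hp
  set q := (s - d) / 2 with hq
  have hpq : p + q = s := by rw [hp, hq]; ring
  have hpq1 : p ^ 2 + q ^ 2 = (n + 1) / ((n + 2) * (n - 1)) := by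
    have : p ^ 2 + q ^ 2 = (s ^ 2 + d ^ 2) / 2 := by rw [hp, hq]; ring
    rw [this, hs, hd]
    field_simp
    ring
  have hpq2 : 2 * (p * q) = -1 / ((n + 2) * (n - 1)) := by
    have : 2 * (p * q) = (s ^ 2 - d ^ 2) / 2 := by rw [hp, hq]; ring
    rw [this, hs, hd]
    field_simp
    ring
  refine ⟨fun i j x => p * ((1 : Mat n) i x.1 * (1 : Mat n) j x.2) +
    q * ((1 : Mat n) j x.1 * (1 : Mat n) i x.2) - s / n * ((1 : Mat n) i j * (1 : Mat n) x.1 x.2),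
    fun x => ?_, fun i j k l => ?_⟩
  · have e1 : ∑ i, (1 : Mat n) i x.1 * (1 : Mat n) i x.2 = (1 : Mat n) x.1 x.2 := by
      simp only [one_symm _ x.1]
      exact sum_one_mul_one _ _
    have e2 : ∑ i, (1 : Mat n) i i * (1 : Mat n) x.1 x.2 = n * (1 : Mat n) x.1 x.2 := by
      rw [← Finset.sum_mul, sum_one_diag]
    rw [Finset.sum_sub_distrib, Finset.sum_add_distrib, ← Finset.mul_sum _ _ p,
      ← Finset.mul_sum _ _ q, ← Finset.mul_sum _ _ (s / n), e1, e2, ← hpq]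
    field_simp
    ring
  · have prod : ∀ f g f' g' : Fin n → ℝ, ∑ a, ∑ b, (f a * g b) * (f' a * g' b) =
        (∑ a, f a * f' a) * ∑ b, g b * g' b := fun f g f' g' => by
      rw [Finset.sum_mul_sum]
      exact Finset.sum_congr rfl fun a _ => Finset.sum_congr rfl fun b _ => by ring
    have tr : ∀ (f g : Fin n → ℝ), ∑ a, ∑ b, (f a * g b) * (1 : Mat n) a b = ∑ a, f a * g a :=
      fun f g => by simp [Matrix.one_apply]
    have hd1 : ∀ i j, ∑ a, (1 : Mat n) i a * (1 : Mat n) j a = (1 : Mat n) i j := fun i j => by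
      simp only [one_symm j]
      exact sum_one_mul_one _ _
    rw [Fintype.sum_prod_type]
    have e : ∀ a b, (p * ((1 : Mat n) i a * (1 : Mat n) j b) +
        q * ((1 : Mat n) j a * (1 : Mat n) i b) - s / n * ((1 : Mat n) i j * (1 : Mat n) a b)) *
        (p * ((1 : Mat n) k a * (1 : Mat n) l b) +
        q * ((1 : Mat n) l a * (1 : Mat n) k b) - s / n * ((1 : Mat n) k l * (1 : Mat n) a b)) =
        p ^ 2 * (((1 : Mat n) i a * (1 : Mat n) j b) * ((1 : Mat n) k a * (1 : Mat n) l b)) +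
        q ^ 2 * (((1 : Mat n) j a * (1 : Mat n) i b) * ((1 : Mat n) l a * (1 : Mat n) k b)) +
        (p * q) * (((1 : Mat n) i a * (1 : Mat n) j b) * ((1 : Mat n) l a * (1 : Mat n) k b)) +
        (p * q) * (((1 : Mat n) j a * (1 : Mat n) i b) * ((1 : Mat n) k a * (1 : Mat n) l b)) -
        (p * (s / n) * (1 : Mat n) k l) * (((1 : Mat n) i a * (1 : Mat n) j b) * (1 : Mat n) a b) -
        (q * (s / n) * (1 : Mat n) k l) * (((1 : Mat n) j a * (1 : Mat n) i b) * (1 : Mat n) a b) -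
        (p * (s / n) * (1 : Mat n) i j) * (((1 : Mat n) k a * (1 : Mat n) l b) * (1 : Mat n) a b) -
        (q * (s / n) * (1 : Mat n) i j) * (((1 : Mat n) l a * (1 : Mat n) k b) * (1 : Mat n) a b) +
        ((s / n) ^ 2 * ((1 : Mat n) i j * (1 : Mat n) k l)) * ((1 : Mat n) a b * (1 : Mat n) a b) :=
      fun a b => by ring
    simp only [e, Finset.sum_add_distrib, Finset.sum_sub_distrib, ← Finset.mul_sum, prod, tr, hd1,
      sum_one_diag]
    rw [one_symm j i, one_symm l k, invariantCov]
    have hr : -2 * (s / n) * (p + q) + n * (s / n) ^ 2 = -1 / ((n + 2) * (n - 1)) := by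
      rw [hpq]
      have : -2 * (s / n) * s + n * (s / n) ^ 2 = -(s ^ 2) / n := by field_simp; ring
      rw [this, hs]
      field_simp
    linear_combination ((1 : Mat n) i k * (1 : Mat n) j l) * hpq1 +
      ((1 : Mat n) i l * (1 : Mat n) j k) * hpq2 + ((1 : Mat n) i j * (1 : Mat n) k l) * hr

variable {Ω : Type u} {mΩ : MeasurableSpace Ω} {P : Measure Ω} {ℱ : Filtration ℝ≥0 mΩ}
  {B F : ℝ≥0 → Ω → Mat n}

/-- Since `B₁` is trace-free. -/
theorem IsBrownianMotionSL.sum_covTensor_eq_zero (hB : IsBrownianMotionSL P ℱ B) (k l : Fin n) :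
    ∑ i, covTensor P B i i k l = 0 := by
  simp only [covTensor]
  have hi : ∀ i, Integrable (fun ω => B 1 ω i i * B 1 ω k l) P := fun i =>
    (hB.memLp_entry 1 i i (p := 2) (by simp)).integrable_mul (hB.memLp_entry 1 k l (p := 2) (by simp))
  rw [← integral_finsetSum _ fun i _ => hi i]
  refine integral_eq_zero_of_ae ?_
  filter_upwards [hB.mem_sl] with ω hω
  have h1 := hω 1
  change (B 1 ω).trace = 0 at h1
  rw [← Finset.sum_mul]
  change (B 1 ω).trace * _ = 0
  rw [h1, zero_mul]

theorem IsNormalized.congr {F' : ℝ≥0 → Ω → Mat n} (h : IsNormalized P F)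
    (hF : ∀ᵐ ω ∂P, ∀ t, F t ω = F' t ω) : IsNormalized P F' := by
  intro t i j
  have e : (fun ω => (F t ω * (F t ω).transpose) i j) =ᵐ[P]
      fun ω => (F' t ω * (F' t ω).transpose) i j := by
    filter_upwards [hF] with ω hω
    rw [hω t]
  exact ⟨(h t i j).1.congr e, (integral_congr_ae e).symm.trans (h t i j).2⟩

/-- The three properties of the solution say that the covariance of the Brownian motion is
`invariantCov`. -/
theorem IsBrownianMotionSL.covTensor_eq_invariantCov_iff [IsProbabilityMeasure P] (hn : 2 ≤ n)
    (hB : IsBrownianMotionSL P ℱ B) :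
    (∀ i j k l, covTensor P B i j k l = invariantCov n i j k l) ↔
      ∀ F, IsStratonovichSolution P ℱ B F →
        IsOrthogonallyInvariant P F ∧ ItoEqStratonovich P F B ∧ IsNormalized P F := by
  constructor
  · intro h F hF
    have hcov : covTensor P B = invariantCov n := by
      ext i j k l
      exact h i j k l
    have hc : quadDrift P B = 0 := by
      ext i j
      rw [quadDrift, Matrix.of_apply, hcov, sum_invariantCov_eq_zero, Matrix.zero_apply]
    refine ⟨hF.isOrthogonallyInvariant hB hc (hcov ▸ isInvariantTensor_invariantCov),
      hF.itoEqStratonovich hB hc, ?_⟩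
    refine (hB.isNormalized_eulerSolution hc fun p q => ?_).congr
      (hB.isStratonovichSolution_eulerSolution.unique hB hF)
    rw [hcov, sum_invariantCov_eq_one hn]
  · intro h
    have hF := hB.isStratonovichSolution_eulerSolution
    obtain ⟨h1, h2, h3⟩ := h _ hF
    -- the vanishing of the Itô correction has to be drawn first: the other two conditions are
    -- extracted from the driftless equation
    have hc := hF.quadDrift_eq_zero hB h2
    refine (hB.isInvariantTensor_covTensor hc h1).eq_invariantCov hn hB.sum_covTensor_eq_zero
      (fun i j => ?_) (hB.sum_covTensor_eq_one hc h3)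
    rw [← Matrix.zero_apply i j, ← hc]
    rfl

end InvariantBrownianMotion

end GeomBM

theorem lemma2 (n : ℕ) (hn : 2 ≤ n) :
    (∀ (Ω : Type u) (mΩ : MeasurableSpace Ω) (P : Measure Ω) (_ : IsProbabilityMeasure P)
        (ℱ : Filtration ℝ≥0 mΩ) (B : ℝ≥0 → Ω → GeomBM.Mat n),
        GeomBM.IsBrownianMotionSL P ℱ B →
        (∃ F, GeomBM.IsStratonovichSolution P ℱ B F) ∧
        ∀ F F', GeomBM.IsStratonovichSolution P ℱ B F → GeomBM.IsStratonovichSolution P ℱ B F' →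
          ∀ᵐ ω ∂P, ∀ t, F t ω = F' t ω) ∧
    ∃! μ : Measure (ℝ≥0 → GeomBM.Mat n),
      (∃ (Ω : Type u) (mΩ : MeasurableSpace Ω) (P : Measure Ω) (_ : IsProbabilityMeasure P)
        (ℱ : Filtration ℝ≥0 mΩ) (B : ℝ≥0 → Ω → GeomBM.Mat n),
        GeomBM.IsBrownianMotionSL P ℱ B ∧ GeomBM.processLaw P B = μ) ∧
      ∀ (Ω : Type u) (mΩ : MeasurableSpace Ω) (P : Measure Ω) (_ : IsProbabilityMeasure P)
        (ℱ : Filtration ℝ≥0 mΩ) (B : ℝ≥0 → Ω → GeomBM.Mat n),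
        GeomBM.IsBrownianMotionSL P ℱ B →
        (GeomBM.processLaw P B = μ ↔
          ∀ F, GeomBM.IsStratonovichSolution P ℱ B F →
            GeomBM.IsOrthogonallyInvariant P F ∧
            GeomBM.ItoEqStratonovich P F B ∧
            GeomBM.IsNormalized P F) := by
  refine ⟨fun Ω mΩ P hP ℱ B hB => ⟨⟨_, hB.isStratonovichSolution_eulerSolution⟩,
    fun F F' hF hF' => hF.unique hB hF'⟩, ?_⟩
  obtain ⟨T, hT0, hT⟩ := GeomBM.exists_sqrt_invariantCov hn
  obtain ⟨Ω₀, mΩ₀, P₀, hP₀, ℱ₀, B₀, hB₀, hC₀⟩ :=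
    GeomBM.exists_brownianMotionSL.{u} (Fin n × Fin n) T hT0
  have hcov₀ : ∀ i j k l, GeomBM.covTensor P₀ B₀ i j k l = GeomBM.invariantCov n i j k l :=
    fun i j k l => (hC₀ i j k l).trans (hT i j k l)
  refine ⟨GeomBM.processLaw P₀ B₀, ⟨⟨Ω₀, mΩ₀, P₀, hP₀, ℱ₀, B₀, hB₀, rfl⟩,
    fun Ω mΩ P hP ℱ B hB => ?_⟩, ?_⟩
  · rw [← hB.covTensor_eq_invariantCov_iff hn]
    refine ⟨fun h i j k l => ?_, fun h => ?_⟩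
    · rw [GeomBM.covTensor_eq_of_processLaw_eq hB.adapted hB₀.adapted h, hcov₀]
    · exact hB.processLaw_eq hB₀ fun i j k l => (h i j k l).trans (hcov₀ i j k l).symm
  -- a law with the stated property is the law of `B₀`, the solution for `B₀` having the three
  -- properties
  · rintro ν ⟨-, hν⟩
    exact ((hν Ω₀ mΩ₀ P₀ hP₀ ℱ₀ B₀ hB₀).2
      ((hB₀.covTensor_eq_invariantCov_iff hn).1 hcov₀)).symm
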